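/- **Setting.** $\Omega=\{0,1\}^{\mathbb N}$; $\alpha_{[n]}$ is the $n$-bit prefix of $\alpha\in\Omega$; $\mathcal E$ is the set of elementary functions $\Omega\to\mathbb Q$ (depending on finitely many digits), $\mathcal E^+$ those that are $\ge 0$. A real function is r.e. if its subgraph is recursively enumerable (for an argument in $\Omega$: an r.e. union of basic open sets). Pairs of sequences are encoded in $\Omega$ by interleaving, pairs of integers and finite strings as integers, and an integer $x\in\mathbb N$ is also identified with the sequence $1^x000\ldots$. Put $\|a\|=|\lceil\log_2 a\rceil-1|$, $\|0\|=\|\infty\|=\infty$. *Complexity.* Let $\mathbf m(x)$ be a largest, up to a constant factor, r.e. function $\mathbb N\to[0,\infty)$ with $\sum_x\mathbf m(x)\le 1$, and $\mathbf m(x|\alpha)$ a largest, up to a constant factor, r.e. function on $\mathbb N\times\Omega$, with values in $[0,\infty)$, such that $\sum_x\mathbf m(x|\alpha)\le 1$ for each $\alpha$. Let $K(x)=\|\mathbf m(x)\|$ and $K(x|\alpha)=\|\mathbf m(x|\alpha)\|$. For integers, $I(x:y)=\|\lceil \mathbf m(x,y)/(\mathbf m(x)\mathbf m(y))\rceil\|-2$.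 *Semimeasures.* A semimeasure is a functional $\mu:\mathcal E\to\mathbb R$ with $\mu(-1)\ge-1$, $\mu(\mathcal E^+)\subset[0,\infty)$ and $\mu(cf+g)\ge c\mu(f)+\mu(g)$ for rational $c\ge 0$. It is extended to bounded $g:\Omega\to\mathbb R$ by $\mu(g)=\sup\{\mu(h):h\in\mathcal E,\ h\le g\}$. It is a measure if it is linear, and deterministic if $\mu(\min\{f,g\})=\min\{\mu(f),\mu(g)\}$. $\lambda$ is the uniform measure. $M$ is a universal semimeasure: an r.e. one that is largest on $\mathcal E^+$, up to a constant factor, among r.e. semimeasures. $(M\otimes M)(f)=M(\alpha\mapsto M(\beta\mapsto f(\alpha,\beta)))$. *Rarity.* For a computable measure $\mu$ let $\mathbf T_\mu(\alpha)=\sum_i\mathbf m(\alpha_{[i]})/\mu(\alpha_{[i]})$ and $d_\mu(\alpha)=\|\lceil\mathbf T_\mu(\alpha)\rceil\|-2$; $\alpha$ is Martin-Löf $\mu$-random if $d_\mu(\alpha)<\infty$. For a semimeasure $\mu$ call an r.e. operator $A:\mathcal E\to\mathbb R^{\Omega}$ admissible if each functional $f\mapsto A(f)(\omega)$ is a deterministic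 semimeasure and $\lambda(A(f))\le\mu(f)$ for $f\in\mathcal E^+$; let $t^A=\sup\{f\in\mathcal E^+:A(f)\le\mathbf T_\lambda\}$. Let $U_\mu$ be a universal admissible operator, i.e. $t^{U_\mu}=O(t^A)$ for each admissible $A$, and let $d(\alpha|\mu)=\|\lceil t^{U_\mu}(\alpha)\rceil\|-2$. *Information.* $I(\alpha:\beta)=d((\alpha,\beta)\,|\,M\otimes M)$ and $i(\alpha:\beta)=\bigl\|\bigl\lceil\sum_{x,y\in\mathbb N}\mathbf m(x|\alpha)\,\mathbf m(y|\beta)\,2^{I(x:y)}\bigr\rceil\bigr\|-2$ for $\alpha,\beta\in\Omega$. A sequence is complete if it is Turing equivalent to a Martin-Löf $\mu$-random sequence for some computable measure $\mu$. **Proposition.** For every choice of the universal objects $\mathbf m(\cdot)$, $\mathbf m(\cdot|\cdot)$, $M$, $U_\lambda$, $U_{M\otimes M}$ the following hold (values may be infinite). 1. There is a constant $C\ge0$ such that for all $\alpha,\beta\in\Omega$, with $S=\sup_{x\in\mathbb N}\bigl(K(x)-K(x|\alpha)-K(x|\beta)\bigr)$ and $D=d(\alpha|\lambda)+d(\beta|\lambda)$,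 $$S-C\ \le\ I(\alpha:\beta)\ \le\ S+D+C\log_2(|D|+2).$$ 2. There is a constant $C\ge0$ such that for all $\alpha\in\Omega$, $x\in\mathbb N$, with $D=d(\alpha|\lambda)$, $$K(x)-K(x|\alpha)-C\ \le\ I(\alpha:x)\ \le\ K(x)-K(x|\alpha)+D+C\log_2(|D|+2).$$ 3. There is a constant $C$ such that $i(\alpha:\beta)\le I(\alpha:\beta)+C$ for all $\alpha,\beta\in\Omega$. Moreover $I=i\pm O(1)$ on complete sequences: for any computable measures $\mu,\nu$, any Turing reductions $\Phi,\Psi,\Phi',\Psi'$ and any $k\in\mathbb N$ there is a $C$ such that $I(\alpha:\beta)\le i(\alpha:\beta)+C$ whenever $\Phi,\Psi$ reduce $\alpha$ and some $\alpha'$ with $d_\mu(\alpha')\le k$ to each other, and $\Phi',\Psi'$ reduce $\beta$ and some $\beta'$ with $d_\nu(\beta')\le k$ to each other. -/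

import Mathlib

open MeasureTheory
open scoped ENNReal

namespace AlgInfo

noncomputable section

/-! ### Sequences and elementary functions -/

/-- Infinite binary sequences, with the product topology. -/
abbrev Seq := ℕ → Bool

/-- The `n`-bit prefix of `α`. -/
def pre (α : Seq) (n : ℕ) : List Bool := (List.range n).map α

/-- Elementary functions: rational functions on sequences that depend on finitely many digits
(by compactness these are exactly the locally constant ones). -/
abbrev Elem := LocallyConstant Seq ℚ

/-- The set of all sequences that extend the finite string `x`. -/
def cylSet (x : List Bool) : Set Seq := {ω | ∀ i : Fin x.length, ω i = x.get i}

theorem isClopen_cylSet (x : List Bool) : IsClopen (cylSet x) := by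
  have h : cylSet x = ⋂ i : Fin x.length, (fun ω : Seq => ω i) ⁻¹' {x.get i} := by
    ext ω; simp [cylSet]
  rw [h]
  exact isClopen_iInter_of_finite fun i =>
    (isClopen_discrete ({x.get i} : Set Bool)).preimage (continuous_apply (i : ℕ))

/-- The indicator of the set of extensions of `x`. -/
def cyl (x : List Bool) : Elem := LocallyConstant.charFn ℚ (isClopen_cylSet x)

/-- The pair `(α, β)` encoded as one sequence, by interleaving the digits. -/
def join (α β : Seq) : Seq := fun n => if n % 2 = 0 then α (n / 2) else β (n / 2)

theorem continuous_join_right (α : Seq) : Continuous (join α) := by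
  refine continuous_pi fun n => ?_
  unfold join
  by_cases h : n % 2 = 0
  · simpa [h] using continuous_const
  · simpa [h] using continuous_apply (n / 2)

/-- For a function `f` of a pair, the function `β ↦ f (α, β)`. -/
def slice (f : Elem) (α : Seq) : Elem := f.comap ⟨join α, continuous_join_right α⟩

/-- The integer `x` as a sequence: `x` ones followed by zeros. -/
def code (x : ℕ) : Seq := fun n => decide (n < x)

/-! ### Recursive enumerability -/

/-- Codes of rationals. -/
abbrev RatCode := ℕ × ℕ × ℕ

def ratOf (q : RatCode) : ℚ := ((q.1 : ℚ) - q.2.1) / (q.2.2 + 1)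

/-- Codes of elementary functions: finite linear combinations of indicators of cylinders. -/
abbrev ElemCode := List (List Bool × RatCode)

def elemOf (c : ElemCode) : Elem := (c.map fun p => ratOf p.2 • cyl p.1).sum

/-- A real function on integers is r.e. if its subgraph is. -/
def REFun (f : ℕ → ℝ) : Prop :=
  REPred fun p : ℕ × RatCode => (ratOf p.2 : ℝ) < f p.1

/-- A real function of an integer and a sequence is r.e. if its subgraph
is a recursively enumerable union of basic open sets. -/
def RECondFun (f : ℕ → Seq → ℝ) : Prop :=
  ∃ S : ℕ × RatCode × List Bool → Prop, REPred S ∧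
    ∀ x q α, (ratOf q : ℝ) < f x α ↔ ∃ n, S (x, q, pre α n)

/-- A functional on elementary functions is r.e. if its subgraph is. -/
def REFunctional (μ : Elem → ℝ) : Prop :=
  REPred fun p : ElemCode × RatCode => (ratOf p.2 : ℝ) < μ (elemOf p.1)

/-- An operator from elementary functions to functions on sequences is r.e. if its subgraph
is a recursively enumerable union of basic open sets. In particular its values are
suprema of elementary functions. -/
def REOperator (A : Elem → Seq → ℝ) : Prop :=
  ∃ S : ElemCode × RatCode × List Bool → Prop, REPred S ∧
    ∀ c q ω, (ratOf q : ℝ) < A (elemOf c) ω ↔ ∃ n, S (c, q, pre ω n)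

/-! ### Universal distributions and complexity -/

/-- `m` is a nonnegative r.e. function on integers with total at most `1`. -/
def IsREDistribution (m : ℕ → ℝ) : Prop :=
  (∀ x, 0 ≤ m x) ∧ Summable m ∧ ∑' x, m x ≤ 1 ∧ REFun m

/-- `m` is a largest, up to a constant factor, r.e. distribution. -/
def IsUniversalDistribution (m : ℕ → ℝ) : Prop :=
  IsREDistribution m ∧ ∀ m', IsREDistribution m' → ∃ c : ℝ, 0 < c ∧ ∀ x, c * m' x ≤ m x

/-- `mc x α` is a nonnegative r.e. function with `∑ x, mc x α ≤ 1` for each sequence `α`. -/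
def IsRECondDistribution (mc : ℕ → Seq → ℝ) : Prop :=
  (∀ x α, 0 ≤ mc x α) ∧ (∀ α, Summable (fun x => mc x α) ∧ ∑' x, mc x α ≤ 1) ∧ RECondFun mc

/-- `mc` is a largest, up to a constant factor, r.e. conditional distribution. -/
def IsUniversalCondDistribution (mc : ℕ → Seq → ℝ) : Prop :=
  IsRECondDistribution mc ∧
    ∀ mc', IsRECondDistribution mc' → ∃ c : ℝ, 0 < c ∧ ∀ x α, c * mc' x α ≤ mc x α

/-- The length `‖a‖ = |⌈log₂ a⌉ - 1|` of a positive real `a`. -/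
def len (a : ℝ) : ℤ := |⌈Real.logb 2 a⌉ - 1|

/-- `‖⌈T⌉‖ - 2` for `T ∈ [0, ∞]`; here `‖0‖ = ‖∞‖ = ∞`. -/
def deficiency (T : ℝ≥0∞) : EReal :=
  if T = 0 ∨ T = ⊤ then ⊤ else (((len (⌈T.toReal⌉ : ℤ) - 2 : ℤ) : ℝ) : EReal)

/-- Complexity `K(x)`, from the universal distribution `m`. -/
def K (m : ℕ → ℝ) (x : ℕ) : ℤ := len (m x)

/-- Conditional complexity `K(x|α)`, from the universal conditional distribution `mc`. -/
def KC (mc : ℕ → Seq → ℝ) (x : ℕ) (α : Seq) : ℤ := len (mc x α)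

/-- Mutual information of integers: the rarity of the pair `(x, y)` with respect to `m ⊗ m`. -/
def infoNat (m : ℕ → ℝ) (x y : ℕ) : ℤ :=
  len (⌈m (Nat.pair x y) / (m x * m y)⌉ : ℤ) - 2

/-! ### Semimeasures and operators -/

/-- Semimeasures: normal concave functionals on elementary functions. -/
structure IsSemimeasure (μ : Elem → ℝ) : Prop where
  neg_one_le : -1 ≤ μ (-1)
  nonneg : ∀ f : Elem, (∀ ω, 0 ≤ f ω) → 0 ≤ μ f
  concave : ∀ (c : ℚ) (f g : Elem), 0 ≤ c → c * μ f + μ g ≤ μ (c • f + g)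

/-- A functional is deterministic if it commutes with pointwise minima. -/
def IsDeterministic (μ : Elem → ℝ) : Prop :=
  ∀ f g h : Elem, (∀ ω, h ω = min (f ω) (g ω)) → μ h = min (μ f) (μ g)

/-- The extension of `μ` (as an inner measure) to bounded functions `g` on sequences. -/
def ext (μ : Elem → ℝ) (g : Seq → ℝ) : ℝ :=
  sSup {r | ∃ h : Elem, (∀ ω, (h ω : ℝ) ≤ g ω) ∧ r = μ h}

/-- Universal semimeasures: largest, up to a constant factor, on nonnegative elementary functions
among all r.e. semimeasures. -/
def IsUniversalSemimeasure (M : Elem → ℝ) : Prop :=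
  IsSemimeasure M ∧ REFunctional M ∧
    ∀ μ, IsSemimeasure μ → REFunctional μ →
      ∃ c : ℝ, 0 < c ∧ ∀ f : Elem, (∀ ω, 0 ≤ f ω) → c * μ f ≤ M f

/-- Measures (of total at most `1`), as linear normal functionals, that are computable. -/
def IsComputableMeasure (μ : Elem → ℝ) : Prop :=
  IsSemimeasure μ ∧ (∀ (c : ℚ) (f g : Elem), μ (c • f + g) = c * μ f + μ g) ∧
    REFunctional μ ∧ REFunctional (fun f => -μ f)

/-- The uniform measure on sequences (independent fair bits). -/
def lamMeasure : Measure Seq :=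
  Measure.infinitePi fun _ : ℕ => (PMF.uniformOfFintype Bool).toMeasure

/-- The uniform measure as a functional on elementary functions. -/
def lam (f : Elem) : ℝ := ∫ ω, (f ω : ℝ) ∂lamMeasure

/-- The product `μ ⊗ φ` on pairs: `f ↦ μ (α ↦ φ (β ↦ f (α, β)))`. -/
def tensor (μ φ : Elem → ℝ) (f : Elem) : ℝ := ext μ fun α => φ (slice f α)

/-- Deterministic normal concave r.e. operators. -/
def IsDetOperator (A : Elem → Seq → ℝ) : Prop :=
  (∀ ω, IsSemimeasure (fun f => A f ω) ∧ IsDeterministic (fun f => A f ω)) ∧ REOperator A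

/-- The output distribution `A(φ)` for the input distribution `φ`. -/
def image (A : Elem → Seq → ℝ) (φ : Elem → ℝ) (f : Elem) : ℝ := ext φ (A f)

/-! ### Rarity -/

/-- The Martin-Löf test `T_μ(α) = ∑ i, m(α_[i]) / μ(α_[i])`, with strings encoded by integers. -/
def mlTest (m : ℕ → ℝ) (μ : Elem → ℝ) (α : Seq) : ℝ≥0∞ :=
  ∑' i : ℕ, ENNReal.ofReal (m (Encodable.encode (pre α i))) / ENNReal.ofReal (μ (cyl (pre α i)))

/-- The Martin-Löf rarity of `α` for a computable measure `μ`. -/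
def mlRarity (m : ℕ → ℝ) (μ : Elem → ℝ) (α : Seq) : EReal := deficiency (mlTest m μ α)

/-- `t^A = sup {f : f ≥ 0 elementary, A(f) ≤ T_λ}`. -/
def opTest (m : ℕ → ℝ) (A : Elem → Seq → ℝ) (α : Seq) : ℝ≥0∞ :=
  ⨆ (f : Elem) (_ : (∀ ω, 0 ≤ f ω) ∧ ∀ ω, ENNReal.ofReal (A f ω) ≤ mlTest m lam ω),
    ENNReal.ofReal (f α : ℝ)

/-- The operators that compete for a semimeasure `μ`: deterministic normal concave r.e. `A`
with `A(λ) ≤ μ` on nonnegative elementary functions. -/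
def IsAdmissible (A : Elem → Seq → ℝ) (μ : Elem → ℝ) : Prop :=
  IsDetOperator A ∧ ∀ f : Elem, (∀ ω, 0 ≤ f ω) → image A lam f ≤ μ f

/-- `U` is a universal operator `U_μ`: admissible for `μ`, with `t^U = O(t^A)` for each
admissible `A`. -/
def IsUniversalOperator (m : ℕ → ℝ) (U : Elem → Seq → ℝ) (μ : Elem → ℝ) : Prop :=
  IsAdmissible U μ ∧
    ∀ A, IsAdmissible A μ → ∃ c : NNReal, ∀ α, opTest m U α ≤ c * opTest m A α

/-- The rarity `d(α|μ)` of a sequence `α` for a semimeasure `μ` with universal operator `U = U_μ`.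
(The mean of the test over the point distribution at `α` is its value at `α`.) -/
def rarity (m : ℕ → ℝ) (U : Elem → Seq → ℝ) (α : Seq) : EReal := deficiency (opTest m U α)

/-! ### Information in sequences -/

/-- Mutual information `I(α:β) = d((α,β) | M ⊗ M)`, where `U` is universal for `M ⊗ M`. -/
def info (m : ℕ → ℝ) (U : Elem → Seq → ℝ) (α β : Seq) : EReal := rarity m U (join α β)

/-- The simple lower bound
`i(α:β) = ‖⌈∑ x y, m(x|α) m(y|β) 2^I(x:y)⌉‖ - 2`. -/
def infoSimple (m : ℕ → ℝ) (mc : ℕ → Seq → ℝ) (α β : Seq) : EReal :=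
  deficiency (∑' x : ℕ, ∑' y : ℕ,
    ENNReal.ofReal (mc x α * mc y β * (2 : ℝ) ^ infoNat m x y))

/-- `sup_x (K(x) - K(x|α) - K(x|β))`. -/
def infoSup (m : ℕ → ℝ) (mc : ℕ → Seq → ℝ) (α β : Seq) : EReal :=
  ⨆ x : ℕ, (((K m x - KC mc x α - KC mc x β : ℤ) : ℝ) : EReal)

/-- `log₂ (|D| + 2)`, infinite for infinite `D`: the unit of logarithmic error terms. -/
def logErr (D : EReal) : EReal :=
  if D = ⊤ ∨ D = ⊥ then ⊤ else ((Real.logb 2 (|D.toReal| + 2) : ℝ) : EReal)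

/-! ### Complete sequences -/

/-- `Φ` is a Turing reduction of `β` to `α`: enumerating `Φ` with oracle `α`
enumerates exactly the true digits of `β`. -/
def Reduces (Φ : List Bool × ℕ × Bool → Prop) (α β : Seq) : Prop :=
  REPred Φ ∧ ∀ n b, β n = b ↔ ∃ k, Φ (pre α k, n, b)

/-- `α` is Turing equivalent, via the reductions `Φ, Ψ`, to a sequence that is Martin-Löf random
for `μ`, with rarity at most `k`. A sequence is complete if this holds for some computable measure
`μ`, some `Φ, Ψ` and some finite `k`. -/
def IsCompleteVia (m : ℕ → ℝ) (μ : Elem → ℝ) (Φ Ψ : List Bool × ℕ × Bool → Prop) (k : ℕ)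
    (α : Seq) : Prop :=
  IsComputableMeasure μ ∧
    ∃ α', Reduces Φ α α' ∧ Reduces Ψ α' α ∧ mlRarity m μ α' ≤ ((k : ℝ) : EReal)

end

end AlgInfo

/-!
All bounds for information are bounds for the test `opTest m V` at the pair `join α β`, where `V` is
a universal operator for `M ⊗ M`.

**Lower bounds.** A test bounds, up to a constant factor, each sum of nonnegative elementary
functions weighted by `m` whose means with respect to `M ⊗ M` are at most `1`, if these functions
are uniformly r.e.: an admissible operator maps them to functions whose uniform means are at most
`1`, and the universal Martin-Löf test dominates the weighted sum of any such functions (`dom_test`,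
`dom_operator`, `le_opTest`). The functions used here are the products `mc(u|α) * mc(v|β)`, divided
by `m u * m v`. As `u ↦ M(mc(u|·))` is an r.e. distribution, their means are bounded
(`semimeasure_cond_le`). The divisor is not computable, and therefore `u` and `v` are supplied with
their complexities; this does not change the weight `m ⟨u, v⟩` by more than a constant factor
(`pair_le_pair`). The result, `simple_le_opTest`, is the inequality between `i` and `I`. Its terms
with `u = v` give the lower bounds by `K(x) - K(x|α) - K(x|β)`.

**Upper bounds.** Let `p₁`, `p₂` be computable measures and `w₁`, `w₂` computable maps of sequences,
given by monotone maps of strings. The binary tree with the product measure `p₁ ⊗ p₂` corresponds to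
nested partitions of the unit interval. A uniform point lies in the intervals of the prefixes of a
pair `(α', β')` distributed by `p₁ ⊗ p₂`, and `treeOp` sends it to `(w₁ α', w₂ β')`. The images
of `p₁` and `p₂` are r.e. semimeasures, hence are dominated by `M`, and `treeOp` is admissible for
`M ⊗ M` (`isAdmissible_treeOp`, `treeSum_prod_le`). An elementary function that exceeds `2 ^ k` at
`(α, β) = (w₁ α', w₂ β')` and competes in the definition of the test for this operator makes the
Martin-Löf test exceed `2 ^ k` on the interval of some prefix of `(α', β')`. The intervals with this
property can be enumerated; weighted by `2 ^ k`, they have a bounded total measure, hence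
their strings `z` have `m z` at least about `2 ^ k` times their measure (`exists_levelTest`,
`opTest_treeOp_le`). Thus `opTest_join_le`: the test at `(α, β)` is at most about the supremum of
`m z / (p₁ ⊗ p₂)(z)` over the prefixes `z` of `(α', β')`. There are three applications.

* Both measures are uniform and both maps are the identity. If `d(α|λ) ≤ r`, then
  `mc(z|α) ≥ m z * 2 ^ |a|` up to a factor of about `2 ^ r`, where `a` is the part of `z` that comes
  from `α` (`mul_two_pow_le_cond`), and likewise for `β`. Hence the supremum is at most about
  `2 ^ r * 2 ^ r' * mc(z|α) * mc(z|β) / m z`.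
* For an integer `x` in place of `β`, the second measure is spread over the codes of the pairs
  `(x, i)`, with the total mass `m x / 2` for each `x` (`exists_codeTree`), and the second map
  takes the code of `(x, i)` to that of `x`. For some `i` the code of `(x, i)` has a ratio of about
  `mc(x|α) / m x` only, because otherwise the prefixes found for all `i` would have too large a total
  probability relative to `α` (`IsUniversalCondDistribution.map`).
* For complete sequences the measures are `μ` and `ν`, and the maps compute `α`, `β` from random
  `α'`, `β'` (`exists_outMap`). Since `α` computes `α'`, and the terms of the Martin-Löf test at `α'`
  have a bounded sum, `mc(a|α)` is at least about `m a / μ(a)` for the prefixes `a` of `α'`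
  (`le_mul_cond_of_random`). Hence `m z / (μ ⊗ ν)(z)` is, up to a constant factor, at most one term
  of the sum that defines `i(α : β)`.
-/

namespace AlgInfo

/-! ### Primitive recursive functions and recursively enumerable predicates -/

/-! The closure properties of primitive recursive functions are stated below for compositions and
tagged `fun_prop`, so that `by fun_prop` proves that an explicit combination of them is primitive
recursive. -/

attribute [fun_prop] Primrec

namespace PrimrecRules

variable {α β γ σ : Type*} [Primcodable α] [Primcodable β] [Primcodable γ] [Primcodable σ]

@[fun_prop] theorem id : Primrec (fun x : α => x) := Primrec.id

@[fun_prop] theorem const (c : β) : Primrec (fun _ : α => c) := Primrec.const c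

@[fun_prop] theorem comp {f : β → σ} {g : α → β} (hf : Primrec f) (hg : Primrec g) :
    Primrec (fun x => f (g x)) := hf.comp hg

@[fun_prop] theorem fst {f : α → β × γ} (hf : Primrec f) : Primrec (fun x => (f x).1) :=
  Primrec.fst.comp hf

@[fun_prop] theorem snd {f : α → β × γ} (hf : Primrec f) : Primrec (fun x => (f x).2) :=
  Primrec.snd.comp hf

@[fun_prop] theorem mk {f : α → β} {g : α → γ} (hf : Primrec f) (hg : Primrec g) :
    Primrec (fun x => (f x, g x)) := hf.pair hg

section nat
variable {f g : α → ℕ} (hf : Primrec f) (hg : Primrec g)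
include hf

@[fun_prop] theorem succ : Primrec (fun x => Nat.succ (f x)) := Primrec.succ.comp hf

include hg

@[fun_prop] theorem add : Primrec (fun x => f x + g x) := Primrec.nat_add.comp hf hg
@[fun_prop] theorem mul : Primrec (fun x => f x * g x) := Primrec.nat_mul.comp hf hg
@[fun_prop] theorem sub : Primrec (fun x => f x - g x) := Primrec.nat_sub.comp hf hg
@[fun_prop] theorem div : Primrec (fun x => f x / g x) := Primrec.nat_div.comp hf hg
@[fun_prop] theorem mod : Primrec (fun x => f x % g x) := Primrec.nat_mod.comp hf hg
@[fun_prop] theorem max : Primrec (fun x => max (f x) (g x)) := Primrec.nat_max.comp hf hg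
@[fun_prop] theorem min : Primrec (fun x => min (f x) (g x)) := Primrec.nat_min.comp hf hg
@[fun_prop] theorem pow : Primrec (fun x => f x ^ g x) :=
  (Primrec₂.unpaired'.1 Nat.Primrec.pow).comp hf hg
@[fun_prop] theorem pair : Primrec (fun x => Nat.pair (f x) (g x)) := Primrec₂.natPair.comp hf hg
@[fun_prop] theorem le : Primrec (fun x => decide (f x ≤ g x)) :=
  (Primrec.nat_le.comp hf hg).decide
end nat

@[fun_prop] theorem unpair {f : α → ℕ} (hf : Primrec f) : Primrec (fun x => Nat.unpair (f x)) :=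
  Primrec.unpair.comp hf

@[fun_prop] theorem eq [DecidableEq β] {f g : α → β} (hf : Primrec f) (hg : Primrec g) :
    Primrec (fun x => decide (f x = g x)) := (Primrec.eq.comp hf hg).decide

@[fun_prop] theorem and {f g : α → Bool} (hf : Primrec f) (hg : Primrec g) :
    Primrec (fun x => f x && g x) := Primrec.and.comp hf hg

@[fun_prop] theorem or {f g : α → Bool} (hf : Primrec f) (hg : Primrec g) :
    Primrec (fun x => f x || g x) := Primrec.or.comp hf hg

@[fun_prop] theorem not {f : α → Bool} (hf : Primrec f) : Primrec (fun x => !f x) :=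
  Primrec.not.comp hf

@[fun_prop] theorem cond {c : α → Bool} {f g : α → β} (hc : Primrec c) (hf : Primrec f)
    (hg : Primrec g) : Primrec (fun x => bif c x then f x else g x) := Primrec.cond hc hf hg

@[fun_prop] theorem ite {p : α → Prop} [DecidablePred p] {f g : α → β}
    (hp : Primrec fun x => decide (p x)) (hf : Primrec f) (hg : Primrec g) :
    Primrec (fun x => if p x then f x else g x) := Primrec.ite hp.primrecPred hf hg

@[fun_prop] theorem decideBool {f : α → Bool} (hf : Primrec f) :
    Primrec (fun x => decide (f x = true)) := by simpa using hf

@[fun_prop] theorem encode {f : α → β} (hf : Primrec f) :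
    Primrec (fun x => Encodable.encode (f x)) := Primrec.encode.comp hf

@[fun_prop] theorem decode {f : α → ℕ} (hf : Primrec f) :
    Primrec (fun x => (Encodable.decode (f x) : Option β)) := Primrec.decode.comp hf

@[fun_prop] theorem isSome {f : α → Option β} (hf : Primrec f) :
    Primrec (fun x => (f x).isSome) := Primrec.option_isSome.comp hf

@[fun_prop] theorem elim {f : α → Option β} {g : α → σ} {h : α → β → σ} (hf : Primrec f)
    (hg : Primrec g) (hh : Primrec (fun p : α × β => h p.1 p.2)) :
    Primrec (fun x => (f x).elim (g x) (h x)) :=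
  (Primrec.option_casesOn (g := h) hf hg hh).of_eq fun x => by cases f x <;> rfl

section list
variable {f : α → List β} (hf : Primrec f)

@[fun_prop] theorem list_cons {g : α → β} (hg : Primrec g) (hf : Primrec f) :
    Primrec (fun x => g x :: f x) := Primrec.list_cons.comp hg hf

@[fun_prop] theorem list_range {f : α → ℕ} (hf : Primrec f) :
    Primrec (fun x => List.range (f x)) := Primrec.list_range.comp hf

include hf

@[fun_prop] theorem list_map {g : α → β → γ} (hg : Primrec (fun p : α × β => g p.1 p.2)) :
    Primrec (fun x => (f x).map (g x)) := Primrec.list_map hf hg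

@[fun_prop] theorem list_flatMap {g : α → β → List γ} (hg : Primrec (fun p : α × β => g p.1 p.2)) :
    Primrec (fun x => (f x).flatMap (g x)) := Primrec.list_flatMap hf hg

@[fun_prop] theorem list_foldl {g : α → σ} {h : α → σ → β → σ} (hg : Primrec g)
    (hh : Primrec (fun p : α × σ × β => h p.1 p.2.1 p.2.2)) :
    Primrec (fun x => (f x).foldl (h x) (g x)) :=
  Primrec.list_foldl (h := fun a p => h a p.1 p.2) hf hg hh

@[fun_prop] theorem list_foldr {g : α → σ} {h : α → β → σ → σ} (hg : Primrec g)
    (hh : Primrec (fun p : α × β × σ => h p.1 p.2.1 p.2.2)) :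
    Primrec (fun x => (f x).foldr (h x) (g x)) :=
  Primrec.list_foldr (h := fun a p => h a p.1 p.2) hf hg hh

@[fun_prop] theorem list_length : Primrec (fun x => (f x).length) := Primrec.list_length.comp hf

@[fun_prop] theorem list_append {g : α → List β} (hg : Primrec g) :
    Primrec (fun x => f x ++ g x) := Primrec.list_append.comp hf hg

@[fun_prop] theorem list_take {n : α → ℕ} (hn : Primrec n) :
    Primrec (fun x => (f x).take (n x)) := Primrec.list_take.comp hn hf

@[fun_prop] theorem list_getD {n : α → ℕ} (hn : Primrec n) (d : β) :
    Primrec (fun x => (f x).getD (n x) d) := (Primrec.list_getD d).comp hf hn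

@[fun_prop] theorem list_any {p : α → β → Bool} (hp : Primrec (fun q : α × β => p q.1 q.2)) :
    Primrec (fun x => (f x).any (p x)) := by
  have : Primrec fun x => (f x).foldr (fun b r => p x b || r) false := by fun_prop
  refine this.of_eq fun x => ?_
  induction f x with
  | nil => rfl
  | cons b l ih => simp [ih]

end list

@[fun_prop] theorem list_sum {f : α → List ℕ} (hf : Primrec f) : Primrec (fun x => (f x).sum) := by
  have : Primrec fun x => (f x).foldr (fun b r => b + r) 0 := by fun_prop
  exact this.of_eq fun x => rfl

@[fun_prop] theorem nat_rec {f : α → ℕ} {g : α → σ} {h : α → ℕ → σ → σ} (hf : Primrec f)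
    (hg : Primrec g) (hh : Primrec (fun p : α × ℕ × σ => h p.1 p.2.1 p.2.2)) :
    Primrec (fun x => Nat.rec (motive := fun _ => σ) (g x) (h x) (f x)) :=
  Primrec.nat_rec' (h := fun a p => h a p.1 p.2) hf hg hh

@[fun_prop] theorem sum_range {f : α → ℕ} {g : α → ℕ → ℕ} (hf : Primrec f)
    (hg : Primrec (fun p : α × ℕ => g p.1 p.2)) :
    Primrec (fun x => ∑ i ∈ Finset.range (f x), g x i) := by
  have : Primrec fun x => ((List.range (f x)).map (g x)).sum := by fun_prop
  refine this.of_eq fun x => ?_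
  induction f x with
  | zero => rfl
  | succ n ih => rw [Finset.sum_range_succ, List.range_succ, List.map_append, List.sum_append, ih]; simp

end PrimrecRules

section re
variable {α β : Type*} [Primcodable α] [Primcodable β]

/-- The projection of a primitive recursive relation is recursively enumerable. -/
theorem rePred_of_exists {p : α → Prop} (R : α → β → Bool) (hR : Primrec fun q : α × β => R q.1 q.2)
    (h : ∀ a, p a ↔ ∃ b, R a b = true) : REPred p := by
  have h1 : Primrec fun q : α × ℕ => ((Encodable.decode q.2 : Option β).elim false (R q.1)) := by
    fun_prop
  have h2 : Partrec fun a => Nat.rfind fun n =>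
      Part.some ((Encodable.decode n : Option β).elim false (R a)) :=
    Partrec.rfind h1.to_comp.partrec
  refine h2.dom_re.of_eq fun a => ?_
  refine Iff.trans (Nat.rfind_dom (p := fun n =>
    Part.some ((Encodable.decode n : Option β).elim false (R a)))) ?_
  rw [h]
  constructor
  · rintro ⟨n, hn, -⟩
    cases hd : (Encodable.decode n : Option β) with
    | none => simp [hd] at hn
    | some b => exact ⟨b, by simpa [hd] using hn⟩
  · rintro ⟨b, hb⟩
    exact ⟨Encodable.encode b, by simp [hb], fun _ => trivial⟩

/-- A recursively enumerable predicate is verified in stages: `R a t` says that `p a` has been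
recognized by time `t`. -/
theorem exists_stages {p : α → Prop} (hp : REPred p) :
    ∃ R : α → ℕ → Bool, (Primrec fun q : α × ℕ => R q.1 q.2) ∧
      (∀ a s t, s ≤ t → R a s = true → R a t = true) ∧ ∀ a, p a ↔ ∃ t, R a t = true := by
  have hp' : Nat.Partrec fun n => Part.bind (Encodable.decode (α := α) n) fun a =>
      ((Part.assert (p a) fun _ => Part.some ()).map Encodable.encode) := hp
  obtain ⟨c, hc⟩ := Nat.Partrec.Code.exists_code.1 hp'
  refine ⟨fun a t => (Nat.Partrec.Code.evaln t c (Encodable.encode a)).isSome, ?_, ?_, ?_⟩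
  · have h := Nat.Partrec.Code.primrec_evaln
    have h' : Primrec fun q : α × ℕ => Nat.Partrec.Code.evaln q.2 c (Encodable.encode q.1) :=
      h.comp (((Primrec.snd).pair (Primrec.const c)).pair (Primrec.encode.comp Primrec.fst))
    fun_prop
  · intro a s t hst h
    obtain ⟨x, hx⟩ := Option.isSome_iff_exists.1 h
    exact Option.isSome_iff_exists.2 ⟨x, Nat.Partrec.Code.evaln_mono hst hx⟩
  · intro a
    have key : p a ↔ ∃ x, x ∈ c.eval (Encodable.encode a) := by
      rw [hc]
      simp
    rw [key]
    simp only [Nat.Partrec.Code.evaln_complete, Option.isSome_iff_exists]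
    exact ⟨fun ⟨x, k, h⟩ => ⟨k, x, h⟩, fun ⟨k, x, h⟩ => ⟨x, k, h⟩⟩

theorem REPred.comp_primrec {p : β → Prop} (hp : REPred p) {f : α → β} (hf : Primrec f) :
    REPred fun a => p (f a) := by
  obtain ⟨R, hR, -, h⟩ := exists_stages hp
  exact rePred_of_exists (fun a t => R (f a) t) (by fun_prop) fun a => h _

theorem REPred.exists_snd {p : α × β → Prop} (hp : REPred p) :
    REPred fun a => ∃ b, p (a, b) := by
  obtain ⟨R, hR, -, h⟩ := exists_stages hp
  exact rePred_of_exists (fun a (q : β × ℕ) => R (a, q.1) q.2) (by fun_prop) fun a => by simp [h]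

end re

/-! ### Rational codes -/

/-- Addition of codes of rationals. -/
def radd (p q : RatCode) : RatCode :=
  (p.1 * (q.2.2 + 1) + q.1 * (p.2.2 + 1), p.2.1 * (q.2.2 + 1) + q.2.1 * (p.2.2 + 1),
    p.2.2 * q.2.2 + p.2.2 + q.2.2)

/-- Strict order of codes of rationals. -/
def rlt (p q : RatCode) : Bool :=
  decide (p.1 * (q.2.2 + 1) + q.2.1 * (p.2.2 + 1) < q.1 * (p.2.2 + 1) + p.2.1 * (q.2.2 + 1))

theorem ratOf_radd (p q : RatCode) : ratOf (radd p q) = ratOf p + ratOf q := by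
  unfold ratOf radd
  push_cast
  field_simp
  ring

theorem rlt_iff (p q : RatCode) : rlt p q = true ↔ ratOf p < ratOf q := by
  unfold ratOf rlt
  rw [div_lt_div_iff₀ (by positivity) (by positivity), decide_eq_true_iff, ← Nat.cast_lt (α := ℚ)]
  push_cast
  constructor <;> intro h <;> linarith

@[fun_prop] theorem primrec_radd {α : Type*} [Primcodable α] {f g : α → RatCode} (hf : Primrec f)
    (hg : Primrec g) : Primrec (fun x => radd (f x) (g x)) := by unfold radd; fun_prop

@[fun_prop] theorem primrec_rlt {α : Type*} [Primcodable α] {f g : α → RatCode} (hf : Primrec f)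
    (hg : Primrec g) : Primrec (fun x => rlt (f x) (g x)) := by unfold rlt; fun_prop

/-- The code of `a / 2 ^ n`. -/
def dyad (a n : ℕ) : RatCode := (a, 0, 2 ^ n - 1)

theorem ratOf_dyad (a n : ℕ) : ratOf (dyad a n) = (a : ℚ) / 2 ^ n := by
  unfold ratOf dyad
  have : 1 ≤ 2 ^ n := Nat.one_le_two_pow
  simp [Nat.cast_sub this]

@[fun_prop] theorem primrec_dyad {α : Type*} [Primcodable α] {f g : α → ℕ} (hf : Primrec f)
    (hg : Primrec g) : Primrec (fun x => dyad (f x) (g x)) := by unfold dyad; fun_prop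

theorem exists_ratOf (q : ℚ) : ∃ c, ratOf c = q := by
  refine ⟨(q.num.toNat, (-q.num).toNat, q.den - 1), ?_⟩
  unfold ratOf
  have h1 : ((q.num.toNat : ℚ) - ((-q.num).toNat : ℚ)) = q.num := by
    have : (q.num.toNat : ℤ) - ((-q.num).toNat : ℤ) = q.num := by omega
    exact_mod_cast this
  have h2 : ((q.den - 1 : ℕ) : ℚ) + 1 = q.den := by
    rw [Nat.cast_sub q.pos]; simp
  simp only [h1, h2]
  exact Rat.num_div_den q

/-! ### Finite strings -/

@[simp] theorem length_pre (α : Seq) (n : ℕ) : (pre α n).length = n := by simp [pre]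

theorem pre_succ (α : Seq) (n : ℕ) : pre α (n + 1) = pre α n ++ [α n] := by
  simp [pre, List.range_succ]

@[simp] theorem pre_zero (α : Seq) : pre α 0 = [] := rfl

theorem take_pre (α : Seq) (n k : ℕ) : (pre α n).take k = pre α (min k n) := by
  unfold pre
  rw [← List.map_take, List.take_range]

theorem pre_getElem? (α : Seq) (n k : ℕ) (h : k < n) : (pre α n)[k]? = some (α k) := by
  simp [pre, h]

theorem pre_getD (α : Seq) (n k : ℕ) (d : Bool) (h : k < n) : (pre α n).getD k d = α k := by
  simp [pre_getElem? α n k h]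

theorem pre_eq_iff (α β : Seq) (n : ℕ) : pre α n = pre β n ↔ ∀ i < n, α i = β i := by
  simp [pre]

theorem mem_cylSet {s : List Bool} {ω : Seq} : ω ∈ cylSet s ↔ pre ω s.length = s := by
  constructor
  · intro h
    refine List.ext_getElem (by simp) fun i h1 h2 => ?_
    simpa [pre] using h ⟨i, h2⟩
  · intro h i
    have := List.getElem_of_eq h (i := i) (by simp)
    simpa [pre] using this

theorem cyl_apply (s : List Bool) (ω : Seq) : cyl s ω = if pre ω s.length = s then 1 else 0 := by
  unfold cyl
  rw [LocallyConstant.coe_charFn]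
  by_cases h : pre ω s.length = s
  · rw [Set.indicator_of_mem (mem_cylSet.2 h), if_pos h]; rfl
  · rw [Set.indicator_of_notMem (fun h' => h (mem_cylSet.1 h')), if_neg h]

/-- An infinite extension of a finite string. -/
def ext0 (s : List Bool) : Seq := fun n => s.getD n false

@[simp] theorem pre_ext0 (s : List Bool) : pre (ext0 s) s.length = s := by
  refine List.ext_getElem (by simp) fun i h1 h2 => ?_
  simp [pre, ext0, h2]

/-- The list of all strings of length `n`. -/
def words : ℕ → List (List Bool)
  | 0 => [[]]
  | n + 1 => (words n).flatMap fun s => [s ++ [false], s ++ [true]]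

theorem mem_words {n : ℕ} {s : List Bool} : s ∈ words n ↔ s.length = n := by
  induction n generalizing s with
  | zero => simp [words]
  | succ n ih =>
    simp only [words, List.mem_flatMap, ih]
    constructor
    · rintro ⟨t, rfl, h⟩
      rcases List.mem_pair.1 h with rfl | rfl <;> simp
    · intro h
      rcases List.eq_nil_or_concat s with rfl | ⟨t, b, rfl⟩
      · simp at h
      · refine ⟨t, by simpa using h, ?_⟩
        cases b <;> simp

theorem nodup_words (n : ℕ) : (words n).Nodup := by
  induction n with
  | zero => simp [words]
  | succ n ih =>
    rw [words, List.nodup_flatMap]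
    refine ⟨fun s _ => by simp, ih.imp fun {s t} hst => ?_⟩
    intro x hx hy
    rcases List.mem_pair.1 hx with rfl | rfl <;> rcases List.mem_pair.1 hy with h | h <;>
      exact hst (List.append_inj_left' h rfl)

@[fun_prop] theorem primrec_words {α : Type*} [Primcodable α] {f : α → ℕ} (hf : Primrec f) :
    Primrec (fun x => words (f x)) := by
  have : Primrec fun x => Nat.rec (motive := fun _ => List (List Bool)) [[]]
      (fun _ l => l.flatMap fun s => [s ++ [false], s ++ [true]]) (f x) := by fun_prop
  refine this.of_eq fun x => ?_
  induction f x with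
  | zero => rfl
  | succ n ih => simp only [words, ih]

/-- The set of all strings of length `n`. -/
def strs (n : ℕ) : Finset (List Bool) := (words n).toFinset

@[simp] theorem mem_strs {n : ℕ} {s : List Bool} : s ∈ strs n ↔ s.length = n := by
  simp [strs, mem_words]

theorem sum_strs {A : Type*} [AddCommMonoid A] (n : ℕ) (g : List Bool → A) :
    ∑ s ∈ strs n, g s = ((words n).map g).sum := List.sum_toFinset g (nodup_words n)

theorem sum_strs_zero {A : Type*} [AddCommMonoid A] (g : List Bool → A) :
    ∑ s ∈ strs 0, g s = g [] := by simp [sum_strs, words]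

theorem sum_strs_succ {A : Type*} [AddCommMonoid A] (n : ℕ) (g : List Bool → A) :
    ∑ s ∈ strs (n + 1), g s = ∑ s ∈ strs n, (g (s ++ [false]) + g (s ++ [true])) := by
  rw [sum_strs, sum_strs, words]
  induction words n with
  | nil => rfl
  | cons s l ih => simp [ih, add_assoc]

theorem card_strs (n : ℕ) : (strs n).card = 2 ^ n := by
  induction n with
  | zero => simp [strs, words]
  | succ n ih => rw [Finset.card_eq_sum_ones, sum_strs_succ, Finset.sum_const, ih]; simp [pow_succ]

@[fun_prop] theorem primrec_sum_strs {α : Type*} [Primcodable α] {f : α → ℕ}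
    {g : α → List Bool → ℕ} (hf : Primrec f)
    (hg : Primrec (fun p : α × List Bool => g p.1 p.2)) :
    Primrec (fun x => ∑ s ∈ strs (f x), g x s) := by
  simp only [sum_strs]
  fun_prop

/-- The even-numbered digits of a string. -/
def ev (z : List Bool) : List Bool := (List.range ((z.length + 1) / 2)).map fun i => z.getD (2 * i) false

/-- The odd-numbered digits of a string. -/
def od (z : List Bool) : List Bool := (List.range (z.length / 2)).map fun i => z.getD (2 * i + 1) false

@[fun_prop] theorem primrec_ev {α : Type*} [Primcodable α] {f : α → List Bool} (hf : Primrec f) :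
    Primrec (fun x => ev (f x)) := by unfold ev; fun_prop

@[fun_prop] theorem primrec_od {α : Type*} [Primcodable α] {f : α → List Bool} (hf : Primrec f) :
    Primrec (fun x => od (f x)) := by unfold od; fun_prop

theorem join_even (α β : Seq) (i : ℕ) : join α β (2 * i) = α i := by simp [join]

theorem join_odd (α β : Seq) (i : ℕ) : join α β (2 * i + 1) = β i := by
  simp only [join]
  rw [if_neg (by omega)]
  congr 1
  omega

theorem ev_pre_join (α β : Seq) (n : ℕ) : ev (pre (join α β) n) = pre α ((n + 1) / 2) := by
  unfold ev
  rw [length_pre]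
  refine List.map_congr_left fun i hi => ?_
  rw [List.mem_range] at hi
  rw [pre_getD _ _ _ _ (by omega), join_even]

theorem od_pre_join (α β : Seq) (n : ℕ) : od (pre (join α β) n) = pre β (n / 2) := by
  unfold od
  rw [length_pre]
  refine List.map_congr_left fun i hi => ?_
  rw [List.mem_range] at hi
  rw [pre_getD _ _ _ _ (by omega), join_odd]

theorem ev_append_even {z : List Bool} (b : Bool) (h : z.length % 2 = 0) :
    ev (z ++ [b]) = ev z ++ [b] := by
  unfold ev
  have h1 : ((z ++ [b]).length + 1) / 2 = (z.length + 1) / 2 + 1 := by simp; omega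
  rw [h1, List.range_succ, List.map_append]
  congr 1
  · refine List.map_congr_left fun i hi => ?_
    rw [List.mem_range] at hi
    rw [List.getD_append _ _ _ _ (by omega)]
  · have : 2 * ((z.length + 1) / 2) = z.length := by omega
    simp [this]

theorem ev_append_odd {z : List Bool} (b : Bool) (h : z.length % 2 = 1) :
    ev (z ++ [b]) = ev z := by
  unfold ev
  have h1 : ((z ++ [b]).length + 1) / 2 = (z.length + 1) / 2 := by simp; omega
  rw [h1]
  refine List.map_congr_left fun i hi => ?_
  rw [List.mem_range] at hi
  rw [List.getD_append _ _ _ _ (by omega)]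

theorem od_append_even {z : List Bool} (b : Bool) (h : z.length % 2 = 0) :
    od (z ++ [b]) = od z := by
  unfold od
  have h1 : ((z ++ [b]).length) / 2 = (z.length) / 2 := by simp; omega
  rw [h1]
  refine List.map_congr_left fun i hi => ?_
  rw [List.mem_range] at hi
  rw [List.getD_append _ _ _ _ (by omega)]

theorem od_append_odd {z : List Bool} (b : Bool) (h : z.length % 2 = 1) :
    od (z ++ [b]) = od z ++ [b] := by
  unfold od
  have h1 : ((z ++ [b]).length) / 2 = (z.length) / 2 + 1 := by simp; omega
  rw [h1, List.range_succ, List.map_append]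
  congr 1
  · refine List.map_congr_left fun i hi => ?_
    rw [List.mem_range] at hi
    rw [List.getD_append _ _ _ _ (by omega)]
  · have : 2 * (z.length / 2) + 1 = z.length := by omega
    simp [this]

/-! ### Elementary functions -/

/-- The elementary function `ω ↦ g (ω_[n])` of the first `n` digits. -/
def digitFn (n : ℕ) (g : List Bool → ℚ) : Elem where
  toFun ω := g (pre ω n)
  isLocallyConstant := by
    refine (IsLocallyConstant.iff_exists_open _).2 fun ω => ?_
    refine ⟨cylSet (pre ω n), (isClopen_cylSet _).isOpen, mem_cylSet.2 (by simp), fun ω' h => ?_⟩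
    have := mem_cylSet.1 h
    rw [length_pre] at this
    rw [this]

@[simp] theorem digitFn_apply (n : ℕ) (g : List Bool → ℚ) (ω : Seq) :
    digitFn n g ω = g (pre ω n) := rfl

/-- By compactness an elementary function depends on finitely many digits. -/
theorem exists_digits (f : Elem) : ∃ n, ∀ ω ω' : Seq, pre ω n = pre ω' n → f ω = f ω' := by
  have h : ∀ ω : Seq, ∃ n, ∀ ω' : Seq, pre ω' n = pre ω n → f ω' = f ω := by
    intro ω
    obtain ⟨V, hV, hω, hf⟩ := (IsLocallyConstant.iff_exists_open _).1 f.isLocallyConstant ω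
    rw [isOpen_pi_iff] at hV
    obtain ⟨I, u, hu, hsub⟩ := hV ω hω
    refine ⟨I.sup id + 1, fun ω' h => hf _ (hsub fun i hi => ?_)⟩
    rw [pre_eq_iff] at h
    rw [h i (Nat.lt_succ_of_le (Finset.le_sup (f := id) hi))]
    exact (hu i hi).2
  choose N hN using h
  obtain ⟨t, ht⟩ := isCompact_univ.elim_finite_subcover (fun ω : Seq => cylSet (pre ω (N ω)))
    (fun ω => (isClopen_cylSet _).isOpen) fun ω _ => Set.mem_iUnion.2 ⟨ω, mem_cylSet.2 (by simp)⟩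
  refine ⟨t.sup N, fun ω ω' h => ?_⟩
  obtain ⟨η, hη⟩ := Set.mem_iUnion.1 (ht (Set.mem_univ ω))
  obtain ⟨hηt, hω⟩ := Set.mem_iUnion.1 hη
  have h1 := mem_cylSet.1 hω
  rw [length_pre] at h1
  have h2 : pre ω' (N η) = pre η (N η) := by
    rw [← h1, pre_eq_iff]
    rw [pre_eq_iff] at h
    exact fun i hi => (h i (lt_of_lt_of_le hi (Finset.le_sup hηt))).symm
  rw [hN η ω h1, hN η ω' h2]

theorem elemOf_apply (c : ElemCode) (ω : Seq) :
    elemOf c ω = (c.map fun p => ratOf p.2 * cyl p.1 ω).sum := by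
  unfold elemOf
  induction c with
  | nil => rfl
  | cons p c ih => simpa using ih

/-- The code of an elementary function given by its values on strings of length `n`. -/
def digitCode (n : ℕ) (r : List Bool → RatCode) : ElemCode := (words n).map fun s => (s, r s)

theorem elemOf_digitCode (n : ℕ) (r : List Bool → RatCode) :
    elemOf (digitCode n r) = digitFn n fun s => ratOf (r s) := by
  ext ω
  rw [elemOf_apply, digitCode, List.map_map, digitFn_apply]
  change ((words n).map fun s => ratOf (r s) * cyl s ω).sum = _
  rw [← sum_strs n fun s => ratOf (r s) * cyl s ω, Finset.sum_eq_single (pre ω n)]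
  · rw [cyl_apply]; simp
  · intro s hs hne
    rw [mem_strs] at hs
    rw [cyl_apply, if_neg (by rw [hs]; exact hne.symm), mul_zero]
  · simp

theorem primrec_digitCode {α : Type*} [Primcodable α] {f : α → ℕ}
    {g : α → List Bool → RatCode} (hf : Primrec f)
    (hg : Primrec (fun p : α × List Bool => g p.1 p.2)) :
    Primrec (fun x => digitCode (f x) (g x)) := by unfold digitCode; fun_prop

attribute [fun_prop] primrec_digitCode

/-- The value of a coded elementary function at the extensions of a long string `s`. -/
def evalCode (c : ElemCode) (s : List Bool) : RatCode :=
  c.foldr (fun p r => if s.take p.1.length = p.1 then radd p.2 r else r) (0, 0, 0)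

/-- The number of digits that a coded elementary function depends on. -/
def codeLen (c : ElemCode) : ℕ := c.foldr (fun p r => max p.1.length r) 0

@[fun_prop] theorem primrec_evalCode {α : Type*} [Primcodable α] {f : α → ElemCode}
    {g : α → List Bool} (hf : Primrec f) (hg : Primrec g) :
    Primrec (fun x => evalCode (f x) (g x)) := by unfold evalCode; fun_prop

@[fun_prop] theorem primrec_codeLen {α : Type*} [Primcodable α] {f : α → ElemCode}
    (hf : Primrec f) : Primrec (fun x => codeLen (f x)) := by unfold codeLen; fun_prop

theorem elemOf_eq_evalCode (c : ElemCode) (ω : Seq) {n : ℕ} (h : codeLen c ≤ n) :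
    elemOf c ω = ratOf (evalCode c (pre ω n)) := by
  rw [elemOf_apply]
  induction c with
  | nil => simp [evalCode, ratOf]
  | cons p c ih =>
    have h1 : p.1.length ≤ n := le_trans (le_max_left _ _) h
    have h2 : codeLen c ≤ n := le_trans (le_max_right _ _) h
    have ih := ih h2
    unfold evalCode at ih ⊢
    rw [List.map_cons, List.sum_cons, ih, List.foldr_cons, cyl_apply, take_pre, min_eq_left h1]
    split_ifs with h3
    · rw [ratOf_radd, mul_one]
    · rw [mul_zero, zero_add]

/-! ### The uniform measure -/

instance : IsProbabilityMeasure lamMeasure := by unfold lamMeasure; infer_instance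

theorem measurableSet_cylSet (s : List Bool) : MeasurableSet (cylSet s) :=
  (isClopen_cylSet s).isOpen.measurableSet

theorem lamMeasure_cylSet (s : List Bool) : lamMeasure (cylSet s) = (2 ^ s.length)⁻¹ := by
  have h : cylSet s = Set.pi (Finset.range s.length : Set ℕ) fun i => {s.getD i false} := by
    ext ω
    simp only [cylSet, Set.mem_ofPred_eq, Set.mem_pi, Finset.coe_range, Set.mem_Iio,
      Set.mem_singleton_iff]
    constructor
    · intro h i hi
      simpa [hi] using h ⟨i, hi⟩
    · intro h i
      simpa using h i i.2
  rw [h, lamMeasure, Measure.infinitePi_pi _ (fun i _ => MeasurableSet.singleton _)]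
  have : ∀ b : Bool, (PMF.uniformOfFintype Bool).toMeasure {b} = 2⁻¹ := by
    intro b
    rw [PMF.toMeasure_apply_singleton _ _ (MeasurableSet.singleton _)]
    simp
  simp [this, ENNReal.inv_pow]

theorem measurable_pre (n : ℕ) (g : List Bool → ℝ≥0∞) : Measurable fun ω : Seq => g (pre ω n) := by
  have : (fun ω : Seq => g (pre ω n)) =
      fun ω => ∑ s ∈ strs n, (cylSet s).indicator (fun _ => g s) ω := by
    funext ω
    rw [Finset.sum_eq_single (pre ω n)]
    · rw [Set.indicator_of_mem (mem_cylSet.2 (by simp))]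
    · intro s hs hne
      rw [mem_strs] at hs
      refine Set.indicator_of_notMem (fun h => hne ?_) _
      have := mem_cylSet.1 h
      rw [hs] at this
      exact this.symm
    · simp
  rw [this]
  exact Finset.measurable_sum _ fun s _ => measurable_const.indicator (measurableSet_cylSet s)

theorem lintegral_pre (n : ℕ) (g : List Bool → ℝ≥0∞) :
    ∫⁻ ω, g (pre ω n) ∂lamMeasure = (∑ s ∈ strs n, g s) / 2 ^ n := by
  have : (fun ω : Seq => g (pre ω n)) =
      fun ω => ∑ s ∈ strs n, (cylSet s).indicator (fun _ => g s) ω := by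
    funext ω
    rw [Finset.sum_eq_single (pre ω n)]
    · rw [Set.indicator_of_mem (mem_cylSet.2 (by simp))]
    · intro s hs hne
      rw [mem_strs] at hs
      refine Set.indicator_of_notMem (fun h => hne ?_) _
      have := mem_cylSet.1 h
      rw [hs] at this
      exact this.symm
    · simp
  rw [this, lintegral_finsetSum _ fun s _ => measurable_const.indicator (measurableSet_cylSet s)]
  rw [div_eq_mul_inv, Finset.sum_mul]
  refine Finset.sum_congr rfl fun s hs => ?_
  rw [lintegral_indicator_const (measurableSet_cylSet s), lamMeasure_cylSet, mem_strs.1 hs]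

theorem continuous_elem (f : Elem) : Continuous fun ω => (f ω : ℝ) :=
  (f.isLocallyConstant.comp fun q : ℚ => (q : ℝ)).continuous

theorem integrable_elem (f : Elem) : Integrable (fun ω => (f ω : ℝ)) lamMeasure :=
  BoundedContinuousFunction.integrable lamMeasure
    (BoundedContinuousFunction.mkOfCompact ⟨_, continuous_elem f⟩)

theorem lam_cyl (s : List Bool) : lam (cyl s) = (2 ^ s.length)⁻¹ := by
  have : (fun ω => ((cyl s ω : ℚ) : ℝ)) = (cylSet s).indicator fun _ => (1 : ℝ) := by
    funext ω
    rw [cyl_apply]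
    split_ifs with h
    · rw [Set.indicator_of_mem (mem_cylSet.2 h)]; simp
    · rw [Set.indicator_of_notMem fun h' => h (mem_cylSet.1 h')]; simp
  rw [lam, this, integral_indicator_const _ (measurableSet_cylSet s), measureReal_def,
    lamMeasure_cylSet]
  simp

theorem lam_add (f g : Elem) : lam (f + g) = lam f + lam g := by
  unfold lam
  rw [← integral_add (integrable_elem f) (integrable_elem g)]
  simp

theorem lam_smul (c : ℚ) (f : Elem) : lam (c • f) = c * lam f := by
  unfold lam
  rw [← integral_const_mul]
  simp

theorem digitFn_eq_sum (n : ℕ) (g : List Bool → ℚ) : digitFn n g = ∑ s ∈ strs n, g s • cyl s := by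
  ext ω
  have : (∑ s ∈ strs n, g s • cyl s) ω = ∑ s ∈ strs n, g s * cyl s ω := by
    induction strs n using Finset.induction_on with
    | empty => rfl
    | insert a t ha ih => simp [Finset.sum_insert ha, ih]
  rw [this, digitFn_apply, Finset.sum_eq_single (pre ω n)]
  · rw [cyl_apply]; simp
  · intro s hs hne
    rw [mem_strs] at hs
    rw [cyl_apply, if_neg (by rw [hs]; exact hne.symm), mul_zero]
  · simp

theorem lam_digitFn (n : ℕ) (g : List Bool → ℚ) :
    lam (digitFn n g) = (∑ s ∈ strs n, (g s : ℝ)) / 2 ^ n := by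
  have h : ∀ t : Finset (List Bool), lam (∑ s ∈ t, g s • cyl s) = ∑ s ∈ t, lam (g s • cyl s) := by
    intro t
    induction t using Finset.induction_on with
    | empty => simp [lam]
    | insert a t ha ih => rw [Finset.sum_insert ha, Finset.sum_insert ha, lam_add, ih]
  rw [digitFn_eq_sum, h, Finset.sum_div]
  refine Finset.sum_congr rfl fun s hs => ?_
  rw [lam_smul, lam_cyl, mem_strs.1 hs, div_eq_mul_inv]

theorem lam_le_lintegral (h : Elem) (g : Seq → ℝ≥0∞)
    (hg : ∀ ω, ENNReal.ofReal (h ω : ℝ) ≤ g ω) (hfin : ∫⁻ ω, g ω ∂lamMeasure ≠ ∞) :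
    lam h ≤ (∫⁻ ω, g ω ∂lamMeasure).toReal := by
  have h1 : lam h ≤ ∫ ω, max (h ω : ℝ) 0 ∂lamMeasure := by
    refine integral_mono (integrable_elem h) ((integrable_elem h).pos_part) fun ω => le_max_left _ _
  refine h1.trans ?_
  rw [integral_eq_lintegral_of_nonneg_ae (f := fun ω => max (h ω : ℝ) 0) (Filter.Eventually.of_forall fun ω => le_max_right _ _)
    ((integrable_elem h).pos_part.aestronglyMeasurable)]
  refine ENNReal.toReal_mono hfin (lintegral_mono fun ω => ?_)
  rw [ENNReal.ofReal_max]
  simpa using hg ω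

/-! ### Semimeasures -/

namespace IsSemimeasure

variable {μ : Elem → ℝ} (hμ : IsSemimeasure μ)
include hμ

theorem zero : μ 0 = 0 := by
  have h1 := hμ.nonneg 0 (fun _ => le_rfl)
  have h2 := hμ.concave 1 0 0 zero_le_one
  simp at h2
  linarith

theorem add_le (f g : Elem) : μ f + μ g ≤ μ (f + g) := by
  simpa using hμ.concave 1 f g zero_le_one

theorem mono {f g : Elem} (h : ∀ ω, f ω ≤ g ω) : μ f ≤ μ g := by
  have h1 := hμ.add_le f (g - f)
  have h2 := hμ.nonneg (g - f) fun ω => sub_nonneg.2 (h ω)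
  rw [add_sub_cancel] at h1
  linarith

theorem smul_le {c : ℚ} (hc : 0 ≤ c) (f : Elem) : c * μ f ≤ μ (c • f) := by
  simpa [hμ.zero] using hμ.concave c f 0 hc

theorem smul {c : ℚ} (hc : 0 ≤ c) (f : Elem) : μ (c • f) = c * μ f := by
  refine le_antisymm ?_ (hμ.smul_le hc f)
  rcases hc.eq_or_lt with rfl | hc'
  · simp [hμ.zero]
  · have h := hμ.smul_le (inv_nonneg.2 hc) (c • f)
    rw [smul_smul, inv_mul_cancel₀ hc'.ne', one_smul] at h
    have : (0 : ℝ) < c := by exact_mod_cast hc'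
    push_cast at h
    field_simp at h
    linarith

theorem one_le : μ 1 ≤ 1 := by
  have h1 := hμ.add_le 1 (-1)
  rw [add_neg_cancel, hμ.zero] at h1
  have := hμ.neg_one_le
  linarith

theorem le_of_le {f : Elem} {B : ℚ} (hB : 0 ≤ B) (h : ∀ ω, f ω ≤ B) : μ f ≤ B := by
  have h1 : μ f ≤ μ (B • (1 : Elem)) := hμ.mono fun ω => by simpa using h ω
  rw [hμ.smul hB] at h1
  have h2 := hμ.one_le
  have : (0 : ℝ) ≤ B := by exact_mod_cast hB
  nlinarith

theorem sum_le {ι : Type*} (t : Finset ι) (f : ι → Elem) :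
    ∑ i ∈ t, μ (f i) ≤ μ (∑ i ∈ t, f i) := by
  classical
  induction t using Finset.induction_on with
  | empty => simp [hμ.zero]
  | insert a t ha ih =>
    rw [Finset.sum_insert ha, Finset.sum_insert ha]
    linarith [hμ.add_le (f a) (∑ i ∈ t, f i)]

theorem bddAbove_ext {g : Seq → ℝ} {B : ℝ} (hB : ∀ ω, g ω ≤ B) :
    BddAbove {r | ∃ h : Elem, (∀ ω, (h ω : ℝ) ≤ g ω) ∧ r = μ h} := by
  obtain ⟨q, hq⟩ := exists_rat_gt (max B 0)
  refine ⟨q, ?_⟩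
  rintro r ⟨h, hh, rfl⟩
  have hq0 : (0 : ℝ) < q := lt_of_le_of_lt (le_max_right _ _) hq
  refine hμ.le_of_le (by exact_mod_cast hq0.le) fun ω => ?_
  have := (hh ω).trans ((hB ω).trans ((le_max_left _ _).trans hq.le))
  exact_mod_cast this

theorem le_ext {g : Seq → ℝ} {B : ℝ} (hB : ∀ ω, g ω ≤ B) {h : Elem} (hh : ∀ ω, (h ω : ℝ) ≤ g ω) :
    μ h ≤ ext μ g := le_csSup (hμ.bddAbove_ext hB) ⟨h, hh, rfl⟩

end IsSemimeasure

theorem exists_bound (f : Elem) : ∃ B : ℚ, 0 ≤ B ∧ ∀ ω, |f ω| ≤ B := by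
  obtain ⟨n, hn⟩ := exists_digits f
  refine ⟨∑ s ∈ strs n, |f (ext0 s)|, Finset.sum_nonneg fun _ _ => abs_nonneg _, fun ω => ?_⟩
  have : f ω = f (ext0 (pre ω n)) := by
    refine hn _ _ ?_
    have := pre_ext0 (pre ω n)
    rw [length_pre] at this
    exact this.symm
  rw [this]
  exact Finset.single_le_sum (f := fun s => |f (ext0 s)|) (fun _ _ => abs_nonneg _) (by simp)

theorem ext_le {μ : Elem → ℝ} {g : Seq → ℝ} {B : ℝ} (h0 : ∃ h : Elem, ∀ ω, (h ω : ℝ) ≤ g ω)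
    (hB : ∀ h : Elem, (∀ ω, (h ω : ℝ) ≤ g ω) → μ h ≤ B) : ext μ g ≤ B := by
  obtain ⟨h, hh⟩ := h0
  refine csSup_le ⟨_, h, hh, rfl⟩ ?_
  rintro r ⟨h', hh', rfl⟩
  exact hB h' hh'

/-! ### Approximation of r.e. real functions from below -/

/-- A candidate for a lower bound found at time `t`: if `t` encodes a rational `q`, a length `p` and
a stage `k` at which `q` is recognized as a lower bound from the `p`-bit prefix of `s`, it is
`q` rounded down to a multiple of `2 ^ (-t - 1)`. -/
def candidate {X : Type*} (R : X × RatCode × List Bool → ℕ → Bool) (x : X) (s : List Bool)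
    (t : ℕ) : ℕ :=
  (Encodable.decode t : Option (RatCode × ℕ × ℕ)).elim 0 fun d =>
    if d.2.1 ≤ t ∧ R (x, d.1, s.take d.2.1) d.2.2 = true then
      (d.1.1 - d.1.2.1) * 2 ^ (t + 1) / (d.1.2.2 + 1) else 0

/-- The best lower bound, as a multiple of `2 ^ (-|s|)`, found in time `|s|` from the prefix `s`. -/
def lowerApprox {X : Type*} (R : X × RatCode × List Bool → ℕ → Bool) (x : X) (s : List Bool) : ℕ :=
  Nat.rec (motive := fun _ => ℕ) 0 (fun t acc => max (2 * acc) (candidate R x s t)) s.length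

section approx

variable {X : Type*}

theorem candidate_append (R : X × RatCode × List Bool → ℕ → Bool) (x : X) (s t : List Bool)
    {k : ℕ} (hk : k ≤ s.length) : candidate R x (s ++ t) k = candidate R x s k := by
  unfold candidate
  congr 1
  funext d
  by_cases h : d.2.1 ≤ k
  · rw [List.take_append_of_le_length (h.trans hk)]
  · simp [h]

theorem lowerApprox_append_singleton (R : X × RatCode × List Bool → ℕ → Bool) (x : X)
    (s : List Bool) (b : Bool) :
    lowerApprox R x (s ++ [b]) = max (2 * lowerApprox R x s) (candidate R x s s.length) := by
  have h : ∀ k ≤ s.length, Nat.rec (motive := fun _ => ℕ) 0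
      (fun t acc => max (2 * acc) (candidate R x (s ++ [b]) t)) k =
      Nat.rec (motive := fun _ => ℕ) 0 (fun t acc => max (2 * acc) (candidate R x s t)) k := by
    intro k
    induction k with
    | zero => intro _; rfl
    | succ k ih =>
      intro hk
      change max (2 * _) (candidate R x (s ++ [b]) k) = max (2 * _) (candidate R x s k)
      rw [ih (by omega), candidate_append R x s [b] (by omega)]
  unfold lowerApprox
  rw [List.length_append, List.length_singleton]
  change max (2 * _) (candidate R x (s ++ [b]) s.length) = _
  rw [h _ le_rfl, candidate_append R x s [b] le_rfl]

theorem primrec_lowerApprox [Primcodable X] (R : X × RatCode × List Bool → ℕ → Bool)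
    (hR : Primrec fun q : (X × RatCode × List Bool) × ℕ => R q.1 q.2) :
    Primrec fun q : X × List Bool => lowerApprox R q.1 q.2 := by
  unfold lowerApprox candidate
  have : Primrec fun q : ((X × List Bool) × ℕ × ℕ) × RatCode × ℕ × ℕ =>
      if q.2.2.1 ≤ q.1.2.1 ∧ R (q.1.1.1, q.2.1, q.1.1.2.take q.2.2.1) q.2.2.2 = true then
      (q.2.1.1 - q.2.1.2.1) * 2 ^ (q.1.2.1 + 1) / (q.2.1.2.2 + 1) else 0 := by
    have : Primrec fun q : ((X × List Bool) × ℕ × ℕ) × RatCode × ℕ × ℕ =>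
      bif decide (q.2.2.1 ≤ q.1.2.1) && R (q.1.1.1, q.2.1, q.1.1.2.take q.2.2.1) q.2.2.2 then
      (q.2.1.1 - q.2.1.2.1) * 2 ^ (q.1.2.1 + 1) / (q.2.1.2.2 + 1) else 0 := by fun_prop
    refine this.of_eq fun q => ?_
    rw [Bool.cond_eq_ite]
    simp only [Bool.and_eq_true, decide_eq_true_eq]
  fun_prop

/-- A nonnegative function of a sequence with an r.e. subgraph is the supremum of a nondecreasing
primitive recursive family of dyadic lower bounds, the `n`-th of which uses `n` digits. -/
theorem exists_lowerApprox [Primcodable X] {f : X → Seq → ℝ} (hf : ∀ x ω, 0 ≤ f x ω)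
    {S : X × RatCode × List Bool → Prop} (hS : REPred S)
    (h : ∀ x q ω, (ratOf q : ℝ) < f x ω ↔ ∃ n, S (x, q, pre ω n)) :
    ∃ a : X → List Bool → ℕ, (Primrec fun q : X × List Bool => a q.1 q.2) ∧ (∀ x, a x [] = 0) ∧
      (∀ x s b, 2 * a x s ≤ a x (s ++ [b])) ∧
      (∀ x ω n, (a x (pre ω n) : ℝ) / 2 ^ n ≤ f x ω) ∧
      ∀ x ω r, r < f x ω → ∃ n, r < (a x (pre ω n) : ℝ) / 2 ^ n := by
  obtain ⟨R, hR, mR, hRS⟩ := exists_stages hS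
  refine ⟨lowerApprox R, primrec_lowerApprox R hR, fun x => rfl, fun x s b => ?_, ?_, ?_⟩
  · rw [lowerApprox_append_singleton]; exact le_max_left _ _
  · intro x ω n
    induction n with
    | zero => simpa [lowerApprox] using hf x ω
    | succ n ih =>
      rw [pre_succ, lowerApprox_append_singleton, Nat.cast_max, div_le_iff₀ (by positivity)]
      refine max_le ?_ ?_
      · rw [div_le_iff₀ (by positivity)] at ih
        push_cast
        rw [pow_succ]
        linarith
      · rw [← div_le_iff₀ (by positivity)]
        unfold candidate
        rw [length_pre]
        cases hd : (Encodable.decode n : Option (RatCode × ℕ × ℕ)) with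
        | none => simpa using hf x ω
        | some d =>
          rw [Option.elim_some]
          split_ifs with hc
          · have h1 : (ratOf d.1 : ℝ) < f x ω := by
              rw [h]
              refine ⟨min d.2.1 n, (hRS _).2 ⟨d.2.2, ?_⟩⟩
              rw [← take_pre]
              exact hc.2
            rw [div_le_iff₀ (by positivity)]
            refine (Nat.cast_div_le).trans ?_
            by_cases h2 : d.1.2.1 ≤ d.1.1
            · have : (ratOf d.1 : ℝ) = ((d.1.1 : ℝ) - d.1.2.1) / (d.1.2.2 + 1) := by
                unfold ratOf; push_cast; rfl
              rw [this] at h1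
              push_cast [Nat.cast_sub h2]
              rw [mul_div_right_comm]
              exact mul_le_mul_of_nonneg_right h1.le (by positivity)
            · have h3 : d.1.1 - d.1.2.1 = 0 := by omega
              rw [h3]
              simp only [zero_mul, Nat.cast_zero, zero_div]
              exact mul_nonneg (hf x ω) (by positivity)
          · simpa using hf x ω
  · intro x ω r hr
    obtain ⟨q, hq1, hq2⟩ := exists_rat_btwn hr
    obtain ⟨c, rfl⟩ := exists_ratOf q
    obtain ⟨p, hp⟩ := (h x c ω).1 hq2
    obtain ⟨k, hk⟩ := (hRS _).1 hp
    obtain ⟨N, hN⟩ := exists_pow_lt_of_lt_one (sub_pos.2 hq1) (by norm_num : (1 / 2 : ℝ) < 1)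
    -- padding the stage makes the code `t` of the candidate at least `p` and `N`, so that the
    -- prefix is long enough and the rounding error at step `t` is small
    set K := max k (max N p) with hK
    set t := Encodable.encode ((c, p, K) : RatCode × ℕ × ℕ) with ht
    have htK : K ≤ t := by
      rw [ht, Encodable.encode_prod_val, Encodable.encode_prod_val]
      exact (Nat.right_le_pair _ _).trans (Nat.right_le_pair _ _)
    have hpt : p ≤ t := le_trans (le_trans (le_max_right _ _) (le_max_right _ _)) htK
    have hNt : N ≤ t := le_trans (le_trans (le_max_left _ _) (le_max_right _ _)) htK
    refine ⟨t + 1, ?_⟩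
    have hcand : candidate R x (pre ω t) t = (c.1 - c.2.1) * 2 ^ (t + 1) / (c.2.2 + 1) := by
      unfold candidate
      rw [ht, Encodable.encodek, Option.elim_some, ← ht, if_pos]
      refine ⟨hpt, ?_⟩
      simp only
      rw [take_pre, min_eq_left hpt]
      exact mR _ _ _ (le_max_left _ _) hk
    have h1 : (candidate R x (pre ω t) t : ℝ) ≤ lowerApprox R x (pre ω (t + 1)) := by
      rw [pre_succ, lowerApprox_append_singleton, length_pre]
      exact_mod_cast le_max_right _ _
    refine lt_of_lt_of_le ?_ (div_le_div_of_nonneg_right h1 (by positivity))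
    rw [hcand, lt_div_iff₀ (by positivity)]
    have h2 : (((c.1 - c.2.1) * 2 ^ (t + 1) : ℕ) : ℝ) / ((c.2.2 + 1 : ℕ) : ℝ) - 1 <
        (((c.1 - c.2.1) * 2 ^ (t + 1) / (c.2.2 + 1) : ℕ) : ℝ) := by
      have := Nat.lt_floor_add_one ((((c.1 - c.2.1) * 2 ^ (t + 1) : ℕ) : ℝ) / ((c.2.2 + 1 : ℕ) : ℝ))
      rw [Nat.floor_div_natCast, Nat.floor_natCast] at this
      linarith
    refine lt_of_le_of_lt ?_ h2
    have h3 : (ratOf c : ℝ) * 2 ^ (t + 1) ≤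
        (((c.1 - c.2.1) * 2 ^ (t + 1) : ℕ) : ℝ) / ((c.2.2 + 1 : ℕ) : ℝ) := by
      have e1 : (ratOf c : ℝ) = ((c.1 : ℝ) - c.2.1) / (c.2.2 + 1) := by
        unfold ratOf; push_cast; rfl
      have e2 : (c.1 : ℝ) - c.2.1 ≤ ((c.1 - c.2.1 : ℕ) : ℝ) := by
        rw [sub_le_iff_le_add]
        exact_mod_cast (by omega : c.1 ≤ c.1 - c.2.1 + c.2.1)
      rw [e1, div_mul_eq_mul_div]
      push_cast
      gcongr
    have h4 : (1 : ℝ) ≤ (ratOf c - r) * 2 ^ (t + 1) := by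
      have h5 : (1 / 2 : ℝ) ^ (t + 1) ≤ (1 / 2) ^ N :=
        pow_le_pow_of_le_one (by norm_num) (by norm_num) (by omega)
      have h6 : (1 / 2 : ℝ) ^ (t + 1) ≤ ratOf c - r := h5.trans hN.le
      rw [one_div, inv_pow] at h6
      rwa [inv_le_iff_one_le_mul₀ (by positivity)] at h6
    linarith

theorem approx_mono {a : List Bool → ℕ} (h : ∀ s b, 2 * a s ≤ a (s ++ [b])) (ω : Seq) :
    Monotone fun n => (a (pre ω n) : ℝ) / 2 ^ n := by
  refine monotone_nat_of_le_succ fun n => ?_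
  rw [pre_succ, div_le_div_iff₀ (by positivity) (by positivity), pow_succ]
  have : (2 * a (pre ω n) : ℝ) ≤ a (pre ω n ++ [ω n]) := by exact_mod_cast h _ _
  have : (2 * a (pre ω n) : ℝ) * 2 ^ n ≤ a (pre ω n ++ [ω n]) * 2 ^ n := by gcongr
  linarith

/-- The version of `exists_lowerApprox` without a sequence. -/
theorem exists_lowerApprox' [Primcodable X] {f : X → ℝ} (hf : ∀ x, 0 ≤ f x)
    (h : REPred fun p : X × RatCode => (ratOf p.2 : ℝ) < f p.1) :
    ∃ b : X → ℕ → ℕ, (Primrec fun q : X × ℕ => b q.1 q.2) ∧ (∀ x, b x 0 = 0) ∧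
      (∀ x n, 2 * b x n ≤ b x (n + 1)) ∧ (∀ x n, (b x n : ℝ) / 2 ^ n ≤ f x) ∧
      ∀ x r, r < f x → ∃ n, r < (b x n : ℝ) / 2 ^ n := by
  have h' : REPred fun p : X × RatCode × List Bool => (ratOf p.2.1 : ℝ) < f p.1 :=
    REPred.comp_primrec h (f := fun p : X × RatCode × List Bool => (p.1, p.2.1)) (by fun_prop)
  obtain ⟨a, ha, h0, hm, hle, hlt⟩ := exists_lowerApprox (f := fun x _ => f x) (fun x _ => hf x) h'
    fun x q ω => by simp
  refine ⟨fun x n => a x (pre (fun _ => false) n), ?_, h0, fun x n => ?_,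
    fun x n => hle x _ n, fun x r hr => hlt x _ r hr⟩
  · unfold pre
    fun_prop
  · dsimp only
    rw [pre_succ]
    exact hm _ _ _

end approx

theorem mono_div_pow {b : ℕ → ℕ} (h : ∀ n, 2 * b n ≤ b (n + 1)) :
    Monotone fun n => (b n : ℝ) / 2 ^ n := by
  refine monotone_nat_of_le_succ fun n => ?_
  rw [div_le_div_iff₀ (by positivity) (by positivity), pow_succ]
  have h1 : (2 * b n : ℝ) ≤ b (n + 1) := by exact_mod_cast h _
  have : (2 * b n : ℝ) * 2 ^ n ≤ b (n + 1) * 2 ^ n := by gcongr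
  linarith

theorem tendsto_of_mono_approx {b : ℕ → ℝ} {x : ℝ} (hm : Monotone b) (hle : ∀ n, b n ≤ x)
    (hlt : ∀ r, r < x → ∃ n, r < b n) : Filter.Tendsto b Filter.atTop (nhds x) := by
  refine tendsto_order.2 ⟨fun r hr => ?_, fun r hr => Filter.Eventually.of_forall fun n =>
    (hle n).trans_lt hr⟩
  obtain ⟨n, hn⟩ := hlt r hr
  exact Filter.eventually_atTop.2 ⟨n, fun k hk => hn.trans_le (hm hk)⟩

/-! ### Constructing r.e. functions -/

theorem rlt_iff_real (p q : RatCode) : rlt p q = true ↔ (ratOf p : ℝ) < (ratOf q : ℝ) := by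
  rw [rlt_iff]; exact_mod_cast Iff.rfl

theorem ratOf_dyad_real (a n : ℕ) : (ratOf (dyad a n) : ℝ) = (a : ℝ) / 2 ^ n := by
  rw [ratOf_dyad]; push_cast; rfl

/-- The code of `a / d` for positive `d`. -/
def frac (a d : ℕ) : RatCode := (a, 0, d - 1)

theorem ratOf_frac (a : ℕ) {d : ℕ} (hd : 0 < d) : (ratOf (frac a d) : ℝ) = (a : ℝ) / d := by
  unfold ratOf frac
  have : ((d - 1 : ℕ) : ℝ) + 1 = d := by rw [Nat.cast_sub hd]; simp
  push_cast
  rw [this]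
  simp

@[fun_prop] theorem primrec_frac {α : Type*} [Primcodable α] {f g : α → ℕ} (hf : Primrec f)
    (hg : Primrec g) : Primrec (fun x => frac (f x) (g x)) := by unfold frac; fun_prop

/-- A supremum of a primitive recursive family of rationals has an r.e. subgraph. -/
theorem re_of_sup {X β : Type*} [Primcodable X] [Primcodable β] {f : X → ℝ} (v : X → β → RatCode)
    (hv : Primrec fun q : X × β => v q.1 q.2)
    (h : ∀ x (r : ℚ), (r : ℝ) < f x ↔ ∃ i, (r : ℝ) < (ratOf (v x i) : ℝ)) :
    REPred fun p : X × RatCode => (ratOf p.2 : ℝ) < f p.1 := by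
  refine rePred_of_exists (fun (p : X × RatCode) i => rlt p.2 (v p.1 i)) (by fun_prop) fun p => ?_
  simp only [rlt_iff_real, h]

/-- A function of an integer and a sequence that is a supremum of a primitive recursive family of
rational functions of its prefixes is r.e. -/
theorem reCond_of_sup {β : Type*} [Primcodable β] {f : ℕ → Seq → ℝ}
    (v : ℕ → List Bool → β → RatCode) (hv : Primrec fun q : ℕ × List Bool × β => v q.1 q.2.1 q.2.2)
    (h : ∀ x α (r : ℚ), (r : ℝ) < f x α ↔ ∃ n i, (r : ℝ) < (ratOf (v x (pre α n) i) : ℝ)) :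
    RECondFun f := by
  refine ⟨fun p => ∃ i, rlt p.2.1 (v p.1 p.2.2 i) = true, ?_, fun x q α => ?_⟩
  · exact rePred_of_exists (fun (p : ℕ × RatCode × List Bool) i => rlt p.2.1 (v p.1 p.2.2 i))
      (by fun_prop) fun p => Iff.rfl
  · simp only [rlt_iff_real, h]

/-! ### Domination by universal distributions -/

theorem sum_range_succ_inv (N : ℕ) :
    ∑ r ∈ Finset.range N, (1 : ℝ) / ((r + 1) * (r + 2)) = 1 - 1 / (N + 1) := by
  induction N with
  | zero => simp
  | succ N ih =>
    rw [Finset.sum_range_succ, ih]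
    push_cast
    field_simp
    ring

/-- The sum of suprema is bounded if each choice of one term from each family has a bounded sum. -/
theorem sum_ciSup_le {ι κ : Type*} [Nonempty κ] (t : Finset ι) (f : ι → κ → ℝ) (B : ℝ)
    (h : ∀ c : ι → κ, ∑ i ∈ t, f i (c i) ≤ B) :
    ∑ i ∈ t, ⨆ k, f i k ≤ B := by
  refine le_of_forall_pos_le_add fun ε hε => ?_
  have h1 : ∀ i, ∃ k, (⨆ k, f i k) - ε / (t.card + 1) < f i k := fun i =>
    exists_lt_of_lt_ciSup (sub_lt_self _ (by positivity))
  choose c hc using h1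
  have h2 : ∑ i ∈ t, ((⨆ k, f i k) - ε / (t.card + 1)) ≤ ∑ i ∈ t, f i (c i) :=
    Finset.sum_le_sum fun i _ => (hc i).le
  rw [Finset.sum_sub_distrib, Finset.sum_const, nsmul_eq_mul] at h2
  have h3 : (t.card : ℝ) * (ε / (t.card + 1)) ≤ ε := by
    rw [mul_div_assoc', div_le_iff₀ (by positivity)]
    nlinarith
  linarith [h c]

section plain

variable {m : ℕ → ℝ} (hm : IsUniversalDistribution m)
include hm

theorem IsUniversalDistribution.nonneg (x : ℕ) : 0 ≤ m x := hm.1.1 x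

theorem IsUniversalDistribution.sum_le (t : Finset ℕ) : ∑ x ∈ t, m x ≤ 1 :=
  (hm.1.2.1.sum_le_tsum t fun x _ => hm.1.1 x).trans hm.1.2.2.1

theorem IsUniversalDistribution.le_one (x : ℕ) : m x ≤ 1 := by
  simpa using hm.sum_le {x}

/-- A nonnegative function with an r.e. subgraph and a finite sum is dominated by the universal
distribution. -/
theorem IsUniversalDistribution.dom {X : Type*} [Primcodable X] {F : X → ℝ} (hF : ∀ x, 0 ≤ F x)
    (hre : REPred fun p : X × RatCode => (ratOf p.2 : ℝ) < F p.1) {B : ℝ}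
    (hB : ∀ t : Finset X, ∑ x ∈ t, F x ≤ B) :
    ∃ C : ℝ, 0 < C ∧ ∀ x, F x ≤ C * m (Encodable.encode x) := by
  classical
  obtain ⟨k, hk⟩ := pow_unbounded_of_one_lt B (one_lt_two)
  -- `F` is scaled by `2 ^ (-k)` to have total at most `1` and extended by `0` off the range of
  -- `encode`
  let f : ℕ → ℝ := fun n => ((Encodable.decode₂ X n).elim 0 F) / 2 ^ k
  have hf0 : ∀ n, 0 ≤ f n := by
    intro n
    refine div_nonneg ?_ (by positivity)
    cases Encodable.decode₂ X n with
    | none => exact le_rfl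
    | some x => exact hF x
  have hfx : ∀ x : X, f (Encodable.encode x) = F x / 2 ^ k := by
    intro x; simp only [f, Encodable.encodek₂, Option.elim_some]
  have hsum : ∀ N, ∑ n ∈ Finset.range N, f n ≤ 1 := by
    intro N
    have h1 : ∑ x ∈ (Finset.range N).preimage Encodable.encode
        (Encodable.encode_injective (α := X)).injOn, f (Encodable.encode x) =
        ∑ n ∈ Finset.range N, f n := by
      refine Finset.sum_preimage _ _ _ _ fun n _ hn => ?_
      have : Encodable.decode₂ X n = none := by
        rw [Option.eq_none_iff_forall_not_mem]
        intro x hx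
        exact hn ⟨x, Encodable.mem_decode₂.1 hx⟩
      simp [f, this]
    rw [← h1]
    simp only [hfx]
    rw [← Finset.sum_div, div_le_one (by positivity)]
    exact (hB _).trans hk.le
  have hd : IsREDistribution f := by
    refine ⟨hf0, summable_of_sum_range_le hf0 hsum, Real.tsum_le_of_sum_range_le hf0 hsum, ?_⟩
    obtain ⟨R, hR, -, hRF⟩ := exists_stages hre
    have hdec : Primrec fun n : ℕ => Encodable.decode₂ X n := Primrec.decode₂
    refine rePred_of_exists (fun (p : ℕ × RatCode) t => (Encodable.decode₂ X p.1).elim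
      (rlt p.2 (0, 0, 0)) fun x => R (x, (p.2.1 * 2 ^ k, p.2.2.1 * 2 ^ k, p.2.2.2)) t)
      (by fun_prop) fun p => ?_
    have e0 : ratOf (0, 0, 0) = 0 := by simp [ratOf]
    simp only [f]
    cases Encodable.decode₂ X p.1 with
    | none => simp [rlt_iff_real, e0]
    | some x =>
      simp only [Option.elim_some]
      rw [← hRF (x, (p.2.1 * 2 ^ k, p.2.2.1 * 2 ^ k, p.2.2.2)), lt_div_iff₀ (by positivity)]
      have : ((ratOf (p.2.1 * 2 ^ k, p.2.2.1 * 2 ^ k, p.2.2.2) : ℚ) : ℝ) = ratOf p.2 * 2 ^ k := by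
        unfold ratOf; push_cast; ring
      rw [this]
  obtain ⟨c, hc, h⟩ := hm.2 f hd
  refine ⟨2 ^ k / c, by positivity, fun x => ?_⟩
  have := h (Encodable.encode x)
  rw [hfx] at this
  rw [div_mul_eq_mul_div, le_div_iff₀ hc]
  rw [mul_div_assoc', div_le_iff₀ (by positivity)] at this
  linarith

theorem IsUniversalDistribution.pos (x : ℕ) : 0 < m x := by
  have hv : Primrec fun q : ℕ × ℕ => frac (if q.1 = x then 1 else 0) 1 := by fun_prop
  have hre : REPred fun p : ℕ × RatCode => (ratOf p.2 : ℝ) < if p.1 = x then (1 : ℝ) else 0 :=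
    re_of_sup (f := fun y => if y = x then (1 : ℝ) else 0)
      (fun y (_ : ℕ) => frac (if y = x then 1 else 0) 1) hv fun y r => by
      rw [ratOf_frac _ one_pos]
      simp
  obtain ⟨C, hC, h⟩ := hm.dom (F := fun y : ℕ => if y = x then (1 : ℝ) else 0) (B := 1)
    (fun y => by split_ifs <;> norm_num) hre
    (fun t => by rw [Finset.sum_ite_eq']; split_ifs <;> norm_num)
  have := h x
  simp only [if_true, Encodable.encode_nat] at this
  by_contra hneg
  push Not at hneg
  nlinarith

/-- Stage approximations of the universal distribution. -/
theorem IsUniversalDistribution.exists_approx :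
    ∃ b : ℕ → ℕ → ℕ, (Primrec fun q : ℕ × ℕ => b q.1 q.2) ∧ (∀ x, b x 0 = 0) ∧
      (∀ x n, 2 * b x n ≤ b x (n + 1)) ∧ (∀ x n, (b x n : ℝ) / 2 ^ n ≤ m x) ∧
      ∀ x r, r < m x → ∃ n, r < (b x n : ℝ) / 2 ^ n :=
  exists_lowerApprox' hm.1.1 hm.1.2.2.2

/-- Computable functions do not increase complexity. -/
theorem IsUniversalDistribution.map {X Y : Type*} [Primcodable X] [Primcodable Y] {φ : X → Y}
    (hφ : Primrec φ) :
    ∃ C : ℝ, 0 < C ∧ ∀ x, m (Encodable.encode x) ≤ C * m (Encodable.encode (φ x)) := by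
  let _ : DecidableEq Y := Encodable.decidableEqOfEncodable Y
  obtain ⟨b, hb, b0, bm, ble, blt⟩ := hm.exists_approx
  let F : Y → ℝ := fun y => ⨆ x : X, if φ x = y then m (Encodable.encode x) else 0
  by_cases hX : Nonempty X
  swap
  · exact ⟨1, one_pos, fun x => (hX ⟨x⟩).elim⟩
  have hbd : ∀ y, BddAbove (Set.range fun x : X => if φ x = y then m (Encodable.encode x) else 0) :=
    fun y => ⟨1, by
      rintro _ ⟨x, rfl⟩
      dsimp only
      split_ifs
      exacts [hm.le_one _, zero_le_one]⟩
  have hF0 : ∀ y, 0 ≤ F y := fun y => Real.iSup_nonneg fun x => by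
    split_ifs
    exacts [hm.nonneg _, le_rfl]
  obtain ⟨C, hC, h⟩ := hm.dom (F := F) (B := 1) hF0
    (re_of_sup (β := X × ℕ) (fun y i => if φ i.1 = y then
      dyad (b (Encodable.encode i.1) i.2) i.2 else (0, 0, 0)) (by fun_prop) fun y r => by
        rw [lt_ciSup_iff (hbd y)]
        constructor
        · rintro ⟨x, hx⟩
          split_ifs at hx with he
          · obtain ⟨n, hn⟩ := blt _ _ hx
            exact ⟨(x, n), by simpa [he, ratOf_dyad] using hn⟩
          · exact ⟨(x, 0), by simpa [he, ratOf] using hx⟩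
        · rintro ⟨⟨x, n⟩, hx⟩
          refine ⟨x, ?_⟩
          dsimp only at hx
          split_ifs at hx ⊢ with he
          · rw [ratOf_dyad_real] at hx
            exact hx.trans_le (ble _ _)
          · simpa [ratOf] using hx)
    (fun t => sum_ciSup_le t _ _ (fun c => by
      rw [← Finset.sum_filter]
      have hinj : Set.InjOn (fun y => (Encodable.encode (c y) : ℕ)) (t.filter fun y => φ (c y) = y) := by
        intro y hy y' hy' hyy
        have h1 : c y = c y' := Encodable.encode_injective hyy
        rw [Finset.coe_filter] at hy hy'
        rw [← hy.2, ← hy'.2, h1]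
      rw [← Finset.sum_image (f := m) hinj]
      exact hm.sum_le _))
  refine ⟨C, hC, fun x => le_trans ?_ (h (φ x))⟩
  have := le_ciSup (hbd (φ x)) x
  rwa [if_pos rfl] at this

end plain

section cond

variable {mc : ℕ → Seq → ℝ} (hmc : IsUniversalCondDistribution mc)
include hmc

theorem IsUniversalCondDistribution.nonneg (x : ℕ) (α : Seq) : 0 ≤ mc x α := hmc.1.1 x α

theorem IsUniversalCondDistribution.sum_le (t : Finset ℕ) (α : Seq) : ∑ x ∈ t, mc x α ≤ 1 :=
  ((hmc.1.2.1 α).1.sum_le_tsum t fun x _ => hmc.1.1 x α).trans (hmc.1.2.1 α).2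

theorem IsUniversalCondDistribution.le_one (x : ℕ) (α : Seq) : mc x α ≤ 1 := by
  simpa using hmc.sum_le {x} α

/-- Stage approximations of the universal conditional distribution. -/
theorem IsUniversalCondDistribution.exists_approx :
    ∃ c : ℕ → List Bool → ℕ, (Primrec fun q : ℕ × List Bool => c q.1 q.2) ∧
      (∀ x s b, 2 * c x s ≤ c x (s ++ [b])) ∧
      (∀ x ω n, (c x (pre ω n) : ℝ) / 2 ^ n ≤ mc x ω) ∧
      ∀ x ω r, r < mc x ω → ∃ n, r < (c x (pre ω n) : ℝ) / 2 ^ n := by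
  obtain ⟨S, hS, h⟩ := hmc.1.2.2
  obtain ⟨a, ha, -, h1, h2, h3⟩ := exists_lowerApprox hmc.1.1 hS h
  exact ⟨a, ha, h1, h2, h3⟩

/-- A family of r.e. functions of an integer and a sequence is dominated by the universal
conditional distribution, with a loss quadratic in the index `r` of the member of the family,
at all sequences at which the total of the member is at most `B r`. (Members are truncated at
the sequences at which their totals are larger.) -/
theorem IsUniversalCondDistribution.dom (a : ℕ → ℕ → List Bool → ℕ)
    (ha : Primrec fun q : ℕ × ℕ × List Bool => a q.1 q.2.1 q.2.2)
    (am : ∀ r x s b, 2 * a r x s ≤ a r x (s ++ [b])) (B : ℕ → ℕ) (hB : Primrec B)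
    (B0 : ∀ r, 0 < B r) :
    ∃ C : ℝ, 0 < C ∧ ∀ r α, (∀ n, ∑ x ∈ Finset.range n, a r x (pre α n) ≤ B r * 2 ^ n) →
      ∀ x n, (a r x (pre α n) : ℝ) / 2 ^ n ≤ C * (B r * ((r + 1) * (r + 2))) * mc x α := by
  have B0' : ∀ r, (0 : ℝ) < B r := fun r => by exact_mod_cast B0 r
  classical
  -- `ok r x s`: the total of member `r` seen on `s` does not exceed `B r`; terms count only while
  -- this holds
  let ok : ℕ → ℕ → List Bool → Bool := fun r x s =>
    decide (x < s.length) && decide (∑ y ∈ Finset.range s.length, a r y s ≤ B r * 2 ^ s.length)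
  -- the weights `1 / ((r + 1) * (r + 2))` have sum `1`
  let v : ℕ → List Bool → ℕ → RatCode := fun x s r =>
    bif ok r x s then frac (a r x s) (2 ^ s.length * (B r * ((r + 1) * (r + 2)))) else (0, 0, 0)
  have hv : Primrec fun q : ℕ × List Bool × ℕ => v q.1 q.2.1 q.2.2 := by
    have hok : Primrec fun q : ℕ × ℕ × List Bool => ok q.1 q.2.1 q.2.2 := by fun_prop
    simp only [v]
    fun_prop
  have vval : ∀ x s r, ok r x s = true → (ratOf (v x s r) : ℝ) =
      (a r x s : ℝ) / 2 ^ s.length / (B r * ((r + 1) * (r + 2))) := by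
    intro x s r h
    simp only [v, h, cond_true]
    have := B0 r
    rw [ratOf_frac _ (by positivity), div_div]
    push_cast
    rfl
  have vval' : ∀ x s r, ok r x s = false → (ratOf (v x s r) : ℝ) = 0 := by
    intro x s r h
    simp only [v, h, cond_false]
    simp [ratOf]
  have v0 : ∀ x s r, 0 ≤ (ratOf (v x s r) : ℝ) := by
    intro x s r
    cases h : ok r x s
    · rw [vval' _ _ _ h]
    · have := B0' r
      rw [vval _ _ _ h]; positivity
  have okle : ∀ r x s, ok r x s = true →
      x < s.length ∧ ∑ y ∈ Finset.range s.length, (a r y s : ℝ) / 2 ^ s.length ≤ B r := by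
    intro r x s h
    simp only [ok, Bool.and_eq_true, decide_eq_true_eq] at h
    refine ⟨h.1, ?_⟩
    rw [← Finset.sum_div, div_le_iff₀ (by positivity)]
    exact_mod_cast h.2
  have v1 : ∀ x s r, (ratOf (v x s r) : ℝ) ≤ 1 := by
    intro x s r
    cases h : ok r x s
    · rw [vval' _ _ _ h]; exact zero_le_one
    · rw [vval _ _ _ h]
      obtain ⟨h1, h2⟩ := okle _ _ _ h
      have h3 : (a r x s : ℝ) / 2 ^ s.length ≤ B r :=
        (Finset.single_le_sum (f := fun y => (a r y s : ℝ) / 2 ^ s.length)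
          (fun _ _ => by positivity) (Finset.mem_range.2 h1)).trans h2
      have h4 := B0' r
      refine div_le_one_of_le₀ (h3.trans (le_mul_of_one_le_right h4.le ?_)) (by positivity)
      nlinarith [(Nat.cast_nonneg r : (0 : ℝ) ≤ r)]
  let f : ℕ → Seq → ℝ := fun x α => ⨆ i : ℕ × ℕ, (ratOf (v x (pre α i.1) i.2) : ℝ)
  have hbd : ∀ x α, BddAbove (Set.range fun i : ℕ × ℕ => (ratOf (v x (pre α i.1) i.2) : ℝ)) :=
    fun x α => ⟨1, by rintro _ ⟨i, rfl⟩; exact v1 _ _ _⟩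
  have hf0 : ∀ x α, 0 ≤ f x α := fun x α => Real.iSup_nonneg fun i => v0 _ _ _
  have hsum : ∀ α N, ∑ x ∈ Finset.range N, f x α ≤ 1 := by
    intro α N
    refine sum_ciSup_le _ _ _ fun c => ?_
    -- group the terms by the member of the family
    have hmaps : ∀ x ∈ Finset.range N, (c x).2 ∈ (Finset.range N).image fun x => (c x).2 :=
      fun x hx => Finset.mem_image_of_mem _ hx
    rw [← Finset.sum_fiberwise_of_maps_to hmaps]
    have hinner : ∀ r, ∑ x ∈ Finset.range N with (c x).2 = r,
        (ratOf (v x (pre α (c x).1) (c x).2) : ℝ) ≤ 1 / ((r + 1) * (r + 2)) := by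
      intro r
      obtain ⟨t, ht⟩ : ∃ t, t = (Finset.range N).filter fun x => (c x).2 = r := ⟨_, rfl⟩
      obtain ⟨u, hu⟩ : ∃ u, u = t.filter fun x => ok r x (pre α (c x).1) = true := ⟨_, rfl⟩
      rw [← ht]
      have e1 : ∑ x ∈ t, (ratOf (v x (pre α (c x).1) (c x).2) : ℝ) =
          ∑ x ∈ u, (a r x (pre α (c x).1) : ℝ) / 2 ^ (c x).1 / (B r * ((r + 1) * (r + 2))) := by
        rw [hu, Finset.sum_filter]
        refine Finset.sum_congr rfl fun x hx => ?_
        have hxr : (c x).2 = r := by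
          rw [ht] at hx
          exact (Finset.mem_filter.1 hx).2
        rw [hxr]
        split_ifs with h
        · rw [vval _ _ _ h, length_pre]
        · exact vval' _ _ _ (by simpa using h)
      have hmem : ∀ x ∈ u, ok r x (pre α (c x).1) = true := fun x hx => by
        rw [hu] at hx
        exact (Finset.mem_filter.1 hx).2
      rw [e1, ← Finset.sum_div]
      have h5 := B0' r
      rw [div_le_div_iff₀ (by positivity) (by positivity), one_mul]
      refine mul_le_mul_of_nonneg_right ?_ (by positivity)
      rcases u.eq_empty_or_nonempty with he | hne
      · simp [he, h5.le]
      -- the terms of member `r` are compared at the latest of the stages chosen for them, where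
      -- the truncation test still holds
      · obtain ⟨x0, hx0, hmax⟩ := u.exists_max_image (fun x => (c x).1) hne
        have h0 := okle _ _ _ (hmem x0 hx0)
        rw [length_pre] at h0
        have h1 : ∑ x ∈ u, (a r x (pre α (c x).1) : ℝ) / 2 ^ (c x).1 ≤
            ∑ x ∈ u, (a r x (pre α (c x0).1) : ℝ) / 2 ^ (c x0).1 :=
          Finset.sum_le_sum fun x hx => approx_mono (am r x) α (hmax x hx)
        refine h1.trans (le_trans ?_ h0.2)
        refine Finset.sum_le_sum_of_subset_of_nonneg (fun x hx => ?_) fun _ _ _ => by positivity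
        have h2 := (okle _ _ _ (hmem x hx)).1
        rw [length_pre] at h2
        exact Finset.mem_range.2 (h2.trans_le (hmax x hx))
    refine (Finset.sum_le_sum fun r _ => hinner r).trans ?_
    obtain ⟨K, hK⟩ := ((Finset.range N).image fun x => (c x).2).exists_nat_subset_range
    refine (Finset.sum_le_sum_of_subset_of_nonneg hK fun _ _ _ => by positivity).trans ?_
    rw [sum_range_succ_inv]
    have : (0 : ℝ) ≤ 1 / (K + 1) := by positivity
    linarith
  have hd : IsRECondDistribution f :=
    ⟨hf0, fun α => ⟨summable_of_sum_range_le (fun x => hf0 x α) (hsum α),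
      Real.tsum_le_of_sum_range_le (fun x => hf0 x α) (hsum α)⟩,
      reCond_of_sup v hv fun x α r => by
        simp only [f, lt_ciSup_iff (hbd x α), Prod.exists]⟩
  obtain ⟨c, hc, h⟩ := hmc.2 f hd
  refine ⟨1 / c, by positivity, fun r α hr x n => ?_⟩
  set N := max n (x + 1) with hN
  have h1 : (a r x (pre α n) : ℝ) / 2 ^ n ≤ (a r x (pre α N) : ℝ) / 2 ^ N :=
    approx_mono (am r x) α (le_max_left _ _)
  have hok : ok r x (pre α N) = true := by
    simp only [ok, Bool.and_eq_true, decide_eq_true_eq, length_pre]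
    exact ⟨lt_of_lt_of_le (Nat.lt_succ_self x) (le_max_right _ _), hr N⟩
  have h2 : (a r x (pre α N) : ℝ) / 2 ^ N / (B r * ((r + 1) * (r + 2))) ≤ f x α := by
    have := le_ciSup (hbd x α) (N, r)
    rwa [vval _ _ _ hok, length_pre] at this
  have h3 := h x α
  have h5 := B0' r
  rw [div_le_iff₀ (by positivity)] at h2
  have h4 : f x α ≤ 1 / c * mc x α := by
    rw [one_div, inv_mul_eq_div, le_div_iff₀ hc]; linarith
  calc _ ≤ _ := h1
    _ ≤ _ := h2
    _ ≤ (1 / c * mc x α) * (B r * ((r + 1) * (r + 2))) := by gcongr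
    _ = _ := by ring

end cond

/-! ### Integrable r.e. functions are bounded by the universal Martin-Löf test -/

theorem mlTest_lam (m : ℕ → ℝ) (ω : Seq) :
    mlTest m lam ω = ∑' i, ENNReal.ofReal (m (Encodable.encode (pre ω i))) * 2 ^ i := by
  unfold mlTest
  refine tsum_congr fun i => ?_
  rw [lam_cyl, length_pre, ENNReal.ofReal_inv_of_pos (by positivity), div_eq_mul_inv, inv_inv,
    ENNReal.ofReal_pow (by norm_num)]
  simp

/-- A series with coefficients `m j` that are approximated from below by `b j n / 2 ^ n` is
the supremum of its approximate partial sums. -/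
theorem lt_tsum_iff {m : ℕ → ℝ} {b : ℕ → ℕ → ℕ} (bm : ∀ x n, 2 * b x n ≤ b x (n + 1))
    (ble : ∀ x n, (b x n : ℝ) / 2 ^ n ≤ m x)
    (blt : ∀ x r, r < m x → ∃ n, r < (b x n : ℝ) / 2 ^ n) {c : ℕ → ℝ} (hc : ∀ j, 0 ≤ c j)
    (hs : Summable fun j => m j * c j) (r : ℝ) :
    r < ∑' j, m j * c j ↔ ∃ N, r < ∑ j ∈ Finset.range N, (b j N : ℝ) / 2 ^ N * c j := by
  have hm0 : ∀ j, 0 ≤ m j := fun j => le_trans (by positivity) (ble j 0)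
  constructor
  · intro h
    obtain ⟨N0, h0⟩ := (hs.hasSum.tendsto_sum_nat.eventually (lt_mem_nhds h)).exists
    have ht : Filter.Tendsto (fun n => ∑ j ∈ Finset.range N0, (b j n : ℝ) / 2 ^ n * c j)
        Filter.atTop (nhds (∑ j ∈ Finset.range N0, m j * c j)) :=
      tendsto_finsetSum _ fun j _ =>
        (tendsto_of_mono_approx (mono_div_pow (bm j)) (ble j) (blt j)).mul_const _
    obtain ⟨N, hN, hN0⟩ := ((ht.eventually (lt_mem_nhds h0)).and
      (Filter.eventually_ge_atTop N0)).exists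
    refine ⟨N, hN.trans_le ?_⟩
    exact Finset.sum_le_sum_of_subset_of_nonneg (Finset.range_mono hN0)
      fun j _ _ => mul_nonneg (by positivity) (hc j)
  · rintro ⟨N, h⟩
    refine h.trans_le (le_trans ?_ (hs.sum_le_tsum (Finset.range N)
      fun j _ => mul_nonneg (hm0 j) (hc j)))
    exact Finset.sum_le_sum fun j _ => mul_le_mul_of_nonneg_right (ble j N) (hc j)

/-- The increment of `a` at the last digit of `s`. -/
def incr (a : List Bool → ℕ) (s : List Bool) : ℕ := a s - 2 * a (s.take (s.length - 1))

@[fun_prop] theorem primrec_incr {α : Type*} [Primcodable α] {a : α → List Bool → ℕ}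
    {f : α → List Bool} (ha : Primrec fun p : α × List Bool => a p.1 p.2) (hf : Primrec f) :
    Primrec fun x => incr (a x) (f x) := by unfold incr; fun_prop

theorem incr_append {a : List Bool → ℕ} (am : ∀ s b, 2 * a s ≤ a (s ++ [b])) (s : List Bool)
    (b : Bool) : (incr a (s ++ [b]) : ℝ) = a (s ++ [b]) - 2 * a s := by
  have : (s ++ [b]).take ((s ++ [b]).length - 1) = s := by simp
  rw [incr, this, Nat.cast_sub (am s b)]
  push_cast
  rfl

theorem sum_incr {a : List Bool → ℕ} (a0 : a [] = 0) (am : ∀ s b, 2 * a s ≤ a (s ++ [b])) (ω : Seq)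
    (n : ℕ) : ∑ i ∈ Finset.range (n + 1), (incr a (pre ω i) : ℝ) / 2 ^ i =
      (a (pre ω n) : ℝ) / 2 ^ n := by
  induction n with
  | zero => simp [incr, a0]
  | succ n ih =>
    rw [Finset.sum_range_succ, ih, pre_succ, incr_append am, pow_succ]
    field_simp
    ring

theorem sum_strs_incr {a : List Bool → ℕ} (am : ∀ s b, 2 * a s ≤ a (s ++ [b])) (n : ℕ) :
    (∑ s ∈ strs (n + 1), (incr a s : ℝ)) / 4 ^ (n + 1) =
      (∑ s ∈ strs (n + 1), (a s : ℝ)) / 4 ^ (n + 1) - (∑ s ∈ strs n, (a s : ℝ)) / 4 ^ n := by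
  rw [sum_strs_succ, sum_strs_succ]
  simp only [incr_append am]
  have : ∑ s ∈ strs n, ((a (s ++ [false]) : ℝ) - 2 * a s + (a (s ++ [true]) - 2 * a s)) =
      ∑ s ∈ strs n, ((a (s ++ [false]) : ℝ) + a (s ++ [true])) - 4 * ∑ s ∈ strs n, (a s : ℝ) := by
    rw [Finset.mul_sum, ← Finset.sum_sub_distrib]
    exact Finset.sum_congr rfl fun s _ => by ring
  rw [this, pow_succ]
  field_simp

theorem sum_strs_mono {a : List Bool → ℕ} (am : ∀ s b, 2 * a s ≤ a (s ++ [b])) (n : ℕ) :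
    (∑ s ∈ strs n, (a s : ℝ)) / 4 ^ n ≤ (∑ s ∈ strs (n + 1), (a s : ℝ)) / 4 ^ (n + 1) := by
  have h : (0 : ℝ) ≤ (∑ s ∈ strs (n + 1), (incr a s : ℝ)) / 4 ^ (n + 1) := by positivity
  rw [sum_strs_incr am] at h
  linarith

/-- Increments stopped when the mean exceeds `1` have total at most `1`. -/
theorem sum_incr_stopped_le {a : List Bool → ℕ} (a0 : a [] = 0)
    (am : ∀ s b, 2 * a s ≤ a (s ++ [b])) (L : ℕ) :
    ∑ n ∈ Finset.range (L + 1), (if ∑ s ∈ strs n, a s ≤ 4 ^ n then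
      (∑ s ∈ strs n, (incr a s : ℝ)) / 4 ^ n else 0) ≤ 1 := by
  set D : ℕ → ℝ := fun n => (∑ s ∈ strs n, (a s : ℝ)) / 4 ^ n with hD
  have hc : ∀ n, (∑ s ∈ strs n, a s ≤ 4 ^ n) ↔ D n ≤ 1 := by
    intro n
    simp only [hD]
    rw [div_le_one (by positivity)]
    norm_cast
  have hmono : ∀ n, D n ≤ D (n + 1) := sum_strs_mono am
  have key : ∀ L, ∑ n ∈ Finset.range (L + 1), (if ∑ s ∈ strs n, a s ≤ 4 ^ n then
      (∑ s ∈ strs n, (incr a s : ℝ)) / 4 ^ n else 0) ≤ 1 ∧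
      (D L ≤ 1 → ∑ n ∈ Finset.range (L + 1), (if ∑ s ∈ strs n, a s ≤ 4 ^ n then
      (∑ s ∈ strs n, (incr a s : ℝ)) / 4 ^ n else 0) = D L) := by
    intro L
    induction L with
    | zero => simp [sum_strs_zero, a0, incr, hD]
    | succ L ih =>
      rw [Finset.sum_range_succ]
      by_cases h : D (L + 1) ≤ 1
      · have h' := ih.2 ((hmono L).trans h)
        rw [if_pos ((hc _).2 h), h', sum_strs_incr am]
        change D L + (D (L + 1) - D L) ≤ 1 ∧ (_ → D L + (D (L + 1) - D L) = _)
        exact ⟨by linarith, fun _ => by ring⟩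
      · rw [if_neg (fun h' => h ((hc _).1 h'))]
        exact ⟨by linarith [ih.1], fun h' => (h h').elim⟩
  exact (key L).1

/-- `a` is an approximation of a function with mean at most `1`. -/
def MeanLeOne (a : List Bool → ℕ) : Prop := ∀ n, ∑ s ∈ strs n, a s ≤ 4 ^ n

/-- For a uniformly r.e. family of functions, the universal Martin-Löf test bounds the
sum of those of its members that have mean at most `1`, weighted by the universal distribution.
The increments of each member at each string, stopped when the mean exceeds `1`, form a
distribution on strings. -/
theorem IsUniversalDistribution.dom_test {m : ℕ → ℝ} (hm : IsUniversalDistribution m)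
    (a : ℕ → List Bool → ℕ) (ha : Primrec fun q : ℕ × List Bool => a q.1 q.2)
    (a0 : ∀ j, a j [] = 0) (am : ∀ j s b, 2 * a j s ≤ a j (s ++ [b])) :
    ∃ C : ℝ, 0 < C ∧ ∀ ω, ∑' j, {j | MeanLeOne (a j)}.indicator (fun j => ENNReal.ofReal (m j) *
      ⨆ n, ENNReal.ofReal ((a j (pre ω n) : ℝ) / 2 ^ n)) j ≤ ENNReal.ofReal C * mlTest m lam ω := by
  obtain ⟨b, hb, b0, bm, ble, blt⟩ := hm.exists_approx
  -- stopped increments of member `j` at `s`, divided by `2 ^ |s|` (value) and by `2 ^ |s|`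
  -- (measure of the cylinder)
  let coef : ℕ → List Bool → ℝ := fun j s =>
    ((if ∑ t ∈ strs s.length, a j t ≤ 4 ^ s.length then incr (a j) s else 0 : ℕ) : ℝ) / 4 ^ s.length
  have coef0 : ∀ j s, 0 ≤ coef j s := fun j s => by positivity
  have coef1 : ∀ j s, coef j s ≤ 1 := by
    intro j s
    simp only [coef]
    rw [div_le_one (by positivity)]
    split_ifs with h
    · have h1 : incr (a j) s ≤ ∑ t ∈ strs s.length, a j t :=
        (Nat.sub_le _ _).trans (Finset.single_le_sum (f := fun t => a j t)
          (fun _ _ => Nat.zero_le _) (by simp))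
      exact_mod_cast h1.trans h
    · rw [Nat.cast_zero]; positivity
  have hsm : ∀ s, Summable fun j => m j * coef j s := fun s =>
    Summable.of_nonneg_of_le (fun j => mul_nonneg (hm.nonneg j) (coef0 j s))
      (fun j => mul_le_of_le_one_right (hm.nonneg j) (coef1 j s)) hm.1.2.1
  let F : List Bool → ℝ := fun s => ∑' j, m j * coef j s
  have hF0 : ∀ s, 0 ≤ F s := fun s => tsum_nonneg fun j => mul_nonneg (hm.nonneg j) (coef0 j s)
  have hlevel : ∀ j n, ∑ s ∈ strs n, coef j s = if ∑ s ∈ strs n, a j s ≤ 4 ^ n then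
      (∑ s ∈ strs n, (incr (a j) s : ℝ)) / 4 ^ n else 0 := by
    intro j n
    have : ∀ s ∈ strs n, coef j s = if ∑ s ∈ strs n, a j s ≤ 4 ^ n then
        (incr (a j) s : ℝ) / 4 ^ n else 0 := by
      intro s hs
      rw [mem_strs] at hs
      simp only [coef, hs]
      split_ifs <;> simp
    rw [Finset.sum_congr rfl this]
    split_ifs
    · rw [Finset.sum_div]
    · simp
  -- for each `j`, the sums over the strings of each length telescope
  have hsum : ∀ t : Finset (List Bool), ∑ s ∈ t, F s ≤ 1 := by
    intro t
    have hsub : t ⊆ (Finset.range (t.sup List.length + 1)).biUnion strs := by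
      intro s hs
      rw [Finset.mem_biUnion]
      exact ⟨s.length, Finset.mem_range.2 (Nat.lt_succ_of_le (Finset.le_sup (f := List.length) hs)),
        by simp⟩
    refine (Finset.sum_le_sum_of_subset_of_nonneg hsub fun s _ _ => hF0 s).trans ?_
    rw [Finset.sum_biUnion]
    swap
    · intro i _ j _ hij
      refine Finset.disjoint_left.2 fun s hs hs' => hij ?_
      rw [mem_strs] at hs hs'
      rw [← hs, ← hs']
    have e1 : ∀ n, ∑ s ∈ strs n, F s = ∑' j, m j * ∑ s ∈ strs n, coef j s := by
      intro n
      simp only [F]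
      rw [← Summable.tsum_finsetSum fun s _ => hsm s]
      simp only [Finset.mul_sum]
    have hsm2 : ∀ n, Summable fun j => m j * ∑ s ∈ strs n, coef j s := by
      intro n
      simp only [Finset.mul_sum]
      exact summable_sum fun s _ => hsm s
    simp only [e1]
    rw [← Summable.tsum_finsetSum fun n _ => hsm2 n]
    refine le_trans (Summable.tsum_le_tsum (g := m) (fun j => ?_) (summable_sum fun n _ => hsm2 n)
      hm.1.2.1) hm.1.2.2.1
    rw [← Finset.mul_sum]
    refine mul_le_of_le_one_right (hm.nonneg j) ?_
    simp only [hlevel]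
    exact sum_incr_stopped_le (a0 j) (am j) _
  have hprim : Primrec fun q : List Bool × ℕ => frac (∑ j ∈ Finset.range q.2, b j q.2 *
      (if ∑ t ∈ strs q.1.length, a j t ≤ 4 ^ q.1.length then incr (a j) q.1 else 0))
      (2 ^ q.2 * 4 ^ q.1.length) := by fun_prop
  have hre : REPred fun p : List Bool × RatCode => (ratOf p.2 : ℝ) < F p.1 := by
    refine re_of_sup (fun s N => frac (∑ j ∈ Finset.range N, b j N *
      (if ∑ t ∈ strs s.length, a j t ≤ 4 ^ s.length then incr (a j) s else 0))
      (2 ^ N * 4 ^ s.length)) hprim fun s r => ?_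
    simp only [F]
    rw [lt_tsum_iff bm ble blt (fun j => coef0 j s) (hsm s)]
    refine exists_congr fun N => ?_
    rw [ratOf_frac _ (by positivity)]
    have : ∑ j ∈ Finset.range N, (b j N : ℝ) / 2 ^ N * coef j s = ((∑ j ∈ Finset.range N, b j N *
      (if ∑ t ∈ strs s.length, a j t ≤ 4 ^ s.length then incr (a j) s else 0) : ℕ) : ℝ) /
      ((2 ^ N * 4 ^ s.length : ℕ) : ℝ) := by
      push_cast
      rw [Finset.sum_div]
      refine Finset.sum_congr rfl fun j _ => ?_
      simp only [coef]
      rw [div_mul_div_comm]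
      push_cast
      rfl
    rw [this]
  obtain ⟨C, hC, h⟩ := hm.dom hF0 hre hsum
  refine ⟨C, hC, fun ω => ?_⟩
  have h1 : ∑' i, ENNReal.ofReal (F (pre ω i)) * 2 ^ i ≤ ENNReal.ofReal C * mlTest m lam ω := by
    rw [mlTest_lam, ← ENNReal.tsum_mul_left]
    refine ENNReal.tsum_le_tsum fun i => ?_
    rw [← mul_assoc, ← ENNReal.ofReal_mul hC.le]
    gcongr
    exact h _
  refine le_trans ?_ h1
  have h2 : ∑' i, ENNReal.ofReal (F (pre ω i)) * 2 ^ i =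
      ∑' j, ENNReal.ofReal (m j) * ∑' i, ENNReal.ofReal (coef j (pre ω i)) * 2 ^ i := by
    have : ∀ i, ENNReal.ofReal (F (pre ω i)) * 2 ^ i =
        ∑' j, ENNReal.ofReal (m j) * (ENNReal.ofReal (coef j (pre ω i)) * 2 ^ i) := by
      intro i
      simp only [F]
      rw [ENNReal.ofReal_tsum_of_nonneg (fun j => mul_nonneg (hm.nonneg j) (coef0 j _)) (hsm _),
        ← ENNReal.tsum_mul_right]
      refine tsum_congr fun j => ?_
      rw [ENNReal.ofReal_mul (hm.nonneg j), mul_assoc]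
    simp only [this]
    rw [ENNReal.tsum_comm]
    simp only [ENNReal.tsum_mul_left]
  rw [h2]
  refine ENNReal.tsum_le_tsum fun j => ?_
  by_cases hj : j ∈ {j | MeanLeOne (a j)}
  swap
  · rw [Set.indicator_of_notMem hj]; exact zero_le
  rw [Set.indicator_of_mem hj]
  gcongr
  refine iSup_le fun n => ?_
  rw [← sum_incr (a0 j) (am j) ω n]
  rw [ENNReal.ofReal_sum_of_nonneg fun i _ => by positivity]
  refine le_trans (Finset.sum_le_sum fun i _ => ?_) (ENNReal.sum_le_tsum (Finset.range (n + 1)))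
  have h3 : coef j (pre ω i) * 2 ^ i = (incr (a j) (pre ω i) : ℝ) / 2 ^ i := by
    simp only [coef, length_pre]
    rw [if_pos (hj i), show (4 : ℝ) = 2 * 2 by norm_num, mul_pow]
    field_simp
  rw [← h3, ENNReal.ofReal_mul (coef0 j _), ENNReal.ofReal_pow (by norm_num)]
  simp

/-! ### Complexity of pairs -/

theorem sum_half_pow_le {x : ℝ} (hx : 0 ≤ x) (t : Finset ℕ) (ht : ∀ k ∈ t, (1 / 2 : ℝ) ^ k < x) :
    ∑ k ∈ t, (1 / 2 : ℝ) ^ k ≤ 2 * x := by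
  rcases t.eq_empty_or_nonempty with rfl | hne
  · simpa using hx
  · have hmin := t.min'_mem hne
    set k0 := t.min' hne
    have h1 : ∑ k ∈ t, (1 / 2 : ℝ) ^ k ≤ ∑ k ∈ Finset.Ico k0 (t.max' hne + 1), (1 / 2 : ℝ) ^ k := by
      refine Finset.sum_le_sum_of_subset_of_nonneg (fun k hk => ?_) fun _ _ _ => by positivity
      rw [Finset.mem_Ico]
      exact ⟨t.min'_le k hk, Nat.lt_succ_of_le (t.le_max' k hk)⟩
    have h2 : ∀ n, ∑ k ∈ Finset.Ico k0 (k0 + n), (1 / 2 : ℝ) ^ k ≤ 2 * (1 / 2) ^ k0 := by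
      intro n
      rw [Finset.sum_Ico_eq_sum_range]
      have : ∑ k ∈ Finset.range (k0 + n - k0), (1 / 2 : ℝ) ^ (k0 + k) =
          (1 / 2) ^ k0 * ∑ k ∈ Finset.range n, (1 / 2 : ℝ) ^ k := by
        rw [Finset.mul_sum, Nat.add_sub_cancel_left]
        exact Finset.sum_congr rfl fun k _ => pow_add _ _ _
      rw [this, geom_sum_eq (by norm_num)]
      have h3 : (0 : ℝ) ≤ (1 / 2) ^ n := by positivity
      have h4 : (0 : ℝ) < (1 / 2) ^ k0 := by positivity
      have h5 : ((1 / 2 : ℝ) ^ n - 1) / (1 / 2 - 1) = 2 - 2 * (1 / 2) ^ n := by ring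
      rw [h5]
      nlinarith
    have h3 : k0 ≤ t.max' hne + 1 := (t.min'_le_max' hne).trans (Nat.le_succ _)
    obtain ⟨n, hn⟩ := Nat.exists_eq_add_of_le h3
    rw [hn] at h1
    linarith [h2 n, ht _ hmin]

theorem pre_code_findIdx {w n : ℕ} (h : w < n) : (pre (code w) n).findIdx (fun b => !b) = w := by
  have hl : w < (pre (code w) n).length := by simpa using h
  rw [List.findIdx_eq hl]
  refine ⟨by simp [pre, code], fun j hj => by simp [pre, code, hj]⟩

theorem findIdx_append_of_lt {s : List Bool} (b : Bool)
    (h : s.findIdx (fun b => !b) < s.length) :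
    (s ++ [b]).findIdx (fun b => !b) = s.findIdx (fun b => !b) := by
  rw [List.findIdx_append, if_pos h]

@[fun_prop] theorem primrec_findIdx {α : Type*} [Primcodable α] {f : α → List Bool}
    (hf : Primrec f) : Primrec fun x => (f x).findIdx (fun b => !b) :=
  Primrec.list_findIdx hf (p := fun _ b => !b) (Primrec.not.comp Primrec.snd).to₂

section

variable {m : ℕ → ℝ} (hm : IsUniversalDistribution m)
include hm

/-- The sum of `m` over all pairs with the first term `u` is an r.e. distribution in `u`. -/
theorem IsUniversalDistribution.marginal :
    ∃ C : ℝ, 0 < C ∧ ∀ u N, ∑ v ∈ Finset.range N, m (Nat.pair u v) ≤ C * m u := by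
  obtain ⟨b, hb, b0, bm, ble, blt⟩ := hm.exists_approx
  have hinj : ∀ u, Function.Injective fun v => Nat.pair u v := fun u v v' h => by
    simpa using h
  have hle : ∀ u N, ∑ v ∈ Finset.range N, m (Nat.pair u v) ≤ 1 := by
    intro u N
    rw [← Finset.sum_image (f := m) (hinj u).injOn]
    exact hm.sum_le _
  have hbd : ∀ u, BddAbove (Set.range fun N => ∑ v ∈ Finset.range N, m (Nat.pair u v)) :=
    fun u => ⟨1, by rintro _ ⟨N, rfl⟩; exact hle u N⟩
  let F : ℕ → ℝ := fun u => ⨆ N, ∑ v ∈ Finset.range N, m (Nat.pair u v)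
  have hF0 : ∀ u, 0 ≤ F u := fun u => Real.iSup_nonneg fun N =>
    Finset.sum_nonneg fun v _ => hm.nonneg _
  have hp : Primrec fun q : ℕ × ℕ => dyad (∑ v ∈ Finset.range q.2, b (Nat.pair q.1 v) q.2) q.2 := by
    fun_prop
  have hre : REPred fun p : ℕ × RatCode => (ratOf p.2 : ℝ) < F p.1 := by
    refine re_of_sup (fun u N => dyad (∑ v ∈ Finset.range N, b (Nat.pair u v) N) N) hp fun u r => ?_
    rw [lt_ciSup_iff (hbd u)]
    simp only [ratOf_dyad_real]
    push_cast
    simp only [Finset.sum_div]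
    constructor
    · rintro ⟨N, hN⟩
      have ht : Filter.Tendsto (fun n => ∑ v ∈ Finset.range N, (b (Nat.pair u v) n : ℝ) / 2 ^ n)
          Filter.atTop (nhds (∑ v ∈ Finset.range N, m (Nat.pair u v))) :=
        tendsto_finsetSum _ fun v _ =>
          tendsto_of_mono_approx (mono_div_pow (bm _)) (ble _) (blt _)
      obtain ⟨n, hn, hnN⟩ := ((ht.eventually (lt_mem_nhds hN)).and
        (Filter.eventually_ge_atTop N)).exists
      exact ⟨n, hn.trans_le (Finset.sum_le_sum_of_subset_of_nonneg (Finset.range_mono hnN)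
        fun v _ _ => by positivity)⟩
    · rintro ⟨n, hn⟩
      exact ⟨n, hn.trans_le (Finset.sum_le_sum fun v _ => ble _ _)⟩
  obtain ⟨C, hC, h⟩ := hm.dom hF0 hre (B := 1) fun t => sum_ciSup_le _ _ _ fun c => by
    rw [Finset.sum_sigma', ← Finset.sum_image (f := m) (g := fun p : (_ : ℕ) × ℕ => Nat.pair p.1 p.2)]
    · exact hm.sum_le _
    · rintro ⟨u, v⟩ _ ⟨u', v'⟩ _ h
      simp only [Nat.pair_eq_pair] at h
      rw [h.1, h.2]
  exact ⟨C, hC, fun u N => (le_ciSup (hbd u) N).trans (h u)⟩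

/-- The integer `w` together with a sample from the conditional distribution at `w`. -/
theorem IsUniversalDistribution.mul_cond_le {mc : ℕ → Seq → ℝ}
    (hmc : IsUniversalCondDistribution mc) :
    ∃ C : ℝ, 0 < C ∧ ∀ w v, m w * mc v (code w) ≤ C * m (Nat.pair w v) := by
  obtain ⟨b, hb, b0, bm, ble, blt⟩ := hm.exists_approx
  obtain ⟨c, hc, cm, cle, clt⟩ := hmc.exists_approx
  let F : ℕ × ℕ → ℝ := fun p => m p.1 * mc p.2 (code p.1)
  have hF0 : ∀ p, 0 ≤ F p := fun p => mul_nonneg (hm.nonneg _) (hmc.nonneg _ _)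
  have hp : Primrec fun q : (ℕ × ℕ) × ℕ => dyad (b q.1.1 q.2 * c q.1.2 (pre (code q.1.1) q.2))
      (q.2 + q.2) := by
    unfold pre code
    fun_prop
  have hre : REPred fun p : (ℕ × ℕ) × RatCode => (ratOf p.2 : ℝ) < F p.1 := by
    refine re_of_sup (fun p n => dyad (b p.1 n * c p.2 (pre (code p.1) n)) (n + n)) hp fun p r => ?_
    simp only [ratOf_dyad_real, F]
    have e : ∀ n, ((b p.1 n * c p.2 (pre (code p.1) n) : ℕ) : ℝ) / 2 ^ (n + n) =
        (b p.1 n : ℝ) / 2 ^ n * ((c p.2 (pre (code p.1) n) : ℝ) / 2 ^ n) := by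
      intro n
      rw [div_mul_div_comm, pow_add]; push_cast; rfl
    simp only [e]
    constructor
    · intro h
      exact (((tendsto_of_mono_approx (mono_div_pow (bm _)) (ble _) (blt p.1)).mul
        (tendsto_of_mono_approx (approx_mono (cm p.2) (code p.1)) (cle _ _)
          (clt p.2 (code p.1)))).eventually (lt_mem_nhds h)).exists
    · rintro ⟨n, hn⟩
      exact hn.trans_le (mul_le_mul (ble _ _) (cle _ _ _) (by positivity) (hm.nonneg _))
  obtain ⟨C, hC, h⟩ := hm.dom hF0 hre (B := 1) fun t => by
    have hsub : t ⊆ t.image Prod.fst ×ˢ t.image Prod.snd := fun p hp =>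
      Finset.mem_product.2 ⟨Finset.mem_image_of_mem _ hp, Finset.mem_image_of_mem _ hp⟩
    refine (Finset.sum_le_sum_of_subset_of_nonneg hsub fun p _ _ => hF0 p).trans ?_
    rw [Finset.sum_product]
    refine le_trans (Finset.sum_le_sum fun w _ => ?_) (hm.sum_le (t.image Prod.fst))
    simp only [F]
    rw [← Finset.mul_sum]
    exact mul_le_of_le_one_right (hm.nonneg _) (hmc.sum_le _ _)
  exact ⟨C, hC, fun w v => by simpa [F, Encodable.encode_prod_val] using h (w, v)⟩

/-- An integer `u` together with its complexity `k` has no more complexity than `u`. -/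
theorem IsUniversalDistribution.half_pow_le :
    ∃ C : ℝ, 0 < C ∧ ∀ u k, (1 / 2 : ℝ) ^ k < m u → (1 / 2 : ℝ) ^ k ≤ C * m (Nat.pair u k) := by
  classical
  obtain ⟨b, hb, b0, bm, ble, blt⟩ := hm.exists_approx
  let F : ℕ × ℕ → ℝ := fun p => if (1 / 2 : ℝ) ^ p.2 < m p.1 then (1 / 2 : ℝ) ^ p.2 else 0
  have hF0 : ∀ p, 0 ≤ F p := fun p => by simp only [F]; positivity
  have hp : Primrec fun q : (ℕ × ℕ) × ℕ =>
      dyad (if 2 ^ q.2 < b q.1.1 q.2 * 2 ^ q.1.2 then 1 else 0) q.1.2 := by fun_prop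
  have hre : REPred fun p : (ℕ × ℕ) × RatCode => (ratOf p.2 : ℝ) < F p.1 := by
    refine re_of_sup (fun p n => dyad (if 2 ^ n < b p.1 n * 2 ^ p.2 then 1 else 0) p.2) hp
      fun p r => ?_
    have e : ∀ n, 2 ^ n < b p.1 n * 2 ^ p.2 ↔ (1 / 2 : ℝ) ^ p.2 < (b p.1 n : ℝ) / 2 ^ n := by
      intro n
      rw [one_div, inv_pow, inv_eq_one_div, div_lt_div_iff₀ (by positivity) (by positivity), one_mul]
      norm_cast
    simp only [ratOf_dyad_real, F, e]
    constructor
    · intro h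
      split_ifs at h with h1
      · obtain ⟨n, hn⟩ := blt _ _ h1
        exact ⟨n, by rw [if_pos hn]; simpa using h⟩
      · refine ⟨0, ?_⟩
        split_ifs
        · exact h.trans (by positivity)
        · simpa using h
    · rintro ⟨n, hn⟩
      split_ifs at hn with h1
      · rw [if_pos (h1.trans_le (ble _ _))]; simpa using hn
      · exact lt_of_lt_of_le (by simpa using hn) (hF0 p)
  obtain ⟨C, hC, h⟩ := hm.dom hF0 hre (B := 2) fun t => by
    have hsub : t ⊆ t.image Prod.fst ×ˢ t.image Prod.snd := fun p hp =>
      Finset.mem_product.2 ⟨Finset.mem_image_of_mem _ hp, Finset.mem_image_of_mem _ hp⟩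
    refine (Finset.sum_le_sum_of_subset_of_nonneg hsub fun p _ _ => hF0 p).trans ?_
    rw [Finset.sum_product]
    have h1 : ∀ u ∈ t.image Prod.fst, ∑ k ∈ t.image Prod.snd, F (u, k) ≤ 2 * m u := by
      intro u _
      simp only [F]
      rw [← Finset.sum_filter]
      exact sum_half_pow_le (hm.nonneg u) _ fun k hk => (Finset.mem_filter.1 hk).2
    refine (Finset.sum_le_sum h1).trans ?_
    rw [← Finset.mul_sum]
    linarith [hm.sum_le (t.image Prod.fst)]
  refine ⟨C, hC, fun u k huk => ?_⟩
  have := h (u, k)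
  simp only [F, if_pos huk, Encodable.encode_prod_val, Encodable.encode_nat] at this
  exact this

/-- The complexity of a pair does not change when one of its terms is replaced
by its shortest description, that is, supplied with its complexity. -/
theorem IsUniversalDistribution.pair_le {mc : ℕ → Seq → ℝ}
    (hmc : IsUniversalCondDistribution mc) :
    ∃ C : ℝ, 0 < C ∧ ∀ u k v, (1 / 2 : ℝ) ^ k < m u → m u ≤ 2 * (1 / 2 : ℝ) ^ k →
      m (Nat.pair u v) ≤ C * m (Nat.pair (Nat.pair u k) v) := by
  obtain ⟨b, hb, b0, bm, ble, blt⟩ := hm.exists_approx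
  obtain ⟨C1, hC1, h1⟩ := hm.marginal
  obtain ⟨C2, hC2, h2⟩ := hm.mul_cond_le hmc
  obtain ⟨C3, hC3, h3⟩ := hm.half_pow_le
  obtain ⟨B, hB⟩ := exists_nat_gt (2 * C1)
  have hB0 : 0 < B := by
    have : (0 : ℝ) < B := lt_trans (by positivity) hB
    exact_mod_cast this
  -- the condition `code ⟨u, k⟩` is decoded from the position of its first zero; relative to it `v`
  -- has the weight `m ⟨u, v⟩ * 2 ^ k`, with a bounded total since `2 ^ (-k)` is about `m u`
  let a : ℕ → ℕ → List Bool → ℕ := fun _ v s =>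
    if s.findIdx (fun b => !b) < s.length then
      b (Nat.pair (s.findIdx fun b => !b).unpair.1 v) s.length *
        2 ^ (s.findIdx fun b => !b).unpair.2 else 0
  have ha : Primrec fun q : ℕ × ℕ × List Bool => a q.1 q.2.1 q.2.2 := by
    simp only [a]
    fun_prop
  have am : ∀ r x s t, 2 * a r x s ≤ a r x (s ++ [t]) := by
    intro r x s t
    simp only [a]
    by_cases h : s.findIdx (fun b => !b) < s.length
    · rw [findIdx_append_of_lt t h, if_pos h, if_pos (h.trans (by simp)), List.length_append,
        List.length_singleton, ← mul_assoc]
      exact Nat.mul_le_mul_right _ (bm _ _)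
    · rw [if_neg h]; simp
  obtain ⟨C4, hC4, h4⟩ := hmc.dom a ha am (fun _ => B) (by fun_prop) fun _ => hB0
  refine ⟨C4 * (B * ((0 + 1) * (0 + 2))) * (C3 * C2), by positivity, fun u k v hk hk' => ?_⟩
  have hval : ∀ x n, (a 0 x (pre (code (Nat.pair u k)) n) : ℝ) / 2 ^ n ≤
      m (Nat.pair u x) * 2 ^ k := by
    intro x n
    simp only [a]
    rw [length_pre]
    split_ifs with h
    · have hlt : Nat.pair u k < n := by
        by_contra hn
        refine absurd h (not_lt.2 ?_)
        push Not at hn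
        have hall : ∀ b ∈ pre (code (Nat.pair u k)) n, (!b) = false := by
          intro b hb
          obtain ⟨i, hi, rfl⟩ := List.mem_map.1 hb
          rw [List.mem_range] at hi
          simp [code]
          omega
        rw [List.findIdx_eq_length_of_false hall, length_pre]
      rw [pre_code_findIdx hlt, Nat.unpair_pair]
      push_cast
      rw [mul_div_right_comm]
      gcongr
      exact ble _ _
    · simp only [Nat.cast_zero, zero_div]
      exact mul_nonneg (hm.nonneg _) (by positivity)
  have hgood : ∀ n, ∑ x ∈ Finset.range n, a 0 x (pre (code (Nat.pair u k)) n) ≤ B * 2 ^ n := by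
    intro n
    have : (∑ x ∈ Finset.range n, (a 0 x (pre (code (Nat.pair u k)) n) : ℝ)) / 2 ^ n ≤ B := by
      rw [Finset.sum_div]
      refine (Finset.sum_le_sum fun x _ => hval x n).trans ?_
      rw [← Finset.sum_mul]
      have h5 : (2 : ℝ) ^ k * (1 / 2) ^ k = 1 := by rw [← mul_pow]; norm_num
      calc _ ≤ (C1 * m u) * 2 ^ k := by gcongr; exact h1 u n
        _ ≤ (C1 * (2 * (1 / 2) ^ k)) * 2 ^ k := by gcongr
        _ = 2 * C1 * (2 ^ k * (1 / 2) ^ k) := by ring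
        _ ≤ B := by rw [h5, mul_one]; exact hB.le
    rw [div_le_iff₀ (by positivity)] at this
    exact_mod_cast this
  have h6 : m (Nat.pair u v) * 2 ^ k ≤
      C4 * (B * ((0 + 1) * (0 + 2))) * mc v (code (Nat.pair u k)) := by
    have ht : Filter.Tendsto (fun n => (b (Nat.pair u v) n : ℝ) / 2 ^ n * 2 ^ k) Filter.atTop
        (nhds (m (Nat.pair u v) * 2 ^ k)) :=
      (tendsto_of_mono_approx (mono_div_pow (bm _)) (ble _) (blt _)).mul_const _
    refine le_of_tendsto ht (Filter.eventually_atTop.2 ⟨Nat.pair u k + 1, fun n hn => ?_⟩)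
    have h7 := h4 0 _ hgood v n
    simp only [a] at h7
    rw [pre_code_findIdx hn, length_pre, if_pos (show Nat.pair u k < n from hn), Nat.unpair_pair] at h7
    push_cast at h7
    rw [← mul_div_right_comm]
    exact h7
  have h8 := h2 (Nat.pair u k) v
  have h9 := h3 u k hk
  have h10 : (0 : ℝ) ≤ mc v (code (Nat.pair u k)) := hmc.nonneg _ _
  have h5 : (2 : ℝ) ^ k * (1 / 2) ^ k = 1 := by rw [← mul_pow]; norm_num
  calc m (Nat.pair u v) = (m (Nat.pair u v) * 2 ^ k) * (1 / 2) ^ k := by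
        rw [mul_assoc, h5, mul_one]
    _ ≤ (C4 * (B * ((0 + 1) * (0 + 2))) * mc v (code (Nat.pair u k))) * (1 / 2) ^ k := by gcongr
    _ ≤ (C4 * (B * ((0 + 1) * (0 + 2))) * mc v (code (Nat.pair u k))) * (C3 * m (Nat.pair u k)) := by
        gcongr
    _ = C4 * (B * ((0 + 1) * (0 + 2))) * C3 * (m (Nat.pair u k) * mc v (code (Nat.pair u k))) := by
        ring
    _ ≤ C4 * (B * ((0 + 1) * (0 + 2))) * C3 * (C2 * m (Nat.pair (Nat.pair u k) v)) := by gcongr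
    _ = _ := by ring

/-- The coarse complexity of an integer. -/
theorem IsUniversalDistribution.exists_level (u : ℕ) :
    ∃ k : ℕ, (1 / 2 : ℝ) ^ k < m u ∧ m u ≤ 2 * (1 / 2 : ℝ) ^ k := by
  classical
  have hex : ∃ k : ℕ, (1 / 2 : ℝ) ^ k < m u :=
    exists_pow_lt_of_lt_one (hm.pos u) (by norm_num)
  refine ⟨Nat.find hex, Nat.find_spec hex, ?_⟩
  rcases h : Nat.find hex with _ | k
  · have := hm.le_one u
    simp only [pow_zero]
    linarith
  · have h1 : ¬ (1 / 2 : ℝ) ^ k < m u := Nat.find_min hex (by omega)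
    push Not at h1
    rw [pow_succ]
    linarith

/-- Both terms of a pair can be supplied with their complexities. -/
theorem IsUniversalDistribution.pair_le_pair {mc : ℕ → Seq → ℝ}
    (hmc : IsUniversalCondDistribution mc) :
    ∃ C : ℝ, 0 < C ∧ ∀ u k v l, (1 / 2 : ℝ) ^ k < m u → m u ≤ 2 * (1 / 2 : ℝ) ^ k →
      (1 / 2 : ℝ) ^ l < m v → m v ≤ 2 * (1 / 2 : ℝ) ^ l →
      m (Nat.pair u v) ≤ C * m (Nat.pair (Nat.pair v l) (Nat.pair u k)) := by
  obtain ⟨C1, hC1, h1⟩ := hm.pair_le hmc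
  have hsw : Primrec fun w : ℕ => Nat.pair w.unpair.2 w.unpair.1 := by fun_prop
  obtain ⟨C2, hC2, h2⟩ := hm.map hsw
  refine ⟨C1 * (C2 * C1), by positivity, fun u k v l hk hk' hl hl' => ?_⟩
  have h3 := h2 (Nat.pair (Nat.pair u k) v)
  rw [Nat.unpair_pair] at h3
  calc _ ≤ C1 * m (Nat.pair (Nat.pair u k) v) := h1 u k v hk hk'
    _ ≤ C1 * (C2 * m (Nat.pair v (Nat.pair u k))) := by gcongr; exact h3
    _ ≤ C1 * (C2 * (C1 * m (Nat.pair (Nat.pair v l) (Nat.pair u k)))) := by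
        gcongr; exact h1 v l _ hl hl'
    _ = _ := by ring

end

/-! ### Lower bounds for tests by operators -/

theorem lam_isSemimeasure : IsSemimeasure lam where
  neg_one_le := by
    simp [lam]
  nonneg f hf := integral_nonneg fun ω => Rat.cast_nonneg.2 (hf ω)
  concave c f g _ := by rw [lam_add, lam_smul]

theorem PrimrecRules.sup_range {α : Type*} [Primcodable α] {f : α → ℕ} {g : α → ℕ → ℕ}
    (hf : Primrec f) (hg : Primrec fun q : α × ℕ => g q.1 q.2) :
    Primrec fun x => (Finset.range (f x)).sup (g x) := by
  have : Primrec fun x => ((List.range (f x)).map (g x)).foldr (fun a b => Max.max a b) 0 := by fun_prop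
  refine this.of_eq fun x => ?_
  induction f x with
  | zero => rfl
  | succ n ih =>
    have h : ∀ (l : List ℕ) (b : ℕ), (l ++ [b]).foldr (fun a b => Max.max a b) 0 =
        Max.max b (l.foldr (fun a b => Max.max a b) 0) := by
      intro l b
      induction l with
      | nil => simp
      | cons a l ih => simp only [List.cons_append, List.foldr_cons, ih]; omega
    rw [List.range_succ, List.map_append, List.map_singleton, h, ih, Finset.range_add_one,
      Finset.sup_insert]

attribute [fun_prop] PrimrecRules.sup_range

theorem exists_digits_le (f : Elem) : ∃ n₀, ∀ n, n₀ ≤ n → ∀ ω ω' : Seq, pre ω n = pre ω' n →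
    f ω = f ω' := by
  obtain ⟨n₀, h⟩ := exists_digits f
  refine ⟨n₀, fun n hn ω ω' hω => h ω ω' ?_⟩
  rw [pre_eq_iff] at hω ⊢
  exact fun i hi => hω i (hi.trans_le hn)

section

variable {m : ℕ → ℝ} (hm : IsUniversalDistribution m)
include hm

/-- The images of nonnegative functions of `μ`-mean at most `1` under an operator admissible for
`μ` have uniform mean at most `1`, so that their weighted sum is bounded
by the Martin-Löf test. -/
theorem IsUniversalDistribution.dom_operator {U : Elem → Seq → ℝ} {μ : Elem → ℝ}
    (hU : IsAdmissible U μ) {c : ℕ → ℕ → ElemCode} (hc : Primrec fun q : ℕ × ℕ => c q.1 q.2)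
    (c0 : ∀ j n ω, 0 ≤ elemOf (c j n) ω) :
    ∃ C : ℝ, 0 < C ∧ ∀ ω, ∑' j, {j | (∀ n ω, elemOf (c j n) ω ≤ elemOf (c j (n + 1)) ω) ∧
      ∀ n, μ (elemOf (c j n)) ≤ 1}.indicator (fun j => ENNReal.ofReal (m j) *
      ⨆ n, ENNReal.ofReal (U (elemOf (c j n)) ω)) j ≤ ENNReal.ofReal C * mlTest m lam ω := by
  obtain ⟨⟨hdet, S, hS, hSU⟩, hadm⟩ := hU
  have hS' : REPred fun p : (ℕ × ℕ) × RatCode × List Bool => S (c p.1.1 p.1.2, p.2) :=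
    REPred.comp_primrec hS (f := fun p : (ℕ × ℕ) × RatCode × List Bool => (c p.1.1 p.1.2, p.2))
      (by fun_prop)
  obtain ⟨a, ha, a0, am, ale, alt⟩ := exists_lowerApprox (X := ℕ × ℕ)
    (f := fun p ω => U (elemOf (c p.1 p.2)) ω) (fun p ω => (hdet ω).1.nonneg _ (c0 _ _)) hS'
    fun p q ω => hSU _ q ω
  -- stage `n` runs over the functions with indices below `n`, so that a single array approximates
  -- the supremum
  let b : ℕ → List Bool → ℕ := fun j s => (Finset.range s.length).sup fun n => a (j, n) s
  have hb : Primrec fun q : ℕ × List Bool => b q.1 q.2 := by simp only [b]; fun_prop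
  have bm : ∀ j s t, 2 * b j s ≤ b j (s ++ [t]) := by
    intro j s t
    rcases Nat.eq_zero_or_pos (b j s) with h | h
    · rw [h]; simp
    · obtain ⟨n, hn, he⟩ := Finset.exists_mem_eq_sup (Finset.range s.length)
        (Finset.nonempty_iff_ne_empty.2 fun h0 => by simp [b, h0] at h) fun n => a (j, n) s
      have h1 : b j s = a (j, n) s := he
      rw [h1]
      refine (am (j, n) s t).trans (Finset.le_sup (f := fun n => a (j, n) (s ++ [t])) ?_)
      simp at hn ⊢
      omega
  obtain ⟨C, hC, h⟩ := hm.dom_test b hb (fun j => rfl) bm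
  refine ⟨C, hC, fun ω => le_trans (ENNReal.tsum_le_tsum fun j => ?_) (h ω)⟩
  refine Set.indicator_le (M := ℝ≥0∞) (fun j' hj => ?_) j
  obtain ⟨hmono, hle⟩ := hj
  have hmono' : ∀ ω, Monotone fun n => U (elemOf (c j' n)) ω := fun ω =>
    monotone_nat_of_le_succ fun n => (hdet ω).1.mono (hmono n)
  have hmean : MeanLeOne (b j') := by
    intro n
    have h1 : ∀ ω, ((digitFn n (fun s => (b j' s : ℚ) / 2 ^ n) ω : ℚ) : ℝ) ≤
        U (elemOf (c j' n)) ω := by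
      intro ω
      rw [digitFn_apply]
      push_cast
      rw [div_le_iff₀ (by positivity)]
      rcases Nat.eq_zero_or_pos (b j' (pre ω n)) with h | h
      · rw [h, Nat.cast_zero]
        exact mul_nonneg ((hdet ω).1.nonneg _ (c0 _ _)) (by positivity)
      · obtain ⟨i, hi, he⟩ := Finset.exists_mem_eq_sup (Finset.range (pre ω n).length)
          (Finset.nonempty_iff_ne_empty.2 fun h0 => by simp only [b, h0] at h; simp at h)
          fun i => a (j', i) (pre ω n)
        have h1 : b j' (pre ω n) = a (j', i) (pre ω n) := he
        rw [length_pre, Finset.mem_range] at hi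
        rw [h1, ← div_le_iff₀ (by positivity)]
        exact (ale (j', i) ω n).trans (hmono' ω hi.le)
    obtain ⟨B, hB0, hB⟩ := exists_bound (elemOf (c j' n))
    have h2 := lam_isSemimeasure.le_ext (B := B) (fun ω => (hdet ω).1.le_of_le hB0
      fun ω' => (le_abs_self _).trans (hB ω')) h1
    have h3 := (h2.trans (hadm _ (c0 j' n))).trans (hle n)
    rw [lam_digitFn, div_le_one (by positivity)] at h3
    push_cast at h3
    rw [← Finset.sum_div, div_le_iff₀ (by positivity)] at h3
    have h4 : (2 : ℝ) ^ n * 2 ^ n = 4 ^ n := by rw [← mul_pow]; norm_num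
    rw [h4] at h3
    exact_mod_cast h3
  rw [Set.indicator_of_mem (show j' ∈ {j | MeanLeOne (b j)} from hmean)]
  gcongr ENNReal.ofReal _ * ?_
  refine iSup_le fun n => le_of_forall_lt fun r hr => ?_
  have hr' : r.toReal < U (elemOf (c j' n)) ω := (ENNReal.lt_ofReal_iff_toReal_lt
    (ne_top_of_lt hr)).1 hr
  obtain ⟨k, hk⟩ := alt (j', n) ω _ hr'
  have h1 : r.toReal < (a (j', n) (pre ω (max k (n + 1))) : ℝ) / 2 ^ (max k (n + 1)) :=
    hk.trans_le (approx_mono (am (j', n)) ω (le_max_left _ _))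
  refine lt_of_lt_of_le ((ENNReal.lt_ofReal_iff_toReal_lt (ne_top_of_lt hr)).2 h1)
    (le_trans ?_ (le_iSup _ (max k (n + 1))))
  gcongr
  refine Finset.le_sup (f := fun i => a (j', i) (pre ω (max k (n + 1)))) ?_
  rw [length_pre, Finset.mem_range]
  exact lt_of_lt_of_le (Nat.lt_succ_self n) (le_max_right _ _)

/-- A weighted sum of nonnegative functions of `μ`-mean at most `1` bounds the test by any operator
admissible for `μ` from below: the operator is homogeneous, and each function is bounded from below
by a multiple of the indicator of a neighbourhood of a given point. -/
theorem IsUniversalDistribution.le_opTest {U : Elem → Seq → ℝ} {μ : Elem → ℝ}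
    (hU : IsAdmissible U μ) {c : ℕ → ℕ → ElemCode} (hc : Primrec fun q : ℕ × ℕ => c q.1 q.2)
    (c0 : ∀ j n ω, 0 ≤ elemOf (c j n) ω) :
    ∃ C : ℝ, 0 < C ∧ ∀ γ, ∑' j, {j | (∀ n ω, elemOf (c j n) ω ≤ elemOf (c j (n + 1)) ω) ∧
      ∀ n, μ (elemOf (c j n)) ≤ 1}.indicator (fun j => ENNReal.ofReal (m j) *
      ⨆ n, ENNReal.ofReal (elemOf (c j n) γ : ℝ)) j ≤ ENNReal.ofReal C * opTest m U γ := by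
  classical
  obtain ⟨C, hC, h⟩ := hm.dom_operator hU hc c0
  refine ⟨C, hC, fun γ => ?_⟩
  set good : Set ℕ := {j | (∀ n ω, elemOf (c j n) ω ≤ elemOf (c j (n + 1)) ω) ∧
      ∀ n, μ (elemOf (c j n)) ≤ 1} with hgood
  rw [ENNReal.tsum_eq_iSup_sum]
  refine iSup_le fun t => ?_
  rw [Finset.sum_indicator_eq_sum_filter]
  set t' := t.filter fun i => i ∈ good
  have ht' : ∀ j ∈ t', j ∈ good := fun j hj => (Finset.mem_filter.1 hj).2
  simp only [ENNReal.mul_iSup]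
  rw [Finset.sum_congr rfl fun j hj => rfl]
  have hm0 : ∀ j ∈ t', Monotone fun n => ENNReal.ofReal (m j) *
      ENNReal.ofReal (elemOf (c j n) γ : ℝ) := by
    intro j hj
    refine monotone_nat_of_le_succ fun n => ?_
    gcongr
    exact_mod_cast (ht' j hj).1 n γ
  have e1 : ∑ j ∈ t', ⨆ n, ENNReal.ofReal (m j) * ENNReal.ofReal (elemOf (c j n) γ : ℝ) =
      ⨆ n, ∑ j ∈ t', ENNReal.ofReal (m j) * ENNReal.ofReal (elemOf (c j n) γ : ℝ) := by
    rw [← Finset.sum_attach]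
    rw [ENNReal.finsetSum_iSup_of_monotone fun j : {x // x ∈ t'} => hm0 j.1 j.2]
    refine iSup_congr fun n => ?_
    exact Finset.sum_attach t' fun j => ENNReal.ofReal (m j) * ENNReal.ofReal (elemOf (c j n) γ : ℝ)
  rw [e1]
  refine iSup_le fun n => ?_
  have hmul : ∀ j, ENNReal.ofReal (m j) * ENNReal.ofReal (elemOf (c j n) γ : ℝ) =
      ENNReal.ofReal (m j * (elemOf (c j n) γ : ℝ)) := fun j =>
    (ENNReal.ofReal_mul (hm.nonneg j)).symm
  have hnn : ∀ j ∈ t', 0 ≤ m j * (elemOf (c j n) γ : ℝ) := fun j _ =>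
    mul_nonneg (hm.nonneg j) (by exact_mod_cast c0 j n γ)
  simp only [hmul]
  rw [← ENNReal.ofReal_sum_of_nonneg hnn]
  set R := ∑ j ∈ t', m j * (elemOf (c j n) γ : ℝ) with hR
  choose N hN using fun j => exists_digits_le (elemOf (c j n))
  -- finitely many of the functions are constant on the cylinder of `z`
  set z := pre γ (t'.sup N)
  have hz : ∀ ω, ENNReal.ofReal (R * U (cyl z) ω) ≤ ENNReal.ofReal C * mlTest m lam ω := by
    intro ω
    have hUz : 0 ≤ U (cyl z) ω := (hU.1.1 ω).1.nonneg _ fun ω' => by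
      rw [cyl_apply]; split_ifs <;> norm_num
    refine le_trans ?_ (h ω)
    refine le_trans ?_ (ENNReal.sum_le_tsum t')
    rw [hR, Finset.sum_mul, ENNReal.ofReal_sum_of_nonneg fun j hj => mul_nonneg (hnn j hj) hUz]
    refine Finset.sum_le_sum fun j hj => ?_
    rw [Set.indicator_of_mem (ht' j hj), mul_assoc, ENNReal.ofReal_mul (hm.nonneg j)]
    gcongr
    refine le_trans ?_ (le_iSup _ n)
    refine ENNReal.ofReal_le_ofReal ?_
    rw [← (hU.1.1 ω).1.smul (c0 j n γ)]
    refine (hU.1.1 ω).1.mono fun ω' => ?_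
    rw [LocallyConstant.smul_apply, cyl_apply]
    split_ifs with h1
    · rw [length_pre] at h1
      rw [hN j _ (Finset.le_sup hj) ω' γ h1]
      simp
    · simpa using c0 j n ω'
  have hR0 : 0 ≤ R := Finset.sum_nonneg hnn
  rw [show R = C * (R / C) by field_simp, ENNReal.ofReal_mul hC.le]
  gcongr
  -- each rational `q < R / C` yields an elementary function `q • cyl z` that competes in the
  -- definition of the test
  refine le_of_forall_lt fun r hr => ?_
  obtain ⟨q, hq1, hq2⟩ := exists_rat_btwn ((ENNReal.lt_ofReal_iff_toReal_lt
    (ne_top_of_lt hr)).1 hr)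
  have hq0 : (0 : ℝ) ≤ q := ENNReal.toReal_nonneg.trans hq1.le
  refine lt_of_lt_of_le ((ENNReal.lt_ofReal_iff_toReal_lt (ne_top_of_lt hr)).2 hq1) ?_
  have hval : (q • cyl z) γ = q := by
    rw [LocallyConstant.smul_apply, cyl_apply, if_pos (by rw [length_pre])]; simp
  have hle : (∀ ω, 0 ≤ (q • cyl z) ω) ∧
      ∀ ω, ENNReal.ofReal (U (q • cyl z) ω) ≤ mlTest m lam ω := by
    have hq0' : 0 ≤ q := by exact_mod_cast hq0
    refine ⟨fun ω => ?_, fun ω => ?_⟩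
    · rw [LocallyConstant.smul_apply, cyl_apply]; split_ifs <;> simp [hq0']
    · rw [(hU.1.1 ω).1.smul hq0']
      have hUz : 0 ≤ U (cyl z) ω := (hU.1.1 ω).1.nonneg _ fun ω' => by
        rw [cyl_apply]; split_ifs <;> norm_num
      have h1 := hz ω
      rw [show R * U (cyl z) ω = C * (R / C * U (cyl z) ω) by field_simp,
        ENNReal.ofReal_mul hC.le] at h1
      have h2 : ENNReal.ofReal (R / C * U (cyl z) ω) ≤ mlTest m lam ω := by
        rwa [ENNReal.mul_le_mul_iff_right (by simpa using hC) ENNReal.ofReal_ne_top] at h1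
      refine le_trans ?_ h2
      gcongr
  calc ENNReal.ofReal (q : ℝ) = ENNReal.ofReal (((q • cyl z) γ : ℚ) : ℝ) := by rw [hval]
    _ ≤ opTest m U γ := le_iSup₂ (f := fun (f : Elem) (_ : (∀ ω, 0 ≤ f ω) ∧
        ∀ ω, ENNReal.ofReal (U f ω) ≤ mlTest m lam ω) => ENNReal.ofReal (f γ : ℝ)) (q • cyl z) hle

end

/-! ### The simple information bound -/

section

variable {m : ℕ → ℝ} (hm : IsUniversalDistribution m)
include hm

/-- The Martin-Löf test has mean at most `1`: level `i` contributes the sum of `m` over strings of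
length `i`. -/
theorem IsUniversalDistribution.lintegral_mlTest_le : ∫⁻ ω, mlTest m lam ω ∂lamMeasure ≤ 1 := by
  have h1 : ∀ ω, mlTest m lam ω =
      ∑' i : ℕ, ENNReal.ofReal (m (Encodable.encode (pre ω i))) * 2 ^ i := fun ω => mlTest_lam m ω
  simp only [h1]
  rw [lintegral_tsum fun i => (measurable_pre i fun s =>
    ENNReal.ofReal (m (Encodable.encode s)) * 2 ^ i).aemeasurable]
  have h2 : ∀ i : ℕ, ∫⁻ ω, ENNReal.ofReal (m (Encodable.encode (pre ω i))) * 2 ^ i ∂lamMeasure =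
      ENNReal.ofReal (∑ s ∈ strs i, m (Encodable.encode s)) := by
    intro i
    rw [lintegral_pre i fun s => ENNReal.ofReal (m (Encodable.encode s)) * 2 ^ i, ← Finset.sum_mul,
      ENNReal.mul_div_cancel_right (by simp) (by simp),
      ENNReal.ofReal_sum_of_nonneg fun s _ => hm.nonneg _]
  simp only [h2]
  rw [ENNReal.tsum_eq_iSup_nat]
  refine iSup_le fun N => ?_
  rw [← ENNReal.ofReal_sum_of_nonneg fun i _ => Finset.sum_nonneg fun s _ => hm.nonneg _,
    ← ENNReal.ofReal_one]
  refine ENNReal.ofReal_le_ofReal ?_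
  classical
  rw [Finset.sum_sigma', ← Finset.sum_image (f := m)
    (g := fun p : (_ : ℕ) × List Bool => Encodable.encode p.2)]
  · exact hm.sum_le _
  · rintro ⟨i, s⟩ h ⟨i', s'⟩ h' e
    have e' := Encodable.encode_injective e
    simp only [Finset.coe_sigma, Set.mem_sigma_iff, Finset.mem_coe, mem_strs] at h h' e'
    obtain rfl := e'
    rw [← h.2, ← h'.2]

/-- Stage approximations of the Martin-Löf test. -/
theorem IsUniversalDistribution.exists_approx_mlTest :
    ∃ t : List Bool → ℕ, Primrec t ∧ (∀ ω, Monotone fun n => (t (pre ω n) : ℝ) / 2 ^ n) ∧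
      ∀ ω, mlTest m lam ω = ⨆ n, ENNReal.ofReal ((t (pre ω n) : ℝ) / 2 ^ n) := by
  obtain ⟨b, hb, b0, bm, ble, blt⟩ := hm.exists_approx
  let t : List Bool → ℕ := fun s =>
    ∑ i ∈ Finset.range (s.length + 1), b (Encodable.encode (s.take i)) s.length * 2 ^ i
  have hval : ∀ n ω, (t (pre ω n) : ℝ) / 2 ^ n = ∑ i ∈ Finset.range (n + 1),
      (b (Encodable.encode (pre ω i)) n : ℝ) / 2 ^ n * 2 ^ i := by
    intro n ω
    simp only [t, length_pre]
    push_cast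
    rw [Finset.sum_div]
    refine Finset.sum_congr rfl fun i hi => ?_
    rw [take_pre, min_eq_left (Nat.lt_succ_iff.1 (Finset.mem_range.1 hi)), mul_div_right_comm]
  refine ⟨t, by simp only [t]; fun_prop, fun ω => monotone_nat_of_le_succ fun n => ?_,
    fun ω => le_antisymm ?_ (iSup_le fun n => ?_)⟩
  · rw [hval, hval]
    refine (Finset.sum_le_sum fun i _ => ?_).trans
      (Finset.sum_le_sum_of_subset_of_nonneg (Finset.range_mono (Nat.le_succ _))
        fun i _ _ => by positivity)
    exact mul_le_mul_of_nonneg_right (mono_div_pow (bm _) (Nat.le_succ n)) (by positivity)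
  · rw [mlTest_lam, ENNReal.tsum_eq_iSup_nat]
    refine iSup_le fun N => ?_
    have ht : Filter.Tendsto (fun n => ENNReal.ofReal (∑ i ∈ Finset.range N,
        (b (Encodable.encode (pre ω i)) n : ℝ) / 2 ^ n * 2 ^ i)) Filter.atTop
        (nhds (ENNReal.ofReal (∑ i ∈ Finset.range N, m (Encodable.encode (pre ω i)) * 2 ^ i))) :=
      ENNReal.tendsto_ofReal (tendsto_finsetSum _ fun i _ =>
        (tendsto_of_mono_approx (mono_div_pow (bm _)) (ble _) (blt _)).mul_const _)
    have e : ∑ i ∈ Finset.range N, ENNReal.ofReal (m (Encodable.encode (pre ω i))) * 2 ^ i =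
        ENNReal.ofReal (∑ i ∈ Finset.range N, m (Encodable.encode (pre ω i)) * 2 ^ i) := by
      rw [ENNReal.ofReal_sum_of_nonneg fun i _ => mul_nonneg (hm.nonneg _) (by positivity)]
      refine Finset.sum_congr rfl fun i _ => ?_
      rw [ENNReal.ofReal_mul (hm.nonneg _), ENNReal.ofReal_pow zero_le_two, ENNReal.ofReal_ofNat]
    rw [e]
    refine le_of_tendsto ht (Filter.eventually_atTop.2 ⟨N, fun n hn => ?_⟩)
    refine le_trans (ENNReal.ofReal_le_ofReal ?_)
      (le_iSup (fun n => ENNReal.ofReal ((t (pre ω n) : ℝ) / 2 ^ n)) n)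
    rw [hval]
    exact Finset.sum_le_sum_of_subset_of_nonneg (Finset.range_mono (by omega))
      fun i _ _ => by positivity
  · rw [hval, mlTest_lam, ENNReal.ofReal_sum_of_nonneg fun i _ => by positivity]
    refine le_trans (Finset.sum_le_sum fun i _ => ?_) (ENNReal.sum_le_tsum (Finset.range (n + 1)))
    rw [ENNReal.ofReal_mul (by positivity), ENNReal.ofReal_pow zero_le_two, ENNReal.ofReal_ofNat]
    gcongr
    exact ble _ _

/-- The Martin-Löf test bounds from below the test by any operator admissible
for the uniform measure. -/
theorem IsUniversalDistribution.mlTest_le_opTest {U : Elem → Seq → ℝ} (hU : IsAdmissible U lam) :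
    ∃ C : ℝ, 0 < C ∧ ∀ α, mlTest m lam α ≤ ENNReal.ofReal C * opTest m U α := by
  obtain ⟨t, ht, tm, tsup⟩ := hm.exists_approx_mlTest
  let c : ℕ → ℕ → ElemCode := fun _ n => digitCode n fun s => dyad (t s) n
  have hc : Primrec fun q : ℕ × ℕ => c q.1 q.2 := by
    simp only [c]
    refine primrec_digitCode (by fun_prop) ?_
    fun_prop
  have hval : ∀ j n ω, ((elemOf (c j n) ω : ℚ) : ℝ) = (t (pre ω n) : ℝ) / 2 ^ n := by
    intro j n ω
    simp only [c, elemOf_digitCode, digitFn_apply, ratOf_dyad_real]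
  have c0 : ∀ j n ω, 0 ≤ elemOf (c j n) ω := by
    intro j n ω
    rw [← Rat.cast_nonneg (K := ℝ), hval j]
    positivity
  obtain ⟨C, hC, h⟩ := hm.le_opTest hU hc c0
  have hm0 := hm.pos 0
  refine ⟨C / m 0, by positivity, fun α => ?_⟩
  have hgood : 0 ∈ {j | (∀ n ω, elemOf (c j n) ω ≤ elemOf (c j (n + 1)) ω) ∧
      ∀ n, lam (elemOf (c j n)) ≤ 1} := by
    refine ⟨fun n ω => ?_, fun n => ?_⟩
    · rw [← Rat.cast_le (K := ℝ), hval 0, hval 0]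
      exact tm ω (Nat.le_succ n)
    · have h1 := lam_le_lintegral (elemOf (c 0 n)) (mlTest m lam) (fun ω => ?_)
        (ne_top_of_le_ne_top ENNReal.one_ne_top hm.lintegral_mlTest_le)
      · refine h1.trans ?_
        have := ENNReal.toReal_mono ENNReal.one_ne_top hm.lintegral_mlTest_le
        simpa using this
      · rw [hval 0, tsup]
        exact le_iSup (fun n => ENNReal.ofReal ((t (pre ω n) : ℝ) / 2 ^ n)) n
  have h1 := (ENNReal.le_tsum 0).trans (h α)
  rw [Set.indicator_of_mem hgood] at h1
  simp only [hval, ← tsup] at h1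
  rw [show C = m 0 * (C / m 0) by field_simp, ENNReal.ofReal_mul hm0.le, mul_assoc] at h1
  rwa [ENNReal.mul_le_mul_iff_right (by simpa using hm0) ENNReal.ofReal_ne_top] at h1

/-- The universal semimeasure of a function `mc v` is at most `m v`, up to a constant factor. -/
theorem IsUniversalDistribution.semimeasure_cond_le {mc : ℕ → Seq → ℝ}
    (hmc : IsUniversalCondDistribution mc) {M : Elem → ℝ} (hM : IsSemimeasure M)
    (hMre : REFunctional M) {c : ℕ → List Bool → ℕ} (hc : Primrec fun q : ℕ × List Bool => c q.1 q.2)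
    (cle : ∀ x ω n, (c x (pre ω n) : ℝ) / 2 ^ n ≤ mc x ω) :
    ∃ C : ℝ, 0 < C ∧ ∀ v n, M (digitFn n fun s => (c v s : ℚ) / 2 ^ n) ≤ C * m v := by
  have hd : ∀ v n, (digitFn n fun s => (c v s : ℚ) / 2 ^ n) =
      elemOf (digitCode n fun s => dyad (c v s) n) := by
    intro v n
    rw [elemOf_digitCode]
    simp only [ratOf_dyad]
  have hval : ∀ v n ω, (((digitFn n fun s => (c v s : ℚ) / 2 ^ n) ω : ℚ) : ℝ) =
      (c v (pre ω n) : ℝ) / 2 ^ n := by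
    intro v n ω
    rw [digitFn_apply]; push_cast; rfl
  have h0 : ∀ v n ω, 0 ≤ (digitFn n fun s => (c v s : ℚ) / 2 ^ n) ω := by
    intro v n ω
    rw [digitFn_apply]; positivity
  have hsum : ∀ (t : Finset ℕ) (n : ℕ → ℕ),
      ∑ v ∈ t, M (digitFn (n v) fun s => (c v s : ℚ) / 2 ^ n v) ≤ 1 := by
    intro t n
    refine (hM.sum_le t _).trans ?_
    have := hM.le_of_le (f := ∑ v ∈ t, digitFn (n v) fun s => (c v s : ℚ) / 2 ^ n v) (B := 1)
      zero_le_one fun ω => ?_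
    · simpa using this
    · have e : (∑ v ∈ t, digitFn (n v) fun s => (c v s : ℚ) / 2 ^ n v) ω =
          ∑ v ∈ t, (digitFn (n v) fun s => (c v s : ℚ) / 2 ^ n v) ω := by
        induction t using Finset.induction_on with
        | empty => rfl
        | insert a t ha ih => simp [Finset.sum_insert ha, ih]
      rw [e, ← Rat.cast_le (K := ℝ)]
      push_cast
      simp only [hval]
      exact (Finset.sum_le_sum fun v _ => cle v ω (n v)).trans (hmc.sum_le t ω)
  have hbd : ∀ v, BddAbove (Set.range fun n => M (digitFn n fun s => (c v s : ℚ) / 2 ^ n)) := by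
    intro v
    refine ⟨1, ?_⟩
    rintro _ ⟨n, rfl⟩
    simpa using hsum {v} fun _ => n
  let F : ℕ → ℝ := fun v => ⨆ n, M (digitFn n fun s => (c v s : ℚ) / 2 ^ n)
  have hF0 : ∀ v, 0 ≤ F v := fun v => Real.iSup_nonneg fun n => hM.nonneg _ (h0 v n)
  have hre : REPred fun p : ℕ × RatCode => (ratOf p.2 : ℝ) < F p.1 := by
    have h1 : REPred fun p : (ℕ × RatCode) × ℕ => (ratOf p.1.2 : ℝ) <
        M (elemOf (digitCode p.2 fun s => dyad (c p.1.1 s) p.2)) :=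
      REPred.comp_primrec hMre (f := fun p : (ℕ × RatCode) × ℕ =>
        (digitCode p.2 fun s => dyad (c p.1.1 s) p.2, p.1.2))
        (Primrec.pair (primrec_digitCode (by fun_prop) (by fun_prop)) (by fun_prop))
    refine (REPred.exists_snd h1).of_eq fun p => ?_
    simp only [F, ← hd]
    rw [lt_ciSup_iff (hbd p.1)]
  obtain ⟨C, hC, h⟩ := hm.dom hF0 hre (B := 1) fun t => by
    refine sum_ciSup_le _ _ _ fun n => ?_
    exact hsum t n
  exact ⟨C, hC, fun v n => (le_ciSup (hbd v) n).trans (h v)⟩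

omit hm in
/-- The product of semimeasures is at most multiplicative on products of functions. -/
theorem tensor_mul_le {M : Elem → ℝ} (hM : IsSemimeasure M) {f g h : Elem}
    (hg : ∀ ω, 0 ≤ g ω) (hh : ∀ ω, 0 ≤ h ω) (hf : ∀ α β, f (join α β) = g α * h β) :
    tensor M M f ≤ M g * M h := by
  have hs : ∀ α, M (slice f α) = (g α : ℝ) * M h := by
    intro α
    rw [← hM.smul (hg α)]
    congr 1
    ext β
    exact hf α β
  unfold tensor
  simp only [hs]
  have hMg := hM.nonneg g hg
  have hMh := hM.nonneg h hh
  refine ext_le ⟨0, fun ω => ?_⟩ fun h' hh' => ?_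
  · have : (0 : ℝ) ≤ g ω := by exact_mod_cast hg ω
    simpa using mul_nonneg this hMh
  · refine le_of_forall_pos_le_add fun ε hε => ?_
    obtain ⟨q, hq1, hq2⟩ := exists_rat_btwn (show M h < M h + ε / (M g + 1) by
      have : 0 < ε / (M g + 1) := by positivity
      linarith)
    have hq0 : 0 ≤ q := by
      have : (0 : ℝ) ≤ q := hMh.trans hq1.le
      exact_mod_cast this
    have h1 : M h' ≤ M (q • g) := hM.mono fun ω => by
      rw [LocallyConstant.smul_apply, smul_eq_mul, ← Rat.cast_le (K := ℝ)]
      push_cast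
      have : (0 : ℝ) ≤ g ω := by exact_mod_cast hg ω
      rw [mul_comm]
      exact (hh' ω).trans (by gcongr)
    rw [hM.smul hq0] at h1
    have h2 : ε / (M g + 1) * M g ≤ ε := by
      rw [div_mul_eq_mul_div, div_le_iff₀ (by positivity)]
      nlinarith
    nlinarith

/-- The rarity test for a pair is at least the weighted sum, over all pairs of integers,
of their probabilities relative to the two sequences. -/
theorem IsUniversalDistribution.simple_le_opTest {mc : ℕ → Seq → ℝ}
    (hmc : IsUniversalCondDistribution mc) {M : Elem → ℝ} (hM : IsSemimeasure M)
    (hMre : REFunctional M) {U : Elem → Seq → ℝ} (hU : IsAdmissible U (tensor M M)) :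
    ∃ C : ℝ, 0 < C ∧ ∀ α β, ∑' u : ℕ, ∑' v : ℕ, ENNReal.ofReal (mc u α * mc v β *
      (m (Nat.pair u v) / (m u * m v))) ≤ ENNReal.ofReal C * opTest m U (join α β) := by
  obtain ⟨a, ha, am, ale, alt⟩ := hmc.exists_approx
  obtain ⟨C1, hC1, h1⟩ := hm.semimeasure_cond_le hmc hM hMre ha ale
  obtain ⟨C2, hC2, h2⟩ := hm.pair_le_pair hmc
  -- `2 ^ κ` absorbs the constants, to bring the means of the products below `1`
  obtain ⟨κ, hκ⟩ := pow_unbounded_of_one_lt (4 * C1 ^ 2) one_lt_two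
  -- `j = ⟨⟨v, l⟩, ⟨u, k⟩⟩` names the product of the approximations of `mc u` and `mc v`,
  -- normalized by `2 ^ (k + l)`, which is about `1 / (m u * m v)`
  let c : ℕ → ℕ → ElemCode := fun j n => digitCode (n + n) fun z =>
    dyad (a j.unpair.2.unpair.1 (ev z) * a j.unpair.1.unpair.1 (od z) *
      2 ^ (j.unpair.2.unpair.2 + j.unpair.1.unpair.2)) (n + n + κ)
  have hc : Primrec fun q : ℕ × ℕ => c q.1 q.2 := by
    simp only [c]
    refine primrec_digitCode (by fun_prop) ?_
    fun_prop
  have hval : ∀ u k v l n α β,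
      elemOf (c (Nat.pair (Nat.pair v l) (Nat.pair u k)) n) (join α β) =
      (a u (pre α n) / 2 ^ n) * ((a v (pre β n) / 2 ^ n) * (2 ^ (k + l) / 2 ^ κ)) := by
    intro u k v l n α β
    simp only [c, elemOf_digitCode, digitFn_apply, Nat.unpair_pair, ratOf_dyad, ev_pre_join,
      od_pre_join]
    rw [show (n + n + 1) / 2 = n by omega, show (n + n) / 2 = n by omega]
    push_cast
    rw [pow_add _ (n + n), pow_add _ n]
    field_simp
  have hjoin : ∀ ω : Seq, ∃ α β, join α β = ω := by
    intro ω
    refine ⟨fun n => ω (2 * n), fun n => ω (2 * n + 1), ?_⟩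
    funext n
    rcases Nat.even_or_odd' n with ⟨i, rfl | rfl⟩
    · rw [join_even]
    · rw [join_odd]
  have hval' : ∀ j n α β, elemOf (c j n) (join α β) =
      (a j.unpair.2.unpair.1 (pre α n) / 2 ^ n) * ((a j.unpair.1.unpair.1 (pre β n) / 2 ^ n) *
        (2 ^ (j.unpair.2.unpair.2 + j.unpair.1.unpair.2) / 2 ^ κ)) := by
    intro j n α β
    rw [← hval, Nat.pair_unpair, Nat.pair_unpair, Nat.pair_unpair]
  have c0 : ∀ j n ω, 0 ≤ elemOf (c j n) ω := by
    intro j n ω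
    obtain ⟨α, β, rfl⟩ := hjoin ω
    rw [hval']
    positivity
  obtain ⟨C3, hC3, h3⟩ := hm.le_opTest hU hc c0
  choose k hk hk' using hm.exists_level
  let φ : ℕ × ℕ → ℕ := fun p => Nat.pair (Nat.pair p.2 (k p.2)) (Nat.pair p.1 (k p.1))
  have hφ : Function.Injective φ := by
    rintro ⟨u, v⟩ ⟨u', v'⟩ h
    simp only [φ, Nat.pair_eq_pair] at h
    rw [h.1.1, h.2.1]
  have hgood : ∀ p, φ p ∈ {j | (∀ n ω, elemOf (c j n) ω ≤ elemOf (c j (n + 1)) ω) ∧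
      ∀ n, tensor M M (elemOf (c j n)) ≤ 1} := by
    rintro ⟨u, v⟩
    have hamono : ∀ x n α, (a x (pre α n) : ℚ) / 2 ^ n ≤ a x (pre α (n + 1)) / 2 ^ (n + 1) := by
      intro x n α
      have := approx_mono (am x) α (Nat.le_succ n)
      rw [← Rat.cast_le (K := ℝ)]
      push_cast
      exact this
    refine ⟨fun n ω => ?_, fun n => ?_⟩
    · obtain ⟨α, β, rfl⟩ := hjoin ω
      simp only [φ]
      rw [hval, hval]
      gcongr ?_ * (?_ * _)
      · exact hamono u n α
      · exact hamono v n β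
    · have e : ∀ α β, elemOf (c (φ (u, v)) n) (join α β) =
          (digitFn n fun s => (a u s : ℚ) / 2 ^ n) α *
            (((2 ^ (k u + k v) / 2 ^ κ : ℚ) • digitFn n fun s => (a v s : ℚ) / 2 ^ n) β) := by
        intro α β
        simp only [φ]
        rw [hval, LocallyConstant.smul_apply, digitFn_apply, digitFn_apply, smul_eq_mul]
        ring
      refine (tensor_mul_le hM (fun ω => ?_) (fun ω => ?_) e).trans ?_
      · rw [digitFn_apply]; positivity
      · rw [LocallyConstant.smul_apply, digitFn_apply, smul_eq_mul]; positivity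
      · rw [hM.smul (by positivity)]
        have hMv : 0 ≤ M (digitFn n fun s => (a v s : ℚ) / 2 ^ n) := hM.nonneg _ fun ω => by
          rw [digitFn_apply]; positivity
        have e2 : (2 : ℝ) ^ k u * (1 / 2) ^ k u = 1 := by rw [← mul_pow]; norm_num
        have e3 : (2 : ℝ) ^ k v * (1 / 2) ^ k v = 1 := by rw [← mul_pow]; norm_num
        have hmu := hm.nonneg u
        push_cast
        calc _ ≤ (C1 * (2 * (1 / 2) ^ k u)) * (2 ^ (k u + k v) / 2 ^ κ *
              (C1 * (2 * (1 / 2) ^ k v))) := by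
              gcongr
              · exact (h1 u n).trans (by gcongr; exact hk' u)
              · exact (h1 v n).trans (by gcongr; exact hk' v)
          _ = 4 * C1 ^ 2 * (2 ^ k u * (1 / 2) ^ k u) * (2 ^ k v * (1 / 2) ^ k v) / 2 ^ κ := by
              rw [pow_add]; ring
          _ ≤ 1 := by
              rw [e2, e3, mul_one, mul_one, div_le_one (by positivity)]
              exact hκ.le
  refine ⟨C2 * 2 ^ κ * C3, by positivity, fun α β => ?_⟩
  rw [← ENNReal.tsum_prod (f := fun u v => ENNReal.ofReal (mc u α * mc v β *
    (m (Nat.pair u v) / (m u * m v)))), ENNReal.ofReal_mul (by positivity), mul_assoc]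
  have h4 := h3 (join α β)
  set G : ℕ → ℝ≥0∞ := fun j => {j | (∀ n ω, elemOf (c j n) ω ≤ elemOf (c j (n + 1)) ω) ∧
      ∀ n, tensor M M (elemOf (c j n)) ≤ 1}.indicator (fun j => ENNReal.ofReal (m j) *
      ⨆ n, ENNReal.ofReal (elemOf (c j n) (join α β) : ℝ)) j with hG
  have h5 : ∀ p : ℕ × ℕ, ENNReal.ofReal (mc p.1 α * mc p.2 β *
      (m (Nat.pair p.1 p.2) / (m p.1 * m p.2))) ≤ ENNReal.ofReal (C2 * 2 ^ κ) * G (φ p) := by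
    rintro ⟨u, v⟩
    have hmu := hm.pos u
    have hmv := hm.pos v
    have hcu := hmc.nonneg u α
    have hcv := hmc.nonneg v β
    have h6 : ENNReal.ofReal (mc u α * (mc v β * (2 ^ (k u + k v) / 2 ^ κ))) ≤
        ⨆ n, ENNReal.ofReal (elemOf (c (φ (u, v)) n) (join α β) : ℝ) := by
      have ht : Filter.Tendsto (fun n => ENNReal.ofReal ((a u (pre α n) : ℝ) / 2 ^ n *
          ((a v (pre β n) : ℝ) / 2 ^ n * (2 ^ (k u + k v) / 2 ^ κ)))) Filter.atTop
          (nhds (ENNReal.ofReal (mc u α * (mc v β * (2 ^ (k u + k v) / 2 ^ κ))))) :=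
        ENNReal.tendsto_ofReal ((tendsto_of_mono_approx (approx_mono (am u) α) (ale u α) (alt u α)).mul
          ((tendsto_of_mono_approx (approx_mono (am v) β) (ale v β) (alt v β)).mul_const _))
      refine le_of_tendsto ht (Filter.Eventually.of_forall fun n => ?_)
      refine le_trans (le_of_eq ?_) (le_iSup _ n)
      simp only [φ]
      rw [hval]
      push_cast
      rfl
    simp only [hG]
    rw [Set.indicator_of_mem (hgood (u, v))]
    refine le_trans ?_ (mul_le_mul_right (mul_le_mul_right h6 _) _)
    rw [← ENNReal.ofReal_mul (hm.nonneg _), ← ENNReal.ofReal_mul (by positivity)]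
    refine ENNReal.ofReal_le_ofReal ?_
    have h7 := h2 u (k u) v (k v) (hk u) (hk' u) (hk v) (hk' v)
    have h8 : m (Nat.pair u v) / (m u * m v) ≤ C2 * m (φ (u, v)) * 2 ^ (k u + k v) := by
      rw [div_le_iff₀ (by positivity)]
      have e2 : (1 : ℝ) ≤ 2 ^ k u * m u := by
        rw [show (1 : ℝ) = 2 ^ k u * (1 / 2) ^ k u by rw [← mul_pow]; norm_num]
        gcongr
        exact (hk u).le
      have e3 : (1 : ℝ) ≤ 2 ^ k v * m v := by
        rw [show (1 : ℝ) = 2 ^ k v * (1 / 2) ^ k v by rw [← mul_pow]; norm_num]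
        gcongr
        exact (hk v).le
      have h9 : (0 : ℝ) ≤ C2 * m (φ (u, v)) := mul_nonneg hC2.le (hm.nonneg _)
      calc m (Nat.pair u v) ≤ C2 * m (φ (u, v)) * (1 * 1) := by rw [mul_one, mul_one]; exact h7
        _ ≤ C2 * m (φ (u, v)) * ((2 ^ k u * m u) * (2 ^ k v * m v)) := by gcongr
        _ = _ := by rw [pow_add]; ring
    calc _ ≤ mc u α * mc v β * (C2 * m (φ (u, v)) * 2 ^ (k u + k v)) := by gcongr
      _ = _ := by field_simp
  refine (ENNReal.tsum_le_tsum h5).trans ?_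
  rw [ENNReal.tsum_mul_left]
  gcongr
  exact (ENNReal.tsum_comp_le_tsum_of_injective hφ G).trans h4

end

/-! ### Minima of elementary functions -/

/-- The minimum of `f` over the extensions of `s`. -/
noncomputable def infOn (s : List Bool) (f : Elem) : ℝ := sInf ((fun ω => (f ω : ℝ)) '' cylSet s)

theorem ext0_mem_cylSet (s : List Bool) : ext0 s ∈ cylSet s := mem_cylSet.2 (pre_ext0 s)

theorem exists_infOn (s : List Bool) (f : Elem) :
    ∃ ω ∈ cylSet s, infOn s f = f ω ∧ ∀ ω' ∈ cylSet s, f ω ≤ f ω' := by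
  have hfin : (f '' cylSet s).Finite := f.range_finite.subset (Set.image_subset_range _ _)
  obtain ⟨ω, hω, h⟩ := Set.exists_min_image (f '' cylSet s) id hfin ⟨_, _, ext0_mem_cylSet s, rfl⟩
  obtain ⟨ω, hω, rfl⟩ := hω
  have h' : ∀ ω' ∈ cylSet s, f ω ≤ f ω' := fun ω' hω' => h _ ⟨ω', hω', rfl⟩
  refine ⟨ω, hω, le_antisymm (csInf_le ⟨f ω, ?_⟩ ⟨ω, hω, rfl⟩) (le_csInf ⟨_, ω, hω, rfl⟩ ?_), h'⟩
  all_goals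
    rintro _ ⟨ω', hω', rfl⟩
    exact Rat.cast_le.2 (h' ω' hω')

theorem le_infOn_iff {s : List Bool} {f : Elem} {r : ℝ} :
    r ≤ infOn s f ↔ ∀ ω ∈ cylSet s, r ≤ f ω := by
  obtain ⟨ω, hω, h1, h2⟩ := exists_infOn s f
  rw [h1]
  exact ⟨fun h ω' hω' => h.trans (by exact_mod_cast h2 ω' hω'), fun h => h ω hω⟩

theorem infOn_le {s : List Bool} (f : Elem) {ω : Seq} (h : ω ∈ cylSet s) : infOn s f ≤ f ω :=
  le_infOn_iff.1 le_rfl ω h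

theorem cylSet_anti {s t : List Bool} (h : s <+: t) : cylSet t ⊆ cylSet s := by
  intro ω hω
  rw [mem_cylSet] at hω ⊢
  obtain ⟨u, rfl⟩ := h
  have := congrArg (List.take s.length) hω
  rw [take_pre, List.take_left] at this
  rwa [min_eq_left (by simp)] at this

theorem infOn_mono {s t : List Bool} (h : s <+: t) (f : Elem) : infOn s f ≤ infOn t f :=
  le_infOn_iff.2 fun _ hω => infOn_le f (cylSet_anti h hω)

theorem infOn_nonneg (s : List Bool) {f : Elem} (h : ∀ ω, 0 ≤ f ω) : 0 ≤ infOn s f :=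
  le_infOn_iff.2 fun ω _ => by exact_mod_cast h ω

theorem infOn_concave (s : List Bool) {c : ℚ} (hc : 0 ≤ c) (f g : Elem) :
    c * infOn s f + infOn s g ≤ infOn s (c • f + g) := by
  refine le_infOn_iff.2 fun ω hω => ?_
  have h0 : (0 : ℝ) ≤ c := by exact_mod_cast hc
  rw [LocallyConstant.add_apply, LocallyConstant.smul_apply, smul_eq_mul]
  push_cast
  exact add_le_add (mul_le_mul_of_nonneg_left (infOn_le f hω) h0) (infOn_le g hω)

theorem infOn_neg_one (s : List Bool) : infOn s (-1) = -1 := by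
  obtain ⟨ω, _, h, _⟩ := exists_infOn s (-1)
  rw [h]; simp

theorem infOn_min (s : List Bool) {f g h : Elem} (hh : ∀ ω, h ω = min (f ω) (g ω)) :
    infOn s h = min (infOn s f) (infOn s g) := by
  refine le_antisymm (le_min ?_ ?_) ?_
  · refine le_infOn_iff.2 fun ω hω => (infOn_le h hω).trans ?_
    rw [hh]; exact_mod_cast min_le_left _ _
  · refine le_infOn_iff.2 fun ω hω => (infOn_le h hω).trans ?_
    rw [hh]; exact_mod_cast min_le_right _ _
  · refine le_infOn_iff.2 fun ω hω => ?_
    rw [hh]; push_cast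
    exact min_le_min (infOn_le f hω) (infOn_le g hω)

theorem infOn_le_of_le (s : List Bool) {f : Elem} {B : ℚ} (h : ∀ ω, |f ω| ≤ B) : infOn s f ≤ B := by
  refine (infOn_le f (ext0_mem_cylSet s)).trans ?_
  exact_mod_cast (le_abs_self _).trans (h _)

/-- The code of the minimum of an elementary function over the extensions of `s`. -/
def minCode (c : ElemCode) (s : List Bool) : RatCode :=
  (words (codeLen c + s.length)).foldr (fun t r =>
    bif decide (t.take s.length = s) && rlt (evalCode c t) r then evalCode c t else r)
    (evalCode c ((List.range (codeLen c + s.length)).map fun i => s.getD i false))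

@[fun_prop] theorem primrec_minCode {α : Type*} [Primcodable α] {f : α → ElemCode}
    {g : α → List Bool} (hf : Primrec f) (hg : Primrec g) :
    Primrec fun x => minCode (f x) (g x) := by
  unfold minCode
  fun_prop

theorem ratOf_minCode (c : ElemCode) (s : List Bool) :
    (ratOf (minCode c s) : ℝ) = infOn s (elemOf c) := by
  set L := codeLen c + s.length with hL
  have hev : ∀ ω, elemOf c ω = ratOf (evalCode c (pre ω L)) := fun ω =>
    elemOf_eq_evalCode c ω (by omega)
  -- the fold keeps a value attained on the cylinder and lowers it to each smaller value seen
  have key : ∀ (l : List (List Bool)) (r0 : RatCode), (∀ t ∈ l, t.length = L) →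
      (∃ ω ∈ cylSet s, ratOf r0 = elemOf c ω) →
      (∃ ω ∈ cylSet s, ratOf (l.foldr (fun t r =>
        bif decide (t.take s.length = s) && rlt (evalCode c t) r then evalCode c t else r) r0) =
          elemOf c ω) ∧
      ∀ t ∈ l, t.take s.length = s → ratOf (l.foldr (fun t r =>
        bif decide (t.take s.length = s) && rlt (evalCode c t) r then evalCode c t else r) r0) ≤
          ratOf (evalCode c t) := by
    intro l r0 hl h0
    induction l with
    | nil => exact ⟨h0, by simp⟩
    | cons t l ih =>
      obtain ⟨ih1, ih2⟩ := ih fun t ht => hl t (List.mem_cons_of_mem _ ht)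
      simp only [List.foldr_cons]
      set R := l.foldr (fun t r =>
        bif decide (t.take s.length = s) && rlt (evalCode c t) r then evalCode c t else r) r0
      have hlen := hl t List.mem_cons_self
      by_cases h : t.take s.length = s
      · by_cases h' : rlt (evalCode c t) R = true
        · simp only [h, h', decide_true, Bool.and_self, cond_true]
          rw [rlt_iff] at h'
          refine ⟨⟨ext0 t, ?_, ?_⟩, fun t' ht' hs => ?_⟩
          · have h1 : s <+: t := by rw [← h]; exact List.take_prefix _ _
            exact cylSet_anti h1 (ext0_mem_cylSet t)
          · rw [hev, ← hlen, pre_ext0]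
          · rcases List.mem_cons.1 ht' with rfl | ht'
            · exact le_rfl
            · exact h'.le.trans (ih2 t' ht' hs)
        · have h'' : rlt (evalCode c t) R = false := by simpa using h'
          simp only [h'', Bool.and_false, cond_false]
          refine ⟨ih1, fun t' ht' hs => ?_⟩
          rcases List.mem_cons.1 ht' with rfl | ht'
          · rw [rlt_iff] at h'
            exact not_lt.1 h'
          · exact ih2 t' ht' hs
      · simp only [h, decide_false, Bool.false_and, cond_false]
        refine ⟨ih1, fun t' ht' hs => ?_⟩
        rcases List.mem_cons.1 ht' with rfl | ht'
        · exact absurd hs h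
        · exact ih2 t' ht' hs
  obtain ⟨⟨ω, hω, h1⟩, h2⟩ := key (words L) (evalCode c ((List.range L).map fun i => s.getD i false))
    (fun t ht => mem_words.1 ht) ⟨ext0 s, ext0_mem_cylSet s, (hev (ext0 s)).symm⟩
  refine le_antisymm (le_infOn_iff.2 fun ω' hω' => ?_) ?_
  · rw [hev]
    have := h2 (pre ω' L) (mem_words.2 (length_pre _ _))
      (by rw [take_pre, min_eq_left (by omega)]; exact mem_cylSet.1 hω')
    exact_mod_cast this
  · have : infOn s (elemOf c) ≤ elemOf c ω := infOn_le _ hω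
    rw [← h1] at this
    exact this

/-! ### Computable measures on the binary tree and their images -/

/-- Computable measures, as functions on finite strings. -/
structure IsComputableTree (p : List Bool → ℝ) : Prop where
  nonneg : ∀ z, 0 ≤ p z
  add : ∀ z, p z = p (z ++ [false]) + p (z ++ [true])
  le_one : p [] ≤ 1
  approx : ∃ lo up : List Bool → ℕ → ℕ, (Primrec fun q : List Bool × ℕ => lo q.1 q.2) ∧
    (Primrec fun q : List Bool × ℕ => up q.1 q.2) ∧
    (∀ z t, (lo z t : ℝ) / 2 ^ t ≤ p z) ∧ (∀ z t, p z ≤ (up z t : ℝ) / 2 ^ t) ∧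
    (∀ z, Filter.Tendsto (fun t => (lo z t : ℝ) / 2 ^ t) Filter.atTop (nhds (p z))) ∧
    ∀ z, Filter.Tendsto (fun t => (up z t : ℝ) / 2 ^ t) Filter.atTop (nhds (p z))

theorem IsComputableTree.sum_strs {p : List Bool → ℝ} (hp : IsComputableTree p) (n : ℕ) :
    ∑ z ∈ strs n, p z = p [] := by
  induction n with
  | zero => rw [sum_strs_zero]
  | succ n ih =>
    rw [sum_strs_succ, ← ih]
    exact Finset.sum_congr rfl fun z _ => (hp.add z).symm

/-- The `n`-th lower bound for the mean of `f` with respect to the image of a measure `p`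
under a monotone map `w` of strings. -/
noncomputable def treeSum (p : List Bool → ℝ) (w : List Bool → List Bool) (f : Elem) (n : ℕ) : ℝ :=
  ∑ z ∈ strs n, p z * infOn (w z) f

/-- The image of a measure `p` under a monotone map `w` of strings. -/
noncomputable def treeImage (p : List Bool → ℝ) (w : List Bool → List Bool) (f : Elem) : ℝ :=
  ⨆ n, treeSum p w f n

section

variable {p : List Bool → ℝ} (hp : IsComputableTree p) {w : List Bool → List Bool}
  (hw : ∀ z b, w z <+: w (z ++ [b]))

include hp hw in
theorem treeSum_mono (f : Elem) : Monotone (treeSum p w f) := by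
  refine monotone_nat_of_le_succ fun n => ?_
  unfold treeSum
  rw [sum_strs_succ]
  refine Finset.sum_le_sum fun z _ => ?_
  rw [hp.add z, add_mul]
  exact add_le_add (mul_le_mul_of_nonneg_left (infOn_mono (hw _ _) f) (hp.nonneg _))
    (mul_le_mul_of_nonneg_left (infOn_mono (hw _ _) f) (hp.nonneg _))

include hp in
theorem treeSum_le {f : Elem} {B : ℚ} (hB0 : 0 ≤ B) (hB : ∀ ω, |f ω| ≤ B) (n : ℕ) :
    treeSum p w f n ≤ B := by
  have h0 : (0 : ℝ) ≤ B := by exact_mod_cast hB0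
  calc treeSum p w f n ≤ ∑ z ∈ strs n, p z * B :=
        Finset.sum_le_sum fun z _ => mul_le_mul_of_nonneg_left (infOn_le_of_le _ hB) (hp.nonneg _)
    _ = p [] * B := by rw [← Finset.sum_mul, hp.sum_strs]
    _ ≤ B := mul_le_of_le_one_left h0 hp.le_one

include hp in
theorem bddAbove_treeSum (f : Elem) : BddAbove (Set.range (treeSum p w f)) := by
  obtain ⟨B, hB0, hB⟩ := exists_bound f
  exact ⟨B, by rintro _ ⟨n, rfl⟩; exact treeSum_le hp hB0 hB n⟩

include hp hw in
/-- Minima are concave, and concavity survives the monotone limit. -/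
theorem isSemimeasure_treeImage : IsSemimeasure (treeImage p w) where
  neg_one_le := by
    refine le_trans ?_ (le_ciSup (bddAbove_treeSum hp (-1)) 0)
    unfold treeSum
    rw [sum_strs_zero, infOn_neg_one]
    linarith [hp.le_one]
  nonneg f hf := Real.iSup_nonneg fun n =>
    Finset.sum_nonneg fun z _ => mul_nonneg (hp.nonneg z) (infOn_nonneg _ hf)
  concave c f g hc := by
    have h0 : (0 : ℝ) ≤ c := by exact_mod_cast hc
    have ht : ∀ f, Filter.Tendsto (treeSum p w f) Filter.atTop (nhds (treeImage p w f)) := fun f =>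
      tendsto_atTop_ciSup (treeSum_mono hp hw f) (bddAbove_treeSum hp f)
    refine le_of_tendsto_of_tendsto' (((ht f).const_mul (c : ℝ)).add (ht g)) (ht (c • f + g))
      fun n => ?_
    unfold treeSum
    rw [Finset.mul_sum, ← Finset.sum_add_distrib]
    refine Finset.sum_le_sum fun z _ => ?_
    have := mul_le_mul_of_nonneg_left (infOn_concave (w z) hc f g) (hp.nonneg z)
    linarith

include hp in
/-- Positive parts of minima are weighted by lower bounds of `p`, negative parts by upper bounds,
so that `treeSum` is approximated from below. -/
theorem reFunctional_treeImage (hwp : Primrec w) : REFunctional (treeImage p w) := by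
  obtain ⟨lo, up, hlo, hup, lo_le, le_up, lo_t, up_t⟩ := hp.approx
  let term : ElemCode → ℕ → List Bool → RatCode := fun c t z =>
    (lo z t * (minCode c (w z)).1, up z t * (minCode c (w z)).2.1,
      ((minCode c (w z)).2.2 + 1) * 2 ^ t - 1)
  have hterm : Primrec fun q : ElemCode × ℕ × List Bool => term q.1 q.2.1 q.2.2 := by
    simp only [term]
    fun_prop
  let v : ElemCode → ℕ × ℕ → RatCode := fun c i =>
    (words i.1).foldr (fun z r => radd (term c i.2 z) r) (0, 0, 0)
  have hv : Primrec fun q : ElemCode × ℕ × ℕ => v q.1 q.2 := by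
    simp only [v]
    fun_prop
  have hval : ∀ c n t, (ratOf (v c (n, t)) : ℝ) = ∑ z ∈ strs n,
      ((lo z t : ℝ) / 2 ^ t * ((minCode c (w z)).1 / ((minCode c (w z)).2.2 + 1)) -
        (up z t : ℝ) / 2 ^ t * ((minCode c (w z)).2.1 / ((minCode c (w z)).2.2 + 1))) := by
    intro c n t
    rw [AlgInfo.sum_strs]
    simp only [v]
    induction words n with
    | nil => simp [ratOf]
    | cons z l ih =>
      rw [List.foldr_cons, ratOf_radd, List.map_cons, List.sum_cons, ← ih]
      push_cast
      congr 1
      simp only [term, ratOf]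
      have : ((((minCode c (w z)).2.2 + 1) * 2 ^ t - 1 : ℕ) : ℝ) + 1 =
          ((minCode c (w z)).2.2 + 1) * 2 ^ t := by
        rw [Nat.cast_sub (Nat.one_le_iff_ne_zero.2 (by positivity))]
        push_cast
        ring
      push_cast
      rw [this]
      field_simp
  have hmin : ∀ c s, infOn s (elemOf c) = (minCode c s).1 / ((minCode c s).2.2 + 1) -
      (minCode c s).2.1 / ((minCode c s).2.2 + 1) := by
    intro c s
    rw [← ratOf_minCode, ratOf]
    push_cast
    ring
  refine re_of_sup (f := fun c => treeImage p w (elemOf c)) v hv fun c r => ?_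
  unfold treeImage
  rw [lt_ciSup_iff (bddAbove_treeSum hp _)]
  constructor
  · rintro ⟨n, hn⟩
    have ht : Filter.Tendsto (fun t => (ratOf (v c (n, t)) : ℝ)) Filter.atTop
        (nhds (treeSum p w (elemOf c) n)) := by
      simp only [hval]
      unfold treeSum
      simp only [hmin, mul_sub]
      exact tendsto_finsetSum _ fun z _ => ((lo_t z).mul_const _).sub ((up_t z).mul_const _)
    obtain ⟨t, ht⟩ := (ht.eventually (lt_mem_nhds hn)).exists
    exact ⟨(n, t), ht⟩
  · rintro ⟨⟨n, t⟩, h⟩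
    refine ⟨n, h.trans_le ?_⟩
    rw [hval]
    unfold treeSum
    refine Finset.sum_le_sum fun z _ => ?_
    rw [hmin, mul_sub]
    gcongr
    · exact lo_le _ _
    · exact le_up _ _

end

/-! ### Products of measures on the binary tree -/

theorem natCast_div_le_div (a b : ℕ) : ((a / b : ℕ) : ℝ) ≤ (a : ℝ) / b := Nat.cast_div_le

theorem div_sub_one_le_natCast_div (a : ℕ) {b : ℕ} (hb : 0 < b) :
    (a : ℝ) / b - 1 ≤ ((a / b : ℕ) : ℝ) := by
  have h1 : a < b * (a / b + 1) := Nat.lt_mul_div_succ a hb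
  have h2 : (a : ℝ) < b * (((a / b : ℕ) : ℝ) + 1) := by exact_mod_cast h1
  have hb' : (0 : ℝ) < b := by exact_mod_cast hb
  rw [sub_le_iff_le_add, div_le_iff₀ hb']
  linarith

theorem ev_od_append (z : List Bool) (b : Bool) :
    (ev (z ++ [b]) = ev z ++ [b] ∧ od (z ++ [b]) = od z) ∨
      (ev (z ++ [b]) = ev z ∧ od (z ++ [b]) = od z ++ [b]) := by
  rcases Nat.mod_two_eq_zero_or_one z.length with h | h
  · exact Or.inl ⟨ev_append_even b h, od_append_even b h⟩
  · exact Or.inr ⟨ev_append_odd b h, od_append_odd b h⟩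

/-- The product of two measures, on interleaved strings, divided by `2 ^ c`. -/
theorem IsComputableTree.prod {p₁ p₂ : List Bool → ℝ} (h₁ : IsComputableTree p₁)
    (h₂ : IsComputableTree p₂) (c : ℕ) :
    IsComputableTree fun z => p₁ (ev z) * p₂ (od z) / 2 ^ c where
  nonneg z := by
    have := h₁.nonneg (ev z)
    have := h₂.nonneg (od z)
    positivity
  add z := by
    rcases Nat.mod_two_eq_zero_or_one z.length with h | h
    · simp only [ev_append_even _ h, od_append_even _ h]
      rw [h₁.add (ev z)]; ring
    · simp only [ev_append_odd _ h, od_append_odd _ h]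
      rw [h₂.add (od z)]; ring
  le_one := by
    have e1 : ev [] = [] := rfl
    have e2 : od [] = [] := rfl
    rw [e1, e2, div_le_one (by positivity)]
    have h3 := h₁.le_one
    have h4 := h₂.le_one
    have h5 := h₂.nonneg []
    calc p₁ [] * p₂ [] ≤ 1 * 1 := by gcongr
      _ ≤ 2 ^ c := by rw [one_mul]; exact one_le_pow₀ one_le_two
  approx := by
    obtain ⟨lo₁, up₁, hlo₁, hup₁, lo_le₁, le_up₁, lo_t₁, up_t₁⟩ := h₁.approx
    obtain ⟨lo₂, up₂, hlo₂, hup₂, lo_le₂, le_up₂, lo_t₂, up_t₂⟩ := h₂.approx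
    have hsmall : Filter.Tendsto (fun t : ℕ => (1 : ℝ) / 2 ^ t) Filter.atTop (nhds 0) := by
      simpa using tendsto_pow_atTop_nhds_zero_of_lt_one (r := (1 / 2 : ℝ)) (by norm_num) (by norm_num)
    have e : ∀ a b t : ℕ, (a : ℝ) / 2 ^ t * (b / 2 ^ t) / 2 ^ c =
        ((a * b : ℕ) : ℝ) / ((2 ^ (t + c) : ℕ) : ℝ) / 2 ^ t := by
      intro a b t
      push_cast
      rw [pow_add]
      field_simp
    have hq : ∀ n t : ℕ, (n : ℝ) / ((2 ^ (t + c) : ℕ) : ℝ) / 2 ^ t - 1 / 2 ^ t ≤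
        ((n / 2 ^ (t + c) : ℕ) : ℝ) / 2 ^ t := by
      intro n t
      have := div_sub_one_le_natCast_div n (b := 2 ^ (t + c)) (by positivity)
      rw [← sub_div]
      gcongr
    have hq' : ∀ n t : ℕ, ((n / 2 ^ (t + c) : ℕ) : ℝ) / 2 ^ t ≤
        (n : ℝ) / ((2 ^ (t + c) : ℕ) : ℝ) / 2 ^ t := by
      intro n t
      gcongr
      exact natCast_div_le_div _ _
    refine ⟨fun z t => lo₁ (ev z) t * lo₂ (od z) t / 2 ^ (t + c),
      fun z t => up₁ (ev z) t * up₂ (od z) t / 2 ^ (t + c) + 1, by fun_prop, by fun_prop,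
      fun z t => ?_, fun z t => ?_, fun z => ?_, fun z => ?_⟩
    · refine (hq' _ _).trans ?_
      rw [← e]
      have := h₁.nonneg (ev z)
      gcongr
      · exact lo_le₁ _ _
      · exact lo_le₂ _ _
    · have h3 := hq (up₁ (ev z) t * up₂ (od z) t) t
      rw [← e] at h3
      have h4 : p₁ (ev z) * p₂ (od z) / 2 ^ c ≤
          (up₁ (ev z) t : ℝ) / 2 ^ t * ((up₂ (od z) t : ℝ) / 2 ^ t) / 2 ^ c := by
        have := h₂.nonneg (od z)
        gcongr
        · exact le_up₁ _ _
        · exact le_up₂ _ _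
      rw [Nat.cast_add, Nat.cast_one, add_div]
      linarith
    · have h3 := ((lo_t₁ (ev z)).mul (lo_t₂ (od z))).div_const ((2 : ℝ) ^ c)
      refine tendsto_of_tendsto_of_tendsto_of_le_of_le (by have := h3.sub hsmall; rwa [sub_zero] at this) h3
        (fun t => ?_) (fun t => ?_)
      · dsimp only
        rw [e]
        exact hq _ _
      · dsimp only
        rw [e]
        exact hq' _ _
    · have h3 := ((up_t₁ (ev z)).mul (up_t₂ (od z))).div_const ((2 : ℝ) ^ c)
      refine tendsto_of_tendsto_of_tendsto_of_le_of_le h3 (by have := h3.add hsmall; rwa [add_zero] at this)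
        (fun t => ?_) (fun t => ?_)
      · dsimp only
        rw [e]
        have := hq (up₁ (ev z) t * up₂ (od z) t) t
        rw [Nat.cast_add, Nat.cast_one, add_div]
        linarith
      · dsimp only
        rw [e, Nat.cast_add, Nat.cast_one, add_div]
        have := hq' (up₁ (ev z) t * up₂ (od z) t) t
        linarith

theorem sum_strs_ev_od {A : Type*} [AddCommMonoid A] (g : List Bool → List Bool → A) (n : ℕ) :
    ∑ z ∈ strs (n + n), g (ev z) (od z) = ∑ a ∈ strs n, ∑ b ∈ strs n, g a b := by
  induction n generalizing g with
  | zero =>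
    rw [sum_strs_zero, sum_strs_zero, sum_strs_zero]
    rfl
  | succ n ih =>
    rw [show n + 1 + (n + 1) = n + n + 1 + 1 by omega, sum_strs_succ, sum_strs_succ]
    have h : ∀ z ∈ strs (n + n), ∀ b b' : Bool,
        ev (z ++ [b] ++ [b']) = ev z ++ [b] ∧ od (z ++ [b] ++ [b']) = od z ++ [b'] := by
      intro z hz b b'
      rw [mem_strs] at hz
      have h0 : z.length % 2 = 0 := by omega
      have h1 : (z ++ [b]).length % 2 = 1 := by simp; omega
      rw [ev_append_odd b' h1, od_append_odd b' h1, ev_append_even b h0, od_append_even b h0]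
      exact ⟨rfl, rfl⟩
    rw [Finset.sum_congr rfl fun z hz => by
      rw [(h z hz _ _).1, (h z hz _ _).2, (h z hz _ _).1, (h z hz _ _).2, (h z hz _ _).1,
        (h z hz _ _).2, (h z hz _ _).1, (h z hz _ _).2]]
    rw [ih fun a b => g (a ++ [false]) (b ++ [false]) + g (a ++ [false]) (b ++ [true]) +
      (g (a ++ [true]) (b ++ [false]) + g (a ++ [true]) (b ++ [true])), sum_strs_succ]
    refine Finset.sum_congr rfl fun a _ => ?_
    rw [sum_strs_succ, sum_strs_succ, ← Finset.sum_add_distrib]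

/-- The interleaving of two strings; the longer one is truncated. -/
def interleave (x y : List Bool) : List Bool :=
  (List.range (2 * min x.length y.length)).map fun i =>
    if i % 2 = 0 then x.getD (i / 2) false else y.getD (i / 2) false

@[fun_prop] theorem primrec_interleave {α : Type*} [Primcodable α] {f g : α → List Bool}
    (hf : Primrec f) (hg : Primrec g) : Primrec fun x => interleave (f x) (g x) := by
  unfold interleave
  fun_prop

theorem interleave_pre (α β : Seq) (a b : ℕ) :
    interleave (pre α a) (pre β b) = pre (join α β) (2 * min a b) := by
  unfold interleave
  rw [length_pre, length_pre]
  refine List.map_congr_left fun i hi => ?_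
  rw [List.mem_range] at hi
  unfold join
  split_ifs
  · rw [pre_getD _ _ _ _ (by omega)]
  · rw [pre_getD _ _ _ _ (by omega)]

theorem pre_prefix (α : Seq) {a b : ℕ} (h : a ≤ b) : pre α a <+: pre α b := by
  have := take_pre α b a
  rw [min_eq_left h] at this
  rw [← this]
  exact List.take_prefix _ _

theorem eq_pre_ext0 {x x' : List Bool} (h : x <+: x') : x = pre (ext0 x') x.length :=
  (mem_cylSet.1 (cylSet_anti h (ext0_mem_cylSet x'))).symm

theorem interleave_mono {x x' y y' : List Bool} (hx : x <+: x') (hy : y <+: y') :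
    interleave x y <+: interleave x' y' := by
  have hx' := hx.length_le
  have hy' := hy.length_le
  have h := interleave_pre (ext0 x') (ext0 y') x.length y.length
  have h' := interleave_pre (ext0 x') (ext0 y') x'.length y'.length
  rw [← eq_pre_ext0 hx, ← eq_pre_ext0 hy] at h
  rw [pre_ext0, pre_ext0] at h'
  rw [h, h']
  exact pre_prefix _ (by omega)

theorem join_mem_cylSet {x y : List Bool} {α β : Seq} (hα : α ∈ cylSet x) (hβ : β ∈ cylSet y) :
    join α β ∈ cylSet (interleave x y) := by
  rw [mem_cylSet] at hα hβ ⊢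
  rw [← hα, ← hβ, interleave_pre, length_pre]

theorem pairMap_mono {w₁ w₂ : List Bool → List Bool} (hw₁ : ∀ z b, w₁ z <+: w₁ (z ++ [b]))
    (hw₂ : ∀ z b, w₂ z <+: w₂ (z ++ [b])) (z : List Bool) (b : Bool) :
    interleave (w₁ (ev z)) (w₂ (od z)) <+: interleave (w₁ (ev (z ++ [b]))) (w₂ (od (z ++ [b]))) := by
  rcases ev_od_append z b with ⟨h1, h2⟩ | ⟨h1, h2⟩ <;> rw [h1, h2]
  · exact interleave_mono (hw₁ _ _) (List.prefix_refl _)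
  · exact interleave_mono (List.prefix_refl _) (hw₂ _ _)

/-- The product of images of two measures is bounded by the product of semimeasures that dominate
these images. -/
theorem treeSum_prod_le {M : Elem → ℝ} (hM : IsSemimeasure M) {p₁ p₂ : List Bool → ℝ}
    (h₁ : IsComputableTree p₁) (h₂ : IsComputableTree p₂) {w₁ w₂ : List Bool → List Bool}
    (hw₁ : ∀ z b, w₁ z <+: w₁ (z ++ [b])) (hw₂ : ∀ z b, w₂ z <+: w₂ (z ++ [b])) {D₁ D₂ : ℝ}
    (hD₁ : 0 < D₁) (hD₂ : 0 < D₂)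
    (hM₁ : ∀ f : Elem, (∀ ω, 0 ≤ f ω) → treeImage p₁ w₁ f ≤ D₁ * M f)
    (hM₂ : ∀ f : Elem, (∀ ω, 0 ≤ f ω) → treeImage p₂ w₂ f ≤ D₂ * M f) {c : ℕ}
    (hc : D₁ * D₂ ≤ 2 ^ c) {f : Elem} (hf : ∀ ω, 0 ≤ f ω) (n : ℕ) :
    treeSum (fun z => p₁ (ev z) * p₂ (od z) / 2 ^ c)
      (fun z => interleave (w₁ (ev z)) (w₂ (od z))) f n ≤ tensor M M f := by
  refine (treeSum_mono (h₁.prod h₂ c) (pairMap_mono hw₁ hw₂) f (show n ≤ n + n by omega)).trans ?_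
  set G : Seq → ℝ := fun α => M (slice f α) with hG
  have hslice : ∀ α β, slice f α β = f (join α β) := fun α β => rfl
  have hG0 : ∀ α, 0 ≤ G α := fun α => hM.nonneg _ fun β => hf _
  obtain ⟨B, hB0, hB⟩ := exists_bound f
  have hGB : ∀ α, G α ≤ B := fun α => hM.le_of_le hB0 fun β => (le_abs_self _).trans (hB _)
  have hT0 : 0 ≤ tensor M M f := by
    have := hM.le_ext hGB (h := 0) fun ω => by simpa using hG0 ω
    rwa [hM.zero] at this
  obtain ⟨N, hN⟩ := exists_digits f
  have hGN : ∀ α α', pre α N = pre α' N → G α = G α' := by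
    intro α α' h
    simp only [hG]
    congr 1
    ext β
    rw [hslice, hslice]
    refine hN _ _ ?_
    rw [pre_eq_iff] at h ⊢
    intro i hi
    unfold join
    split_ifs
    · exact h _ (by omega)
    · rfl
  set v : List Bool → ℝ := fun a => ∑ b ∈ strs n, p₂ b * infOn (interleave (w₁ a) (w₂ b)) f with hv
  have hGv : ∀ a α, α ∈ cylSet (w₁ a) → v a ≤ D₂ * G α := by
    intro a α hα
    refine le_trans ?_ (hM₂ (slice f α) fun β => hf _)
    refine le_trans ?_ (le_ciSup (bddAbove_treeSum h₂ (slice f α)) n)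
    refine Finset.sum_le_sum fun b _ => mul_le_mul_of_nonneg_left ?_ (h₂.nonneg b)
    exact le_infOn_iff.2 fun β hβ => infOn_le f (join_mem_cylSet hα hβ)
  have key : ∀ ε > 0, ∑ a ∈ strs n, p₁ a * v a ≤ D₁ * D₂ * tensor M M f + ε := by
    intro ε hε
    have hδ : 0 < ε / D₂ := by positivity
    -- an elementary function `h ≤ G` is chosen within `ε / D₂` of `G`, which depends on finitely
    -- many digits
    choose q hq1 hq2 using fun s : List Bool =>
      exists_rat_btwn (show G (ext0 s) - ε / D₂ < G (ext0 s) by linarith)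
    set h : Elem := digitFn N fun s => max (q s) 0
    have hext : ∀ α, G (ext0 (pre α N)) = G α := fun α => hGN _ _ (by
      have := pre_ext0 (pre α N)
      rwa [length_pre] at this)
    have h1 : ∀ α, (h α : ℝ) ≤ G α := by
      intro α
      simp only [h, digitFn_apply]
      push_cast
      refine max_le ?_ (hG0 α)
      rw [← hext]
      exact (hq2 _).le
    have h2 : ∀ α, G α - ε / D₂ ≤ h α := by
      intro α
      simp only [h, digitFn_apply]
      push_cast
      refine le_trans ?_ (le_max_left _ _)
      rw [← hext]
      exact (hq1 _).le
    have h3 : M h ≤ tensor M M f := hM.le_ext hGB h1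
    have h4 : treeSum p₁ w₁ h n ≤ D₁ * M h :=
      (le_ciSup (bddAbove_treeSum h₁ h) n).trans (hM₁ h fun ω => by
        simp only [h, digitFn_apply]
        exact le_max_right _ _)
    have h5 : ∑ a ∈ strs n, p₁ a * v a - ε ≤ D₂ * treeSum p₁ w₁ h n := by
      have h6 : ∑ a ∈ strs n, p₁ a * ε ≤ ε := by
        rw [← Finset.sum_mul, h₁.sum_strs]
        exact mul_le_of_le_one_left hε.le h₁.le_one
      have h7 : ∑ a ∈ strs n, p₁ a * (v a - ε) ≤ D₂ * treeSum p₁ w₁ h n := by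
        unfold treeSum
        rw [Finset.mul_sum]
        refine Finset.sum_le_sum fun a _ => ?_
        rw [mul_left_comm]
        refine mul_le_mul_of_nonneg_left ?_ (h₁.nonneg a)
        rw [← div_le_iff₀' hD₂]
        refine le_infOn_iff.2 fun α hα => le_trans ?_ (h2 α)
        rw [sub_div]
        have := hGv a α hα
        rw [← div_le_iff₀' hD₂] at this
        linarith
      simp only [mul_sub, Finset.sum_sub_distrib] at h7
      linarith
    calc _ ≤ D₂ * treeSum p₁ w₁ h n + ε := by linarith
      _ ≤ D₂ * (D₁ * tensor M M f) + ε := by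
          gcongr
          exact h4.trans (by gcongr)
      _ = _ := by ring
  have key' : ∑ a ∈ strs n, p₁ a * v a ≤ D₁ * D₂ * tensor M M f := le_of_forall_pos_le_add key
  have e : treeSum (fun z => p₁ (ev z) * p₂ (od z) / 2 ^ c)
      (fun z => interleave (w₁ (ev z)) (w₂ (od z))) f (n + n) =
      (∑ a ∈ strs n, p₁ a * v a) / 2 ^ c := by
    unfold treeSum
    rw [sum_strs_ev_od fun a b => p₁ a * p₂ b / 2 ^ c * infOn (interleave (w₁ a) (w₂ b)) f,
      Finset.sum_div]
    refine Finset.sum_congr rfl fun a _ => ?_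
    simp only [hv]
    rw [Finset.mul_sum, Finset.sum_div]
    exact Finset.sum_congr rfl fun b _ => by ring
  rw [e, div_le_iff₀ (by positivity)]
  calc _ ≤ _ := key'
    _ ≤ 2 ^ c * tensor M M f := by gcongr
    _ = _ := mul_comm _ _

/-! ### Sequences as points of the unit interval -/

/-- The integer with binary digits `s`. -/
def natOf (s : List Bool) : ℕ := s.foldl (fun a b => 2 * a + bif b then 1 else 0) 0

@[fun_prop] theorem primrec_natOf {α : Type*} [Primcodable α] {f : α → List Bool}
    (hf : Primrec f) : Primrec fun x => natOf (f x) := by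
  unfold natOf
  fun_prop

theorem natOf_append (s : List Bool) (b : Bool) :
    natOf (s ++ [b]) = 2 * natOf s + bif b then 1 else 0 := by
  simp [natOf]

theorem sum_strs_natOf {A : Type*} [AddCommMonoid A] (n : ℕ) (g : ℕ → A) :
    ∑ s ∈ strs n, g (natOf s) = ∑ i ∈ Finset.range (2 ^ n), g i := by
  have h : ∀ (k : ℕ) (g : ℕ → A),
      ∑ i ∈ Finset.range k, (g (2 * i) + g (2 * i + 1)) = ∑ i ∈ Finset.range (2 * k), g i := by
    intro k g
    induction k with
    | zero => rfl
    | succ k ih =>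
      rw [Finset.sum_range_succ, ih, show 2 * (k + 1) = 2 * k + 1 + 1 by ring,
        Finset.sum_range_succ, Finset.sum_range_succ, add_assoc]
  induction n generalizing g with
  | zero => rw [sum_strs_zero]; simp [natOf]
  | succ n ih =>
    rw [sum_strs_succ]
    simp only [natOf_append, cond_false, cond_true, add_zero]
    rw [ih fun i => g (2 * i) + g (2 * i + 1), h, pow_succ, mul_comm]

/-- The number with binary digits `ω` after the binary point. -/
noncomputable def point (ω : Seq) : ℝ := ⨆ n, (natOf (pre ω n) : ℝ) / 2 ^ n

theorem natOf_div_mono (ω : Seq) : Monotone fun n => (natOf (pre ω n) : ℝ) / 2 ^ n :=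
  mono_div_pow fun n => by rw [pre_succ, natOf_append]; omega

theorem natOf_succ_div_anti (ω : Seq) : Antitone fun n => ((natOf (pre ω n) : ℝ) + 1) / 2 ^ n := by
  refine antitone_nat_of_succ_le fun n => ?_
  rw [div_le_div_iff₀ (by positivity) (by positivity), pow_succ, pre_succ, natOf_append]
  have : (((2 * natOf (pre ω n) + bif ω n then 1 else 0 : ℕ) : ℝ) + 1) ≤
      2 * (natOf (pre ω n) + 1) := by
    cases ω n <;> push_cast <;> simp <;> linarith
  calc _ ≤ 2 * ((natOf (pre ω n) : ℝ) + 1) * 2 ^ n := by gcongr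
    _ = _ := by ring

theorem natOf_div_le (ω : Seq) (n k : ℕ) :
    (natOf (pre ω n) : ℝ) / 2 ^ n ≤ ((natOf (pre ω k) : ℝ) + 1) / 2 ^ k := by
  calc _ ≤ (natOf (pre ω (max n k)) : ℝ) / 2 ^ (max n k) := natOf_div_mono ω (le_max_left _ _)
    _ ≤ ((natOf (pre ω (max n k)) : ℝ) + 1) / 2 ^ (max n k) := by gcongr; linarith
    _ ≤ _ := natOf_succ_div_anti ω (le_max_right _ _)

theorem bddAbove_natOf_div (ω : Seq) :
    BddAbove (Set.range fun n => (natOf (pre ω n) : ℝ) / 2 ^ n) :=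
  ⟨_, by rintro _ ⟨n, rfl⟩; exact natOf_div_le ω n 0⟩

theorem natOf_div_le_point (ω : Seq) (n : ℕ) : (natOf (pre ω n) : ℝ) / 2 ^ n ≤ point ω :=
  le_ciSup (bddAbove_natOf_div ω) n

theorem point_le (ω : Seq) (n : ℕ) : point ω ≤ ((natOf (pre ω n) : ℝ) + 1) / 2 ^ n :=
  ciSup_le fun k => natOf_div_le ω k n

theorem measurable_point : Measurable point := by
  refine measurable_of_tendsto_metrizable (f := fun n ω => (natOf (pre ω n) : ℝ) / 2 ^ n)
    (fun n => ?_) (tendsto_pi_nhds.2 fun ω =>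
      tendsto_atTop_ciSup (natOf_div_mono ω) (bddAbove_natOf_div ω))
  have h : (fun ω : Seq => (natOf (pre ω n) : ℝ) / 2 ^ n) =
      fun ω => ((digitFn n fun s => (natOf s : ℚ) / 2 ^ n) ω : ℝ) := by
    funext ω
    rw [digitFn_apply]
    push_cast
    rfl
  rw [h]
  exact (continuous_elem _).measurable

theorem lamMeasure_pre (n : ℕ) (P : List Bool → Prop) [DecidablePred P] :
    lamMeasure {ω | P (pre ω n)} = ((strs n).filter P).card / 2 ^ n := by
  have h1 := lintegral_pre n fun s => if P s then 1 else 0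
  have h2 : (fun ω : Seq => if P (pre ω n) then (1 : ℝ≥0∞) else 0) =
      {ω | P (pre ω n)}.indicator 1 := by
    funext ω
    by_cases h : P (pre ω n) <;> simp [h]
  have h3 : MeasurableSet {ω : Seq | P (pre ω n)} := by
    have := measurable_pre n fun s => if P s then 1 else 0
    have h4 : {ω : Seq | P (pre ω n)} =
        (fun ω : Seq => if P (pre ω n) then (1 : ℝ≥0∞) else 0) ⁻¹' {1} := by
      ext ω
      by_cases h : P (pre ω n) <;> simp [h]
    rw [h4]
    exact this (measurableSet_singleton 1)
  rw [h2, lintegral_indicator_one h3] at h1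
  rw [h1, Finset.sum_ite, Finset.sum_const_zero, add_zero, Finset.sum_const, nsmul_eq_mul, mul_one]

theorem card_filter_natOf (n : ℕ) (P : ℕ → Prop) [DecidablePred P] :
    ((strs n).filter fun s => P (natOf s)).card = ((Finset.range (2 ^ n)).filter P).card := by
  rw [Finset.card_filter, Finset.card_filter, sum_strs_natOf n fun i => if P i then 1 else 0]

/-! ### Partitions of the unit interval -/

/-- The left end of the interval that corresponds to `z`; intervals have lengths `p z` and are
ordered lexicographically. -/
def leftEnd (p : List Bool → ℝ) (z : List Bool) : ℝ :=
  ∑ i ∈ Finset.range z.length, if z.getD i false then p (z.take i ++ [false]) else 0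

theorem sum_take_append {A : Type*} [AddCommMonoid A] (p : List Bool → A) (z : List Bool) (b : Bool) :
    (∑ i ∈ Finset.range (z ++ [b]).length,
      if (z ++ [b]).getD i false then p ((z ++ [b]).take i ++ [false]) else 0) =
    (∑ i ∈ Finset.range z.length, if z.getD i false then p (z.take i ++ [false]) else 0) +
      if b then p (z ++ [false]) else 0 := by
  rw [List.length_append, List.length_singleton, Finset.sum_range_succ]
  congr 1
  · refine Finset.sum_congr rfl fun i hi => ?_
    rw [Finset.mem_range] at hi
    rw [List.getD_append _ _ _ _ hi, List.take_append_of_le_length hi.le]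
  · rw [List.take_left, List.getD_append_right _ _ _ _ le_rfl]
    simp

theorem leftEnd_append (p : List Bool → ℝ) (z : List Bool) (b : Bool) :
    leftEnd p (z ++ [b]) = leftEnd p z + if b then p (z ++ [false]) else 0 :=
  sum_take_append p z b

/-- The half-open interval that corresponds to `z`, as a set of sequences. -/
def cell (p : List Bool → ℝ) (z : List Bool) : Set Seq :=
  {ω | leftEnd p z ≤ point ω ∧ point ω < leftEnd p z + p z}

/-- The open interval that corresponds to `z`, as an open set of sequences. -/
def openCell (p : List Bool → ℝ) (z : List Bool) : Set Seq :=
  {ω | ∃ n, leftEnd p z < (natOf (pre ω n) : ℝ) / 2 ^ n ∧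
    ((natOf (pre ω n) : ℝ) + 1) / 2 ^ n < leftEnd p z + p z}

theorem openCell_subset_cell (p : List Bool → ℝ) (z : List Bool) : openCell p z ⊆ cell p z :=
  fun ω ⟨n, h1, h2⟩ => ⟨h1.le.trans (natOf_div_le_point ω n), (point_le ω n).trans_lt h2⟩

theorem measurableSet_cell (p : List Bool → ℝ) (z : List Bool) : MeasurableSet (cell p z) :=
  (measurableSet_le measurable_const measurable_point).inter
    (measurableSet_lt measurable_point measurable_const)

section

variable {p : List Bool → ℝ} (hp : IsComputableTree p)
include hp

theorem cell_eq_union (z : List Bool) :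
    cell p z = cell p (z ++ [false]) ∪ cell p (z ++ [true]) := by
  have h0 := hp.nonneg (z ++ [false])
  have h1 := hp.nonneg (z ++ [true])
  have h2 := hp.add z
  ext ω
  simp only [cell, leftEnd_append, Set.mem_ofPred_eq, Set.mem_union]
  simp only [Bool.false_eq_true, if_false, if_true, add_zero]
  constructor
  · rintro ⟨h3, h4⟩
    rcases lt_or_ge (point ω) (leftEnd p z + p (z ++ [false])) with h | h
    · exact Or.inl ⟨h3, h⟩
    · exact Or.inr ⟨h, by linarith⟩
  · rintro (⟨h3, h4⟩ | ⟨h3, h4⟩) <;> constructor <;> linarith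

omit hp in
theorem disjoint_cell (z : List Bool) : Disjoint (cell p (z ++ [false])) (cell p (z ++ [true])) := by
  rw [Set.disjoint_left]
  intro ω h1 h2
  simp only [cell, leftEnd_append, Set.mem_ofPred_eq] at h1 h2
  simp only [Bool.false_eq_true, if_false, if_true, add_zero] at h1 h2
  linarith [h1.2, h2.1]

theorem cell_append_subset (z : List Bool) (b : Bool) : cell p (z ++ [b]) ⊆ cell p z := by
  rw [cell_eq_union hp z]
  cases b
  · exact Set.subset_union_left
  · exact Set.subset_union_right

theorem eq_of_mem_cell {z z' : List Bool} (hl : z.length = z'.length) {ω : Seq}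
    (h : ω ∈ cell p z) (h' : ω ∈ cell p z') : z = z' := by
  induction z using List.reverseRecOn generalizing z' with
  | nil => exact (List.length_eq_zero_iff.1 hl.symm).symm
  | append_singleton x b ih =>
    rcases List.eq_nil_or_concat' z' with rfl | ⟨x', b', rfl⟩
    · simp at hl
    · obtain rfl := ih (by simpa using hl) (cell_append_subset hp _ _ h)
        (cell_append_subset hp _ _ h')
      have hd := Set.disjoint_left.1 (disjoint_cell (p := p) x)
      cases b <;> cases b' <;> first | rfl | exact absurd h' (hd h) | exact absurd h (hd h')

theorem cell_take_subset (z : List Bool) (k : ℕ) : cell p z ⊆ cell p (z.take k) := by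
  induction z using List.reverseRecOn with
  | nil => simp
  | append_singleton x b ih =>
    rcases le_or_gt k x.length with h | h
    · rw [List.take_append_of_le_length h]
      exact (cell_append_subset hp _ _).trans ih
    · rw [List.take_of_length_le (by simpa using h)]

theorem prefix_of_mem_cell {z z' : List Bool} (hl : z.length ≤ z'.length) {ω : Seq}
    (h : ω ∈ cell p z) (h' : ω ∈ cell p z') : z <+: z' := by
  have := eq_of_mem_cell hp (z' := z'.take z.length) (by simp [hl]) h (cell_take_subset hp _ _ h')
  rw [this]
  exact List.take_prefix _ _

/-- An interval of length `p z` meets at most `p z * 2 ^ n + 2` of the dyadic intervals of length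
`2 ^ (-n)`. -/
theorem lamMeasure_cell_le (z : List Bool) : lamMeasure (cell p z) ≤ ENNReal.ofReal (p z) := by
  classical
  set a := leftEnd p z
  have h1 : ∀ n : ℕ, lamMeasure (cell p z) ≤ ENNReal.ofReal (p z + 2 * (1 / 2) ^ n) := by
    intro n
    set P : ℕ → Prop := fun i => a * 2 ^ n - 1 ≤ i ∧ (i : ℝ) < (a + p z) * 2 ^ n
    have hsub : cell p z ⊆ {ω | P (natOf (pre ω n))} := by
      rintro ω ⟨h2, h3⟩
      have h4 := h2.trans (point_le ω n)
      have h5 := (natOf_div_le_point ω n).trans_lt h3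
      rw [le_div_iff₀ (by positivity)] at h4
      rw [div_lt_iff₀ (by positivity)] at h5
      exact ⟨by linarith, h5⟩
    refine (measure_mono hsub).trans ?_
    rw [lamMeasure_pre n fun s => P (natOf s), card_filter_natOf n P]
    have hcard : (((Finset.range (2 ^ n)).filter P).card : ℝ) ≤ p z * 2 ^ n + 2 := by
      have h6 : ((Finset.range (2 ^ n)).filter P).image (fun i : ℕ => (i : ℤ)) ⊆
          Finset.Ico ⌈a * 2 ^ n - 1⌉ ⌈(a + p z) * 2 ^ n⌉ := by
        intro i hi
        obtain ⟨j, hj, rfl⟩ := Finset.mem_image.1 hi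
        obtain ⟨h7, h8⟩ := (Finset.mem_filter.1 hj).2
        rw [Finset.mem_Ico]
        exact ⟨Int.ceil_le.2 (by exact_mod_cast h7), Int.lt_ceil.2 (by exact_mod_cast h8)⟩
      have h9 := Finset.card_le_card h6
      rw [Finset.card_image_of_injective _ Nat.cast_injective, Int.card_Ico] at h9
      have hpz := hp.nonneg z
      have h10 : ⌈a * 2 ^ n - 1⌉ ≤ ⌈(a + p z) * 2 ^ n⌉ := by
        refine Int.ceil_mono ?_
        have : 0 ≤ p z * 2 ^ n := by positivity
        linarith
      have h11 : (((⌈(a + p z) * 2 ^ n⌉ - ⌈a * 2 ^ n - 1⌉).toNat : ℕ) : ℝ) =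
          (⌈(a + p z) * 2 ^ n⌉ : ℝ) - ⌈a * 2 ^ n - 1⌉ := by
        have := Int.toNat_of_nonneg (sub_nonneg.2 h10)
        exact_mod_cast this
      have h12 : (((Finset.range (2 ^ n)).filter P).card : ℝ) ≤
          ((⌈(a + p z) * 2 ^ n⌉ - ⌈a * 2 ^ n - 1⌉).toNat : ℕ) := by exact_mod_cast h9
      have h13 := Int.ceil_lt_add_one ((a + p z) * 2 ^ n)
      have h14 := Int.le_ceil (a * 2 ^ n - 1)
      linarith
    rw [show (((Finset.range (2 ^ n)).filter P).card : ℝ≥0∞) / 2 ^ n =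
      ENNReal.ofReal ((((Finset.range (2 ^ n)).filter P).card : ℝ) / 2 ^ n) by
        rw [ENNReal.ofReal_div_of_pos (by positivity), ENNReal.ofReal_natCast,
          ENNReal.ofReal_pow zero_le_two, ENNReal.ofReal_ofNat]]
    refine ENNReal.ofReal_le_ofReal ?_
    rw [div_le_iff₀ (by positivity)]
    have : (1 / 2 : ℝ) ^ n * 2 ^ n = 1 := by rw [← mul_pow]; norm_num
    calc _ ≤ _ := hcard
      _ = p z * 2 ^ n + 2 * ((1 / 2 : ℝ) ^ n * 2 ^ n) := by rw [this]; ring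
      _ = _ := by ring
  have h2 : Filter.Tendsto (fun n : ℕ => ENNReal.ofReal (p z + 2 * (1 / 2) ^ n)) Filter.atTop
      (nhds (ENNReal.ofReal (p z))) := by
    refine ENNReal.tendsto_ofReal ?_
    have := ((tendsto_pow_atTop_nhds_zero_of_lt_one (r := (1 / 2 : ℝ)) (by norm_num)
      (by norm_num)).const_mul 2).const_add (p z)
    simpa using this
  exact ge_of_tendsto' h2 h1

end

/-! ### The operator of an image of a measure -/

theorem isSemimeasure_iSup {ι : Type*} [Nonempty ι] {φ : ι → Elem → ℝ}
    (hφ : ∀ i, IsSemimeasure (φ i)) (hb : ∀ f, BddAbove (Set.range fun i => φ i f))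
    (hdir : ∀ i j, ∃ k, ∀ f, φ i f ≤ φ k f ∧ φ j f ≤ φ k f) :
    IsSemimeasure fun f => ⨆ i, φ i f where
  neg_one_le := by
    obtain ⟨i⟩ := ‹Nonempty ι›
    exact (hφ i).neg_one_le.trans (le_ciSup (hb _) i)
  nonneg f hf := Real.iSup_nonneg fun i => (hφ i).nonneg f hf
  concave c f g hc := by
    have hc' : (0 : ℝ) ≤ c := by exact_mod_cast hc
    rw [Real.mul_iSup_of_nonneg hc', ← le_sub_iff_add_le]
    refine ciSup_le fun i => ?_
    rw [le_sub_comm]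
    refine ciSup_le fun j => ?_
    rw [le_sub_iff_add_le, add_comm]
    obtain ⟨k, hk⟩ := hdir i j
    refine le_trans ?_ ((hφ k).concave c f g hc |>.trans (le_ciSup (hb _) k))
    exact add_le_add (mul_le_mul_of_nonneg_left (hk f).1 hc') (hk g).2

theorem isDeterministic_iSup {ι : Type*} [Nonempty ι] {φ : ι → Elem → ℝ}
    (hφ : ∀ i, IsDeterministic (φ i)) (hb : ∀ f, BddAbove (Set.range fun i => φ i f))
    (hdir : ∀ i j, ∃ k, ∀ f, φ i f ≤ φ k f ∧ φ j f ≤ φ k f) :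
    IsDeterministic fun f => ⨆ i, φ i f := by
  intro f g h hh
  refine le_antisymm (ciSup_le fun i => ?_) (le_of_forall_lt fun r hr => ?_)
  · rw [hφ i f g h hh]
    exact min_le_min (le_ciSup (hb f) i) (le_ciSup (hb g) i)
  · obtain ⟨h1, h2⟩ := lt_min_iff.1 hr
    obtain ⟨i, hi⟩ := exists_lt_of_lt_ciSup h1
    obtain ⟨j, hj⟩ := exists_lt_of_lt_ciSup h2
    obtain ⟨k, hk⟩ := hdir i j
    refine lt_of_lt_of_le ?_ (le_ciSup (hb h) k)
    rw [hφ k f g h hh]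
    exact lt_min (hi.trans_le (hk f).1) (hj.trans_le (hk g).2)

theorem isSemimeasure_infOn (s : List Bool) : IsSemimeasure (infOn s) where
  neg_one_le := (infOn_neg_one s).ge
  nonneg _ hf := infOn_nonneg s hf
  concave _ f g hc := infOn_concave s hc f g

/-- The value of an elementary function at an unknown point, with a penalty for negative values
only. -/
noncomputable def baseValue (f : Elem) : ℝ := min 0 (infOn [] f)

theorem isSemimeasure_baseValue : IsSemimeasure baseValue where
  neg_one_le := by unfold baseValue; rw [infOn_neg_one]; norm_num
  nonneg f hf := le_min le_rfl (infOn_nonneg _ hf)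
  concave c f g hc := by
    have hc' : (0 : ℝ) ≤ c := by exact_mod_cast hc
    have h1 : c * baseValue f ≤ 0 := mul_nonpos_of_nonneg_of_nonpos hc' (min_le_left _ _)
    have h2 : baseValue g ≤ 0 := min_le_left _ _
    refine le_min (by linarith) (le_trans ?_ (infOn_concave [] hc f g))
    exact add_le_add (mul_le_mul_of_nonneg_left (min_le_right _ _) hc') (min_le_right _ _)

theorem isDeterministic_baseValue : IsDeterministic baseValue := by
  intro f g h hh
  unfold baseValue
  rw [infOn_min [] hh, ← min_min_min_comm, min_self]

/-- The operator that maps a sequence `ω` to the limit of the strings `w z`, for all `z` such that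
`ω` belongs to the open interval of `z`. -/
noncomputable def treeOp (p : List Bool → ℝ) (w : List Bool → List Bool) (f : Elem) (ω : Seq) : ℝ :=
  ⨆ i : Option {z // ω ∈ openCell p z}, i.elim (baseValue f) fun z => infOn (w z.1) f

section

variable {p : List Bool → ℝ} (hp : IsComputableTree p) {w : List Bool → List Bool}
  (hw : ∀ z b, w z <+: w (z ++ [b]))

theorem bddAbove_treeOp (p : List Bool → ℝ) (w : List Bool → List Bool) (f : Elem) (ω : Seq) :
    BddAbove (Set.range fun i : Option {z // ω ∈ openCell p z} =>
      i.elim (baseValue f) fun z => infOn (w z.1) f) := by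
  obtain ⟨B, hB0, hB⟩ := exists_bound f
  refine ⟨B, ?_⟩
  rintro _ ⟨_ | z, rfl⟩
  · exact (min_le_left _ _).trans (by exact_mod_cast hB0)
  · exact infOn_le_of_le _ hB

theorem infOn_le_treeOp {z : List Bool} {ω : Seq} (h : ω ∈ openCell p z) (f : Elem) :
    infOn (w z) f ≤ treeOp p w f ω :=
  le_ciSup (bddAbove_treeOp p w f ω) (some ⟨z, h⟩)

include hw in
theorem prefix_map {z z' : List Bool} (h : z <+: z') : w z <+: w z' := by
  obtain ⟨u, rfl⟩ := h
  induction u using List.reverseRecOn with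
  | nil => simp
  | append_singleton u b ih =>
    rw [← List.append_assoc]
    exact ih.trans (hw _ _)

include hp hw in
/-- Open intervals that contain the same point belong to comparable strings, hence the suprema that
define `treeOp` are directed. -/
theorem treeOp_directed (ω : Seq) (i j : Option {z // ω ∈ openCell p z}) :
    ∃ k : Option {z // ω ∈ openCell p z}, ∀ f : Elem,
      i.elim (baseValue f) (fun z => infOn (w z.1) f) ≤
        k.elim (baseValue f) (fun z => infOn (w z.1) f) ∧
      j.elim (baseValue f) (fun z => infOn (w z.1) f) ≤
        k.elim (baseValue f) (fun z => infOn (w z.1) f) := by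
  have hbase : ∀ (k : Option {z // ω ∈ openCell p z}) (f : Elem),
      baseValue f ≤ k.elim (baseValue f) (fun z => infOn (w z.1) f) := by
    rintro (_ | z) f
    · exact le_rfl
    · exact (min_le_right _ _).trans (infOn_mono (List.nil_prefix) f)
  rcases i with _ | z
  · exact ⟨j, fun f => ⟨hbase j f, le_rfl⟩⟩
  rcases j with _ | z'
  · exact ⟨some z, fun f => ⟨le_rfl, hbase _ f⟩⟩
  have h1 := openCell_subset_cell p _ z.2
  have h2 := openCell_subset_cell p _ z'.2
  rcases le_total z.1.length z'.1.length with h | h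
  · exact ⟨some z', fun f => ⟨infOn_mono (prefix_map hw (prefix_of_mem_cell hp h h1 h2)) f, le_rfl⟩⟩
  · exact ⟨some z, fun f => ⟨le_rfl, infOn_mono (prefix_map hw (prefix_of_mem_cell hp h h2 h1)) f⟩⟩

include hp in
theorem leftEnd_add_le_one (z : List Bool) : leftEnd p z + p z ≤ 1 := by
  induction z using List.reverseRecOn with
  | nil => simpa [leftEnd] using hp.le_one
  | append_singleton z b ih =>
    have h0 := hp.nonneg (z ++ [false])
    have h1 := hp.nonneg (z ++ [true])
    have h2 := hp.add z
    rw [leftEnd_append]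
    cases b
    · simp only [Bool.false_eq_true, if_false]; linarith
    · simp only [if_true]; linarith

include hp in
/-- The open intervals are uniformly r.e., and at most a vanishing part of an interval is not
enumerated at late stages. -/
theorem exists_cellTest : ∃ test : List Bool → List Bool → ℕ → Bool,
    (Primrec fun q : List Bool × List Bool × ℕ => test q.1 q.2.1 q.2.2) ∧
    (∀ z ω, ω ∈ openCell p z ↔ ∃ n t, test z (pre ω n) t = true) ∧
    ∀ z r, r < p z → ∀ᶠ n in Filter.atTop,
      r < (((strs n).filter fun s => test z s n = true).card : ℝ) / 2 ^ n := by
  obtain ⟨lo, up, hlo, hup, lo_le, le_up, lo_t, up_t⟩ := hp.approx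
  let loL : List Bool → ℕ → ℕ := fun z t =>
    ∑ i ∈ Finset.range z.length, if z.getD i false then lo (z.take i ++ [false]) t else 0
  let upL : List Bool → ℕ → ℕ := fun z t =>
    ∑ i ∈ Finset.range z.length, if z.getD i false then up (z.take i ++ [false]) t else 0
  have hupL : Primrec fun q : List Bool × ℕ => upL q.1 q.2 := by simp only [upL]; fun_prop
  have hloL : Primrec fun q : List Bool × ℕ => loL q.1 q.2 := by simp only [loL]; fun_prop
  have loL_t : ∀ z, Filter.Tendsto (fun t => (loL z t : ℝ) / 2 ^ t) Filter.atTop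
      (nhds (leftEnd p z)) := by
    intro z
    simp only [loL, leftEnd]
    push_cast
    simp only [Finset.sum_div]
    refine tendsto_finsetSum _ fun i _ => ?_
    split_ifs
    · exact lo_t _
    · simp
  have upL_t : ∀ z, Filter.Tendsto (fun t => (upL z t : ℝ) / 2 ^ t) Filter.atTop
      (nhds (leftEnd p z)) := by
    intro z
    simp only [upL, leftEnd]
    push_cast
    simp only [Finset.sum_div]
    refine tendsto_finsetSum _ fun i _ => ?_
    split_ifs
    · exact up_t _
    · simp
  have loL_le : ∀ z t, (loL z t : ℝ) / 2 ^ t ≤ leftEnd p z := by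
    intro z t
    simp only [loL, leftEnd]
    push_cast
    simp only [Finset.sum_div]
    refine Finset.sum_le_sum fun i _ => ?_
    split_ifs
    · exact lo_le _ _
    · simp
  have le_upL : ∀ z t, leftEnd p z ≤ (upL z t : ℝ) / 2 ^ t := by
    intro z t
    simp only [upL, leftEnd]
    push_cast
    simp only [Finset.sum_div]
    refine Finset.sum_le_sum fun i _ => ?_
    split_ifs
    · exact le_up _ _
    · simp
  let test : List Bool → List Bool → ℕ → Bool := fun z s t =>
    decide (upL z t * 2 ^ s.length < natOf s * 2 ^ t) &&
      decide ((natOf s + 1) * 2 ^ t < (loL z t + lo z t) * 2 ^ s.length)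
  have test_iff : ∀ z s t, test z s t = true ↔
      (upL z t : ℝ) / 2 ^ t < (natOf s : ℝ) / 2 ^ s.length ∧
        ((natOf s : ℝ) + 1) / 2 ^ s.length < (loL z t : ℝ) / 2 ^ t + (lo z t : ℝ) / 2 ^ t := by
    intro z s t
    rw [← add_div, div_lt_div_iff₀ (by positivity) (by positivity),
      div_lt_div_iff₀ (by positivity) (by positivity)]
    simp only [test, Bool.and_eq_true, decide_eq_true_eq]
    norm_cast
  have htest : Primrec fun q : List Bool × List Bool × ℕ => test q.1 q.2.1 q.2.2 := by
    simp only [test]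
    fun_prop
  have hcell : ∀ z ω, ω ∈ openCell p z ↔ ∃ n t, test z (pre ω n) t = true := by
    intro z ω
    simp only [openCell, Set.mem_ofPred_eq, test_iff, length_pre]
    refine exists_congr fun n => ⟨fun ⟨h1, h2⟩ => ?_, fun ⟨t, h1, h2⟩ => ?_⟩
    · exact (((upL_t z).eventually (gt_mem_nhds h1)).and
        (((loL_t z).add (lo_t z)).eventually (lt_mem_nhds h2))).exists
    · exact ⟨(le_upL z t).trans_lt h1, h2.trans_le (add_le_add (loL_le z t) (lo_le z t))⟩
  refine ⟨test, htest, hcell, fun z r hr => ?_⟩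
  have hsmall : Filter.Tendsto (fun n : ℕ => (2 : ℝ) / 2 ^ n) Filter.atTop (nhds 0) := by
    simpa [div_eq_mul_inv] using
      (tendsto_pow_atTop_nhds_zero_of_lt_one (r := (1 / 2 : ℝ)) (by norm_num) (by norm_num)).const_mul 2
  have h1 := ((((loL_t z).add (lo_t z)).sub (upL_t z)).sub hsmall).eventually
    (lt_mem_nhds (show r < leftEnd p z + p z - leftEnd p z - 0 by linarith))
  filter_upwards [h1] with n hn
  refine hn.trans_le ?_
  rw [← add_div, ← sub_div, ← sub_div]
  gcongr
  have h2 : ((strs n).filter fun s => test z s n = true) =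
      (strs n).filter fun s => upL z n < natOf s ∧ natOf s + 1 < loL z n + lo z n := by
    refine Finset.filter_congr fun s hs => ?_
    rw [mem_strs] at hs
    simp only [test, Bool.and_eq_true, decide_eq_true_eq, hs]
    rw [Nat.mul_lt_mul_right (by positivity), Nat.mul_lt_mul_right (by positivity)]
  rw [h2, card_filter_natOf n fun i => upL z n < i ∧ i + 1 < loL z n + lo z n]
  have h3 : loL z n + lo z n ≤ 2 ^ n := by
    have h4 := (add_le_add (loL_le z n) (lo_le z n)).trans (leftEnd_add_le_one hp z)
    rw [← add_div, div_le_one (by positivity)] at h4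
    exact_mod_cast h4
  -- the test accepts all integers between the approximate ends except at most two
  have h5 : Finset.Ioo (upL z n) (loL z n + lo z n - 1) ⊆
      (Finset.range (2 ^ n)).filter fun i => upL z n < i ∧ i + 1 < loL z n + lo z n := by
    intro i hi
    rw [Finset.mem_Ioo] at hi
    rw [Finset.mem_filter, Finset.mem_range]
    omega
  have h6 := Finset.card_le_card h5
  rw [Nat.card_Ioo] at h6
  have h7 : loL z n + lo z n ≤ ((Finset.range (2 ^ n)).filter fun i =>
      upL z n < i ∧ i + 1 < loL z n + lo z n).card + 2 + upL z n := by omega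
  have h8 : ((loL z n + lo z n : ℕ) : ℝ) ≤ ((((Finset.range (2 ^ n)).filter fun i =>
      upL z n < i ∧ i + 1 < loL z n + lo z n).card + 2 + upL z n : ℕ) : ℝ) := by exact_mod_cast h7
  push_cast at h8
  linarith

include hp in
theorem reOperator_treeOp (hwp : Primrec w) : REOperator (treeOp p w) := by
  obtain ⟨test, htest, hcell, -⟩ := exists_cellTest hp
  refine ⟨fun x => ∃ i : List Bool × ℕ,
    ((rlt x.2.1 (0, 0, 0) && rlt x.2.1 (minCode x.1 [])) ||
      (test i.1 x.2.2 i.2 && rlt x.2.1 (minCode x.1 (w i.1)))) = true, ?_, fun c q ω => ?_⟩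
  · refine rePred_of_exists (fun (x : ElemCode × RatCode × List Bool) (i : List Bool × ℕ) =>
      ((rlt x.2.1 (0, 0, 0) && rlt x.2.1 (minCode x.1 [])) ||
      (test i.1 x.2.2 i.2 && rlt x.2.1 (minCode x.1 (w i.1))))) ?_ fun x => Iff.rfl
    fun_prop
  · have h0 : (ratOf (0, 0, 0) : ℝ) = 0 := by simp [ratOf]
    unfold treeOp
    rw [lt_ciSup_iff (bddAbove_treeOp p w _ ω)]
    simp only [Bool.or_eq_true, Bool.and_eq_true, rlt_iff_real, ratOf_minCode, h0]
    constructor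
    · rintro ⟨_ | ⟨z, hz⟩, h⟩
      · exact ⟨0, ([], 0), Or.inl (lt_min_iff.1 h)⟩
      · obtain ⟨n, t, ht⟩ := (hcell z ω).1 hz
        exact ⟨n, (z, t), Or.inr ⟨ht, h⟩⟩
    · rintro ⟨n, ⟨z, t⟩, h | ⟨h, h'⟩⟩
      · exact ⟨none, lt_min h.1 h.2⟩
      · exact ⟨some ⟨z, (hcell z ω).2 ⟨n, t, h⟩⟩, h'⟩

include hp hw in
/-- The image of the uniform measure is bounded by the sums `treeSum`, as the interval of `z` has
measure at most `p z`. -/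
theorem image_treeOp_le {μ : Elem → ℝ} {f : Elem} (hf : ∀ ω, 0 ≤ f ω)
    (hμ : ∀ n, treeSum p w f n ≤ μ f) : image (treeOp p w) lam f ≤ μ f := by
  have hμ0 : 0 ≤ μ f := le_trans (Finset.sum_nonneg fun z _ =>
    mul_nonneg (hp.nonneg z) (infOn_nonneg _ hf)) (hμ 0)
  let g : ℕ → Seq → ℝ≥0∞ := fun n ω =>
    ∑ z ∈ strs n, (cell p z).indicator (fun _ => ENNReal.ofReal (infOn (w z) f)) ω
  have hg : ∀ n, Measurable (g n) := fun n =>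
    Finset.measurable_sum _ fun z _ => measurable_const.indicator (measurableSet_cell p z)
  have hgm : Monotone g := by
    refine monotone_nat_of_le_succ fun n ω => ?_
    simp only [g]
    rw [sum_strs_succ]
    refine Finset.sum_le_sum fun z _ => ?_
    by_cases h : ω ∈ cell p z
    · rw [Set.indicator_of_mem h]
      rw [cell_eq_union hp] at h
      rcases h with h | h
      · rw [Set.indicator_of_mem h]
        exact (ENNReal.ofReal_le_ofReal (infOn_mono (hw _ _) f)).trans le_self_add
      · rw [Set.indicator_of_mem h]
        exact (ENNReal.ofReal_le_ofReal (infOn_mono (hw _ _) f)).trans le_add_self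
    · rw [Set.indicator_of_notMem h]
      exact zero_le
  have hint : ∫⁻ ω, ⨆ n, g n ω ∂lamMeasure ≤ ENNReal.ofReal (μ f) := by
    rw [lintegral_iSup hg hgm]
    refine iSup_le fun n => ?_
    simp only [g]
    rw [lintegral_finsetSum _ fun z _ => measurable_const.indicator (measurableSet_cell p z)]
    refine le_trans ?_ (ENNReal.ofReal_le_ofReal (hμ n))
    unfold treeSum
    rw [ENNReal.ofReal_sum_of_nonneg fun z _ => mul_nonneg (hp.nonneg z) (infOn_nonneg _ hf)]
    refine Finset.sum_le_sum fun z _ => ?_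
    rw [lintegral_indicator_const (measurableSet_cell p z), ENNReal.ofReal_mul (hp.nonneg z),
      mul_comm]
    gcongr
    exact lamMeasure_cell_le hp z
  have hbase : baseValue f = 0 := min_eq_left (infOn_nonneg _ hf)
  have hA : ∀ ω, ENNReal.ofReal (treeOp p w f ω) ≤ ⨆ n, g n ω := by
    intro ω
    refine le_of_forall_lt fun r hr => ?_
    have hr' := (ENNReal.lt_ofReal_iff_toReal_lt (ne_top_of_lt hr)).1 hr
    obtain ⟨i, hi⟩ := exists_lt_of_lt_ciSup hr'
    rcases i with _ | ⟨z, hz⟩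
    · simp only [Option.elim_none, hbase] at hi
      exact absurd hi (not_lt.2 ENNReal.toReal_nonneg)
    · simp only [Option.elim_some] at hi
      refine lt_of_lt_of_le ((ENNReal.lt_ofReal_iff_toReal_lt (ne_top_of_lt hr)).2 hi)
        (le_trans ?_ (le_iSup _ z.length))
      have h1 : ENNReal.ofReal (infOn (w z) f) =
          (cell p z).indicator (fun _ => ENNReal.ofReal (infOn (w z) f)) ω := by
        rw [Set.indicator_of_mem (openCell_subset_cell p z hz)]
      rw [h1]
      exact Finset.single_le_sum (f := fun z => (cell p z).indicator
        (fun _ => ENNReal.ofReal (infOn (w z) f)) ω) (fun _ _ => zero_le) (mem_strs.2 rfl)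
  refine ext_le ⟨0, fun ω => ?_⟩ fun h hh => ?_
  · refine le_trans ?_ (le_ciSup (bddAbove_treeOp p w f ω) none)
    simp [hbase]
  · have h1 := lam_le_lintegral h (fun ω => ⨆ n, g n ω)
      (fun ω => (ENNReal.ofReal_le_ofReal (hh ω)).trans (hA ω))
      (ne_top_of_le_ne_top ENNReal.ofReal_ne_top hint)
    refine h1.trans ?_
    have h2 := ENNReal.toReal_mono ENNReal.ofReal_ne_top hint
    rwa [ENNReal.toReal_ofReal hμ0] at h2

include hp hw in
/-- The operator of `p` and `w` is admissible for each functional that dominates the image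
of `p`. -/
theorem isAdmissible_treeOp (hwp : Primrec w) {μ : Elem → ℝ}
    (hμ : ∀ f : Elem, (∀ ω, 0 ≤ f ω) → ∀ n, treeSum p w f n ≤ μ f) :
    IsAdmissible (treeOp p w) μ := by
  refine ⟨⟨fun ω => ⟨?_, ?_⟩, reOperator_treeOp hp hwp⟩,
    fun f hf => image_treeOp_le hp hw hf (hμ f hf)⟩
  · refine isSemimeasure_iSup (φ := fun (i : Option {z // ω ∈ openCell p z}) f =>
      i.elim (baseValue f) fun z => infOn (w z.1) f) ?_ (fun f => bddAbove_treeOp p w f ω)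
      (treeOp_directed hp hw ω)
    rintro (_ | z)
    · exact isSemimeasure_baseValue
    · exact isSemimeasure_infOn _
  · refine isDeterministic_iSup (φ := fun (i : Option {z // ω ∈ openCell p z}) f =>
      i.elim (baseValue f) fun z => infOn (w z.1) f) ?_ (fun f => bddAbove_treeOp p w f ω)
      (treeOp_directed hp hw ω)
    rintro (_ | z)
    · exact isDeterministic_baseValue
    · exact fun f g h hh => infOn_min _ hh

end

/-! ### Minimal strings of an upward closed set -/

/-- Some prefix of `z` satisfies `P`. -/
def covered (P : List Bool → Bool) (z : List Bool) : Bool :=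
  (List.range (z.length + 1)).any fun i => P (z.take i)

/-- `z` satisfies `P`, and no proper prefix of `z` does. -/
def isFirst (P : List Bool → Bool) (z : List Bool) : Bool :=
  P z && !(List.range z.length).any fun i => P (z.take i)

theorem covered_iff {P : List Bool → Bool} {z : List Bool} :
    covered P z = true ↔ ∃ i ≤ z.length, P (z.take i) = true := by
  simp [covered]

theorem isFirst_append (P : List Bool → Bool) (z : List Bool) (b : Bool) :
    isFirst P (z ++ [b]) = (P (z ++ [b]) && !covered P z) := by
  unfold isFirst covered
  rw [List.length_append, List.length_singleton]
  congr 2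
  rw [Bool.eq_iff_iff, List.any_eq_true, List.any_eq_true]
  refine exists_congr fun i => and_congr_right fun hi => ?_
  rw [List.mem_range, Nat.lt_succ_iff] at hi
  rw [List.take_append_of_le_length hi]

theorem covered_append (P : List Bool → Bool) (z : List Bool) (b : Bool) :
    covered P (z ++ [b]) = (covered P z || P (z ++ [b])) := by
  rw [Bool.eq_iff_iff, Bool.or_eq_true, covered_iff, covered_iff]
  constructor
  · rintro ⟨i, hi, h⟩
    rcases Nat.lt_or_ge z.length i with h1 | h1
    · rw [List.take_of_length_le (by simp; omega)] at h
      exact Or.inr h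
    · rw [List.take_append_of_le_length h1] at h
      exact Or.inl ⟨i, h1, h⟩
  · rintro (⟨i, hi, h⟩ | h)
    · exact ⟨i, by simp; omega, by rwa [List.take_append_of_le_length hi]⟩
    · exact ⟨_, le_rfl, by rwa [List.take_length]⟩

/-- The measure of the strings of length `n` covered by `P` is the total measure of the minimal
strings that satisfy `P`. -/
theorem sum_covered {A : Type*} [AddCommMonoid A] (P : List Bool → Bool) {g : List Bool → A}
    (hg : ∀ z, g z = g (z ++ [false]) + g (z ++ [true])) (n : ℕ) :
    ∑ z ∈ strs n, (if covered P z then g z else 0) =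
      ∑ j ∈ Finset.range (n + 1), ∑ z ∈ strs j, if isFirst P z then g z else 0 := by
  induction n with
  | zero =>
    rw [sum_strs_zero, Finset.sum_range_one, sum_strs_zero]
    simp [covered, isFirst]
  | succ n ih =>
    rw [Finset.sum_range_succ, ← ih, sum_strs_succ, sum_strs_succ, ← Finset.sum_add_distrib]
    refine Finset.sum_congr rfl fun z _ => ?_
    rw [covered_append, covered_append, isFirst_append, isFirst_append]
    by_cases h : covered P z = true
    · simp [h, ← hg]
    · simp [h]

theorem exists_isFirst {P : List Bool → Bool} {γ : Seq} {n : ℕ} (h : P (pre γ n) = true) :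
    ∃ j, isFirst P (pre γ j) = true := by
  classical
  have hex : ∃ n, P (pre γ n) = true := ⟨n, h⟩
  refine ⟨Nat.find hex, ?_⟩
  unfold isFirst
  rw [Nat.find_spec hex, Bool.true_and, Bool.not_eq_true', List.any_eq_false]
  intro i hi
  rw [length_pre, List.mem_range] at hi
  rw [take_pre, min_eq_left hi.le]
  exact Nat.find_min hex hi

/-! ### Upper bounds for tests by operators -/

theorem sum_two_pow_le (x : ℝ≥0∞) (n : ℕ) :
    ∑ k ∈ Finset.range n, (if (2 : ℝ≥0∞) ^ k < x then (2 : ℝ≥0∞) ^ k else 0) ≤ 2 * x := by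
  have h : ∀ n, ∑ k ∈ Finset.range n, (if (2 : ℝ≥0∞) ^ k < x then (2 : ℝ≥0∞) ^ k else 0) ≤ 2 ^ n := by
    intro n
    induction n with
    | zero => simp
    | succ n ih =>
      rw [Finset.sum_range_succ, pow_succ, mul_two]
      refine add_le_add ih ?_
      split_ifs <;> simp
  induction n with
  | zero => simp
  | succ n ih =>
    rw [Finset.sum_range_succ]
    split_ifs with h1
    · calc _ ≤ (2 : ℝ≥0∞) ^ n + 2 ^ n := by gcongr; exact h n
        _ = 2 * 2 ^ n := (two_mul _).symm
        _ ≤ 2 * x := by gcongr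
    · rw [add_zero]; exact ih

section

variable {m : ℕ → ℝ} (hm : IsUniversalDistribution m)
include hm

theorem IsUniversalDistribution.measurable_mlTest : Measurable (mlTest m lam) := by
  obtain ⟨t, -, -, ht⟩ := hm.exists_approx_mlTest
  rw [funext ht]
  exact Measurable.iSup fun n => measurable_pre n fun s => ENNReal.ofReal ((t s : ℝ) / 2 ^ n)

/-- Decidable tests `R k z n` which can be satisfied for some `n` if the Martin-Löf test
exceeds `2 ^ k` on the whole interval of `z`, and only if it does so on a half of this interval. -/
theorem IsUniversalDistribution.exists_levelTest {p : List Bool → ℝ} (hp : IsComputableTree p) :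
    ∃ R : ℕ → List Bool → ℕ → Bool, (Primrec fun q : ℕ × List Bool × ℕ => R q.1 q.2.1 q.2.2) ∧
      (∀ k z n, R k z n = true →
        ENNReal.ofReal (p z) ≤ 2 * lamMeasure (cell p z ∩ {ω | 2 ^ k < mlTest m lam ω})) ∧
      ∀ k z, 0 < p z → openCell p z ⊆ {ω | 2 ^ k < mlTest m lam ω} → ∃ n, R k z n = true := by
  obtain ⟨t, htp, tm, tsup⟩ := hm.exists_approx_mlTest
  obtain ⟨lo, up, hlo, hup, lo_le, le_up, lo_t, up_t⟩ := hp.approx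
  obtain ⟨test, htest, hcell, hcount⟩ := exists_cellTest hp
  let R : ℕ → List Bool → ℕ → Bool := fun k z n => decide (up z n ≤
    2 * ∑ s ∈ strs n, bif test z s n && decide (2 ^ k * 2 ^ n < t s) then 1 else 0)
  have hR : Primrec fun q : ℕ × List Bool × ℕ => R q.1 q.2.1 q.2.2 := by
    simp only [R]
    fun_prop
  have hcard : ∀ k z n, (((∑ s ∈ strs n, bif test z s n && decide (2 ^ k * 2 ^ n < t s)
      then 1 else 0 : ℕ) : ℝ≥0∞) / 2 ^ n) =
      lamMeasure {ω | test z (pre ω n) n = true ∧ 2 ^ k * 2 ^ n < t (pre ω n)} := by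
    intro k z n
    rw [lamMeasure_pre n fun s => test z s n = true ∧ 2 ^ k * 2 ^ n < t s, Finset.card_filter]
    congr 2
    refine Finset.sum_congr rfl fun s _ => ?_
    rw [Bool.cond_eq_ite]
    simp only [Bool.and_eq_true, decide_eq_true_eq]
  have hlevel : ∀ k n ω, 2 ^ k * 2 ^ n < t (pre ω n) ↔
      (2 : ℝ≥0∞) ^ k < ENNReal.ofReal ((t (pre ω n) : ℝ) / 2 ^ n) := by
    intro k n ω
    rw [show (2 : ℝ≥0∞) ^ k = ENNReal.ofReal (2 ^ k) by
      rw [ENNReal.ofReal_pow zero_le_two, ENNReal.ofReal_ofNat],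
      ENNReal.ofReal_lt_ofReal_iff_of_nonneg (by positivity), lt_div_iff₀ (by positivity)]
    norm_cast
  refine ⟨R, hR, fun k z n h => ?_, fun k z hz hsub => ?_⟩
  · simp only [R, decide_eq_true_eq] at h
    have h1 : ENNReal.ofReal (p z) ≤ (up z n : ℝ≥0∞) / 2 ^ n := by
      refine (ENNReal.ofReal_le_ofReal (le_up z n)).trans ?_
      rw [ENNReal.ofReal_div_of_pos (by positivity), ENNReal.ofReal_natCast,
        ENNReal.ofReal_pow zero_le_two, ENNReal.ofReal_ofNat]
    refine h1.trans ?_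
    calc (up z n : ℝ≥0∞) / 2 ^ n ≤ ((2 * ∑ s ∈ strs n,
          bif test z s n && decide (2 ^ k * 2 ^ n < t s) then 1 else 0 : ℕ) : ℝ≥0∞) / 2 ^ n := by
          gcongr
      _ = 2 * lamMeasure {ω | test z (pre ω n) n = true ∧ 2 ^ k * 2 ^ n < t (pre ω n)} := by
          rw [← hcard, Nat.cast_mul, mul_div_assoc, Nat.cast_ofNat]
      _ ≤ _ := by
          gcongr
          rintro ω ⟨h2, h3⟩
          refine ⟨openCell_subset_cell p z ((hcell z ω).2 ⟨n, n, h2⟩), ?_⟩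
          refine lt_of_lt_of_le ((hlevel k n ω).1 h3) ?_
          rw [tsup]
          exact le_iSup (fun n => ENNReal.ofReal ((t (pre ω n) : ℝ) / 2 ^ n)) n
  · set E := {ω | 2 ^ k < mlTest m lam ω} with hE
    have hEm : MeasurableSet E := measurableSet_lt measurable_const hm.measurable_mlTest
    let G : ℕ → Set Seq := fun n => (cell p z ∩ E) \
      {ω | (2 : ℝ≥0∞) ^ k < ENNReal.ofReal ((t (pre ω n) : ℝ) / 2 ^ n)}
    have hG : ∀ n, MeasurableSet (G n) := fun n =>
      ((measurableSet_cell p z).inter hEm).diff (measurableSet_lt measurable_const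
        (measurable_pre n fun s => ENNReal.ofReal ((t s : ℝ) / 2 ^ n)))
    have hGa : Antitone G := by
      intro n n' hn
      refine Set.sdiff_subset_sdiff_right fun ω hω => ?_
      exact lt_of_lt_of_le hω (ENNReal.ofReal_le_ofReal (tm ω hn))
    have hG0 : ⋂ n, G n = ∅ := by
      rw [Set.eq_empty_iff_forall_notMem]
      intro ω hω
      rw [Set.mem_iInter] at hω
      have h1 : (2 : ℝ≥0∞) ^ k < mlTest m lam ω := (hω 0).1.2
      rw [tsup, lt_iSup_iff] at h1
      obtain ⟨n, hn⟩ := h1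
      exact (hω n).2 hn
    have hGt := tendsto_measure_iInter_atTop (μ := lamMeasure)
      (fun n => (hG n).nullMeasurableSet) hGa ⟨0, measure_ne_top _ _⟩
    rw [hG0, measure_empty] at hGt
    -- at late stages the part of the cell where the test is not yet seen to be large is below
    -- `p z / 8`, the enumerated part of the interval exceeds `7 / 8 * p z`, and the upper bound of
    -- `p z` is below `9 / 8 * p z`, which is less than twice `7 / 8 - 1 / 8`
    have e1 := hGt.eventually (gt_mem_nhds (show (0 : ℝ≥0∞) < ENNReal.ofReal (p z / 8) by
      rw [ENNReal.ofReal_pos]; positivity))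
    have e2 := hcount z (7 / 8 * p z) (by linarith)
    have e3 := (up_t z).eventually (gt_mem_nhds (show p z < 9 / 8 * p z by linarith))
    obtain ⟨n, h1, h2, h3⟩ := (e1.and (e2.and e3)).exists
    refine ⟨n, ?_⟩
    simp only [R, decide_eq_true_eq]
    set c : ℕ := ∑ s ∈ strs n, bif test z s n && decide (2 ^ k * 2 ^ n < t s) then 1 else 0 with hc
    have h4 : lamMeasure {ω | test z (pre ω n) n = true} ≤ (c : ℝ≥0∞) / 2 ^ n + lamMeasure (G n) := by
      rw [hc, hcard]
      refine (measure_mono ?_).trans (measure_union_le _ _)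
      intro ω hω
      by_cases h5 : 2 ^ k * 2 ^ n < t (pre ω n)
      · exact Or.inl ⟨hω, h5⟩
      · have h6 : ω ∈ openCell p z := (hcell z ω).2 ⟨n, n, hω⟩
        exact Or.inr ⟨⟨openCell_subset_cell p z h6, hsub h6⟩, fun h7 => h5 ((hlevel k n ω).2 h7)⟩
    rw [lamMeasure_pre n fun s => test z s n = true] at h4
    have h5 : ((((strs n).filter fun s => test z s n = true).card : ℝ) / 2 ^ n) ≤
        (c : ℝ) / 2 ^ n + p z / 8 := by
      have h6 := h4.trans (add_le_add le_rfl h1.le)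
      have h7 : ∀ x : ℕ, (x : ℝ≥0∞) / 2 ^ n = ENNReal.ofReal ((x : ℝ) / 2 ^ n) := by
        intro x
        rw [ENNReal.ofReal_div_of_pos (by positivity), ENNReal.ofReal_natCast,
          ENNReal.ofReal_pow zero_le_two, ENNReal.ofReal_ofNat]
      rw [h7, h7, ← ENNReal.ofReal_add (by positivity) (by positivity),
        ENNReal.ofReal_le_ofReal_iff (by positivity)] at h6
      exact h6
    have h6 : (up z n : ℝ) / 2 ^ n ≤ ((2 * c : ℕ) : ℝ) / 2 ^ n := by
      push_cast
      rw [mul_div_assoc]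
      linarith
    rw [div_le_div_iff_of_pos_right (by positivity)] at h6
    exact_mod_cast h6

/-- If an operator defined by a measure `p` and a map `w` yields a large test at a limit `γ` of
strings `w z`, then the level sets of the Martin-Löf test contain large parts of the intervals of
these strings `z`, and the minimal strings with this property have large ratios of the
universal distribution to `p`. -/
theorem IsUniversalDistribution.opTest_treeOp_le {p : List Bool → ℝ} (hp : IsComputableTree p)
    (w : List Bool → List Bool) :
    ∃ C : ℝ, 0 < C ∧ ∀ γ γ' : Seq, (∀ N, ∃ n, pre γ N <+: w (pre γ' n)) →
      opTest m (treeOp p w) γ ≤ ENNReal.ofReal C *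
        ⨆ n, ENNReal.ofReal (m (Encodable.encode (pre γ' n))) / ENNReal.ofReal (p (pre γ' n)) := by
  classical
  obtain ⟨R, hR, hR1, hR2⟩ := hm.exists_levelTest hp
  obtain ⟨lo, up, hlo, hup, lo_le, le_up, lo_t, up_t⟩ := hp.approx
  let P : ℕ → List Bool → Bool := fun k z => (List.range (z.length + 1)).any fun n =>
    (List.range (z.length + 1)).any fun i => R k (z.take i) n
  have P_iff : ∀ k z, P k z = true ↔
      ∃ n ≤ z.length, ∃ i ≤ z.length, R k (z.take i) n = true := by
    intro k z
    simp [P]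
  -- mass `2 ^ k * p z` on the minimal strings `z` found at level `k`; its total is bounded because
  -- `∑ 2 ^ k * λ {T > 2 ^ k} ≤ 2 * λ T`
  let F : List Bool × ℕ → ℝ := fun x => if isFirst (P x.2) x.1 then 2 ^ x.2 * p x.1 else 0
  have hF0 : ∀ x, 0 ≤ F x := by
    intro x
    simp only [F]
    split_ifs
    · exact mul_nonneg (by positivity) (hp.nonneg _)
    · exact le_rfl
  have hfirst : Primrec fun x : List Bool × ℕ => isFirst (P x.2) x.1 := by
    have hP : Primrec fun q : ℕ × List Bool => P q.1 q.2 := by simp only [P]; fun_prop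
    simp only [isFirst]
    fun_prop
  have hre : REPred fun q : (List Bool × ℕ) × RatCode => (ratOf q.2 : ℝ) < F q.1 := by
    refine re_of_sup (β := ℕ) (fun x n =>
      dyad (bif isFirst (P x.2) x.1 then 2 ^ x.2 * lo x.1 n else 0) n)
      (primrec_dyad (PrimrecRules.cond (hfirst.comp Primrec.fst) (by fun_prop) (by fun_prop))
        (by fun_prop)) fun x r => ?_
    simp only [ratOf_dyad_real, F]
    cases isFirst (P x.2) x.1
    · simp
    · simp only [cond_true, if_true]
      push_cast
      simp only [mul_div_assoc]
      exact ⟨fun h => (((lo_t x.1).const_mul (2 ^ x.2)).eventually (lt_mem_nhds h)).exists,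
        fun ⟨n, hn⟩ => hn.trans_le (by gcongr; exact lo_le _ _)⟩
  have hlev : ∀ k N, ∑ j ∈ Finset.range (N + 1), ∑ z ∈ strs j,
      (if isFirst (P k) z then ENNReal.ofReal (p z) else 0) ≤
      2 * lamMeasure {ω | 2 ^ k < mlTest m lam ω} := by
    intro k N
    set E := {ω | 2 ^ k < mlTest m lam ω} with hE
    have hEm : MeasurableSet E := measurableSet_lt measurable_const hm.measurable_mlTest
    have hpadd : ∀ z, ENNReal.ofReal (p z) =
        ENNReal.ofReal (p (z ++ [false])) + ENNReal.ofReal (p (z ++ [true])) := fun z => by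
      rw [hp.add z, ENNReal.ofReal_add (hp.nonneg _) (hp.nonneg _)]
    have hEadd : ∀ z, lamMeasure (cell p z ∩ E) =
        lamMeasure (cell p (z ++ [false]) ∩ E) + lamMeasure (cell p (z ++ [true]) ∩ E) := by
      intro z
      rw [cell_eq_union hp z, Set.union_inter_distrib_right, measure_union
        ((disjoint_cell (p := p) z).mono Set.inter_subset_left Set.inter_subset_left)
        ((measurableSet_cell p _).inter hEm)]
    let Q : List Bool → Bool := fun z => (List.range (N + 1)).any fun n => R k z n
    rw [← sum_covered (P k) hpadd]
    calc ∑ z ∈ strs N, (if covered (P k) z then ENNReal.ofReal (p z) else 0)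
        ≤ ∑ z ∈ strs N, (if covered Q z then ENNReal.ofReal (p z) else 0) := by
          refine Finset.sum_le_sum fun z hz => ?_
          rw [mem_strs] at hz
          by_cases h : covered (P k) z = true
          · have h' : covered Q z = true := by
              obtain ⟨i, hi, h1⟩ := covered_iff.1 h
              obtain ⟨n, hn, j, hj, h2⟩ := (P_iff _ _).1 h1
              rw [List.length_take, min_eq_left hi] at hn hj
              rw [List.take_take, min_eq_left hj] at h2
              refine covered_iff.2 ⟨j, hj.trans hi, ?_⟩
              simp only [Q, List.any_eq_true, List.mem_range]
              exact ⟨n, by omega, h2⟩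
            rw [if_pos h, if_pos h']
          · rw [if_neg h]
            exact zero_le
      _ = ∑ j ∈ Finset.range (N + 1), ∑ z ∈ strs j,
          (if isFirst Q z then ENNReal.ofReal (p z) else 0) := sum_covered Q hpadd N
      _ ≤ ∑ j ∈ Finset.range (N + 1), ∑ z ∈ strs j,
          2 * (if isFirst Q z then lamMeasure (cell p z ∩ E) else 0) := by
          refine Finset.sum_le_sum fun j _ => Finset.sum_le_sum fun z _ => ?_
          split_ifs with h
          · have hQ : Q z = true := by
              unfold isFirst at h
              rw [Bool.and_eq_true] at h
              exact h.1
            simp only [Q, List.any_eq_true, List.mem_range] at hQ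
            obtain ⟨n, -, hn⟩ := hQ
            exact hR1 k z n hn
          · simp
      _ = 2 * ∑ z ∈ strs N, (if covered Q z then lamMeasure (cell p z ∩ E) else 0) := by
          rw [sum_covered Q hEadd N]
          simp only [Finset.mul_sum]
      _ ≤ 2 * ∑ z ∈ strs N, lamMeasure (cell p z ∩ E) := by
          gcongr with z
          split_ifs
          · exact le_rfl
          · exact zero_le
      _ = 2 * lamMeasure (cell p [] ∩ E) := by
          congr 1
          clear * - hEadd
          induction N with
          | zero => rw [sum_strs_zero]
          | succ N ih =>
            rw [sum_strs_succ, ← ih]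
            exact Finset.sum_congr rfl fun z _ => (hEadd z).symm
      _ ≤ 2 * lamMeasure E := by gcongr; exact Set.inter_subset_right
  have htot : ∀ u : Finset (List Bool × ℕ), ∑ x ∈ u, F x ≤ 4 := by
    intro u
    set N := u.sup fun x => x.1.length
    set K := u.sup fun x => x.2
    set u' : Finset (ℕ × (_ : ℕ) × List Bool) :=
      Finset.range (K + 1) ×ˢ (Finset.range (N + 1)).sigma fun j => strs j
    have hle : ∑ x ∈ u, ENNReal.ofReal (F x) ≤ ∑ k ∈ Finset.range (K + 1),
        ∑ j ∈ Finset.range (N + 1), ∑ z ∈ strs j, ENNReal.ofReal (F (z, k)) := by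
      have h1 : u ⊆ u'.image fun y => (y.2.2, y.1) := by
        rintro ⟨z, k⟩ hx
        rw [Finset.mem_image]
        refine ⟨(k, ⟨z.length, z⟩), ?_, rfl⟩
        have h2 : z.length ≤ N := Finset.le_sup (f := fun x : List Bool × ℕ => x.1.length) hx
        have h3 : k ≤ K := Finset.le_sup (f := fun x : List Bool × ℕ => x.2) hx
        simp only [u', Finset.mem_product, Finset.mem_sigma, Finset.mem_range, mem_strs]
        exact ⟨Nat.lt_succ_of_le h3, Nat.lt_succ_of_le h2, trivial⟩
      refine (Finset.sum_le_sum_of_subset h1).trans ?_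
      refine (Finset.sum_image_le_of_nonneg fun _ _ => zero_le).trans ?_
      simp only [u']
      rw [Finset.sum_product]
      refine Finset.sum_le_sum fun k _ => ?_
      rw [Finset.sum_sigma]
    have hk : ∀ k ∈ Finset.range (K + 1), ∑ j ∈ Finset.range (N + 1), ∑ z ∈ strs j,
        ENNReal.ofReal (F (z, k)) ≤ 2 * (2 ^ k * lamMeasure {ω | 2 ^ k < mlTest m lam ω}) := by
      intro k _
      have h1 : ∀ z, ENNReal.ofReal (F (z, k)) =
          2 ^ k * (if isFirst (P k) z then ENNReal.ofReal (p z) else 0) := by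
        intro z
        simp only [F]
        split_ifs
        · rw [ENNReal.ofReal_mul (by positivity), ENNReal.ofReal_pow zero_le_two,
            ENNReal.ofReal_ofNat]
        · simp
      simp only [h1, ← Finset.mul_sum]
      rw [mul_left_comm]
      gcongr
      exact hlev k N
    have hint : ∑ k ∈ Finset.range (K + 1), 2 ^ k * lamMeasure {ω | 2 ^ k < mlTest m lam ω} ≤ 2 := by
      have hEm : ∀ k : ℕ, MeasurableSet {ω | 2 ^ k < mlTest m lam ω} := fun k =>
        measurableSet_lt measurable_const hm.measurable_mlTest
      have h1 : ∀ k : ℕ, 2 ^ k * lamMeasure {ω | 2 ^ k < mlTest m lam ω} =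
          ∫⁻ ω, {ω | 2 ^ k < mlTest m lam ω}.indicator (fun _ => (2 : ℝ≥0∞) ^ k) ω ∂lamMeasure :=
        fun k => (lintegral_indicator_const (hEm k) _).symm
      simp only [h1]
      rw [← lintegral_finsetSum _ fun k _ => measurable_const.indicator (hEm k)]
      calc _ ≤ ∫⁻ ω, 2 * mlTest m lam ω ∂lamMeasure := by
            refine lintegral_mono fun ω => le_trans (le_of_eq ?_)
              (sum_two_pow_le (mlTest m lam ω) (K + 1))
            exact Finset.sum_congr rfl fun k _ => by
              simp only [Set.indicator_apply, Set.mem_ofPred_eq]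
        _ = 2 * ∫⁻ ω, mlTest m lam ω ∂lamMeasure := lintegral_const_mul _ hm.measurable_mlTest
        _ ≤ 2 * 1 := by gcongr; exact hm.lintegral_mlTest_le
        _ = 2 := mul_one _
    have h4 : ENNReal.ofReal (∑ x ∈ u, F x) ≤ ENNReal.ofReal 4 := by
      rw [ENNReal.ofReal_sum_of_nonneg fun x _ => hF0 x]
      refine (hle.trans (Finset.sum_le_sum hk)).trans ?_
      rw [← Finset.mul_sum]
      calc _ ≤ (2 : ℝ≥0∞) * 2 := by gcongr
        _ = ENNReal.ofReal 4 := by rw [ENNReal.ofReal_ofNat]; norm_num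
    rwa [ENNReal.ofReal_le_ofReal_iff (by norm_num)] at h4
  obtain ⟨C1, hC1, h1⟩ := hm.dom hF0 hre htot
  obtain ⟨C2, hC2, h2⟩ := hm.map (φ := fun x : List Bool × ℕ => x.1) (by fun_prop)
  have hm0 := hm.pos (Encodable.encode ([] : List Bool))
  set m0 := m (Encodable.encode ([] : List Bool)) with hm0'
  refine ⟨2 * (C1 * C2) + 2 / m0, by positivity, fun γ γ' hγ => ?_⟩
  set Q := ⨆ n, ENNReal.ofReal (m (Encodable.encode (pre γ' n))) / ENNReal.ofReal (p (pre γ' n))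
    with hQ
  refine iSup₂_le fun f ⟨hf0, hfT⟩ => ?_
  -- small values are covered by the ratio at the empty string
  rcases le_or_gt (f γ : ℝ) 2 with hv | hv
  · have h3 : ENNReal.ofReal m0 ≤ Q := by
      refine le_trans ?_ (le_iSup _ 0)
      rw [pre_zero, ← hm0']
      calc ENNReal.ofReal m0 = ENNReal.ofReal m0 / 1 := by simp
        _ ≤ _ := by
          gcongr
          rw [← ENNReal.ofReal_one]
          exact ENNReal.ofReal_le_ofReal hp.le_one
    calc ENNReal.ofReal (f γ : ℝ) ≤ ENNReal.ofReal ((2 * (C1 * C2) + 2 / m0) * m0) := by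
          refine ENNReal.ofReal_le_ofReal (hv.trans ?_)
          rw [add_mul, div_mul_cancel₀ _ hm0.ne']
          have : 0 ≤ 2 * (C1 * C2) * m0 := by positivity
          linarith
      _ = ENNReal.ofReal (2 * (C1 * C2) + 2 / m0) * ENNReal.ofReal m0 :=
          ENNReal.ofReal_mul (by positivity)
      _ ≤ _ := by gcongr
  · by_cases hpos : ∀ n, 0 < p (pre γ' n)
    · obtain ⟨N, hN⟩ := exists_digits f
      obtain ⟨n, hn⟩ := hγ N
      have hinf : (f γ : ℝ) ≤ infOn (w (pre γ' n)) f := by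
        refine le_infOn_iff.2 fun ω hω => ?_
        have h3 := mem_cylSet.1 (cylSet_anti hn hω)
        rw [length_pre] at h3
        rw [hN ω γ h3]
      have hexk : ∃ k : ℕ, (f γ : ℝ) ≤ 2 ^ (k + 1) := by
        obtain ⟨k, hk⟩ := pow_unbounded_of_one_lt (f γ : ℝ) one_lt_two
        exact ⟨k, hk.le.trans (pow_le_pow_right₀ one_le_two (Nat.le_succ k))⟩
      -- thus `2 ^ k < f γ ≤ 2 ^ (k + 1)`
      set k := Nat.find hexk
      have hk1 : (f γ : ℝ) ≤ 2 ^ (k + 1) := Nat.find_spec hexk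
      have hk2 : (2 : ℝ) ^ k < f γ := by
        rcases hk : k with _ | k'
        · rw [pow_zero]; linarith
        · exact not_le.1 (Nat.find_min hexk (show k' < Nat.find hexk by omega))
      have hsub : openCell p (pre γ' n) ⊆ {ω | 2 ^ k < mlTest m lam ω} := by
        intro ω hω
        have h3 := hinf.trans (infOn_le_treeOp hω f)
        calc (2 : ℝ≥0∞) ^ k = ENNReal.ofReal (2 ^ k) := by
              rw [ENNReal.ofReal_pow zero_le_two, ENNReal.ofReal_ofNat]
          _ < ENNReal.ofReal (treeOp p w f ω) := by
              rw [ENNReal.ofReal_lt_ofReal_iff_of_nonneg (by positivity)]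
              exact hk2.trans_le h3
          _ ≤ _ := hfT ω
      obtain ⟨N', hN'⟩ := hR2 k _ (hpos n) hsub
      have hP : P k (pre γ' (max n N')) = true := by
        refine (P_iff _ _).2 ⟨N', by simp, n, by simp, ?_⟩
        rwa [take_pre, min_eq_left (le_max_left _ _)]
      obtain ⟨j, hj⟩ := exists_isFirst hP
      have h3 := (h1 (pre γ' j, k)).trans (mul_le_mul_of_nonneg_left (h2 (pre γ' j, k)) hC1.le)
      simp only [F, hj, if_true] at h3
      refine le_trans ?_ (mul_le_mul_right (le_iSup _ j) _)
      rw [← ENNReal.ofReal_div_of_pos (hpos j), ← ENNReal.ofReal_mul (by positivity)]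
      refine ENNReal.ofReal_le_ofReal (hk1.trans ?_)
      rw [← mul_div_assoc, le_div_iff₀ (hpos j), pow_succ]
      have h4 := hm.pos (Encodable.encode (pre γ' j))
      have h5 : 0 ≤ 2 / m0 * m (Encodable.encode (pre γ' j)) := by positivity
      nlinarith
    -- a string of measure `0` makes the ratio infinite
    · push Not at hpos
      obtain ⟨n, hn⟩ := hpos
      have h3 : Q = ⊤ := by
        refine top_le_iff.1 (le_trans ?_ (le_iSup _ n))
        rw [ENNReal.ofReal_of_nonpos hn, ENNReal.div_zero]
        simpa using hm.pos _
      rw [h3, ENNReal.mul_top (by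
        rw [Ne, ENNReal.ofReal_eq_zero, not_le]; positivity)]
      exact le_top

end

/-! ### Output maps of Turing reductions -/

/-- The string that a reduction, whose stages are `R`, outputs while it reads `z`: the step `t`
examines one prefix of `z`, one stage and one candidate for the next digit. -/
def outMap (R : List Bool × ℕ × Bool → ℕ → Bool) (z : List Bool) : List Bool :=
  (List.range z.length).foldl (fun o t =>
    bif R (z.take t.unpair.1, o.length, decide (t.unpair.2.unpair.2 = 1)) t.unpair.2.unpair.1
    then o ++ [decide (t.unpair.2.unpair.2 = 1)] else o) []

theorem outMap_append (R : List Bool × ℕ × Bool → ℕ → Bool) (z : List Bool) (b : Bool) :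
    outMap R (z ++ [b]) =
      bif R (z.take z.length.unpair.1, (outMap R z).length,
        decide (z.length.unpair.2.unpair.2 = 1)) z.length.unpair.2.unpair.1
      then outMap R z ++ [decide (z.length.unpair.2.unpair.2 = 1)] else outMap R z := by
  have h : ∀ (l : List ℕ), (∀ t ∈ l, t < z.length) → ∀ o,
      l.foldl (fun o t => bif R ((z ++ [b]).take t.unpair.1, o.length,
        decide (t.unpair.2.unpair.2 = 1)) t.unpair.2.unpair.1
        then o ++ [decide (t.unpair.2.unpair.2 = 1)] else o) o =
      l.foldl (fun o t => bif R (z.take t.unpair.1, o.length,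
        decide (t.unpair.2.unpair.2 = 1)) t.unpair.2.unpair.1
        then o ++ [decide (t.unpair.2.unpair.2 = 1)] else o) o := by
    intro l hl
    induction l with
    | nil => intro o; rfl
    | cons t l ih =>
      intro o
      rw [List.foldl_cons, List.foldl_cons, ih fun t ht => hl t (List.mem_cons_of_mem _ ht),
        List.take_append_of_le_length ((Nat.unpair_left_le t).trans (hl t List.mem_cons_self).le)]
  unfold outMap
  rw [List.length_append, List.length_singleton, List.range_succ, List.foldl_append,
    h _ fun t ht => List.mem_range.1 ht, List.foldl_cons, List.foldl_nil,
    List.take_append_of_le_length (Nat.unpair_left_le _)]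

theorem outMap_mono (R : List Bool × ℕ × Bool → ℕ → Bool) (z : List Bool) (b : Bool) :
    outMap R z <+: outMap R (z ++ [b]) := by
  rw [outMap_append, Bool.cond_eq_ite]
  split_ifs
  · exact List.prefix_append _ _
  · exact List.prefix_refl _

theorem primrec_outMap {R : List Bool × ℕ × Bool → ℕ → Bool}
    (hR : Primrec fun q : (List Bool × ℕ × Bool) × ℕ => R q.1 q.2) : Primrec (outMap R) := by
  unfold outMap
  fun_prop

/-- A reduction has a primitive recursive monotone output map. -/
theorem exists_outMap {Φ : List Bool × ℕ × Bool → Prop} (hΦ : REPred Φ) :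
    ∃ w : List Bool → List Bool, Primrec w ∧ (∀ z b, w z <+: w (z ++ [b])) ∧
      ∀ α' α, Reduces Φ α' α → ∀ N, ∃ n, pre α N <+: w (pre α' n) := by
  obtain ⟨R, hR, Rm, hRΦ⟩ := exists_stages hΦ
  refine ⟨outMap R, primrec_outMap hR, outMap_mono R, fun α' α ⟨_, h⟩ => ?_⟩
  have hstep : ∀ t, outMap R (pre α' (t + 1)) =
      bif R (pre α' t.unpair.1, (outMap R (pre α' t)).length,
        decide (t.unpair.2.unpair.2 = 1)) t.unpair.2.unpair.1
      then outMap R (pre α' t) ++ [decide (t.unpair.2.unpair.2 = 1)] else outMap R (pre α' t) := by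
    intro t
    rw [pre_succ, outMap_append, length_pre, take_pre, min_eq_left (Nat.unpair_left_le t)]
  have hsound : ∀ t, outMap R (pre α' t) = pre α (outMap R (pre α' t)).length := by
    intro t
    induction t with
    | zero => rfl
    | succ t ih =>
      rw [hstep]
      cases hc : R (pre α' t.unpair.1, (outMap R (pre α' t)).length,
        decide (t.unpair.2.unpair.2 = 1)) t.unpair.2.unpair.1
      · exact ih
      · have h1 := (h _ _).2 ⟨_, (hRΦ _).2 ⟨_, hc⟩⟩
        rw [cond_true, List.length_append, List.length_singleton, pre_succ, ← ih, h1]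
  have hmono : ∀ t t', t ≤ t' →
      (outMap R (pre α' t)).length ≤ (outMap R (pre α' t')).length := by
    refine fun t t' htt => monotone_nat_of_le_succ
      (f := fun t => (outMap R (pre α' t)).length) (fun t => ?_) htt
    rw [pre_succ]
    exact (outMap_mono R _ _).length_le
  have hgrow : ∀ N, ∃ n, N ≤ (outMap R (pre α' n)).length := by
    intro N
    induction N with
    | zero => exact ⟨0, Nat.zero_le _⟩
    | succ N ih =>
      obtain ⟨n, hn⟩ := ih
      obtain ⟨k, hk⟩ := (h N (α N)).1 rfl
      obtain ⟨s, hs⟩ := (hRΦ _).1 hk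
      set b : ℕ := bif α N then 1 else 0
      -- the step that examines the prefix of length `k`, a late stage and the digit `α N`
      set t := Nat.pair k (Nat.pair (max s n) b) with ht
      have hnt : n ≤ t := (le_max_right s n).trans
        ((Nat.left_le_pair _ _).trans (Nat.right_le_pair _ _))
      have hb : decide (b = 1) = α N := by
        rcases h1 : α N with _ | _ <;> simp [b, h1]
      by_cases hN : N + 1 ≤ (outMap R (pre α' t)).length
      · exact ⟨t, hN⟩
      · refine ⟨t + 1, ?_⟩
        have hlen : (outMap R (pre α' t)).length = N := by
          have := hmono n t hnt
          omega
        have hyes : R (pre α' k, N, α N) (max s n) = true := Rm _ _ _ (le_max_left _ _) hs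
        rw [hstep, hlen, ht, Nat.unpair_pair, Nat.unpair_pair, hb, hyes, cond_true,
          List.length_append, ← ht, hlen]
        simp
  intro N
  obtain ⟨n, hn⟩ := hgrow N
  exact ⟨n, by rw [hsound n]; exact pre_prefix α hn⟩

/-! ### Upper bound for the information between images of two sequences -/

/-- The information between `α` and `β` is bounded by the rarity of a pair `(α', β')` with respect
to a product of computable measures, for all `α'` and `β'` that are mapped to `α` and `β`. -/
theorem IsUniversalDistribution.opTest_join_le {m : ℕ → ℝ} (hm : IsUniversalDistribution m)
    {M : Elem → ℝ} (hM : IsUniversalSemimeasure M) {U : Elem → Seq → ℝ}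
    (hU : IsUniversalOperator m U (tensor M M)) {p₁ p₂ : List Bool → ℝ}
    (h₁ : IsComputableTree p₁) (h₂ : IsComputableTree p₂) {w₁ w₂ : List Bool → List Bool}
    (hw₁ : ∀ z b, w₁ z <+: w₁ (z ++ [b])) (hw₂ : ∀ z b, w₂ z <+: w₂ (z ++ [b]))
    (hwp₁ : Primrec w₁) (hwp₂ : Primrec w₂) :
    ∃ C : ℝ, 0 < C ∧ ∀ α α' β β' : Seq, (∀ N, ∃ n, pre α N <+: w₁ (pre α' n)) →
      (∀ N, ∃ n, pre β N <+: w₂ (pre β' n)) → ∀ Q : ℝ, 0 ≤ Q →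
      (∀ n, m (Encodable.encode (pre (join α' β') n)) ≤
        Q * (p₁ (pre α' ((n + 1) / 2)) * p₂ (pre β' (n / 2)))) →
      opTest m U (join α β) ≤ ENNReal.ofReal (C * Q) := by
  obtain ⟨c₁, hc₁, hM₁⟩ := hM.2.2 _ (isSemimeasure_treeImage h₁ hw₁)
    (reFunctional_treeImage h₁ hwp₁)
  obtain ⟨c₂, hc₂, hM₂⟩ := hM.2.2 _ (isSemimeasure_treeImage h₂ hw₂)
    (reFunctional_treeImage h₂ hwp₂)
  obtain ⟨c, hc⟩ := pow_unbounded_of_one_lt (c₁⁻¹ * c₂⁻¹) one_lt_two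
  set p : List Bool → ℝ := fun z => p₁ (ev z) * p₂ (od z) / 2 ^ c
  set w : List Bool → List Bool := fun z => interleave (w₁ (ev z)) (w₂ (od z)) with hw
  have hp : IsComputableTree p := h₁.prod h₂ c
  have hwp : Primrec w := by
    rw [hw]
    fun_prop
  have hadm : IsAdmissible (treeOp p w) (tensor M M) := by
    refine isAdmissible_treeOp hp (pairMap_mono hw₁ hw₂) hwp
      fun f hf n => treeSum_prod_le hM.1 h₁ h₂ hw₁ hw₂ (inv_pos.2 hc₁) (inv_pos.2 hc₂)
        (fun f hf => ?_) (fun f hf => ?_) hc.le hf n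
    · rw [← div_eq_inv_mul, le_div_iff₀' hc₁]
      exact hM₁ f hf
    · rw [← div_eq_inv_mul, le_div_iff₀' hc₂]
      exact hM₂ f hf
  obtain ⟨C1, hC1⟩ := hU.2 _ hadm
  obtain ⟨C2, hC2, h2⟩ := hm.opTest_treeOp_le hp w
  refine ⟨(C1 + 1) * (C2 * 2 ^ c), by positivity, fun α α' β β' hα hβ Q hQ h => ?_⟩
  have hlim : ∀ N, ∃ n, pre (join α β) N <+: w (pre (join α' β') n) := by
    intro N
    obtain ⟨n, hn⟩ := hα N
    obtain ⟨n', hn'⟩ := hβ N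
    refine ⟨2 * max n n', ?_⟩
    simp only [hw]
    rw [ev_pre_join, od_pre_join]
    have h3 : pre (join α β) N <+: interleave (pre α N) (pre β N) := by
      rw [interleave_pre]
      exact pre_prefix _ (by omega)
    refine h3.trans (interleave_mono (hn.trans ?_) (hn'.trans ?_))
    · exact prefix_map hw₁ (pre_prefix _ (by omega))
    · exact prefix_map hw₂ (pre_prefix _ (by omega))
  have h4 : ⨆ n, ENNReal.ofReal (m (Encodable.encode (pre (join α' β') n))) /
      ENNReal.ofReal (p (pre (join α' β') n)) ≤ ENNReal.ofReal (2 ^ c * Q) := by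
    refine iSup_le fun n => ENNReal.div_le_of_le_mul ?_
    rw [← ENNReal.ofReal_mul (by positivity)]
    refine ENNReal.ofReal_le_ofReal ((h n).trans (le_of_eq ?_))
    simp only [p, ev_pre_join, od_pre_join]
    field_simp
  calc opTest m U (join α β) ≤ C1 * opTest m (treeOp p w) (join α β) := hC1 _
    _ ≤ C1 * (ENNReal.ofReal C2 * ENNReal.ofReal (2 ^ c * Q)) := by
        gcongr
        exact (h2 _ _ hlim).trans (mul_le_mul_right h4 _)
    _ ≤ ENNReal.ofReal (C1 + 1) * (ENNReal.ofReal C2 * ENNReal.ofReal (2 ^ c * Q)) := by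
        gcongr
        rw [← ENNReal.ofReal_coe_nnreal]
        exact ENNReal.ofReal_le_ofReal (by linarith)
    _ = _ := by
        rw [← ENNReal.ofReal_mul (by positivity), ← ENNReal.ofReal_mul (by positivity)]
        ring_nf

/-! ### Lengths and deficiencies -/

theorem len_le {N : ℤ} (hN : 1 ≤ N) : (len (N : ℝ) : ℝ) ≤ Real.logb 2 N + 1 := by
  have h1 : (1 : ℝ) ≤ N := by exact_mod_cast hN
  have h2 : 0 ≤ Real.logb 2 N := Real.logb_nonneg one_lt_two h1
  have h3 := Int.ceil_lt_add_one (Real.logb 2 N)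
  have h4 : (0 : ℝ) ≤ ⌈Real.logb 2 N⌉ := by exact_mod_cast Int.ceil_nonneg h2
  unfold len
  push_cast
  rw [abs_le]
  constructor <;> linarith

theorem le_len (a : ℝ) : Real.logb 2 a - 1 ≤ (len a : ℝ) := by
  have h3 := Int.le_ceil (Real.logb 2 a)
  unfold len
  push_cast
  refine le_trans ?_ (le_abs_self _)
  linarith

/-- For `a ≤ 1` the length is `-log₂ a`, rounded. -/
theorem len_bounds {a : ℝ} (h0 : 0 < a) (h1 : a ≤ 1) :
    -(len a : ℝ) < Real.logb 2 a ∧ Real.logb 2 a ≤ 1 - len a := by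
  have h2 : Real.logb 2 a ≤ 0 := Real.logb_nonpos one_lt_two h0.le h1
  have h3 : ⌈Real.logb 2 a⌉ ≤ 0 := Int.ceil_le.2 (by exact_mod_cast h2)
  have h4 : (len a : ℝ) = 1 - ⌈Real.logb 2 a⌉ := by
    unfold len
    rw [abs_of_nonpos (by omega)]
    push_cast
    ring
  have h5 := Int.ceil_lt_add_one (Real.logb 2 a)
  have h6 := Int.le_ceil (Real.logb 2 a)
  rw [h4]
  constructor <;> linarith

theorem one_le_ceil_toReal {T : ℝ≥0∞} (h0 : T ≠ 0) (h1 : T ≠ ⊤) : 1 ≤ ⌈T.toReal⌉ :=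
  Int.one_le_ceil_iff.2 (ENNReal.toReal_pos h0 h1)

theorem deficiency_of_ne {T : ℝ≥0∞} (h0 : T ≠ 0) (h1 : T ≠ ⊤) :
    deficiency T = (((len (⌈T.toReal⌉ : ℤ) - 2 : ℤ) : ℝ) : EReal) := if_neg (by simp [h0, h1])

theorem deficiency_top : deficiency ⊤ = ⊤ := if_pos (Or.inr rfl)

theorem deficiency_ne_bot (T : ℝ≥0∞) : deficiency T ≠ ⊥ := by
  unfold deficiency
  split_ifs
  · exact top_ne_bot
  · exact EReal.coe_ne_bot _

theorem deficiency_le {T : ℝ≥0∞} (h0 : T ≠ 0) {Y : ℝ} (hY : T ≤ ENNReal.ofReal Y) :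
    deficiency T ≤ ((Real.logb 2 (Y + 1) : ℝ) : EReal) := by
  have h1 : T ≠ ⊤ := ne_top_of_le_ne_top ENNReal.ofReal_ne_top hY
  have hpos : 0 < T.toReal := ENNReal.toReal_pos h0 h1
  have hY0 : 0 < Y := by
    by_contra h
    rw [ENNReal.ofReal_of_nonpos (not_lt.1 h)] at hY
    exact h0 (le_zero_iff.1 hY)
  have hTY : T.toReal ≤ Y := by
    have := ENNReal.toReal_mono ENNReal.ofReal_ne_top hY
    rwa [ENNReal.toReal_ofReal hY0.le] at this
  have hN := one_le_ceil_toReal h0 h1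
  have hN' : (1 : ℝ) ≤ (⌈T.toReal⌉ : ℤ) := by exact_mod_cast hN
  rw [deficiency_of_ne h0 h1, EReal.coe_le_coe_iff]
  push_cast
  have h2 := len_le hN
  have h3 : Real.logb 2 (⌈T.toReal⌉ : ℤ) ≤ Real.logb 2 (Y + 1) := by
    refine Real.logb_le_logb_of_le one_lt_two (by linarith) ?_
    linarith [Int.ceil_lt_add_one T.toReal]
  linarith

/-- The loss `3` is due to the `- 2` in the deficiency and to rounding. -/
theorem le_deficiency {T : ℝ≥0∞} {r : ℝ} (hr : 0 < r) (h : ENNReal.ofReal r ≤ T) :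
    ((Real.logb 2 r - 3 : ℝ) : EReal) ≤ deficiency T := by
  rcases eq_or_ne T ⊤ with rfl | h1
  · rw [deficiency_top]; exact le_top
  have h0 : T ≠ 0 := fun h0 => by
    rw [h0, nonpos_iff_eq_zero, ENNReal.ofReal_eq_zero] at h
    linarith
  have hrT : r ≤ T.toReal := by
    have := ENNReal.toReal_mono h1 h
    rwa [ENNReal.toReal_ofReal hr.le] at this
  rw [deficiency_of_ne h0 h1, EReal.coe_le_coe_iff]
  push_cast
  have h2 := le_len (⌈T.toReal⌉ : ℤ)
  have h3 : Real.logb 2 r ≤ Real.logb 2 (⌈T.toReal⌉ : ℤ) :=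
    Real.logb_le_logb_of_le one_lt_two hr (hrT.trans (Int.le_ceil _))
  linarith

/-- A test that is finite on `ω` is bounded by a power of `2` with the exponent `d + 3`, where
`d` is the deficiency. -/
theorem exists_deficiency {T : ℝ≥0∞} (h0 : T ≠ 0) (h1 : deficiency T ≠ ⊤) :
    ∃ r : ℕ, deficiency T = (((r : ℝ) - 3 : ℝ) : EReal) ∧ 1 ≤ r ∧ T ≤ 2 ^ r := by
  have hT : T ≠ ⊤ := fun h => h1 (by rw [h, deficiency_top])
  rw [deficiency_of_ne h0 hT]
  have hl : 0 ≤ len (⌈T.toReal⌉ : ℤ) := abs_nonneg _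
  obtain ⟨n, hn⟩ := Int.eq_ofNat_of_zero_le hl
  refine ⟨n + 1, ?_, by omega, ?_⟩
  · rw [hn]
    congr 1
    push_cast
    ring
  · have hN := one_le_ceil_toReal h0 hT
    have hN' : (1 : ℝ) ≤ (⌈T.toReal⌉ : ℤ) := by exact_mod_cast hN
    have h2 := le_len (⌈T.toReal⌉ : ℤ)
    have hn' : (len (⌈T.toReal⌉ : ℤ) : ℝ) = n := by exact_mod_cast hn
    have h3 : Real.logb 2 (⌈T.toReal⌉ : ℤ) ≤ ((n + 1 : ℕ) : ℝ) := by
      push_cast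
      linarith
    rw [Real.logb_le_iff_le_rpow one_lt_two (by linarith), Real.rpow_natCast] at h3
    rw [← ENNReal.ofReal_toReal hT]
    calc ENNReal.ofReal T.toReal ≤ ENNReal.ofReal (2 ^ (n + 1)) :=
          ENNReal.ofReal_le_ofReal ((Int.le_ceil _).trans h3)
      _ = _ := by rw [ENNReal.ofReal_pow zero_le_two, ENNReal.ofReal_ofNat]

/-- Domination of tests up to a factor is domination of deficiencies up to a summand. -/
theorem deficiency_mono {C : ℝ} (hC : 0 < C) :
    ∃ C' : ℝ, 0 ≤ C' ∧ ∀ T T' : ℝ≥0∞, T ≠ 0 → T ≤ ENNReal.ofReal C * T' →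
      deficiency T ≤ deficiency T' + (C' : EReal) := by
  refine ⟨Real.logb 2 (C + 1) + 3, by
    have := Real.logb_nonneg one_lt_two (show (1 : ℝ) ≤ C + 1 by linarith)
    linarith, fun T T' h0 h => ?_⟩
  rcases eq_or_ne T' ⊤ with rfl | h1
  · rw [deficiency_top, EReal.top_add_coe]; exact le_top
  have h0' : T' ≠ 0 := fun h' => h0 (by rw [h', mul_zero] at h; exact le_zero_iff.1 h)
  have hN := one_le_ceil_toReal h0' h1
  have hN' : (1 : ℝ) ≤ (⌈T'.toReal⌉ : ℤ) := by exact_mod_cast hN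
  set N : ℝ := ((⌈T'.toReal⌉ : ℤ) : ℝ)
  have h2 : T ≤ ENNReal.ofReal (C * N) := by
    rw [ENNReal.ofReal_mul hC.le]
    refine h.trans ?_
    gcongr
    rw [← ENNReal.ofReal_toReal h1]
    exact ENNReal.ofReal_le_ofReal (Int.le_ceil _)
  refine (deficiency_le h0 h2).trans ?_
  rw [deficiency_of_ne h0' h1, ← EReal.coe_add, EReal.coe_le_coe_iff]
  push_cast
  have h3 := le_len N
  have h4 : Real.logb 2 (C * N + 1) ≤ Real.logb 2 (C + 1) + Real.logb 2 N := by
    rw [← Real.logb_mul (by linarith) (by linarith)]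
    refine Real.logb_le_logb_of_le one_lt_two (by positivity) ?_
    nlinarith
  linarith

/-! ### Lower bounds for information -/

section

variable {m : ℕ → ℝ} (hm : IsUniversalDistribution m)
  {mc : ℕ → Seq → ℝ} (hmc : IsUniversalCondDistribution mc)

include hm in
/-- `2 ^ I(x : y)` is the ratio `m(x, y) / (m x * m y)` up to a factor and to the summand from
rounding up. -/
theorem IsUniversalDistribution.two_zpow_infoNat (x y : ℕ) :
    m (Nat.pair x y) / (m x * m y) / 8 ≤ (2 : ℝ) ^ infoNat m x y ∧
      (2 : ℝ) ^ infoNat m x y ≤ m (Nat.pair x y) / (m x * m y) + 1 := by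
  set R := m (Nat.pair x y) / (m x * m y) with hR
  have hR0 : 0 < R := div_pos (hm.pos _) (mul_pos (hm.pos _) (hm.pos _))
  have hN : 1 ≤ ⌈R⌉ := Int.one_le_ceil_iff.2 hR0
  have hN' : (1 : ℝ) ≤ (⌈R⌉ : ℤ) := by exact_mod_cast hN
  have h1 := len_le hN
  have h2 := le_len (⌈R⌉ : ℤ)
  have h3 := Int.le_ceil R
  have h4 := Int.ceil_lt_add_one R
  have e : (2 : ℝ) ^ infoNat m x y = (2 : ℝ) ^ ((len (⌈R⌉ : ℤ) : ℝ) - 2) := by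
    rw [← Real.rpow_intCast]
    unfold infoNat
    push_cast
    rfl
  have e2 : (2 : ℝ) ^ Real.logb 2 (⌈R⌉ : ℤ) = (⌈R⌉ : ℤ) :=
    Real.rpow_logb two_pos (by norm_num) (by linarith)
  rw [e]
  constructor
  · calc R / 8 ≤ (⌈R⌉ : ℤ) / 8 := by gcongr
      _ = (2 : ℝ) ^ (Real.logb 2 (⌈R⌉ : ℤ) - 3) := by
          rw [Real.rpow_sub two_pos, e2]; norm_num
      _ ≤ _ := Real.rpow_le_rpow_of_exponent_le one_le_two (by linarith)
  · calc (2 : ℝ) ^ ((len (⌈R⌉ : ℤ) : ℝ) - 2) ≤ (2 : ℝ) ^ Real.logb 2 (⌈R⌉ : ℤ) :=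
          Real.rpow_le_rpow_of_exponent_le one_le_two (by linarith)
      _ ≤ R + 1 := by rw [e2]; exact h4.le

include hm hmc in
/-- A condition can be ignored. -/
theorem IsUniversalCondDistribution.exists_mul_le : ∃ c : ℝ, 0 < c ∧ ∀ x α, c * m x ≤ mc x α := by
  obtain ⟨b, hb, b0, bm, ble, blt⟩ := hm.exists_approx
  obtain ⟨C, hC, h⟩ := hmc.dom (fun _ x s => b x s.length) (by fun_prop)
    (fun r x s t => by simpa using bm x s.length) (fun _ => 1) (by fun_prop) fun _ => one_pos
  refine ⟨(C * 2)⁻¹, by positivity, fun x α => ?_⟩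
  rw [← div_eq_inv_mul, div_le_iff₀ (by positivity)]
  have h1 := h 0 α fun n => ?_
  · refine le_of_tendsto (tendsto_of_mono_approx (mono_div_pow (bm _)) (ble x) (blt x))
      (Filter.Eventually.of_forall fun n => ?_)
    have h2 := h1 x n
    rw [length_pre] at h2
    push_cast at h2
    linarith
  · simp only [length_pre, one_mul]
    have h3 : ∑ x ∈ Finset.range n, (b x n : ℝ) / 2 ^ n ≤ 1 :=
      (Finset.sum_le_sum fun x _ => ble x n).trans (hm.sum_le _)
    rw [← Finset.sum_div, div_le_one (by positivity)] at h3
    exact_mod_cast h3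

include hm hmc in
theorem IsUniversalCondDistribution.pos (x : ℕ) (α : Seq) : 0 < mc x α := by
  obtain ⟨c, hc, h⟩ := hmc.exists_mul_le hm
  exact lt_of_lt_of_le (mul_pos hc (hm.pos x)) (h x α)

include hmc in
/-- An integer has bounded complexity relative to its own code. -/
theorem IsUniversalCondDistribution.exists_le_code : ∃ c : ℝ, 0 < c ∧ ∀ x, c ≤ mc x (code x) := by
  let a : ℕ → ℕ → List Bool → ℕ := fun _ x s =>
    if s.findIdx (fun b => !b) < s.length then
      if s.findIdx (fun b => !b) = x then 2 ^ s.length else 0 else 0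
  have ha : Primrec fun q : ℕ × ℕ × List Bool => a q.1 q.2.1 q.2.2 := by
    simp only [a]
    fun_prop
  have am : ∀ r x s t, 2 * a r x s ≤ a r x (s ++ [t]) := by
    intro r x s t
    simp only [a]
    by_cases h : s.findIdx (fun b => !b) < s.length
    · rw [findIdx_append_of_lt t h, if_pos h, if_pos (h.trans (by simp)), List.length_append,
        List.length_singleton]
      split_ifs
      · rw [pow_succ, mul_comm]
      · simp
    · rw [if_neg h]; simp
  obtain ⟨C, hC, h⟩ := hmc.dom a ha am (fun _ => 1) (by fun_prop) fun _ => one_pos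
  refine ⟨(C * 2)⁻¹, by positivity, fun x => ?_⟩
  have h1 := h 0 (code x) (fun n => ?_) x (x + 1)
  · simp only [a] at h1
    rw [pre_code_findIdx (Nat.lt_succ_self x), length_pre, if_pos (Nat.lt_succ_self x), if_pos rfl]
      at h1
    push_cast at h1
    rw [div_self (by positivity)] at h1
    rw [inv_le_iff_one_le_mul₀' (by positivity)]
    linarith
  · simp only [a]
    rw [one_mul, length_pre]
    split_ifs
    · rw [Finset.sum_ite_eq]
      split_ifs <;> simp
    · simp

variable {M : Elem → ℝ} (hM : IsUniversalSemimeasure M) {U : Elem → Seq → ℝ}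
  (hU : IsAdmissible U (tensor M M))

include hm hmc hM hU in
/-- The diagonal terms `x = y` of the simple bound. -/
theorem IsUniversalDistribution.le_opTest_join : ∃ c : ℝ, 0 < c ∧ ∀ α β x,
    ENNReal.ofReal (c * (mc x α * mc x β / m x)) ≤ opTest m U (join α β) := by
  obtain ⟨C, hC, h⟩ := hm.simple_le_opTest hmc hM.1 hM.2.1 hU
  obtain ⟨C1, hC1, h1⟩ := hm.map (φ := fun x : ℕ => Nat.pair x x) (by fun_prop)
  refine ⟨(C1 * C)⁻¹, by positivity, fun α β x => ?_⟩
  have hmx := hm.pos x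
  have hα := hmc.nonneg x α
  have hβ := hmc.nonneg x β
  have h2 := ((ENNReal.le_tsum x).trans (ENNReal.le_tsum x)).trans (h α β)
  have h3 : ENNReal.ofReal (C * ((C1 * C)⁻¹ * (mc x α * mc x β / m x))) ≤
      ENNReal.ofReal C * opTest m U (join α β) := by
    refine le_trans (ENNReal.ofReal_le_ofReal ?_) h2
    have h4 : m x ≤ C1 * m (Nat.pair x x) := h1 x
    have h5 : (m x)⁻¹ ≤ C1 * (m (Nat.pair x x) / (m x * m x)) := by
      rw [← mul_div_assoc, le_div_iff₀ (by positivity)]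
      calc (m x)⁻¹ * (m x * m x) = m x := by field_simp
        _ ≤ _ := h4
    calc C * ((C1 * C)⁻¹ * (mc x α * mc x β / m x)) = mc x α * mc x β * ((m x)⁻¹ / C1) := by
          field_simp
      _ ≤ mc x α * mc x β * (m (Nat.pair x x) / (m x * m x)) :=
          mul_le_mul_of_nonneg_left ((div_le_iff₀' hC1).2 h5) (mul_nonneg hα hβ)
  rw [ENNReal.ofReal_mul hC.le] at h3
  rwa [ENNReal.mul_le_mul_iff_right (by simpa using hC) ENNReal.ofReal_ne_top] at h3

include hm hmc hM hU in
theorem IsUniversalDistribution.exists_le_opTest_join : ∃ c : ℝ, 0 < c ∧ ∀ α β,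
    ENNReal.ofReal c ≤ opTest m U (join α β) := by
  obtain ⟨c, hc, h⟩ := hm.le_opTest_join hmc hM hU
  obtain ⟨c', hc', h'⟩ := hmc.exists_mul_le hm
  have hm0 := hm.pos 0
  refine ⟨c * (c' * m 0 * (c' * m 0) / m 0), by positivity, fun α β => ?_⟩
  refine le_trans (ENNReal.ofReal_le_ofReal ?_) (h α β 0)
  have := hmc.nonneg 0 α
  gcongr
  · exact h' 0 α
  · exact h' 0 β

include hm hmc hM hU in
theorem IsUniversalDistribution.opTest_join_ne_zero (α β : Seq) : opTest m U (join α β) ≠ 0 := by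
  obtain ⟨c, hc, h⟩ := hm.exists_le_opTest_join hmc hM hU
  intro h0
  have := h α β
  rw [h0, nonpos_iff_eq_zero, ENNReal.ofReal_eq_zero] at this
  linarith

include hm hmc hM hU in
theorem IsUniversalDistribution.le_info : ∃ C : ℝ, 0 ≤ C ∧ ∀ α β x,
    (((K m x - KC mc x α - KC mc x β : ℤ) : ℝ) : EReal) ≤ info m U α β + (C : EReal) := by
  obtain ⟨c, hc, h⟩ := hm.le_opTest_join hmc hM hU
  refine ⟨|Real.logb 2 c| + 4, by positivity, fun α β x => ?_⟩
  have hmx := hm.pos x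
  have hα := hmc.pos hm x α
  have hβ := hmc.pos hm x β
  have h1 := le_deficiency (by positivity) (h α β x)
  have h2 := len_bounds hmx (hm.le_one x)
  have h3 := len_bounds hα (hmc.le_one x α)
  have h4 := len_bounds hβ (hmc.le_one x β)
  rw [Real.logb_mul hc.ne' (by positivity), Real.logb_div (by positivity) hmx.ne',
    Real.logb_mul hα.ne' hβ.ne'] at h1
  refine le_trans ?_ (add_le_add_left h1 _)
  rw [← EReal.coe_add, EReal.coe_le_coe_iff]
  push_cast
  unfold K KC
  have := neg_abs_le (Real.logb 2 c)
  linarith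

include hm hmc hM hU in
/-- The summand from rounding up in `2 ^ I(x : y)` contributes a bounded total, which the test
exceeds up to a constant factor. -/
theorem IsUniversalDistribution.infoSimple_le_info : ∃ C : ℝ, ∀ α β,
    infoSimple m mc α β ≤ info m U α β + (C : EReal) := by
  obtain ⟨C, hC, h⟩ := hm.simple_le_opTest hmc hM.1 hM.2.1 hU
  obtain ⟨c, hc, h'⟩ := hm.exists_le_opTest_join hmc hM hU
  obtain ⟨C', -, hdef⟩ := deficiency_mono (show 0 < C + c⁻¹ by positivity)
  refine ⟨C', fun α β => hdef _ _ (fun h0 => ?_) ?_⟩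
  · rw [ENNReal.tsum_eq_zero] at h0
    have h1 := h0 0
    rw [ENNReal.tsum_eq_zero] at h1
    have h2 := h1 0
    rw [ENNReal.ofReal_eq_zero] at h2
    have := hmc.pos hm 0 α
    have := hmc.pos hm 0 β
    have : 0 < mc 0 α * mc 0 β * (2 : ℝ) ^ infoNat m 0 0 := by positivity
    linarith
  · have h1 : ∀ x y, ENNReal.ofReal (mc x α * mc y β * (2 : ℝ) ^ infoNat m x y) ≤
        ENNReal.ofReal (mc x α * mc y β * (m (Nat.pair x y) / (m x * m y))) +
          ENNReal.ofReal (mc x α) * ENNReal.ofReal (mc y β) := by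
      intro x y
      have hα := hmc.nonneg x α
      have hβ := hmc.nonneg y β
      have := hm.nonneg x
      have := hm.nonneg y
      have := hm.nonneg (Nat.pair x y)
      rw [← ENNReal.ofReal_mul hα, ← ENNReal.ofReal_add (by positivity) (by positivity)]
      refine ENNReal.ofReal_le_ofReal ?_
      rw [← mul_add_one]
      exact mul_le_mul_of_nonneg_left (hm.two_zpow_infoNat x y).2 (by positivity)
    have hone : ∀ α, ∑' x, ENNReal.ofReal (mc x α) ≤ 1 := by
      intro α
      rw [ENNReal.tsum_eq_iSup_sum]
      refine iSup_le fun t => ?_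
      rw [← ENNReal.ofReal_sum_of_nonneg fun x _ => hmc.nonneg x α, ← ENNReal.ofReal_one]
      exact ENNReal.ofReal_le_ofReal (hmc.sum_le t α)
    refine (ENNReal.tsum_le_tsum fun x => ENNReal.tsum_le_tsum fun y => h1 x y).trans ?_
    simp only [ENNReal.tsum_add, ENNReal.tsum_mul_left, ENNReal.tsum_mul_right]
    rw [ENNReal.ofReal_add hC.le (by positivity), add_mul]
    refine add_le_add (h α β) ?_
    calc _ ≤ (1 : ℝ≥0∞) * 1 := mul_le_mul' (hone α) (hone β)
      _ = ENNReal.ofReal c⁻¹ * ENNReal.ofReal c := by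
          rw [← ENNReal.ofReal_mul (by positivity), inv_mul_cancel₀ hc.ne']; simp
      _ ≤ _ := by gcongr; exact h' α β

include hm hmc hM hU in
/-- The condition `code x` makes the term `K(x|β)` bounded. -/
theorem IsUniversalDistribution.le_info_code : ∃ C : ℝ, 0 ≤ C ∧ ∀ α x,
    (((K m x - KC mc x α : ℤ) : ℝ) : EReal) ≤ info m U α (code x) + (C : EReal) := by
  obtain ⟨C, hC, h⟩ := hm.le_info hmc hM hU
  obtain ⟨c, hc, h'⟩ := hmc.exists_le_code
  refine ⟨C + (|Real.logb 2 c| + 1), by positivity, fun α x => ?_⟩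
  have h1 := h α (code x) x
  have h2 := len_bounds (hmc.pos hm x (code x)) (hmc.le_one x _)
  have h3 := Real.logb_le_logb_of_le one_lt_two hc (h' x)
  have h4 := neg_abs_le (Real.logb 2 c)
  rw [EReal.coe_add, ← add_assoc]
  refine le_trans ?_ (add_le_add_left h1 _)
  rw [← EReal.coe_add, EReal.coe_le_coe_iff]
  push_cast
  unfold KC at *
  linarith [h2.2]

end

/-! ### Prefixes of random sequences -/

/-- At most the fraction `2 ^ (-|t|)` of the strings of length `n` extend `t`. -/
theorem card_extensions_le (t : List Bool) (n : ℕ) :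
    2 ^ t.length * ((strs n).filter fun s => s.take t.length = t).card ≤ 2 ^ n := by
  rw [← card_strs t.length, ← card_strs n, ← Finset.card_product]
  refine Finset.card_le_card_of_injOn (fun p => p.1 ++ p.2.drop t.length) (fun p hp => ?_)
    fun p hp q hq h => ?_
  · simp only [Finset.coe_product, Set.mem_prod, Finset.mem_coe, Finset.mem_filter] at hp
    rw [Finset.mem_coe, mem_strs, List.length_append, List.length_drop, mem_strs.1 hp.1,
      mem_strs.1 hp.2.1]
    have h2 := congrArg List.length hp.2.2
    rw [List.length_take, mem_strs.1 hp.2.1] at h2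
    omega
  · simp only [Finset.coe_product, Set.mem_prod, Finset.mem_coe, Finset.mem_filter] at hp hq
    have h1 := List.append_inj h ((mem_strs.1 hp.1).trans (mem_strs.1 hq.1).symm)
    refine Prod.ext h1.1 ?_
    rw [← List.take_append_drop t.length p.2, ← List.take_append_drop t.length q.2, hp.2.2, hq.2.2,
      h1.2]

section

variable {m : ℕ → ℝ} (hm : IsUniversalDistribution m)
  {mc : ℕ → Seq → ℝ} (hmc : IsUniversalCondDistribution mc) {U : Elem → Seq → ℝ}
  (hU : IsAdmissible U lam)

include hm hmc hU in
/-- A sequence of low rarity `r` makes every string `z` such that `e z` is one of its prefixes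
at least `2 ^ |e z|` times more likely, up to a factor of about `2 ^ r`: the sum of these
quantities over all `z` is a test, and a bounded sum is a conditional distribution. -/
theorem IsUniversalDistribution.mul_two_pow_le_cond {e : List Bool → List Bool} (he : Primrec e) :
    ∃ C : ℝ, 0 < C ∧ ∀ α (r : ℕ), opTest m U α ≤ 2 ^ r → ∀ z, pre α (e z).length = e z →
      m (Encodable.encode z) * 2 ^ (e z).length ≤
        C * (2 ^ r * ((r + 1) * (r + 2))) * mc (Encodable.encode z) α := by
  obtain ⟨b, hb, b0, bm, ble, blt⟩ := hm.exists_approx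
  -- stage `|s|` of the quantity for the string `z` coded by `x`, counted once `e z` is a prefix of
  -- `s`
  let a : ℕ → List Bool → ℕ := fun x s => (Encodable.decode (α := List Bool) x).elim 0 fun z =>
    if s.take (e z).length = e z then b x s.length * 2 ^ (e z).length else 0
  have ha : Primrec fun q : ℕ × List Bool => a q.1 q.2 := by
    simp only [a]
    fun_prop
  have am : ∀ x s t, 2 * a x s ≤ a x (s ++ [t]) := by
    intro x s t
    simp only [a]
    cases Encodable.decode (α := List Bool) x with
    | none => simp
    | some z =>
      simp only [Option.elim_some]
      by_cases h : s.take (e z).length = e z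
      · have h' : (s ++ [t]).take (e z).length = e z := by
          have h1 : e z <+: s := by rw [List.prefix_iff_eq_take, h]
          exact (List.prefix_iff_eq_take.1 (h1.trans (List.prefix_append _ _))).symm
        rw [if_pos h, if_pos h', ← mul_assoc]
        gcongr
        simpa using bm x s.length
      · simp [h]
  have hmean : MeanLeOne fun s => ∑ x ∈ Finset.range s.length, a x s := by
    intro n
    have h1 : ∀ x, ∑ s ∈ strs n, a x s ≤ b x n * 2 ^ n := by
      intro x
      simp only [a]
      cases Encodable.decode (α := List Bool) x with
      | none => simp
      | some z =>
        simp only [Option.elim_some]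
        rw [← Finset.sum_filter]
        calc _ = ∑ s ∈ (strs n).filter fun s => s.take (e z).length = e z,
              b x n * 2 ^ (e z).length :=
              Finset.sum_congr rfl fun s hs => by rw [mem_strs.1 (Finset.mem_filter.1 hs).1]
          _ = b x n * (2 ^ (e z).length *
              ((strs n).filter fun s => s.take (e z).length = e z).card) := by
              rw [Finset.sum_const, smul_eq_mul]; ring
          _ ≤ _ := Nat.mul_le_mul_left _ (card_extensions_le _ _)
    have h2 : ∑ x ∈ Finset.range n, b x n ≤ 2 ^ n := by
      have h3 : ∑ x ∈ Finset.range n, (b x n : ℝ) / 2 ^ n ≤ 1 :=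
        (Finset.sum_le_sum fun x _ => ble x n).trans (hm.sum_le _)
      rw [← Finset.sum_div, div_le_one (by positivity)] at h3
      exact_mod_cast h3
    calc _ = ∑ s ∈ strs n, ∑ x ∈ Finset.range n, a x s :=
          Finset.sum_congr rfl fun s hs => by simp only [mem_strs.1 hs]
      _ = ∑ x ∈ Finset.range n, ∑ s ∈ strs n, a x s := Finset.sum_comm
      _ ≤ ∑ x ∈ Finset.range n, b x n * 2 ^ n := Finset.sum_le_sum fun x _ => h1 x
      _ = (∑ x ∈ Finset.range n, b x n) * 2 ^ n := by rw [Finset.sum_mul]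
      _ ≤ 2 ^ n * 2 ^ n := Nat.mul_le_mul_right _ h2
      _ = 4 ^ n := by rw [← mul_pow]; norm_num
  obtain ⟨C1, hC1, h1⟩ := hm.dom_test (fun _ s => ∑ x ∈ Finset.range s.length, a x s)
    (by fun_prop) (fun _ => by simp) fun _ s t => by
      rw [List.length_append, List.length_singleton, Finset.sum_range_succ, Finset.mul_sum]
      exact (Finset.sum_le_sum fun x _ => am x s t).trans (Nat.le_add_right _ _)
  obtain ⟨C2, hC2, h2⟩ := hm.mlTest_le_opTest hU
  have hm0 := hm.pos 0
  -- the sum is at most `κ * 2 ^ r` at sequences of rarity at most `2 ^ r`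
  obtain ⟨κ, hκ⟩ := exists_nat_gt (C1 * C2 / m 0)
  have hκ0 : (0 : ℝ) < κ := lt_trans (by positivity) hκ
  obtain ⟨C3, hC3, h3⟩ := hmc.dom (fun _ x s => a x s) (by fun_prop) (fun _ => am)
    (fun r => κ * 2 ^ r) (by fun_prop) fun r => Nat.mul_pos (by exact_mod_cast hκ0) (by positivity)
  refine ⟨C3 * κ, by positivity, fun α r hr z hz => ?_⟩
  have h4 : ∀ n, ∑ x ∈ Finset.range n, a x (pre α n) ≤ κ * 2 ^ r * 2 ^ n := by
    intro n
    have h5 := (ENNReal.le_tsum 0).trans (h1 α)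
    have hmem : 0 ∈ {j : ℕ | MeanLeOne fun s => ∑ x ∈ Finset.range s.length, a x s} := hmean
    rw [Set.indicator_of_mem hmem] at h5
    have h6 := (mul_le_mul_right (le_iSup (fun n => ENNReal.ofReal (((∑ x ∈ Finset.range
      (pre α n).length, a x (pre α n) : ℕ) : ℝ) / 2 ^ n)) n) (ENNReal.ofReal (m 0))).trans
      (h5.trans (mul_le_mul_right ((h2 α).trans (mul_le_mul_right hr _)) _))
    rw [length_pre, show (2 : ℝ≥0∞) ^ r = ENNReal.ofReal (2 ^ r) by
      rw [ENNReal.ofReal_pow zero_le_two, ENNReal.ofReal_ofNat], ← ENNReal.ofReal_mul hC2.le,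
      ← ENNReal.ofReal_mul hC1.le, ← ENNReal.ofReal_mul hm0.le,
      ENNReal.ofReal_le_ofReal_iff (by positivity)] at h6
    have h7 : ((∑ x ∈ Finset.range n, a x (pre α n) : ℕ) : ℝ) / 2 ^ n ≤ κ * 2 ^ r := by
      calc _ ≤ C1 * (C2 * 2 ^ r) / m 0 := by rwa [le_div_iff₀' hm0]
        _ = C1 * C2 / m 0 * 2 ^ r := by ring
        _ ≤ _ := by gcongr
    rw [div_le_iff₀ (by positivity)] at h7
    exact_mod_cast h7
  have h5 := h3 r α h4 (Encodable.encode z)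
  have ht : Filter.Tendsto (fun n => (b (Encodable.encode z) n : ℝ) / 2 ^ n * 2 ^ (e z).length)
      Filter.atTop (nhds (m (Encodable.encode z) * 2 ^ (e z).length)) :=
    (tendsto_of_mono_approx (mono_div_pow (bm _)) (ble _) (blt _)).mul_const _
  refine le_of_tendsto ht (Filter.eventually_atTop.2 ⟨(e z).length, fun n hn => ?_⟩)
  have h6 := h5 n
  simp only [a] at h6
  rw [Encodable.encodek, Option.elim_some, take_pre, min_eq_left hn, if_pos hz, length_pre] at h6
  push_cast at h6
  rw [div_mul_eq_mul_div]
  refine h6.trans (le_of_eq ?_)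
  ring

end

/-! ### Dyadic measures on the binary tree -/

/-- A measure with dyadic values given by primitive recursive numerators and exponents is
computable. -/
theorem IsComputableTree.of_dyadic {p : List Bool → ℝ} {num den : List Bool → ℕ}
    (hnum : Primrec num) (hden : Primrec den) (hp : ∀ z, p z = (num z : ℝ) / 2 ^ den z)
    (hadd : ∀ z, p z = p (z ++ [false]) + p (z ++ [true])) (h1 : p [] ≤ 1) :
    IsComputableTree p where
  nonneg z := by rw [hp]; positivity
  add := hadd
  le_one := h1
  approx := by
    have hsmall : Filter.Tendsto (fun t : ℕ => (1 : ℝ) / 2 ^ t) Filter.atTop (nhds 0) := by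
      simpa using tendsto_pow_atTop_nhds_zero_of_lt_one (r := (1 / 2 : ℝ)) (by norm_num) (by norm_num)
    have hle : ∀ z t, ((num z * 2 ^ t / 2 ^ den z : ℕ) : ℝ) / 2 ^ t ≤ p z := by
      intro z t
      rw [div_le_iff₀ (by positivity), hp]
      refine (natCast_div_le_div _ _).trans (le_of_eq ?_)
      push_cast
      ring
    have hge : ∀ z t, p z ≤ ((num z * 2 ^ t / 2 ^ den z : ℕ) : ℝ) / 2 ^ t + 1 / 2 ^ t := by
      intro z t
      have := div_sub_one_le_natCast_div (num z * 2 ^ t) (b := 2 ^ den z) (by positivity)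
      rw [← add_div, le_div_iff₀ (by positivity), hp]
      push_cast at this
      rw [div_mul_eq_mul_div]
      linarith
    have hlo : ∀ z, Filter.Tendsto (fun t => ((num z * 2 ^ t / 2 ^ den z : ℕ) : ℝ) / 2 ^ t)
        Filter.atTop (nhds (p z)) := by
      intro z
      refine tendsto_of_tendsto_of_tendsto_of_le_of_le
        (by have := (tendsto_const_nhds (x := p z)).sub hsmall; rwa [sub_zero] at this)
        tendsto_const_nhds (fun t => ?_) (hle z)
      have := hge z t
      dsimp only
      linarith
    refine ⟨fun z t => num z * 2 ^ t / 2 ^ den z, fun z t => num z * 2 ^ t / 2 ^ den z + 1,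
      by fun_prop, by fun_prop, hle, fun z t => ?_, hlo, fun z => ?_⟩
    · rw [Nat.cast_add, Nat.cast_one, add_div]
      exact hge z t
    · have := (hlo z).add hsmall
      rw [add_zero] at this
      refine this.congr fun t => ?_
      rw [Nat.cast_add, Nat.cast_one, add_div]

theorem isComputableTree_uniform : IsComputableTree fun z => 1 / 2 ^ z.length :=
  IsComputableTree.of_dyadic (num := fun _ => 1) (den := List.length) (by fun_prop) (by fun_prop)
    (fun z => by simp) (fun z => by
      simp only [List.length_append, List.length_singleton, pow_succ]
      field_simp
      norm_num) (by simp)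

/-! ### Upper bounds for information in pairs of sequences -/

/-- A bound of a test by `2 ^ (s + D)` with a polynomial factor in `D` bounds its deficiency by
`s + D` up to a logarithmic term; `-s₀ ≤ s + D` lets the constant absorb the rounding up. -/
theorem exists_deficiency_le_logErr {C : ℝ} (hC : 0 < C) (s₀ : ℝ) :
    ∃ C' : ℝ, 0 < C' ∧ ∀ (T : ℝ≥0∞) (s D P : ℝ), T ≠ 0 → -s₀ ≤ s + D → 1 ≤ P →
      P ≤ (4 * (|D| + 2)) ^ 4 → T ≤ ENNReal.ofReal (C * ((2 : ℝ) ^ (s + D) * P)) →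
      deficiency T ≤ (s : EReal) + (D : EReal) + (C' : EReal) * logErr (D : EReal) := by
  set c : ℝ := C + (2 : ℝ) ^ s₀ with hc
  have hs0 : (0 : ℝ) < 2 ^ s₀ := Real.rpow_pos_of_pos two_pos _
  refine ⟨|Real.logb 2 c| + 12, by positivity, fun T s D P hT hs hP hP' h => ?_⟩
  have h2 : (0 : ℝ) < 2 ^ (s + D) := Real.rpow_pos_of_pos two_pos _
  have hlog : logErr (D : EReal) = ((Real.logb 2 (|D| + 2) : ℝ) : EReal) := by
    rw [logErr, if_neg (by simp), EReal.toReal_coe]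
  refine (deficiency_le hT h).trans ?_
  rw [hlog, ← EReal.coe_mul, ← EReal.coe_add, ← EReal.coe_add, EReal.coe_le_coe_iff]
  have hD := abs_nonneg D
  have hL : 1 ≤ Real.logb 2 (|D| + 2) := by
    rw [Real.le_logb_iff_rpow_le one_lt_two (by positivity), Real.rpow_one]
    linarith
  have h1 : C * ((2 : ℝ) ^ (s + D) * P) + 1 ≤ c * ((2 : ℝ) ^ (s + D) * (4 * (|D| + 2)) ^ 4) := by
    have h3 : (1 : ℝ) ≤ 2 ^ s₀ * ((2 : ℝ) ^ (s + D) * (4 * (|D| + 2)) ^ 4) := by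
      rw [← mul_assoc, ← Real.rpow_add two_pos]
      exact one_le_mul_of_one_le_of_one_le (Real.one_le_rpow one_le_two (by linarith)) (hP.trans hP')
    have h4 : C * ((2 : ℝ) ^ (s + D) * P) ≤ C * ((2 : ℝ) ^ (s + D) * (4 * (|D| + 2)) ^ 4) := by
      gcongr
    rw [hc, add_mul]
    linarith
  have h3 : Real.logb 2 (C * ((2 : ℝ) ^ (s + D) * P) + 1) ≤
      Real.logb 2 c + ((s + D) + 4 * (2 + Real.logb 2 (|D| + 2))) := by
    refine (Real.logb_le_logb_of_le one_lt_two (by positivity) h1).trans (le_of_eq ?_)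
    have h4 : Real.logb 2 4 = 2 := by
      rw [show (4 : ℝ) = 2 ^ (2 : ℝ) by norm_num, Real.logb_rpow two_pos (by norm_num)]
    rw [Real.logb_mul (by positivity) (by positivity), Real.logb_mul h2.ne' (by positivity),
      Real.logb_rpow two_pos (by norm_num), Real.logb_pow, Real.logb_mul (by norm_num) (by positivity),
      h4]
    norm_num
  have h5 := le_abs_self (Real.logb 2 c)
  have h6 := mul_le_mul_of_nonneg_left hL (abs_nonneg (Real.logb 2 c))
  linarith

section

variable {m : ℕ → ℝ} (hm : IsUniversalDistribution m)
  {mc : ℕ → Seq → ℝ} (hmc : IsUniversalCondDistribution mc)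

include hm hmc in
/-- A condition increases complexity by at most a constant. -/
theorem IsUniversalCondDistribution.KC_le : ∃ s₀ : ℝ, 0 ≤ s₀ ∧ ∀ x α,
    (KC mc x α : ℝ) ≤ K m x + s₀ := by
  obtain ⟨c, hc, h⟩ := hmc.exists_mul_le hm
  refine ⟨1 + |Real.logb 2 c|, by positivity, fun x α => ?_⟩
  have hmx := hm.pos x
  have h1 := len_bounds hmx (hm.le_one x)
  have h2 := len_bounds (hmc.pos hm x α) (hmc.le_one x α)
  have h3 := Real.logb_le_logb_of_le one_lt_two (by positivity) (h x α)
  rw [Real.logb_mul hc.ne' hmx.ne'] at h3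
  have := neg_abs_le (Real.logb 2 c)
  unfold K KC
  linarith

variable {U : Elem → Seq → ℝ} (hU : IsAdmissible U lam)

include hm hU in
theorem IsUniversalDistribution.opTest_ne_zero (α : Seq) : opTest m U α ≠ 0 := by
  obtain ⟨C, hC, h⟩ := hm.mlTest_le_opTest hU
  intro h0
  have h1 := h α
  rw [h0, mul_zero, nonpos_iff_eq_zero, mlTest_lam, ENNReal.tsum_eq_zero] at h1
  have h2 := h1 0
  rw [pow_zero, mul_one, ENNReal.ofReal_eq_zero] at h2
  exact absurd (hm.pos _) (not_lt.2 h2)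

variable {M : Elem → ℝ} (hM : IsUniversalSemimeasure M) {V : Elem → Seq → ℝ}
  (hV : IsUniversalOperator m V (tensor M M))

include hm hmc hM hU hV in
/-- For `z` a prefix of `(α, β)`, both sequences make `z` likely, hence `m z` is small relative to
the uniform measure of `z` unless `s` is large. -/
theorem IsUniversalDistribution.opTest_join_le_rpow : ∃ C : ℝ, 0 < C ∧ ∀ (α β : Seq) (r r' : ℕ)
    (s : ℝ), opTest m U α ≤ 2 ^ r → opTest m U β ≤ 2 ^ r' →
    (∀ x, (K m x - KC mc x α - KC mc x β : ℝ) ≤ s) → opTest m V (join α β) ≤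
      ENNReal.ofReal (C * ((2 : ℝ) ^ s * (2 ^ r * ((r + 1) * (r + 2))) *
        (2 ^ r' * ((r' + 1) * (r' + 2))))) := by
  obtain ⟨A, hA, h1⟩ := hm.mul_two_pow_le_cond hmc hU (e := ev) (by fun_prop)
  obtain ⟨B, hB, h2⟩ := hm.mul_two_pow_le_cond hmc hU (e := od) (by fun_prop)
  obtain ⟨C, hC, h⟩ := hm.opTest_join_le hM hV isComputableTree_uniform isComputableTree_uniform
    (w₁ := fun z => z) (w₂ := fun z => z) (fun z b => List.prefix_append _ _)
    (fun z b => List.prefix_append _ _) (by fun_prop) (by fun_prop)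
  refine ⟨C * (A * B * 4), by positivity, fun α β r r' s hr hr' hs => ?_⟩
  have h2s : (0 : ℝ) < 2 ^ s := Real.rpow_pos_of_pos two_pos _
  refine (h α α β β (fun N => ⟨N, List.prefix_refl _⟩) (fun N => ⟨N, List.prefix_refl _⟩)
    (A * B * 4 * ((2 : ℝ) ^ s * (2 ^ r * ((r + 1) * (r + 2))) * (2 ^ r' * ((r' + 1) * (r' + 2)))))
    (by positivity) fun n => ?_).trans (le_of_eq (by congr 1; ring))
  set z := pre (join α β) n
  set x := Encodable.encode z
  have e1 : ev z = pre α ((n + 1) / 2) := ev_pre_join _ _ _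
  have e2 : od z = pre β (n / 2) := od_pre_join _ _ _
  have h3 := h1 α r hr z (by rw [e1, length_pre])
  have h4 := h2 β r' hr' z (by rw [e2, length_pre])
  rw [e1, length_pre] at h3
  rw [e2, length_pre] at h4
  rw [length_pre, length_pre]
  have hmx := hm.pos x
  have hα := hmc.pos hm x α
  have hβ := hmc.pos hm x β
  -- the factor `4` comes from the rounding of the lengths
  have h5 : mc x α * mc x β / m x ≤ 4 * (2 : ℝ) ^ s := by
    have b1 := len_bounds hmx (hm.le_one x)
    have b2 := len_bounds hα (hmc.le_one x α)
    have b3 := len_bounds hβ (hmc.le_one x β)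
    have b4 := hs x
    unfold K KC at b4
    rw [show (4 : ℝ) = 2 ^ (2 : ℝ) by norm_num, ← Real.rpow_add two_pos,
      ← Real.logb_le_iff_le_rpow one_lt_two (by positivity), Real.logb_div (by positivity) hmx.ne',
      Real.logb_mul hα.ne' hβ.ne']
    linarith
  set g : ℝ := 2 ^ r * ((r + 1) * (r + 2))
  set g' : ℝ := 2 ^ r' * ((r' + 1) * (r' + 2))
  have hg : 0 ≤ g := by positivity
  have hg' : 0 ≤ g' := by positivity
  rw [div_mul_div_comm, one_mul, ← mul_div_assoc, mul_one, le_div_iff₀ (by positivity)]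
  calc m x * (2 ^ ((n + 1) / 2) * 2 ^ (n / 2)) =
        (m x * 2 ^ ((n + 1) / 2)) * (m x * 2 ^ (n / 2)) / m x := by field_simp
    _ ≤ (A * g * mc x α) * (B * g' * mc x β) / m x := by gcongr
    _ = A * B * (g * g') * (mc x α * mc x β / m x) := by ring
    _ ≤ A * B * (g * g') * (4 * (2 : ℝ) ^ s) := by gcongr
    _ = _ := by ring

include hm hmc hM hU hV in
theorem IsUniversalDistribution.info_le : ∃ C : ℝ, 0 ≤ C ∧ ∀ α β : Seq,
    info m V α β ≤ infoSup m mc α β + (rarity m U α + rarity m U β) +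
      (C : EReal) * logErr (rarity m U α + rarity m U β) := by
  obtain ⟨C, hC, h⟩ := hm.opTest_join_le_rpow hmc hU hM hV
  obtain ⟨s₀, hs0, hKC⟩ := hmc.KC_le hm
  obtain ⟨C', hC', h'⟩ := exists_deficiency_le_logErr (C := C * 2 ^ 6) (by positivity)
    (2 * s₀ + K m 0 + 4)
  refine ⟨C', hC'.le, fun α β => ?_⟩
  have hS : infoSup m mc α β ≠ ⊥ := by
    refine ne_bot_of_le_ne_bot ?_ (le_iSup (fun x => (((K m x - KC mc x α - KC mc x β : ℤ) : ℝ)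
      : EReal)) 0)
    exact EReal.coe_ne_bot _
  by_cases hα : rarity m U α = ⊤
  · rw [hα, EReal.top_add_of_ne_bot (show rarity m U β ≠ ⊥ from deficiency_ne_bot _), EReal.add_top_of_ne_bot hS, logErr,
      if_pos (Or.inl rfl), EReal.coe_mul_top_of_pos hC']
    exact le_top
  by_cases hβ : rarity m U β = ⊤
  · rw [hβ, EReal.add_top_of_ne_bot (show rarity m U α ≠ ⊥ from deficiency_ne_bot _), EReal.add_top_of_ne_bot hS, logErr,
      if_pos (Or.inl rfl), EReal.coe_mul_top_of_pos hC']
    exact le_top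
  obtain ⟨r, hr, hr1, hTr⟩ := exists_deficiency (hm.opTest_ne_zero hU α) hα
  obtain ⟨r', hr', hr1', hTr'⟩ := exists_deficiency (hm.opTest_ne_zero hU β) hβ
  have hD : rarity m U α + rarity m U β = (((r : ℝ) - 3 + (r' - 3) : ℝ) : EReal) := by
    rw [EReal.coe_add]
    exact congrArg₂ _ hr hr'
  rw [hD]
  set D : ℝ := (r : ℝ) - 3 + (r' - 3) with hDdef
  have hlog : logErr (D : EReal) = ((Real.logb 2 (|D| + 2) : ℝ) : EReal) := by
    rw [logErr, if_neg (by simp), EReal.toReal_coe]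
  by_cases hS' : infoSup m mc α β = ⊤
  · rw [hS', EReal.top_add_coe, hlog, ← EReal.coe_mul, EReal.top_add_coe]
    exact le_top
  lift infoSup m mc α β to ℝ using ⟨hS', hS⟩ with s hs
  have hle : ∀ x, (K m x - KC mc x α - KC mc x β : ℝ) ≤ s := by
    intro x
    have h1 := le_iSup (fun x => (((K m x - KC mc x α - KC mc x β : ℤ) : ℝ) : EReal)) x
    change _ ≤ infoSup m mc α β at h1
    rw [← hs, EReal.coe_le_coe_iff] at h1
    push_cast at h1
    exact h1
  have hr1'' : (1 : ℝ) ≤ r := by exact_mod_cast hr1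
  have hr1''' : (1 : ℝ) ≤ r' := by exact_mod_cast hr1'
  have habs := le_abs_self D
  have habs0 := abs_nonneg D
  have hrr : (r : ℝ) + 2 ≤ 4 * (|D| + 2) := by linarith
  have hrr' : (r' : ℝ) + 2 ≤ 4 * (|D| + 2) := by linarith
  refine h' _ s D (((r + 1) * (r + 2)) * ((r' + 1) * (r' + 2)))
    (hm.opTest_join_ne_zero hmc hM hV.1 α β) ?_ ?_ ?_ ((h α β r r' s hTr hTr' hle).trans
      (le_of_eq ?_))
  · have := hle 0
    have := hKC 0 α
    have := hKC 0 β
    linarith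
  · have h1 : ∀ t : ℝ, 1 ≤ t → 1 ≤ (t + 1) * (t + 2) := fun t ht => by nlinarith
    exact one_le_mul_of_one_le_of_one_le (h1 _ hr1'') (h1 _ hr1''')
  · rw [show ∀ y : ℝ, y ^ 4 = (y * y) * (y * y) by intro y; ring]
    gcongr <;> linarith
  · congr 1
    have e : (2 : ℝ) ^ (s + D) = (2 : ℝ) ^ s * (2 ^ r * 2 ^ r') / 2 ^ 6 := by
      rw [hDdef, Real.rpow_add two_pos, mul_div_assoc]
      congr 1
      rw [show (r : ℝ) - 3 + (r' - 3) = ((r + r' : ℕ) : ℝ) - ((6 : ℕ) : ℝ) by push_cast; ring,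
        Real.rpow_sub two_pos, Real.rpow_natCast, Real.rpow_natCast, pow_add]
    rw [e]
    ring

end

/-! ### A computable measure on the codes of integers -/

theorem pre_code_of_le {t n : ℕ} (h : n ≤ t) :
    (pre (code t) n).findIdx (fun b => !b) = (pre (code t) n).length := by
  rw [List.findIdx_eq_length]
  intro b hb
  simp only [pre, code, List.mem_map, List.mem_range] at hb
  obtain ⟨i, hi, rfl⟩ := hb
  simpa using lt_of_lt_of_le hi h

theorem eq_pre_code {z : List Bool} (h : z.findIdx (fun b => !b) = z.length) :
    z = pre (code z.length) z.length := by
  refine List.ext_getElem (by simp) fun i hi hi' => ?_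
  have := List.not_of_lt_findIdx (p := fun b : Bool => !b) (xs := z) (i := i) (by omega)
  simp only [pre, code, List.getElem_map, List.getElem_range, hi, decide_true]
  simpa using this

section

variable {m : ℕ → ℝ} (hm : IsUniversalDistribution m)

include hm in
/-- A computable measure under which the codes of all the pairs `(x, i)`, with `x` fixed, have the
total mass `m x / 2`. The code of the pair has a mass proportional to the growth of `m x` at
the stage `i` of its approximation. -/
theorem IsUniversalDistribution.exists_codeTree : ∃ (A : ℕ → ℝ) (p : List Bool → ℝ),
    IsComputableTree p ∧ (∀ x, Filter.Tendsto (fun I => ∑ i ∈ Finset.range I, A (Nat.pair x i))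
      Filter.atTop (nhds (m x / 2))) ∧ (∀ t n, n ≤ t → 1 / 2 ≤ p (pre (code t) n)) ∧
      ∀ t n, t < n → p (pre (code t) n) = A t := by
  obtain ⟨b, hb, b0, bm, ble, blt⟩ := hm.exists_approx
  let N : ℕ → ℕ → ℕ := fun t k =>
    (b t.unpair.1 (t.unpair.2 + 1) - 2 * b t.unpair.1 t.unpair.2) * 2 ^ (k - t.unpair.2)
  have hN : Primrec fun q : ℕ × ℕ => N q.1 q.2 := by
    simp only [N]
    fun_prop
  let A : ℕ → ℝ := fun t => ((b t.unpair.1 (t.unpair.2 + 1) : ℝ) / 2 ^ (t.unpair.2 + 1) -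
    (b t.unpair.1 t.unpair.2 : ℝ) / 2 ^ t.unpair.2) / 2
  have hNA : ∀ t k, t ≤ k → (N t k : ℝ) / 2 ^ (k + 2) = A t := by
    intro t k h
    obtain ⟨d, rfl⟩ := Nat.exists_eq_add_of_le ((Nat.unpair_right_le t).trans h)
    simp only [N, A, Nat.add_sub_cancel_left]
    rw [Nat.cast_mul, Nat.cast_sub (bm _ _)]
    push_cast
    rw [pow_add, pow_add, pow_succ]
    field_simp
    ring
  have hA0 : ∀ t, 0 ≤ A t := fun t => by
    rw [← hNA t t le_rfl]
    positivity
  have hAsum : ∀ x I, ∑ i ∈ Finset.range I, A (Nat.pair x i) = (b x I : ℝ) / 2 ^ I / 2 := by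
    intro x I
    simp only [A, Nat.unpair_pair]
    rw [← Finset.sum_div, Finset.sum_range_sub fun i => (b x i : ℝ) / 2 ^ i, b0]
    simp
  have hAle : ∀ n, ∑ t ∈ Finset.range n, A t ≤ 1 / 2 := by
    intro n
    have h1 : Finset.range n ⊆ (Finset.range n ×ˢ Finset.range n).image fun q => Nat.pair q.1 q.2 := by
      intro t ht
      rw [Finset.mem_image]
      refine ⟨t.unpair, ?_, Nat.pair_unpair t⟩
      rw [Finset.mem_range] at ht
      rw [Finset.mem_product, Finset.mem_range, Finset.mem_range]
      exact ⟨(Nat.unpair_left_le t).trans_lt ht, (Nat.unpair_right_le t).trans_lt ht⟩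
    calc _ ≤ ∑ t ∈ (Finset.range n ×ˢ Finset.range n).image fun q => Nat.pair q.1 q.2, A t :=
          Finset.sum_le_sum_of_subset_of_nonneg h1 fun t _ _ => hA0 t
      _ = ∑ q ∈ Finset.range n ×ˢ Finset.range n, A (Nat.pair q.1 q.2) :=
          Finset.sum_image fun q _ q' _ h => by
            rw [Nat.pair_eq_pair] at h
            exact Prod.ext h.1 h.2
      _ = ∑ x ∈ Finset.range n, (b x n : ℝ) / 2 ^ n / 2 := by
          rw [Finset.sum_product]
          exact Finset.sum_congr rfl fun x _ => hAsum x n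
      _ ≤ 1 / 2 := by
          rw [← Finset.sum_div]
          gcongr
          exact (Finset.sum_le_sum fun x _ => ble x n).trans (hm.sum_le _)
  let num : List Bool → ℕ := fun z => if z.findIdx (fun b => !b) = z.length then
      2 ^ (z.length + 2) - ∑ t ∈ Finset.range z.length, N t z.length
    else if z = pre (code (z.findIdx fun b => !b)) z.length then
      N (z.findIdx fun b => !b) z.length else 0
  have hnum : Primrec num := by
    simp only [num]
    unfold pre code
    fun_prop
  let p : List Bool → ℝ := fun z => if z.findIdx (fun b => !b) = z.length then
      1 - ∑ t ∈ Finset.range z.length, A t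
    else if z = pre (code (z.findIdx fun b => !b)) z.length then A (z.findIdx fun b => !b) else 0
  have hp : ∀ z, p z = (num z : ℝ) / 2 ^ (z.length + 2) := by
    intro z
    simp only [p, num]
    split_ifs with h h'
    · have h1 : (∑ t ∈ Finset.range z.length, N t z.length : ℝ) / 2 ^ (z.length + 2) =
          ∑ t ∈ Finset.range z.length, A t := by
        rw [Finset.sum_div]
        exact Finset.sum_congr rfl fun t ht => hNA t _ (Finset.mem_range.1 ht).le
      have h2 : ∑ t ∈ Finset.range z.length, N t z.length ≤ 2 ^ (z.length + 2) := by
        have h3 := h1.le.trans (hAle z.length)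
        rw [div_le_iff₀ (by positivity)] at h3
        have h4 : (∑ t ∈ Finset.range z.length, N t z.length : ℝ) ≤ 2 ^ (z.length + 2) :=
          h3.trans (by rw [div_mul_eq_mul_div, one_mul]; exact half_le_self (by positivity))
        exact_mod_cast h4
      rw [Nat.cast_sub h2, sub_div]
      push_cast
      rw [h1, div_self (by positivity)]
    · exact (hNA _ _ (List.findIdx_le_length)).symm
    · simp
  refine ⟨A, p, IsComputableTree.of_dyadic hnum (den := fun z => z.length + 2) (by fun_prop) hp
    (fun z => ?_) (by simp [p]), fun x => ?_, fun t n h => ?_, fun t n h => ?_⟩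
  · have hz := List.findIdx_le_length (p := fun b : Bool => !b) (xs := z)
    simp only [p]
    rcases hz.lt_or_eq with h | h
    · have hc : ¬ z.length < z.findIdx fun b => !b := not_lt.2 hz
      rw [findIdx_append_of_lt false h, findIdx_append_of_lt true h]
      simp only [List.length_append, List.length_singleton, pre_succ]
      have e : code (z.findIdx fun b => !b) z.length = false := by simp [code]
      rw [e, if_neg h.ne, if_neg (c := z.findIdx (fun b => !b) = z.length + 1) (by omega),
        if_neg (c := z.findIdx (fun b => !b) = z.length + 1) (by omega)]
      simp
    · have e1 : (z ++ [false]).findIdx (fun b => !b) = z.length := by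
        rw [List.findIdx_append, if_neg (by omega)]
        simp
      have e2 : (z ++ [true]).findIdx (fun b => !b) = z.length + 1 := by
        rw [List.findIdx_append, if_neg (by omega)]
        simp [add_comm]
      rw [e1, e2]
      simp only [List.length_append, List.length_singleton, pre_succ]
      have e : code z.length z.length = false := by simp [code]
      rw [if_pos h, if_neg (by omega), e, ← eq_pre_code h, if_pos rfl, if_pos trivial,
        Finset.sum_range_succ]
      ring
  · simp only [hAsum]
    exact (tendsto_of_mono_approx (mono_div_pow (bm x)) (ble x) (blt x)).div_const 2
  · simp only [p]
    rw [if_pos (pre_code_of_le h)]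
    linarith [hAle (pre (code t) n).length]
  · simp only [p]
    rw [pre_code_findIdx h, length_pre, if_neg h.ne, if_pos rfl]

/-! ### Information in a sequence and an integer -/

variable {mc : ℕ → Seq → ℝ} (hmc : IsUniversalCondDistribution mc)

include hmc in
/-- The total over a fibre of a computable map is dominated by the value at the image. -/
theorem IsUniversalCondDistribution.map {φ : ℕ → ℕ} (hφ : Primrec φ) :
    ∃ C : ℝ, 0 < C ∧ ∀ α x (F : Finset ℕ), (∀ y ∈ F, φ y = x) → ∑ y ∈ F, mc y α ≤ C * mc x α := by
  obtain ⟨c, hc, cm, cle, clt⟩ := hmc.exists_approx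
  obtain ⟨C, hC, h⟩ := hmc.dom (fun _ x s => ∑ y ∈ Finset.range s.length, if φ y = x then c y s else 0)
    (by fun_prop) (fun _ x s t => by
      rw [List.length_append, List.length_singleton, Finset.sum_range_succ, Finset.mul_sum]
      refine (Finset.sum_le_sum fun y _ => ?_).trans (Nat.le_add_right _ _)
      split_ifs
      · exact cm y s t
      · simp) (fun _ => 1) (by fun_prop) fun _ => one_pos
  refine ⟨C * 2, by positivity, fun α x F hF => ?_⟩
  have h1 := h 0 α fun n => ?_
  · have ht : Filter.Tendsto (fun n => ∑ y ∈ F, (c y (pre α n) : ℝ) / 2 ^ n) Filter.atTop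
        (nhds (∑ y ∈ F, mc y α)) :=
      tendsto_finsetSum _ fun y _ => tendsto_of_mono_approx (approx_mono (cm y) α) (cle y α) (clt y α)
    obtain ⟨L, hL⟩ := F.exists_nat_subset_range
    refine le_of_tendsto ht (Filter.eventually_atTop.2 ⟨L, fun n hn => ?_⟩)
    refine le_trans ?_ ((h1 x n).trans (le_of_eq (by push_cast; ring)))
    rw [length_pre, ← Finset.sum_div]
    gcongr
    push_cast
    calc ∑ y ∈ F, (c y (pre α n) : ℝ) = ∑ y ∈ F, if φ y = x then (c y (pre α n) : ℝ) else 0 :=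
          Finset.sum_congr rfl fun y hy => by rw [if_pos (hF y hy)]
      _ ≤ _ := Finset.sum_le_sum_of_subset_of_nonneg
          (hL.trans (Finset.range_subset_range.2 hn)) fun y _ _ => by positivity
  · rw [length_pre, one_mul, Finset.sum_comm]
    have h3 : ∑ y ∈ Finset.range n, (c y (pre α n) : ℝ) / 2 ^ n ≤ 1 :=
      (Finset.sum_le_sum fun y _ => cle y α n).trans (hmc.sum_le _ α)
    rw [← Finset.sum_div, div_le_one (by positivity)] at h3
    refine le_trans (Finset.sum_le_sum fun y _ => ?_) (show ∑ y ∈ Finset.range n, c y (pre α n) ≤ _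
      by exact_mod_cast h3)
    rw [Finset.sum_ite_eq]
    split_ifs <;> simp

variable {U : Elem → Seq → ℝ} (hU : IsAdmissible U lam) {M : Elem → ℝ}
  (hM : IsUniversalSemimeasure M) {V : Elem → Seq → ℝ} (hV : IsUniversalOperator m V (tensor M M))

include hm hmc hU hM hV in
/-- The integer `x` is replaced by the code of a pair `(x, i)` that is typical for the measure of
`exists_codeTree`, from which `code x` is computed. -/
theorem IsUniversalDistribution.opTest_join_code_le : ∃ C : ℝ, 0 < C ∧ ∀ (α : Seq) (x r : ℕ),
    opTest m U α ≤ 2 ^ r → opTest m V (join α (code x)) ≤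
      ENNReal.ofReal (C * (2 ^ r * ((r + 1) * (r + 2)) * (mc x α / m x))) := by
  obtain ⟨A, p, hp, hA, hp1, hp2⟩ := hm.exists_codeTree
  obtain ⟨B, hB, h1⟩ := hm.mul_two_pow_le_cond hmc hU (e := ev) (by fun_prop)
  obtain ⟨C₁, hC₁, h2⟩ := hmc.map (φ := fun y => (((Encodable.decode (α := List Bool) y).elim []
    fun z => od z).findIdx fun b => !b).unpair.1) (by fun_prop)
  obtain ⟨c, hc, h3⟩ := hmc.exists_mul_le hm
  let w₂ : List Bool → List Bool := fun z => if z.findIdx (fun b => !b) < z.length then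
    pre (code (z.findIdx fun b => !b).unpair.1) z.length else []
  have hw₂ : Primrec w₂ := by
    simp only [w₂]
    unfold pre code
    fun_prop
  have hw₂m : ∀ z b, w₂ z <+: w₂ (z ++ [b]) := by
    intro z b
    simp only [w₂]
    by_cases h : z.findIdx (fun b => !b) < z.length
    · rw [findIdx_append_of_lt b h, if_pos h, if_pos (h.trans (by simp))]
      exact pre_prefix _ (by simp)
    · rw [if_neg h]
      exact List.nil_prefix
  obtain ⟨C, hC, h⟩ := hm.opTest_join_le hM hV isComputableTree_uniform hp
    (w₁ := fun z => z) (w₂ := w₂) (fun z b => List.prefix_append _ _) hw₂m (by fun_prop) hw₂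
  -- `2 / c` excludes prefixes of the codes read before the first zero; `2 * C₁` contradicts the
  -- bound for the fibre of `x`
  set κ : ℝ := 2 / c + 2 * C₁ + 1 with hκ
  have hκ0 : 0 < κ := by positivity
  refine ⟨C * (B * κ), by positivity, fun α x r hr => ?_⟩
  have hmx := hm.pos x
  have hα := hmc.pos hm x α
  set g : ℝ := 2 ^ r * ((r + 1) * (r + 2)) with hg
  have hg0 : 0 < g := by positivity
  set q : ℝ := κ * (mc x α / m x) with hq
  have hq0 : 0 < q := by positivity
  have hq2 : 2 < q := by
    have h4 : c ≤ mc x α / m x := by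
      rw [le_div_iff₀ hmx]
      exact h3 x α
    calc 2 = 2 / c * c := by field_simp
      _ < κ * c := by gcongr; linarith
      _ ≤ q := by rw [hq]; gcongr
  -- Some pair `t = (x, i)` has a code that is not too improbable, because otherwise
  -- the prefixes of the codes of these pairs would be too likely relative to `α`.
  obtain ⟨t, ht, hgood⟩ : ∃ t : ℕ, t.unpair.1 = x ∧ ∀ n,
      mc (Encodable.encode (pre (join α (code t)) n)) α ≤ q * p (pre (code t) (n / 2)) := by
    by_contra! hbad
    choose! n hn using hbad
    have key : ∀ t, t.unpair.1 = x → t < n t / 2 := by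
      intro t ht
      by_contra! hle
      have h5 := hn t ht
      have h6 := hp1 t _ hle
      have h7 := hmc.le_one (Encodable.encode (pre (join α (code t)) (n t))) α
      nlinarith
    let y : ℕ → ℕ := fun i => Encodable.encode
      (pre (join α (code (Nat.pair x i))) (n (Nat.pair x i)))
    have hidx : ∀ i, ((Encodable.decode (α := List Bool) (y i)).elim [] fun z => od z).findIdx
        (fun b => !b) = Nat.pair x i := by
      intro i
      simp only [y]
      rw [Encodable.encodek, Option.elim_some, od_pre_join]
      exact pre_code_findIdx (key _ (by simp))
    have hinj : Function.Injective y := by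
      intro i j hij
      have h5 := hidx i
      rw [hij, hidx j, Nat.pair_eq_pair] at h5
      exact h5.2.symm
    have h4 : q * (m x / 2) ≤ C₁ * mc x α := by
      refine le_of_tendsto ((hA x).const_mul q) (Filter.Eventually.of_forall fun I => ?_)
      refine le_trans ?_ (h2 α x ((Finset.range I).image y) fun z hz => ?_)
      · rw [Finset.sum_image hinj.injOn, Finset.mul_sum]
        refine Finset.sum_le_sum fun i _ => ?_
        have h5 := hn (Nat.pair x i) (by simp)
        rw [hp2 _ _ (key _ (by simp))] at h5
        exact h5.le
      · obtain ⟨i, -, rfl⟩ := Finset.mem_image.1 hz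
        rw [hidx, Nat.unpair_pair]
    have h5 : q * (m x / 2) = κ / 2 * mc x α := by
      rw [hq]
      field_simp
    rw [h5] at h4
    have h6 := le_of_mul_le_mul_right h4 hα
    have : 0 < 2 / c := by positivity
    linarith
  refine (h α α (code x) (code t) (fun N => ⟨N, List.prefix_refl _⟩) (fun N => ?_) (B * g * q)
    (by positivity) fun n => ?_).trans (le_of_eq (by rw [hq]; congr 1; ring))
  · refine ⟨max N (t + 1), ?_⟩
    simp only [w₂]
    rw [pre_code_findIdx (lt_of_lt_of_le (Nat.lt_succ_self t) (le_max_right _ _)), length_pre,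
      if_pos (lt_of_lt_of_le (Nat.lt_succ_self t) (le_max_right _ _)), ht]
    exact pre_prefix _ (le_max_left _ _)
  · have e1 : ev (pre (join α (code t)) n) = pre α ((n + 1) / 2) := ev_pre_join _ _ _
    have h4 := h1 α r hr (pre (join α (code t)) n) (by rw [e1, length_pre])
    rw [e1, length_pre] at h4
    rw [length_pre, div_mul_eq_mul_div, one_mul, ← mul_div_assoc, le_div_iff₀ (by positivity)]
    refine h4.trans ?_
    rw [mul_assoc (B * g)]
    exact mul_le_mul_of_nonneg_left (hgood n) (by positivity)

include hm hmc hU hM hV in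
theorem IsUniversalDistribution.info_code_le : ∃ C : ℝ, 0 ≤ C ∧ ∀ (α : Seq) (x : ℕ),
    info m V α (code x) ≤ (((K m x - KC mc x α : ℤ) : ℝ) : EReal) + rarity m U α +
      (C : EReal) * logErr (rarity m U α) := by
  obtain ⟨C, hC, h⟩ := hm.opTest_join_code_le hmc hU hM hV
  obtain ⟨s₀, hs0, hKC⟩ := hmc.KC_le hm
  obtain ⟨C', hC', h'⟩ := exists_deficiency_le_logErr (C := C * (2 * 2 ^ 3)) (by positivity)
    (s₀ + 2)
  refine ⟨C', hC'.le, fun α x => ?_⟩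
  by_cases hα : rarity m U α = ⊤
  · rw [hα, EReal.coe_add_top, logErr, if_pos (Or.inl rfl), EReal.coe_mul_top_of_pos hC']
    exact le_top
  obtain ⟨r, hr, hr1, hTr⟩ := exists_deficiency (hm.opTest_ne_zero hU α) hα
  have hr' : rarity m U α = (((r : ℝ) - 3 : ℝ) : EReal) := hr
  rw [hr']
  set D : ℝ := (r : ℝ) - 3 with hD
  have hr1' : (1 : ℝ) ≤ r := by exact_mod_cast hr1
  have habs := le_abs_self D
  have habs0 := abs_nonneg D
  have hrr : (r : ℝ) + 2 ≤ 4 * (|D| + 2) := by linarith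
  refine h' _ _ D ((r + 1) * (r + 2)) (hm.opTest_join_ne_zero hmc hM hV.1 α (code x)) ?_ ?_ ?_
    ((h α x r hTr).trans (ENNReal.ofReal_le_ofReal ?_))
  · have := hKC x α
    push_cast
    linarith
  · nlinarith
  · calc ((r : ℝ) + 1) * (r + 2) ≤ (4 * (|D| + 2)) * (4 * (|D| + 2)) := by gcongr; linarith
      _ = (4 * (|D| + 2)) ^ 2 := by ring
      _ ≤ _ := pow_le_pow_right₀ (by linarith) (by norm_num)
  · have hmx := hm.pos x
    have hmc0 := hmc.pos hm x α
    have h1 : mc x α / m x ≤ 2 * (2 : ℝ) ^ (((K m x - KC mc x α : ℤ) : ℝ)) := by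
      have b1 := len_bounds hmx (hm.le_one x)
      have b2 := len_bounds hmc0 (hmc.le_one x α)
      nth_rw 1 [show (2 : ℝ) = 2 ^ (1 : ℝ) by norm_num]
      rw [← Real.rpow_add two_pos, ← Real.logb_le_iff_le_rpow one_lt_two (by positivity),
        Real.logb_div hmc0.ne' hmx.ne']
      push_cast
      unfold K KC
      linarith
    have e : (2 : ℝ) ^ (((K m x - KC mc x α : ℤ) : ℝ) + D) =
        (2 : ℝ) ^ (((K m x - KC mc x α : ℤ) : ℝ)) * 2 ^ r / 2 ^ 3 := by
      rw [hD, Real.rpow_add two_pos, mul_div_assoc]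
      congr 1
      rw [show (r : ℝ) - 3 = (r : ℝ) - ((3 : ℕ) : ℝ) by norm_num, Real.rpow_sub two_pos,
        Real.rpow_natCast, Real.rpow_natCast]
    rw [e]
    calc C * (2 ^ r * ((r + 1) * (r + 2)) * (mc x α / m x)) ≤
          C * (2 ^ r * ((r + 1) * (r + 2)) * (2 * (2 : ℝ) ^ (((K m x - KC mc x α : ℤ) : ℝ)))) := by
          gcongr
      _ = _ := by ring

end

/-! ### Random sequences for computable measures -/

/-- Values on cylinders are approximated from below since `μ` is r.e., and from above since `-μ`
is. -/
theorem IsComputableMeasure.isComputableTree {μ : Elem → ℝ} (hμ : IsComputableMeasure μ) :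
    IsComputableTree fun z => μ (cyl z) := by
  obtain ⟨hs, hlin, hre, hre'⟩ := hμ
  have h0 : ∀ z, 0 ≤ μ (cyl z) := fun z => hs.nonneg _ fun ω => by
    rw [cyl_apply]; split_ifs <;> norm_num
  have h1 : ∀ z, μ (cyl z) ≤ 1 := fun z => by
    have := hs.le_of_le (f := cyl z) (B := 1) zero_le_one fun ω => by
      rw [cyl_apply]; split_ifs <;> norm_num
    simpa using this
  have hcode : ∀ z, elemOf [(z, (1, 0, 0))] = cyl z := fun z => by
    ext ω
    rw [elemOf_apply]
    simp [ratOf, cyl_apply]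
  obtain ⟨lo, hlo, -, lom, lole, lolt⟩ := exists_lowerApprox' h0 (by
    have := REPred.comp_primrec hre (f := fun p : List Bool × RatCode =>
      (([(p.1, (1, 0, 0))] : ElemCode), p.2)) (by fun_prop)
    simpa only [hcode] using this)
  obtain ⟨b, hb, -, bm, ble, blt⟩ := exists_lowerApprox' (f := fun z => 1 - μ (cyl z))
    (fun z => sub_nonneg.2 (h1 z)) (by
    have := REPred.comp_primrec hre' (f := fun p : List Bool × RatCode =>
      (([(p.1, (1, 0, 0))] : ElemCode), ((p.2.1, p.2.2.1 + (p.2.2.2 + 1), p.2.2.2) : RatCode)))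
      (by fun_prop)
    refine this.of_eq fun p => ?_
    rw [hcode]
    have e : (ratOf (p.2.1, p.2.2.1 + (p.2.2.2 + 1), p.2.2.2) : ℝ) = ratOf p.2 - 1 := by
      simp only [ratOf]
      push_cast
      field_simp
      ring
    rw [e]
    constructor <;> intro h <;> linarith)
  have hsub : ∀ z t, ((2 ^ t - b z t : ℕ) : ℝ) / 2 ^ t = 1 - (b z t : ℝ) / 2 ^ t := by
    intro z t
    have h2 : (b z t : ℝ) ≤ 2 ^ t := by
      have := (ble z t).trans (sub_le_self 1 (h0 z))
      rwa [div_le_one (by positivity)] at this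
    have h3 : b z t ≤ 2 ^ t := by exact_mod_cast h2
    rw [Nat.cast_sub h3, sub_div]
    push_cast
    rw [div_self (by positivity)]
  refine ⟨h0, fun z => ?_, h1 [], lo, fun z t => 2 ^ t - b z t, hlo, by fun_prop, lole,
    fun z t => ?_, fun z => tendsto_of_mono_approx (mono_div_pow (lom z)) (lole z) (lolt z),
    fun z => ?_⟩
  · have := hlin 1 (cyl (z ++ [false])) (cyl (z ++ [true]))
    rw [Rat.cast_one, one_mul, one_smul] at this
    rw [← this]
    congr 1
    ext ω
    rw [LocallyConstant.add_apply]
    simp only [cyl_apply, List.length_append, List.length_singleton, pre_succ]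
    by_cases h : pre ω z.length = z
    · cases hb : ω z.length <;> simp [h]
    · simp [h]
  · rw [hsub]
    linarith [ble z t]
  · simp only [hsub]
    have := (tendsto_of_mono_approx (mono_div_pow (bm z)) (ble z) (blt z)).const_sub 1
    simpa using this

/-- Outputs on prefixes of `α` are prefixes of `α'`. -/
theorem eq_pre_of_prefix {w : List Bool → List Bool} (hw : ∀ z b, w z <+: w (z ++ [b]))
    {α α' : Seq} (h : ∀ N, ∃ n, pre α' N <+: w (pre α n)) {a : List Bool} {n : ℕ}
    (ha : a <+: w (pre α n)) : a = pre α' a.length := by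
  obtain ⟨n', hn'⟩ := h a.length
  have h1 := ha.trans (prefix_map hw (pre_prefix α (le_max_left n n')))
  have h2 := hn'.trans (prefix_map hw (pre_prefix α (le_max_right n n')))
  exact List.prefix_of_prefix_length_le h1 h2 (by simp) |>.eq_of_length (by simp)

section

variable {m : ℕ → ℝ} (hm : IsUniversalDistribution m)
  {mc : ℕ → Seq → ℝ} (hmc : IsUniversalCondDistribution mc)

include hm hmc in
/-- If `α` computes a sequence `α'` that is random for a computable measure `p`, the prefixes `a`
of `α'` have the probability at least `m a / p a` relative to `α`, up to a constant factor: these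
quantities are the terms of the Martin-Löf test, so that they have a bounded sum, and they can be
approximated when `α` is given. -/
theorem IsUniversalDistribution.le_mul_cond_of_random {p : List Bool → ℝ} (hp : IsComputableTree p)
    {w : List Bool → List Bool} (hw : ∀ z b, w z <+: w (z ++ [b])) (hwp : Primrec w) (r : ℕ) :
    ∃ C : ℝ, 0 < C ∧ ∀ α α' : Seq, (∀ N, ∃ n, pre α' N <+: w (pre α n)) →
      ∑' i, ENNReal.ofReal (m (Encodable.encode (pre α' i))) / ENNReal.ofReal (p (pre α' i)) ≤
        2 ^ r → ∀ i, m (Encodable.encode (pre α' i)) ≤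
          C * (p (pre α' i) * mc (Encodable.encode (pre α' i)) α) := by
  obtain ⟨b, hb, b0, bm, ble, blt⟩ := hm.exists_approx
  obtain ⟨lo, up, hlo, hup, lo_le, le_up, lo_t, up_t⟩ := hp.approx
  -- approximations of `m a / p a` from below; only strings with `p a > 0` matter
  let v : List Bool → ℕ → ℕ := fun a n => (Finset.range n).sup fun k =>
    b (Encodable.encode a) k * 2 ^ n / (up a k + 1)
  have hv : Primrec fun q : List Bool × ℕ => v q.1 q.2 := by
    simp only [v]
    fun_prop
  have vm : ∀ a n, 2 * v a n ≤ v a (n + 1) := by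
    intro a n
    simp only [v]
    rw [mul_comm, ← Nat.le_div_iff_mul_le two_pos]
    refine Finset.sup_le fun k hk => ?_
    rw [Nat.le_div_iff_mul_le two_pos]
    refine le_trans ?_ (Finset.le_sup (f := fun k => b (Encodable.encode a) k * 2 ^ (n + 1) /
      (up a k + 1)) (Finset.range_subset_range.2 n.le_succ hk))
    rw [Nat.le_div_iff_mul_le (Nat.succ_pos _), pow_succ, ← mul_assoc, mul_right_comm]
    exact Nat.mul_le_mul_right _ (Nat.div_mul_le_self _ _)
  have vle : ∀ a n, 0 < p a → (v a n : ℝ) ≤ m (Encodable.encode a) / p a * 2 ^ n := by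
    intro a n ha
    have hmx := hm.nonneg (Encodable.encode a)
    have h1 : v a n ≤ ⌊m (Encodable.encode a) / p a * 2 ^ n⌋₊ := by
      refine Finset.sup_le fun k _ => Nat.le_floor ?_
      refine (natCast_div_le_div _ _).trans ?_
      push_cast
      rw [mul_div_right_comm]
      refine mul_le_mul_of_nonneg_right ?_ (by positivity)
      rw [div_le_div_iff₀ (by positivity) ha]
      have h2 := ble (Encodable.encode a) k
      have h3 := le_up a k
      rw [div_le_iff₀ (by positivity)] at h2
      rw [le_div_iff₀ (by positivity)] at h3
      calc (b (Encodable.encode a) k : ℝ) * p a ≤ m (Encodable.encode a) * 2 ^ k * p a := by gcongr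
        _ = m (Encodable.encode a) * (p a * 2 ^ k) := by ring
        _ ≤ m (Encodable.encode a) * (up a k + 1) := by gcongr; linarith
    exact (Nat.cast_le.2 h1).trans (Nat.floor_le (by positivity))
  -- the check `encode a = x` guards against integers that decode to `a` without being its code
  let d : ℕ → List Bool → ℕ := fun x s => (Encodable.decode (α := List Bool) x).elim 0 fun a =>
    if Encodable.encode a = x then if (w s).take a.length = a then v a s.length else 0 else 0
  have hd : Primrec fun q : ℕ × List Bool => d q.1 q.2 := by
    simp only [d]
    fun_prop
  have dm : ∀ x s t, 2 * d x s ≤ d x (s ++ [t]) := by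
    intro x s t
    simp only [d]
    cases Encodable.decode (α := List Bool) x with
    | none => simp
    | some a =>
      simp only [Option.elim_some]
      by_cases hx : Encodable.encode a = x
      swap
      · simp [hx]
      rw [if_pos hx, if_pos hx]
      by_cases h : (w s).take a.length = a
      · have h' : (w (s ++ [t])).take a.length = a := by
          have h1 : a <+: w s := by rw [List.prefix_iff_eq_take, h]
          exact (List.prefix_iff_eq_take.1 (h1.trans (hw _ _))).symm
        rw [if_pos h, if_pos h', List.length_append, List.length_singleton]
        exact vm a s.length
      · simp [h]
  obtain ⟨C, hC, h⟩ := hmc.dom (fun _ => d) (by fun_prop) (fun _ => dm) (fun _ => 2 ^ r)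
    (by fun_prop) fun _ => by positivity
  refine ⟨C * 2 ^ r * 2, by positivity, fun α α' hα hT i => ?_⟩
  have hT' : (2 : ℝ≥0∞) ^ r ≠ ⊤ := by simp
  have hpos : ∀ i, 0 < p (pre α' i) := by
    intro i
    by_contra hneg
    have h1 := (ENNReal.le_tsum i).trans hT
    rw [ENNReal.ofReal_of_nonpos (not_lt.1 hneg), ENNReal.div_zero
      (by simpa using hm.pos (Encodable.encode (pre α' i)))] at h1
    exact hT' (top_le_iff.1 h1)
  have hinj : Function.Injective fun i => Encodable.encode (pre α' i) := fun i j hij => by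
    have := congrArg List.length (Encodable.encode_injective hij)
    simpa using this
  have hsum : ∀ n, ∑ x ∈ Finset.range n, d x (pre α n) ≤ 2 ^ r * 2 ^ n := by
    intro n
    set L := (w (pre α n)).length
    have h1 : ∑ x ∈ Finset.range n, d x (pre α n) ≤
        ∑ x ∈ (Finset.range (L + 1)).image fun i => Encodable.encode (pre α' i), d x (pre α n) := by
      refine Finset.sum_le_sum_of_ne_zero fun x _ hx => ?_
      simp only [d] at hx
      rcases hdec : Encodable.decode (α := List Bool) x with _ | a
      · simp [hdec] at hx
      · simp only [hdec, Option.elim_some, ne_eq, ite_eq_right_iff, not_forall] at hx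
        obtain ⟨rfl, h2, -⟩ := hx
        have h3 : a <+: w (pre α n) := by rw [List.prefix_iff_eq_take, h2]
        rw [Finset.mem_image]
        exact ⟨a.length, Finset.mem_range.2 (Nat.lt_succ_of_le h3.length_le),
          congrArg _ (eq_pre_of_prefix hw hα h3).symm⟩
    have h2 : (∑ i ∈ Finset.range (L + 1), (v (pre α' i) n : ℝ)) ≤ 2 ^ r * 2 ^ n := by
      calc _ ≤ ∑ i ∈ Finset.range (L + 1), m (Encodable.encode (pre α' i)) / p (pre α' i) * 2 ^ n :=
            Finset.sum_le_sum fun i _ => vle _ n (hpos i)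
        _ = (∑ i ∈ Finset.range (L + 1), m (Encodable.encode (pre α' i)) / p (pre α' i)) * 2 ^ n := by
            rw [Finset.sum_mul]
        _ ≤ _ := by
            gcongr
            have h3 := (ENNReal.sum_le_tsum (Finset.range (L + 1))).trans hT
            simp only [← ENNReal.ofReal_div_of_pos (hpos _)] at h3
            rw [← ENNReal.ofReal_sum_of_nonneg fun i _ => div_nonneg (hm.nonneg _) (hpos i).le,
              show (2 : ℝ≥0∞) ^ r = ENNReal.ofReal (2 ^ r) by
                rw [ENNReal.ofReal_pow zero_le_two, ENNReal.ofReal_ofNat],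
              ENNReal.ofReal_le_ofReal_iff (by positivity)] at h3
            exact h3
    refine h1.trans ?_
    rw [Finset.sum_image hinj.injOn]
    refine (Finset.sum_le_sum fun i _ => ?_).trans
      (show ∑ i ∈ Finset.range (L + 1), v (pre α' i) n ≤ _ by exact_mod_cast h2)
    simp only [d]
    rw [Encodable.encodek, Option.elim_some, if_pos rfl, length_pre, length_pre]
    split_ifs
    · exact le_rfl
    · exact Nat.zero_le _
  set a := pre α' i
  set x := Encodable.encode a with hx
  have hmx := hmc.nonneg x α
  obtain ⟨n₀, hn₀⟩ := hα i
  have h1 : ∀ k, (b x k : ℝ) / (up a k + 1) ≤ C * 2 ^ r * 2 * mc x α := by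
    intro k
    have hsmall : Filter.Tendsto (fun t : ℕ => (1 : ℝ) / 2 ^ t) Filter.atTop (nhds 0) := by
      simpa using tendsto_pow_atTop_nhds_zero_of_lt_one (r := (1 / 2 : ℝ)) (by norm_num) (by norm_num)
    have h2 := (tendsto_const_nhds (x := (b x k : ℝ) / (up a k + 1))).sub hsmall
    rw [sub_zero] at h2
    refine le_of_tendsto h2 (Filter.eventually_atTop.2 ⟨max n₀ (k + 1), fun n hn => ?_⟩)
    have h3 := h 0 α hsum x n
    have h4 : a <+: w (pre α n) :=
      hn₀.trans (prefix_map hw (pre_prefix α ((le_max_left _ _).trans hn)))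
    simp only [d] at h3
    rw [hx, Encodable.encodek, Option.elim_some, if_pos rfl, if_pos (List.prefix_iff_eq_take.1 h4).symm,
      length_pre] at h3
    have h5 : b x k * 2 ^ n / (up a k + 1) ≤ v a n :=
      Finset.le_sup (f := fun k => b (Encodable.encode a) k * 2 ^ n / (up a k + 1))
        (Finset.mem_range.2 ((Nat.lt_succ_self k).trans_le ((le_max_right _ _).trans hn)))
    have h6 := div_sub_one_le_natCast_div (b x k * 2 ^ n) (b := up a k + 1) (Nat.succ_pos _)
    have h7 : ((b x k * 2 ^ n / (up a k + 1) : ℕ) : ℝ) ≤ v a n := by exact_mod_cast h5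
    push_cast at h3 h6
    calc (b x k : ℝ) / (up a k + 1) - 1 / 2 ^ n =
          ((b x k : ℝ) * 2 ^ n / (up a k + 1) - 1) / 2 ^ n := by field_simp
      _ ≤ (v a n : ℝ) / 2 ^ n := by gcongr; exact h6.trans h7
      _ ≤ _ := h3.trans (le_of_eq (by rw [hx]; ring))
  have hsmall : Filter.Tendsto (fun t : ℕ => (1 : ℝ) / 2 ^ t) Filter.atTop (nhds 0) := by
    simpa using tendsto_pow_atTop_nhds_zero_of_lt_one (r := (1 / 2 : ℝ)) (by norm_num) (by norm_num)
  have h2 := ((up_t a).add hsmall).const_mul (C * 2 ^ r * 2 * mc x α)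
  rw [add_zero] at h2
  refine (le_of_tendsto_of_tendsto' (tendsto_of_mono_approx (mono_div_pow (bm x)) (ble x) (blt x))
    h2 fun k => ?_).trans (le_of_eq (by ring))
  have h3 := h1 k
  rw [div_le_iff₀ (by positivity)] at h3
  rw [← add_div, ← mul_div_assoc]
  gcongr

/-! ### Information in complete sequences -/

/-- The exponent `k + 3` accounts for the `- 2` in the deficiency and for rounding. -/
theorem IsCompleteVia.exists_random {μ : Elem → ℝ} {Φ Ψ : List Bool × ℕ × Bool → Prop} {k : ℕ}
    {α : Seq} (h : IsCompleteVia m μ Φ Ψ k α) :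
    ∃ α', Reduces Φ α α' ∧ Reduces Ψ α' α ∧ mlTest m μ α' ≤ 2 ^ (k + 3) := by
  obtain ⟨-, α', h1, h2, h3⟩ := h
  refine ⟨α', h1, h2, ?_⟩
  have hne : deficiency (mlTest m μ α') ≠ ⊤ := fun h => by
    have h4 : mlRarity m μ α' = ⊤ := h
    rw [h4] at h3
    exact EReal.coe_ne_top _ (top_le_iff.1 h3)
  have h0 : mlTest m μ α' ≠ 0 := fun h => hne (if_pos (Or.inl h))
  obtain ⟨r, hr, -, hT⟩ := exists_deficiency h0 hne
  have h4 : mlRarity m μ α' = (((r : ℝ) - 3 : ℝ) : EReal) := hr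
  rw [h4, EReal.coe_le_coe_iff] at h3
  have h5 : r ≤ k + 3 := by
    have : (r : ℝ) ≤ ((k + 3 : ℕ) : ℝ) := by push_cast; linarith
    exact_mod_cast this
  exact hT.trans (pow_le_pow_right₀ (by norm_num) h5)

variable {M : Elem → ℝ} (hM : IsUniversalSemimeasure M) {V : Elem → Seq → ℝ}
  (hV : IsUniversalOperator m V (tensor M M))

include hm hmc hM hV in
/-- Each pair of prefixes of `α'` and `β'` contributes one term to the simple bound. -/
theorem IsUniversalDistribution.info_le_infoSimple (μ ν : Elem → ℝ)
    (Φ Ψ Φ' Ψ' : List Bool × ℕ × Bool → Prop) (k : ℕ) : ∃ C : ℝ, ∀ α β,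
      IsCompleteVia m μ Φ Ψ k α → IsCompleteVia m ν Φ' Ψ' k β →
        info m V α β ≤ infoSimple m mc α β + (C : EReal) := by
  by_cases hex : ∃ α β, IsCompleteVia m μ Φ Ψ k α ∧ IsCompleteVia m ν Φ' Ψ' k β
  swap
  · exact ⟨0, fun α β hα hβ => (hex ⟨α, β, hα, hβ⟩).elim⟩
  obtain ⟨_, _, ⟨hμ, _, ⟨hΦ, -⟩, ⟨hΨ, -⟩, -⟩, ⟨hν, _, ⟨hΦ', -⟩, ⟨hΨ', -⟩, -⟩⟩ := hex
  have hp₁ := hμ.isComputableTree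
  have hp₂ := hν.isComputableTree
  obtain ⟨u₁, hu₁p, hu₁, hu₁r⟩ := exists_outMap hΦ
  obtain ⟨u₂, hu₂p, hu₂, hu₂r⟩ := exists_outMap hΦ'
  obtain ⟨w₁, hw₁p, hw₁, hw₁r⟩ := exists_outMap hΨ
  obtain ⟨w₂, hw₂p, hw₂, hw₂r⟩ := exists_outMap hΨ'
  obtain ⟨C₁, hC₁, h1⟩ := hm.le_mul_cond_of_random hmc hp₁ hu₁ hu₁p (k + 3)
  obtain ⟨C₂, hC₂, h2⟩ := hm.le_mul_cond_of_random hmc hp₂ hu₂ hu₂p (k + 3)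
  obtain ⟨C₃, hC₃, h3⟩ := hm.map (φ := fun z : List Bool =>
    Nat.pair (Encodable.encode (ev z)) (Encodable.encode (od z))) (by fun_prop)
  obtain ⟨C, hC, h⟩ := hm.opTest_join_le hM hV hp₁ hp₂ hw₁ hw₂ hw₁p hw₂p
  obtain ⟨C', -, h'⟩ := deficiency_mono (C := C * (C₃ * 8 * C₁ * C₂)) (by positivity)
  refine ⟨C', fun α β hα hβ => ?_⟩
  obtain ⟨α', hΦα, hΨα, hTα⟩ := hα.exists_random
  obtain ⟨β', hΦβ, hΨβ, hTβ⟩ := hβ.exists_random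
  refine h' _ _ (hm.opTest_join_ne_zero hmc hM hV.1 α β) ?_
  set T := ∑' x : ℕ, ∑' y : ℕ, ENNReal.ofReal (mc x α * mc y β * (2 : ℝ) ^ infoNat m x y) with hT
  rcases eq_or_ne T ⊤ with hTt | hTt
  · rw [hTt, ENNReal.mul_top (by simpa using by positivity)]
    exact le_top
  rw [← ENNReal.ofReal_toReal hTt, ← ENNReal.ofReal_mul (by positivity), mul_assoc]
  refine h α α' β β' (hw₁r _ _ hΨα) (hw₂r _ _ hΨβ) _ (by positivity) fun n => ?_
  have e1 : ev (pre (join α' β') n) = pre α' ((n + 1) / 2) := ev_pre_join _ _ _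
  have e2 : od (pre (join α' β') n) = pre β' (n / 2) := od_pre_join _ _ _
  have h4 := h3 (pre (join α' β') n)
  rw [e1, e2, Encodable.encode_nat] at h4
  have h5 := h1 α α' (hu₁r _ _ hΦα) hTα ((n + 1) / 2)
  have h6 := h2 β β' (hu₂r _ _ hΦβ) hTβ (n / 2)
  have hpx := hp₁.nonneg (pre α' ((n + 1) / 2))
  have hpy := hp₂.nonneg (pre β' (n / 2))
  set x := Encodable.encode (pre α' ((n + 1) / 2))
  set y := Encodable.encode (pre β' (n / 2))
  have hx := hm.pos x
  have hy := hm.pos y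
  have hcx := hmc.nonneg x α
  have hcy := hmc.nonneg y β
  have hI : (0 : ℝ) < 2 ^ infoNat m x y := by positivity
  have h7 : mc x α * mc y β * (2 : ℝ) ^ infoNat m x y ≤ T.toReal := by
    have h8 := (ENNReal.le_tsum y).trans (ENNReal.le_tsum (f := fun x => ∑' y : ℕ,
      ENNReal.ofReal (mc x α * mc y β * (2 : ℝ) ^ infoNat m x y)) x)
    rw [← hT] at h8
    have h9 := ENNReal.toReal_mono hTt h8
    rwa [ENNReal.toReal_ofReal (by positivity)] at h9
  have h8 : m (Nat.pair x y) ≤ 8 * (2 : ℝ) ^ infoNat m x y * (m x * m y) := by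
    have h9 := (hm.two_zpow_infoNat x y).1
    rw [div_div, div_le_iff₀ (by positivity)] at h9
    linarith
  calc _ ≤ C₃ * m (Nat.pair x y) := h4
    _ ≤ C₃ * (8 * (2 : ℝ) ^ infoNat m x y * ((C₁ * (μ (cyl (pre α' ((n + 1) / 2))) * mc x α)) *
          (C₂ * (ν (cyl (pre β' (n / 2))) * mc y β)))) := by
        refine mul_le_mul_of_nonneg_left (h8.trans ?_) hC₃.le
        gcongr
    _ = C₃ * 8 * C₁ * C₂ * (mc x α * mc y β * (2 : ℝ) ^ infoNat m x y) *
          (μ (cyl (pre α' ((n + 1) / 2))) * ν (cyl (pre β' (n / 2)))) := by ring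
    _ ≤ _ := by gcongr

end

/-! ### Error terms -/

theorem logErr_nonneg (D : EReal) : 0 ≤ logErr D := by
  unfold logErr
  split_ifs
  · exact le_top
  · have := abs_nonneg D.toReal
    exact_mod_cast Real.logb_nonneg one_lt_two (by linarith)

theorem add_mul_logErr_mono (s D : EReal) {C C' : ℝ} (h : C ≤ C') :
    s + (C : EReal) * logErr D ≤ s + (C' : EReal) * logErr D :=
  add_le_add_right (mul_le_mul_of_nonneg_right (by exact_mod_cast h) (logErr_nonneg D)) s

end AlgInfo

theorem mainTheorem2
    (m : ℕ → ℝ) (hm : AlgInfo.IsUniversalDistribution m)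
    (mc : ℕ → AlgInfo.Seq → ℝ) (hmc : AlgInfo.IsUniversalCondDistribution mc)
    (M : AlgInfo.Elem → ℝ) (hM : AlgInfo.IsUniversalSemimeasure M)
    (U₁ : AlgInfo.Elem → AlgInfo.Seq → ℝ)
    (hU₁ : AlgInfo.IsUniversalOperator m U₁ AlgInfo.lam)
    (U₂ : AlgInfo.Elem → AlgInfo.Seq → ℝ)
    (hU₂ : AlgInfo.IsUniversalOperator m U₂ (AlgInfo.tensor M M)) :
    -- pairs of sequences
    (∃ C : ℝ, 0 ≤ C ∧ ∀ α β : AlgInfo.Seq,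
      AlgInfo.infoSup m mc α β ≤ AlgInfo.info m U₂ α β + (C : EReal) ∧
      AlgInfo.info m U₂ α β ≤ AlgInfo.infoSup m mc α β
        + (AlgInfo.rarity m U₁ α + AlgInfo.rarity m U₁ β)
        + (C : EReal) * AlgInfo.logErr (AlgInfo.rarity m U₁ α + AlgInfo.rarity m U₁ β)) ∧
    -- a sequence and an integer
    (∃ C : ℝ, 0 ≤ C ∧ ∀ (α : AlgInfo.Seq) (x : ℕ),
      (((AlgInfo.K m x - AlgInfo.KC mc x α : ℤ) : ℝ) : EReal)
        ≤ AlgInfo.info m U₂ α (AlgInfo.code x) + (C : EReal) ∧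
      AlgInfo.info m U₂ α (AlgInfo.code x)
        ≤ (((AlgInfo.K m x - AlgInfo.KC mc x α : ℤ) : ℝ) : EReal) + AlgInfo.rarity m U₁ α
          + (C : EReal) * AlgInfo.logErr (AlgInfo.rarity m U₁ α)) ∧
    -- the simple bound is a lower bound for all pairs
    (∃ C : ℝ, ∀ α β : AlgInfo.Seq,
      AlgInfo.infoSimple m mc α β ≤ AlgInfo.info m U₂ α β + (C : EReal)) ∧
    -- and it is tight for complete sequences
    (∀ (μ ν : AlgInfo.Elem → ℝ) (Φ Ψ Φ' Ψ' : List Bool × ℕ × Bool → Prop) (k : ℕ),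
      ∃ C : ℝ, ∀ α β : AlgInfo.Seq,
        AlgInfo.IsCompleteVia m μ Φ Ψ k α → AlgInfo.IsCompleteVia m ν Φ' Ψ' k β →
        AlgInfo.info m U₂ α β ≤ AlgInfo.infoSimple m mc α β + (C : EReal)) := by
  obtain ⟨C₁, hC₁, h₁⟩ := hm.le_info hmc hM hU₂.1
  obtain ⟨C₂, hC₂, h₂⟩ := hm.info_le hmc hU₁.1 hM hU₂
  obtain ⟨C₃, hC₃, h₃⟩ := hm.le_info_code hmc hM hU₂.1
  obtain ⟨C₄, hC₄, h₄⟩ := hm.info_code_le hmc hU₁.1 hM hU₂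
  refine ⟨⟨max C₁ C₂, le_max_of_le_left hC₁, fun α β => ⟨iSup_le fun x => ?_, ?_⟩⟩,
    ⟨max C₃ C₄, le_max_of_le_left hC₃, fun α x => ⟨?_, ?_⟩⟩,
    hm.infoSimple_le_info hmc hM hU₂.1, hm.info_le_infoSimple hmc hM hU₂⟩
  · exact (h₁ α β x).trans (add_le_add_right (by exact_mod_cast le_max_left C₁ C₂) _)
  · exact (h₂ α β).trans (AlgInfo.add_mul_logErr_mono _ _ (le_max_right C₁ C₂))
  · exact (h₃ α x).trans (add_le_add_right (by exact_mod_cast le_max_left C₃ C₄) _)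
  · exact (h₄ α x).trans (AlgInfo.add_mul_logErr_mono _ _ (le_max_right C₃ C₄))
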